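/- Let $0<q<1$, $[z]:=(q^z-q^{-z})/(q-q^{-1})$. **The quantum sphere.** $\mathcal A(S^4_q)$ is the unital complex $*$-algebra generated by $x_0=x_0^*,x_1,x_2$ with the relations $x_ix_j=q^2x_jx_i$ ($0\le i<j\le 2$), $x_i^*x_j=q^2x_jx_i^*$ ($i\ne j$), $[x_1^*,x_1]=(1-q^4)x_0^2$, $[x_2^*,x_2]=x_1^*x_1-q^4x_1x_1^*$, $x_0^2+x_1x_1^*+x_2x_2^*=1$ and their conjugates. **The symmetry algebra.** $U_q(so(5))$ is the unital complex $*$-algebra generated by $K_i=K_i^*,K_i^{-1},E_i,F_i=E_i^*$ ($i=1,2$) with the relations $[K_1,K_2]=0$, $K_iK_i^{-1}=K_i^{-1}K_i=1$, $[E_i,F_j]=\delta_{ij}\frac{K_j^2-K_j^{-2}}{q^j-q^{-j}}$, $K_iE_iK_i^{-1}=q^iE_i$, $K_iE_jK_i^{-1}=q^{-1}E_j$ ($i\neq j$), $E_1E_2^2-(q^2+q^{-2})E_2E_1E_2+E_2^2E_1=0$, $E_1^3E_2-(q^2+1+q^{-2})(E_1^2E_2E_1-E_1E_2E_1^2)-E_2E_1^3=0$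 and their conjugates. Its antipode $S$ is the linear antihomomorphism with $S(K_i)=K_i^{-1}$, $S(E_i)=-q^iE_i$, $S(F_i)=-q^{-i}F_i$. **The Hilbert space.** $\mathcal H=\mathcal H_+\oplus\mathcal H_-$, where $\mathcal H_\pm$ has orthonormal basis $|l,m_1,m_2;j\rangle_\pm$ with $l\in\mathbb N+\frac12$, $j=\frac12,\frac32,\dots,l$, $j-|m_1|\in\mathbb N$, $l+\frac12-j-|m_2|\in\mathbb N$; a symbol $|l,m_1,m_2;j\rangle_\pm$ with inadmissible labels denotes $0$. $\mathcal V\subset\mathcal H$ is the span of the basis. Let $\epsilon=\pm\frac12$ be such that $l+\epsilon-j-m_2\in2\mathbb N$; write $D_{l,j,m_2}$ etc. for coefficients evaluated with the $\epsilon$ of their own indices. The operators $\gamma$, $D$, $|D|$ are $\gamma=\pm1$ on $\mathcal H_\pm$ and the self-adjoint operators with $D|l,m_1,m_2;j\rangle_\pm=(l+\frac32)|l,m_1,m_2;j\rangle_\mp$, $|D|\,|l,m_1,m_2;j\rangle_\pm=(l+\frac32)|l,m_1,m_2;j\rangle_\pm$. **Action of $U_q(so(5))$ on $\mathcal V$.**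 There is a $*$-representation (i.e. $\langle hv,w\rangle=\langle v,h^*w\rangle$) of $U_q(so(5))$ on $\mathcal V$ with (the same formulas for both signs) $K_1|l,m_1,m_2;j\rangle=q^{m_1}|l,m_1,m_2;j\rangle$, $K_2|l,m_1,m_2;j\rangle=q^{m_2-m_1}|l,m_1,m_2;j\rangle$, $E_1|l,m_1,m_2;j\rangle=\sqrt{[j-m_1][j+m_1+1]}\,|l,m_1+1,m_2;j\rangle$ and $$E_2|l,m_1,m_2;j\rangle=\sqrt{[j-m_1+1][j-m_1+2]}\,a\,|l,m_1-1,m_2+1;j+1\rangle+\sqrt{[j+m_1][j-m_1+1]}\,b\,|l,m_1-1,m_2+1;j\rangle+\sqrt{[j+m_1][j+m_1-1]}\,c\,|l,m_1-1,m_2+1;j-1\rangle,$$ $$a=\tfrac1{[2]}\sqrt{\tfrac{[l-j-m_2+\epsilon][l+j+m_2+3+\epsilon]}{[2(j+|\epsilon|)+1][2(j-|\epsilon|)+3]}},\quad b=2|\epsilon|\tfrac{\sqrt{[l-\epsilon(2j+1)-m_2+1][l-\epsilon(2j+1)+m_2+2]}}{[2j][2j+2]},\quad c=\tfrac{(-1)^{2\epsilon}}{[2]}\sqrt{\tfrac{[l-j+m_2+2-\epsilon][l+j-m_2+1-\epsilon]}{[2(j+|\epsilon|)-1][2(j-|\epsilon|)+1]}}.$$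 **Action of $\mathcal A(S^4_q)$ on $\mathcal H$.** There is a $*$-representation of $\mathcal A(S^4_q)$ by bounded operators on $\mathcal H$ (whose symbol is omitted) with $$x_2|l,m_1,m_2;j\rangle_\pm=D^+_{l,j,m_2}|l+1,m_1,m_2+1;j\rangle_\pm\pm D^0_{l,j,m_2}|l,m_1,m_2+1;j\rangle_\pm+D^-_{l,j,m_2}|l-1,m_1,m_2+1;j\rangle_\pm,$$ and, for $i=0,1$, with $X^+=A^+_{j,m_1},X^0=A^0_{j,m_1},X^-=A^+_{j-1,m_1}$ if $i=0$ and $X^\bullet=B^\bullet_{j,m_1}$ if $i=1$, and $m_1'=m_1+i$, $$\begin{aligned}x_i|l,m_1,m_2;j\rangle_\pm&=X^+\{C^+_{l,j,m_2}|l+1,m_1',m_2;j+1\rangle_\pm\mp C^0_{l,j,m_2}|l,m_1',m_2;j+1\rangle_\pm+C^-_{l,j,m_2}|l-1,m_1',m_2;j+1\rangle_\pm\}\\&+X^0\{H^+_{l,j,m_2}|l+1,m_1',m_2;j\rangle_\pm\pm H^0_{l,j,m_2}|l,m_1',m_2;j\rangle_\pm+H^+_{l-1,j,m_2}|l-1,m_1',m_2;j\rangle_\pm\}\\&+X^-\{C^-_{l+1,j-1,m_2}|l+1,m_1',m_2;j-1\rangle_\pm\mp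 C^0_{l,j-1,m_2}|l,m_1',m_2;j-1\rangle_\pm+C^+_{l-1,j-1,m_2}|l-1,m_1',m_2;j-1\rangle_\pm\}.\end{aligned}$$ Here $A^+_{j,m_1}=q^{m_1-1}\frac{\sqrt{[j+m_1+1][j-m_1+1]}}{[2j+2]}$, $A^0_{j,m_1}=q^{-2}\frac{q^{j+m_1+1}[2][j-m_1]-[2j]}{[2j][2j+2]}$, $B^+_{j,m_1}=q^{-j+m_1-1/2}\frac{\sqrt{[j+m_1+1][j+m_1+2]}}{[2j+2]}$, $B^0_{j,m_1}=(1+q^2)q^{m_1-1/2}\frac{\sqrt{[j-m_1][j+m_1+1]}}{[2j][2j+2]}$, $B^-_{j,m_1}=-q^{j+m_1+1/2}\frac{\sqrt{[j-m_1][j-m_1-1]}}{[2j]}$, $C^+_{l,j,m_2}=-q^{m_2-1-\epsilon}\frac{\sqrt{[l+j+m_2+3+\epsilon][l+j-m_2+3-\epsilon]}}{[2l+4]}$, $C^0_{l,j,m_2}=[4\epsilon]\,q^{2\epsilon l+m_2-1+3\epsilon}\frac{\sqrt{[l+\frac12+j-2\epsilon m_2+2][l+\frac12-j-2\epsilon m_2]}}{[2l+2][2l+4]}$,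 $C^-_{l,j,m_2}=-q^{m_2-1+\epsilon}\frac{\sqrt{[l-j+m_2-\epsilon][l-j-m_2+\epsilon]}}{[2l+2]}$, $H^+_{l,j,m_2}=q^{m_2-1+\epsilon(2j+1)}\frac{\sqrt{[l+2\epsilon j-m_2+2+\epsilon][l-2\epsilon j+m_2+2-\epsilon]}}{[2l+4]}$, $H^0_{l,j,m_2}=\frac{[l-\epsilon(2j+1)-m_2+1][l-\epsilon(2j+1)+m_2+2]-q^{-2}[l+\epsilon(2j+1)-m_2+2][l+\epsilon(2j+1)+m_2+1]}{[2l+2][2l+4]}$, $D^+_{l,j,m_2}=q^{-l+m_2-3/2}\frac{\sqrt{[l+j+m_2+3+\epsilon][l-j+m_2+2-\epsilon]}}{[2l+4]}$, $D^0_{l,j,m_2}=[2]q^{m_2+1/2}\frac{\sqrt{[l-2\epsilon j-m_2+1-\epsilon][l-2\epsilon j+m_2+2-\epsilon]}}{[2l+2][2l+4]}$, $D^-_{l,j,m_2}=-q^{l+m_2+3/2}\frac{\sqrt{[l-j-m_2+\epsilon][l+j-m_2+1-\epsilon]}}{[2l+2]}$. **The ideal.** Let $\delta=[|D|,\cdot\,]$,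 let $\mathrm{OP}^0=\bigcap_{n}\mathrm{dom}\,\delta^n\subset\mathcal B(\mathcal H)$ and let $\mathcal I$ be the set of the $T\in\mathrm{OP}^0$ such that $T|D|^{-p}$ is of trace class for all real $p>2$. **Proposition.** The two representations above exist. The antilinear isometry $J$ of $\mathcal H$ with $$J|l,m_1,m_2;j\rangle_\pm=i^{2l+1}(-1)^{j+m_1}|l,-m_1,-m_2;j\rangle_\pm$$ satisfies $J^2=-1$, $J\gamma=\gamma J$ and $JD=DJ$ (including equality of domains). Let $T:\mathcal V\to\mathcal V$ be the antilinear operator $$T|l,m_1,m_2;j\rangle_\pm=i^{2l+1}(-1)^{j+m_1}q^{m_1+3m_2}|l,-m_1,-m_2;j\rangle_\pm .$$ Then $T$ is equivariant, $Thv=S(h)^*Tv$ for all $h\in U_q(so(5))$ and $v\in\mathcal V$, and $J$ is the antiunitary part in the polar decomposition of (the closure of) $T$. Finally, for all $a\in\mathcal A(S^4_q)$ the commutator $[D,a]$ is (extends to) a bounded operator, and for all $a,b\in\mathcal A(S^4_q)$ $$[a,JbJ]\in\mathcal I,\qquad[[D,a],JbJ]\in\mathcal I .$$ -/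

import Mathlib

open scoped ComplexConjugate InnerProductSpace

noncomputable section

namespace QSphere

/-! ### Complex `*`-algebras given by generators and relations -/

/-- The opposite of a complex algebra `A`, on which a scalar `c` acts as its conjugate.  A linear
map into `ConjOp A` is an antilinear map into `A`, and it reverses products. -/
def ConjOp (A : Type*) : Type _ := Aᵐᵒᵖ

instance (A : Type*) [Ring A] : Ring (ConjOp A) := inferInstanceAs (Ring Aᵐᵒᵖ)

instance (A : Type*) [Ring A] [Algebra ℂ A] : Algebra ℂ (ConjOp A) :=
  RingHom.toAlgebra' (((algebraMap ℂ Aᵐᵒᵖ).comp (starRingEnd ℂ) : ℂ →+* Aᵐᵒᵖ))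
    (fun c x => Algebra.commutes (A := Aᵐᵒᵖ) (starRingEnd ℂ c) x)

def toConjOp {A : Type*} (a : A) : ConjOp A := MulOpposite.op a

def ofConjOp {A : Type*} (a : ConjOp A) : A := MulOpposite.unop a

section ConjOpLemmas

@[simp] lemma ofConjOp_toConjOp {A : Type*} (a : A) : ofConjOp (toConjOp a) = a := rfl

@[simp] lemma ofConjOp_add {A : Type*} [Ring A] (a b : ConjOp A) : ofConjOp (a + b) = ofConjOp a + ofConjOp b := rfl

@[simp] lemma ofConjOp_sub {A : Type*} [Ring A] (a b : ConjOp A) : ofConjOp (a - b) = ofConjOp a - ofConjOp b := rfl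

@[simp] lemma ofConjOp_mul {A : Type*} [Ring A] (a b : ConjOp A) : ofConjOp (a * b) = ofConjOp b * ofConjOp a := rfl

@[simp] lemma ofConjOp_algebraMap {A : Type*} [Ring A] [Algebra ℂ A] (c : ℂ) :
    ofConjOp (algebraMap ℂ (ConjOp A) c) = algebraMap ℂ A (conj c) := rfl

end ConjOpLemmas

section Presented

variable {X : Type} [InvolutiveStar X]

/-- The antilinear antimultiplicative involution of the free algebra `ℂ⟨X⟩` that extends the
involution `x ↦ x*` of the set of generators. -/
def freeStarHom : FreeAlgebra ℂ X →ₐ[ℂ] ConjOp (FreeAlgebra ℂ X) :=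
  FreeAlgebra.lift ℂ fun x => toConjOp (FreeAlgebra.ι ℂ (star x))

def freeStar (w : FreeAlgebra ℂ X) : FreeAlgebra ℂ X := ofConjOp (freeStarHom w)

@[simp] lemma freeStar_ι (x : X) :
    freeStar (FreeAlgebra.ι ℂ x) = FreeAlgebra.ι ℂ (star x) := by
  simp [freeStar, freeStarHom]

@[simp] lemma freeStar_add (a b : FreeAlgebra ℂ X) :
    freeStar (a + b) = freeStar a + freeStar b := by
  simp [freeStar]

@[simp] lemma freeStar_sub (a b : FreeAlgebra ℂ X) :
    freeStar (a - b) = freeStar a - freeStar b := by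
  simp [freeStar]

@[simp] lemma freeStar_mul (a b : FreeAlgebra ℂ X) :
    freeStar (a * b) = freeStar b * freeStar a := by
  simp [freeStar]

@[simp] lemma freeStar_algebraMap (c : ℂ) :
    freeStar (algebraMap ℂ (FreeAlgebra ℂ X) c) = algebraMap ℂ _ (conj c) := by
  simp [freeStar]

@[simp] lemma freeStar_one : freeStar (1 : FreeAlgebra ℂ X) = 1 := by
  simpa using freeStar_algebraMap (X := X) 1

@[simp] lemma freeStar_zero : freeStar (0 : FreeAlgebra ℂ X) = 0 := by
  simpa using freeStar_algebraMap (X := X) 0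

@[simp] lemma freeStar_smul (c : ℂ) (a : FreeAlgebra ℂ X) :
    freeStar (c • a) = conj c • freeStar a := by
  rw [Algebra.smul_def, freeStar_mul, freeStar_algebraMap, ← Algebra.commutes,
    ← Algebra.smul_def]

lemma freeStar_freeStar (a : FreeAlgebra ℂ X) : freeStar (freeStar a) = a := by
  induction a using FreeAlgebra.induction with
  | grade0 c => simp
  | grade1 x => simp
  | mul a b ha hb => simp [ha, hb]
  | add a b ha hb => simp [ha, hb]

/-- A set of relations together with the ones obtained by conjugation. -/
def StarRel (r : FreeAlgebra ℂ X → FreeAlgebra ℂ X → Prop) (a b : FreeAlgebra ℂ X) : Prop :=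
  r a b ∨ r (freeStar a) (freeStar b)

/-- The complex unital `*`-algebra generated by the set `X` (closed under `*`), subject to the
relations `r` and their conjugates. -/
def PresentedAlg (r : FreeAlgebra ℂ X → FreeAlgebra ℂ X → Prop) : Type :=
  RingQuot (StarRel r)

variable (r : FreeAlgebra ℂ X → FreeAlgebra ℂ X → Prop)

instance : Ring (PresentedAlg r) := inferInstanceAs (Ring (RingQuot (StarRel r)))

instance : Algebra ℂ (PresentedAlg r) := inferInstanceAs (Algebra ℂ (RingQuot (StarRel r)))

namespace PresentedAlg

/-- The quotient map from the free algebra. -/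
def mk : FreeAlgebra ℂ X →ₐ[ℂ] PresentedAlg r := RingQuot.mkAlgHom ℂ (StarRel r)

/-- A generator. -/
def gen (x : X) : PresentedAlg r := mk r (FreeAlgebra.ι ℂ x)

variable {r}

lemma mk_surjective : Function.Surjective (mk r) := RingQuot.mkAlgHom_surjective ℂ (StarRel r)

lemma mk_rel {a b : FreeAlgebra ℂ X} (h : StarRel r a b) : mk r a = mk r b :=
  RingQuot.mkAlgHom_rel ℂ h

/-- The universal property. -/
def lift {B : Type*} [Ring B] [Algebra ℂ B] (f : FreeAlgebra ℂ X →ₐ[ℂ] B)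
    (hf : ∀ a b, r a b → f a = f b ∧ f (freeStar a) = f (freeStar b)) :
    PresentedAlg r →ₐ[ℂ] B :=
  RingQuot.liftAlgHom ℂ ⟨f, fun a b h => h.elim (fun h => (hf a b h).1) fun h => by
    simpa [freeStar_freeStar] using (hf _ _ h).2⟩

lemma lift_mk {B : Type*} [Ring B] [Algebra ℂ B] (f : FreeAlgebra ℂ X →ₐ[ℂ] B)
    (hf : ∀ a b, r a b → f a = f b ∧ f (freeStar a) = f (freeStar b)) (w : FreeAlgebra ℂ X) :
    lift f hf (mk r w) = f w :=
  RingQuot.liftAlgHom_mkAlgHom_apply ..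

def conjMap {A B : Type*} [Ring A] [Algebra ℂ A] [Ring B] [Algebra ℂ B] (f : A →ₐ[ℂ] B) :
    ConjOp A →ₐ[ℂ] ConjOp B where
  toFun a := toConjOp (f (ofConjOp a))
  map_one' := congrArg toConjOp (map_one f)
  map_zero' := congrArg toConjOp (map_zero f)
  map_mul' a b := congrArg toConjOp (map_mul f (ofConjOp b) (ofConjOp a))
  map_add' a b := congrArg toConjOp (map_add f (ofConjOp a) (ofConjOp b))
  commutes' c := congrArg toConjOp (f.commutes (conj c))

/-- The involution of the presented algebra, induced by that of the free algebra. -/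
def starHom : PresentedAlg r →ₐ[ℂ] ConjOp (PresentedAlg r) :=
  lift ((conjMap (mk r)).comp freeStarHom) fun a b h => by
    refine ⟨congrArg toConjOp (mk_rel (Or.inr ?_)), congrArg toConjOp (mk_rel (Or.inl ?_))⟩
    · change r (freeStar (freeStar a)) (freeStar (freeStar b))
      simpa [freeStar_freeStar] using h
    · change r (freeStar (freeStar a)) (freeStar (freeStar b))
      simpa [freeStar_freeStar] using h

instance : Star (PresentedAlg r) := ⟨fun a => ofConjOp (starHom a)⟩

lemma star_mk (w : FreeAlgebra ℂ X) : star (mk r w) = mk r (freeStar w) :=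
  congrArg ofConjOp (lift_mk _ _ w)

@[simp] lemma star_gen (x : X) : star (gen r x) = gen r (star x) := by
  simp [gen, star_mk]

instance : StarRing (PresentedAlg r) where
  star_involutive a := by
    obtain ⟨w, rfl⟩ := mk_surjective a
    simp [star_mk, freeStar_freeStar]
  star_mul a b := by
    obtain ⟨v, rfl⟩ := mk_surjective a
    obtain ⟨w, rfl⟩ := mk_surjective b
    rw [← map_mul, star_mk, star_mk, star_mk, freeStar_mul, map_mul]
  star_add a b := by
    obtain ⟨v, rfl⟩ := mk_surjective a
    obtain ⟨w, rfl⟩ := mk_surjective b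
    rw [← map_add, star_mk, star_mk, star_mk, freeStar_add, map_add]

instance : StarModule ℂ (PresentedAlg r) where
  star_smul c a := by
    obtain ⟨w, rfl⟩ := mk_surjective a
    rw [← map_smul, star_mk, star_mk, freeStar_smul, map_smul]
    rfl

end PresentedAlg

end Presented

/-! ### The algebra of the orthogonal quantum 4-sphere -/

/-- The generators `x₀ = x₀*`, `x₁`, `x₁*`, `x₂`, `x₂*`. -/
inductive SphereGen
  | x0 | x1 | x1s | x2 | x2s

instance : InvolutiveStar SphereGen where
  star
    | .x0 => .x0
    | .x1 => .x1s
    | .x1s => .x1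
    | .x2 => .x2s
    | .x2s => .x2
  star_involutive x := by cases x <;> rfl

/-- The word `x i`, `i = 0, 1, 2`, of the free algebra on the generators of the sphere. -/
def wx (i : Fin 3) : FreeAlgebra ℂ SphereGen := FreeAlgebra.ι ℂ (![.x0, .x1, .x2] i)

/-- The word `(x i)*`, `i = 0, 1, 2`. -/
def wxs (i : Fin 3) : FreeAlgebra ℂ SphereGen := FreeAlgebra.ι ℂ (![.x0, .x1s, .x2s] i)

/-- The defining relations of the quantum 4-sphere. -/
inductive SphereRel (q : ℝ) : FreeAlgebra ℂ SphereGen → FreeAlgebra ℂ SphereGen → Prop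
  | comm (i j : Fin 3) (h : i < j) :
      SphereRel q (wx i * wx j) (((q ^ 2 : ℝ) : ℂ) • (wx j * wx i))
  | star_comm (i j : Fin 3) (h : i ≠ j) :
      SphereRel q (wxs i * wx j) (((q ^ 2 : ℝ) : ℂ) • (wx j * wxs i))
  | comm_one : SphereRel q (wxs 1 * wx 1 - wx 1 * wxs 1) (((1 - q ^ 4 : ℝ) : ℂ) • (wx 0 * wx 0))
  | comm_two : SphereRel q (wxs 2 * wx 2 - wx 2 * wxs 2)
      (wxs 1 * wx 1 - ((q ^ 4 : ℝ) : ℂ) • (wx 1 * wxs 1))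
  | radius : SphereRel q (wx 0 * wx 0 + wx 1 * wxs 1 + wx 2 * wxs 2) 1

/-- The `*`-algebra `𝒜(S⁴_q)`. -/
abbrev SphereAlg (q : ℝ) : Type := PresentedAlg (SphereRel q)

/-! ### The symmetry algebra `U_q(so(5))`, its involution and its antipode -/

/-- The generators `K i`, `(K i)⁻¹`, `E i`, `F i = (E i)*`; the index `i : Fin 2` is one less than
the usual index `1, 2`. -/
inductive UGen
  | K (i : Fin 2)
  | Kinv (i : Fin 2)
  | E (i : Fin 2)
  | F (i : Fin 2)

instance : InvolutiveStar UGen where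
  star
    | .K i => .K i
    | .Kinv i => .Kinv i
    | .E i => .F i
    | .F i => .E i
  star_involutive x := by cases x <;> rfl

def wK (i : Fin 2) : FreeAlgebra ℂ UGen := FreeAlgebra.ι ℂ (.K i)
def wKinv (i : Fin 2) : FreeAlgebra ℂ UGen := FreeAlgebra.ι ℂ (.Kinv i)
def wE (i : Fin 2) : FreeAlgebra ℂ UGen := FreeAlgebra.ι ℂ (.E i)
def wF (i : Fin 2) : FreeAlgebra ℂ UGen := FreeAlgebra.ι ℂ (.F i)

/-- `qpow q 0 = q` and `qpow q 1 = q²`: the power of `q` attached to the two simple roots. -/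
def qpow (q : ℝ) (i : Fin 2) : ℝ := q ^ ((i : ℕ) + 1)

/-- The defining relations of `U_q(so(5))`. -/
inductive URel (q : ℝ) : FreeAlgebra ℂ UGen → FreeAlgebra ℂ UGen → Prop
  | KK : URel q (wK 0 * wK 1 - wK 1 * wK 0) 0
  | K_Kinv (i : Fin 2) : URel q (wK i * wKinv i) 1
  | Kinv_K (i : Fin 2) : URel q (wKinv i * wK i) 1
  | EF (j : Fin 2) : URel q (wE j * wF j - wF j * wE j)
      ((((qpow q j - (qpow q j)⁻¹)⁻¹ : ℝ) : ℂ) • (wK j * wK j - wKinv j * wKinv j))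
  | EF_ne (i j : Fin 2) (h : i ≠ j) : URel q (wE i * wF j - wF j * wE i) 0
  | KE (i : Fin 2) : URel q (wK i * wE i * wKinv i) (((qpow q i : ℝ) : ℂ) • wE i)
  | KE_ne (i j : Fin 2) (h : i ≠ j) : URel q (wK i * wE j * wKinv i) (((q⁻¹ : ℝ) : ℂ) • wE j)
  | serre₁ : URel q (wE 0 * (wE 1 * wE 1)
      - ((q ^ 2 + (q ^ 2)⁻¹ : ℝ) : ℂ) • (wE 1 * wE 0 * wE 1) + wE 1 * wE 1 * wE 0) 0
  | serre₂ : URel q (wE 0 * wE 0 * wE 0 * wE 1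
      - ((q ^ 2 + 1 + (q ^ 2)⁻¹ : ℝ) : ℂ) •
        (wE 0 * wE 0 * wE 1 * wE 0 - wE 0 * wE 1 * wE 0 * wE 0)
      - wE 1 * wE 0 * wE 0 * wE 0) 0

/-- The `*`-algebra `U_q(so(5))`. -/
abbrev Uq (q : ℝ) : Type := PresentedAlg (URel q)

open MulOpposite in
/-- The antipode on words: `K i ↦ (K i)⁻¹`, `E i ↦ -qⁱ E i`, `F i ↦ -q⁻ⁱ F i`, `i = 1, 2`. -/
def freeAntipode (q : ℝ) : FreeAlgebra ℂ UGen →ₐ[ℂ] (Uq q)ᵐᵒᵖ :=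
  FreeAlgebra.lift ℂ fun
    | .K i => op (PresentedAlg.gen _ (.Kinv i))
    | .Kinv i => op (PresentedAlg.gen _ (.K i))
    | .E i => op (-((qpow q i : ℝ) : ℂ) • PresentedAlg.gen _ (.E i))
    | .F i => op (-(((qpow q i)⁻¹ : ℝ) : ℂ) • PresentedAlg.gen _ (.F i))

namespace Uq

variable {q : ℝ}

abbrev K (i : Fin 2) : Uq q := PresentedAlg.gen _ (.K i)
abbrev Kinv (i : Fin 2) : Uq q := PresentedAlg.gen _ (.Kinv i)
abbrev E (i : Fin 2) : Uq q := PresentedAlg.gen _ (.E i)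
abbrev F (i : Fin 2) : Uq q := PresentedAlg.gen _ (.F i)

lemma rel_of {a b : FreeAlgebra ℂ UGen} (h : URel q a b) :
    PresentedAlg.mk (URel q) a = PresentedAlg.mk (URel q) b :=
  PresentedAlg.mk_rel (Or.inl h)

lemma KK : (K 0 * K 1 - K 1 * K 0 : Uq q) = 0 := by
  simpa [wK, PresentedAlg.gen] using rel_of (q := q) .KK

lemma K_Kinv (i : Fin 2) : (K i * Kinv i : Uq q) = 1 := by
  simpa [wK, wKinv, PresentedAlg.gen] using rel_of (q := q) (.K_Kinv i)

lemma Kinv_K (i : Fin 2) : (Kinv i * K i : Uq q) = 1 := by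
  simpa [wK, wKinv, PresentedAlg.gen] using rel_of (q := q) (.Kinv_K i)

lemma EF (i : Fin 2) : (E i * F i - F i * E i : Uq q) =
    (((qpow q i - (qpow q i)⁻¹)⁻¹ : ℝ) : ℂ) • (K i * K i - Kinv i * Kinv i) := by
  have h := rel_of (q := q) (.EF i)
  simp only [wE, wF, wK, wKinv, map_sub, map_mul, map_smul] at h
  exact h

lemma EF_ne (i j : Fin 2) (h : i ≠ j) : (E i * F j - F j * E i : Uq q) = 0 := by
  simpa [wE, wF, PresentedAlg.gen] using rel_of (q := q) (.EF_ne i j h)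

lemma KE (i : Fin 2) : (K i * E i * Kinv i : Uq q) = ((qpow q i : ℝ) : ℂ) • E i := by
  have h := rel_of (q := q) (.KE i)
  simp only [wE, wK, wKinv, map_mul, map_smul] at h
  exact h

lemma KE_ne (i j : Fin 2) (h : i ≠ j) :
    (K i * E j * Kinv i : Uq q) = ((q⁻¹ : ℝ) : ℂ) • E j := by
  have h := rel_of (q := q) (.KE_ne i j h)
  simp only [wE, wK, wKinv, map_mul, map_smul] at h
  exact h

lemma serre₁ : (E 0 * (E 1 * E 1) - ((q ^ 2 + (q ^ 2)⁻¹ : ℝ) : ℂ) • (E 1 * E 0 * E 1)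
    + E 1 * E 1 * E 0 : Uq q) = 0 := by
  have h := rel_of (q := q) .serre₁
  simp only [wE, map_mul, map_smul, map_add, map_sub, map_zero] at h
  exact h

lemma serre₂ : (E 0 * E 0 * E 0 * E 1 - ((q ^ 2 + 1 + (q ^ 2)⁻¹ : ℝ) : ℂ) •
      (E 0 * E 0 * E 1 * E 0 - E 0 * E 1 * E 0 * E 0) - E 1 * E 0 * E 0 * E 0 : Uq q) = 0 := by
  have h := rel_of (q := q) .serre₂
  simp only [wE, map_mul, map_smul, map_sub, map_zero] at h
  exact h

lemma rel_of_star {a b : FreeAlgebra ℂ UGen} (h : URel q a b) :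
    PresentedAlg.mk (URel q) (freeStar a) = PresentedAlg.mk (URel q) (freeStar b) :=
  PresentedAlg.mk_rel (Or.inr (by simpa [freeStar_freeStar] using h))

lemma KinvKinv : (Kinv 0 * Kinv 1 - Kinv 1 * Kinv 0 : Uq q) = 0 := by
  have h : (K 0 * K 1 : Uq q) = K 1 * K 0 := sub_eq_zero.1 KK
  have h2 : (Kinv 1 * Kinv 0 : Uq q) = Kinv 0 * Kinv 1 := by
    calc (Kinv 1 * Kinv 0 : Uq q)
        = Kinv 1 * Kinv 0 * (K 0 * K 1) * (Kinv 1 * Kinv 0) := by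
          rw [show (Kinv 1 * Kinv 0 * (K 0 * K 1) * (Kinv 1 * Kinv 0) : Uq q)
            = Kinv 1 * (Kinv 0 * K 0) * K 1 * (Kinv 1 * Kinv 0) by simp only [mul_assoc]]
          rw [Kinv_K, mul_one, Kinv_K, one_mul]
      _ = Kinv 1 * Kinv 0 * (K 0 * K 1) * (Kinv 0 * Kinv 1) := by
          rw [show (Kinv 1 * Kinv 0 * (K 0 * K 1) * (Kinv 1 * Kinv 0) : Uq q)
            = Kinv 1 * Kinv 0 * (K 0 * (K 1 * Kinv 1) * Kinv 0) by simp only [mul_assoc],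
            K_Kinv, mul_one, K_Kinv, mul_one, h,
            show (Kinv 1 * Kinv 0 * (K 1 * K 0) * (Kinv 0 * Kinv 1) : Uq q)
            = Kinv 1 * Kinv 0 * (K 1 * (K 0 * Kinv 0) * Kinv 1) by simp only [mul_assoc],
            K_Kinv, mul_one, K_Kinv, mul_one]
      _ = Kinv 0 * Kinv 1 := by
          rw [show (Kinv 1 * Kinv 0 * (K 0 * K 1) * (Kinv 0 * Kinv 1) : Uq q)
            = Kinv 1 * (Kinv 0 * K 0) * K 1 * (Kinv 0 * Kinv 1) by simp only [mul_assoc]]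
          rw [Kinv_K, mul_one, Kinv_K, one_mul]
  rw [h2, sub_self]

lemma KF (i : Fin 2) : (Kinv i * F i * K i : Uq q) = ((qpow q i : ℝ) : ℂ) • F i := by
  have h := rel_of_star (q := q) (.KE i)
  simp only [wE, wK, wKinv, map_mul, map_smul, freeStar_mul, freeStar_smul, freeStar_ι, star,
    Complex.conj_ofReal] at h
  rw [mul_assoc]
  exact h

lemma KF_ne (i j : Fin 2) (h : i ≠ j) :
    (Kinv i * F j * K i : Uq q) = ((q⁻¹ : ℝ) : ℂ) • F j := by
  have h := rel_of_star (q := q) (.KE_ne i j h)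
  simp only [wE, wK, wKinv, map_mul, map_smul, freeStar_mul, freeStar_smul, freeStar_ι, star,
    Complex.conj_ofReal] at h
  rw [mul_assoc]
  exact h

lemma serreF₁ : (F 1 * F 1 * F 0 - ((q ^ 2 + (q ^ 2)⁻¹ : ℝ) : ℂ) • (F 1 * (F 0 * F 1))
    + F 0 * (F 1 * F 1) : Uq q) = 0 := by
  have h := rel_of_star (q := q) .serre₁
  simp only [wE, map_mul, map_smul, map_add, map_sub, map_zero, freeStar_mul, freeStar_smul,
    freeStar_ι, star, freeStar_add, freeStar_sub, freeStar_zero, Complex.conj_ofReal] at h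
  exact h

lemma serreF₂ : (F 1 * (F 0 * (F 0 * F 0)) - ((q ^ 2 + 1 + (q ^ 2)⁻¹ : ℝ) : ℂ) •
      (F 0 * (F 1 * (F 0 * F 0)) - F 0 * (F 0 * (F 1 * F 0)))
      - F 0 * (F 0 * (F 0 * F 1)) : Uq q) = 0 := by
  have h := rel_of_star (q := q) .serre₂
  simp only [wE, map_mul, map_smul, map_sub, map_zero, freeStar_mul, freeStar_smul,
    freeStar_ι, star, freeStar_sub, freeStar_zero, Complex.conj_ofReal] at h
  exact h

lemma freeAntipode_rel (hq : q ≠ 0) (a b : FreeAlgebra ℂ UGen) (h : URel q a b) :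
    freeAntipode q a = freeAntipode q b ∧
      freeAntipode q (freeStar a) = freeAntipode q (freeStar b) := by
  have hp : ∀ i, ((qpow q i : ℝ) : ℂ) ≠ 0 := fun i => by simp [qpow, hq]
  cases h <;>
  refine ⟨MulOpposite.unop_injective ?_, MulOpposite.unop_injective ?_⟩ <;>
  simp only [freeStar_sub, freeStar_mul, freeStar_smul, freeStar_one, freeStar_zero, freeStar_add,
    wK, wKinv, wE, wF, freeStar_ι, star, map_sub, map_mul, map_smul, map_one, map_zero, map_add,
    freeAntipode, FreeAlgebra.lift_ι_apply, MulOpposite.unop_sub, MulOpposite.unop_mul,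
    MulOpposite.unop_add, MulOpposite.unop_smul, MulOpposite.unop_op, MulOpposite.unop_one,
    MulOpposite.unop_zero, mul_smul_comm, smul_mul_assoc, smul_smul, neg_mul, mul_neg, neg_neg,
    Complex.conj_ofReal]
  case KK.refine_1 => rw [← neg_eq_zero, neg_sub]; exact KinvKinv
  case KK.refine_2 => exact KinvKinv
  case K_Kinv.refine_1 i => exact K_Kinv i
  case K_Kinv.refine_2 i => exact Kinv_K i
  case Kinv_K.refine_1 i => exact Kinv_K i
  case Kinv_K.refine_2 i => exact K_Kinv i
  case EF.refine_1 i =>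
    rw [Complex.ofReal_inv, mul_inv_cancel₀ (hp i), inv_mul_cancel₀ (hp i), one_smul, one_smul,
      ← neg_inj, neg_sub, EF i, ← smul_neg, neg_sub]
  case EF.refine_2 i =>
    rw [Complex.ofReal_inv, mul_inv_cancel₀ (hp i), inv_mul_cancel₀ (hp i), one_smul, one_smul,
      ← neg_inj, neg_sub, EF i, ← smul_neg, neg_sub]
  case EF_ne.refine_1 i j h =>
    rw [mul_comm, ← smul_sub, ← neg_sub, EF_ne i j h, neg_zero, smul_zero]
  case EF_ne.refine_2 i j h =>
    rw [mul_comm, ← smul_sub, ← neg_sub, EF_ne j i h.symm, neg_zero, smul_zero]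
  case KE.refine_1 i => rw [← mul_assoc, KE i, smul_smul, neg_mul]
  case KE.refine_2 i => rw [KF i, smul_smul, neg_mul, mul_comm]
  case KE_ne.refine_1 i j h => rw [← mul_assoc, KE_ne i j h, smul_smul, neg_mul, mul_comm]
  case KE_ne.refine_2 i j h => rw [KF_ne i j h, smul_smul, neg_mul, mul_comm]
  case serre₁.refine_1 =>
    refine Eq.trans ?_ ((congrArg (fun z => (-(((qpow q 0 : ℝ) : ℂ) * ((qpow q 1 : ℝ) : ℂ)
      * ((qpow q 1 : ℝ) : ℂ))) • z) (serre₁ (q := q))).trans (smul_zero _))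
    simp only [mul_assoc]
    module
  case serre₁.refine_2 =>
    refine Eq.trans ?_ ((congrArg (fun z => (-(((qpow q 0)⁻¹ : ℝ) : ℂ) * (((qpow q 1)⁻¹ : ℝ) : ℂ)
      * (((qpow q 1)⁻¹ : ℝ) : ℂ)) • z) (serreF₁ (q := q))).trans (smul_zero _))
    simp only [mul_assoc]
    module
  case serre₂.refine_1 =>
    refine Eq.trans ?_ ((congrArg (fun z => (-(((qpow q 0 : ℝ) : ℂ) * ((qpow q 0 : ℝ) : ℂ)
      * ((qpow q 0 : ℝ) : ℂ) * ((qpow q 1 : ℝ) : ℂ))) • z) (serre₂ (q := q))).trans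
      (smul_zero _))
    simp only [mul_assoc]
    module
  case serre₂.refine_2 =>
    refine Eq.trans ?_ ((congrArg (fun z => (-((((qpow q 0)⁻¹ : ℝ) : ℂ) *
      (((qpow q 0)⁻¹ : ℝ) : ℂ) * (((qpow q 0)⁻¹ : ℝ) : ℂ) * (((qpow q 1)⁻¹ : ℝ) : ℂ))) • z)
      (serreF₂ (q := q))).trans (smul_zero _))
    simp only [mul_assoc]
    module

/-- The antipode of `U_q(so(5))`, as an antimultiplicative linear map. -/
def antipode (q : Set.Ioo (0 : ℝ) 1) : Uq q →ₐ[ℂ] (Uq q)ᵐᵒᵖ :=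
  PresentedAlg.lift (freeAntipode q) (freeAntipode_rel q.2.1.ne')

/-- `h ↦ S(h)*`. -/
def antipodeStar (q : Set.Ioo (0 : ℝ) 1) (h : Uq q) : Uq q :=
  star (MulOpposite.unop (antipode q h))

end Uq

/-! ### The Hilbert space of chiral spinors

All of `l, j, m₁, m₂` are half-integers; a half-integer is stored as the integer `n` with value
`n + 1/2`. -/

/-- The half-integer `n + 1/2`. -/
def hf (n : ℤ) : ℝ := n + 1 / 2

/-- With `l = L + 1/2`, etc.: `j = 1/2, …, l`, `j - |m₁| ∈ ℕ` and `l + 1/2 - j - |m₂| ∈ ℕ`. -/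
def IsLabel (L M₁ M₂ J : ℤ) : Prop :=
  0 ≤ J ∧ J ≤ L ∧ |2 * M₁ + 1| ≤ 2 * J + 1 ∧ |2 * M₂ + 1| ≤ 2 * (L - J) + 1

instance (L M₁ M₂ J : ℤ) : Decidable (IsLabel L M₁ M₂ J) := by
  unfold IsLabel; infer_instance

/-- The labels `(l, m₁, m₂; j)` of the orthonormal basis of each of the spaces `H_±`. -/
@[ext]
structure Label where
  L : ℤ
  M₁ : ℤ
  M₂ : ℤ
  J : ℤ
  valid : IsLabel L M₁ M₂ J

/-- `(l, m₁, m₂; j) ↦ (l, -m₁, -m₂; j)`. -/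
def Label.neg (k : Label) : Label where
  L := k.L
  M₁ := -k.M₁ - 1
  M₂ := -k.M₂ - 1
  J := k.J
  valid := by
    obtain ⟨h1, h2, h3, h4⟩ := k.valid
    refine ⟨h1, h2, ?_, ?_⟩
    · rw [← abs_neg]; convert h3 using 2; ring
    · rw [← abs_neg]; convert h4 using 2; ring

@[simp] lemma Label.neg_neg (k : Label) : k.neg.neg = k := by
  ext <;> simp [Label.neg]

/-- The basis labels of `H = H_+ ⊕ H_-`; the second component is the sign `±`. -/
abbrev Idx : Type := Label × ℤˣ

instance : DecidableEq Idx := Classical.decEq _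

def Idx.neg (k : Idx) : Idx := (k.1.neg, k.2)

/-- `|l, m₁, m₂; j⟩_± ↦ |l, m₁, m₂; j⟩_∓` on labels. -/
def Idx.flip (k : Idx) : Idx := (k.1, -k.2)

@[simp] lemma Idx.neg_neg (k : Idx) : Idx.neg (Idx.neg k) = k := by simp [Idx.neg]

@[simp] lemma Idx.flip_flip (k : Idx) : Idx.flip (Idx.flip k) = k := by simp [Idx.flip]

def Idx.negEquiv : Idx ≃ Idx := ⟨Idx.neg, Idx.neg, Idx.neg_neg, Idx.neg_neg⟩

def Idx.flipEquiv : Idx ≃ Idx := ⟨Idx.flip, Idx.flip, Idx.flip_flip, Idx.flip_flip⟩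

/-- The Hilbert space `H = H_+ ⊕ H_-`. -/
abbrev Spinors : Type := lp (fun _ : Idx => ℂ) 2

/-- The dense subspace `⊕ V_l ⊕ V_l` of finite linear combinations of basis vectors. -/
abbrev FinSpinors : Type := Idx →₀ ℂ

/-- The basis vector of `Spinors` with a given label. -/
def ket (k : Idx) : Spinors := lp.single 2 k (1 : ℂ)

/-- The inclusion of the finite linear combinations into the Hilbert space. -/
def incl : FinSpinors →ₗ[ℂ] Spinors := Finsupp.linearCombination ℂ ket

/-- The vector `|l, m₁, m₂; j⟩_s`, which is zero unless the labels are admissible. -/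
def vec (s : ℤˣ) (L M₁ M₂ J : ℤ) : FinSpinors :=
  if h : IsLabel L M₁ M₂ J then Finsupp.single (⟨L, M₁, M₂, J, h⟩, s) 1 else 0

/-! ### Coefficients -/

section Coefficients

variable (q : ℝ)

/-- The `q`-number `[z]`. -/
def qn (z : ℝ) : ℝ := (q ^ z - q ^ (-z)) / (q - q⁻¹)

/-- `ε = ±1/2`, determined by `l + ε - j - m₂ ∈ 2ℕ`. -/
def eps (L J M₂ : ℤ) : ℝ := if Even (L - J - M₂) then 1 / 2 else -1 / 2

def cA₁ (J M₁ : ℤ) : ℝ :=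
  let j := hf J; let m := hf M₁;
  q ^ (m - 1) * (√(qn q (j + m + 1) * qn q (j - m + 1)) / qn q (2 * j + 2))

def cA₀ (J M₁ : ℤ) : ℝ :=
  let j := hf J; let m := hf M₁;
  q ^ (-2 : ℝ) * ((q ^ (j + m + 1) * qn q 2 * qn q (j - m) - qn q (2 * j)) /
    (qn q (2 * j) * qn q (2 * j + 2)))

def cB₁ (J M₁ : ℤ) : ℝ :=
  let j := hf J; let m := hf M₁;
  q ^ (-j + m - 1 / 2) * (√(qn q (j + m + 1) * qn q (j + m + 2)) / qn q (2 * j + 2))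

def cB₀ (J M₁ : ℤ) : ℝ :=
  let j := hf J; let m := hf M₁;
  (1 + q ^ 2) * q ^ (m - 1 / 2) *
    (√(qn q (j - m) * qn q (j + m + 1)) / (qn q (2 * j) * qn q (2 * j + 2)))

def cBm (J M₁ : ℤ) : ℝ :=
  let j := hf J; let m := hf M₁;
  -q ^ (j + m + 1 / 2) * (√(qn q (j - m) * qn q (j - m - 1)) / qn q (2 * j))

def cC₁ (L J M₂ : ℤ) : ℝ :=
  let l := hf L; let j := hf J; let m := hf M₂; let e := eps L J M₂;
  -q ^ (m - 1 - e) * (√(qn q (l + j + m + 3 + e) * qn q (l + j - m + 3 - e)) / qn q (2 * l + 4))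

def cC₀ (L J M₂ : ℤ) : ℝ :=
  let l := hf L; let j := hf J; let m := hf M₂; let e := eps L J M₂;
  qn q (4 * e) * q ^ (2 * e * l + m - 1 + 3 * e) *
    (√(qn q (l + 1 / 2 + j - 2 * e * m + 2) * qn q (l + 1 / 2 - j - 2 * e * m)) /
      (qn q (2 * l + 2) * qn q (2 * l + 4)))

def cCm (L J M₂ : ℤ) : ℝ :=
  let l := hf L; let j := hf J; let m := hf M₂; let e := eps L J M₂;
  -q ^ (m - 1 + e) * (√(qn q (l - j + m - e) * qn q (l - j - m + e)) / qn q (2 * l + 2))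

def cH₁ (L J M₂ : ℤ) : ℝ :=
  let l := hf L; let j := hf J; let m := hf M₂; let e := eps L J M₂;
  q ^ (m - 1 + e * (2 * j + 1)) *
    (√(qn q (l + 2 * e * j - m + 2 + e) * qn q (l - 2 * e * j + m + 2 - e)) / qn q (2 * l + 4))

def cH₀ (L J M₂ : ℤ) : ℝ :=
  let l := hf L; let j := hf J; let m := hf M₂; let e := eps L J M₂;
  (qn q (l - e * (2 * j + 1) - m + 1) * qn q (l - e * (2 * j + 1) + m + 2)
    - q ^ (-2 : ℝ) * qn q (l + e * (2 * j + 1) - m + 2) * qn q (l + e * (2 * j + 1) + m + 1)) /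
      (qn q (2 * l + 2) * qn q (2 * l + 4))

def cD₁ (L J M₂ : ℤ) : ℝ :=
  let l := hf L; let j := hf J; let m := hf M₂; let e := eps L J M₂;
  q ^ (-l + m - 3 / 2) *
    (√(qn q (l + j + m + 3 + e) * qn q (l - j + m + 2 - e)) / qn q (2 * l + 4))

def cD₀ (L J M₂ : ℤ) : ℝ :=
  let l := hf L; let j := hf J; let m := hf M₂; let e := eps L J M₂;
  qn q 2 * q ^ (m + 1 / 2) *
    (√(qn q (l - 2 * e * j - m + 1 - e) * qn q (l - 2 * e * j + m + 2 - e)) /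
      (qn q (2 * l + 2) * qn q (2 * l + 4)))

def cDm (L J M₂ : ℤ) : ℝ :=
  let l := hf L; let j := hf J; let m := hf M₂; let e := eps L J M₂;
  -q ^ (l + m + 3 / 2) *
    (√(qn q (l - j - m + e) * qn q (l + j - m + 1 - e)) / qn q (2 * l + 2))

/-- The coefficient `a_l(j, m₂)` of the representation of `U_q(so(5))`. -/
def ca (L J M₂ : ℤ) : ℝ :=
  let l := hf L; let j := hf J; let m := hf M₂; let e := eps L J M₂;
  1 / qn q 2 * √(qn q (l - j - m + e) * qn q (l + j + m + 3 + e) /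
    (qn q (2 * (j + |e|) + 1) * qn q (2 * (j - |e|) + 3)))

/-- The coefficient `b_l(j, m₂)`. -/
def cb (L J M₂ : ℤ) : ℝ :=
  let l := hf L; let j := hf J; let m := hf M₂; let e := eps L J M₂;
  2 * |e| * (√(qn q (l - e * (2 * j + 1) - m + 1) * qn q (l - e * (2 * j + 1) + m + 2)) /
    (qn q (2 * j) * qn q (2 * j + 2)))

/-- The coefficient `c_l(j, m₂)`; here `(-1)^(2ε) = -1`. -/
def cc (L J M₂ : ℤ) : ℝ :=
  let l := hf L; let j := hf J; let m := hf M₂; let e := eps L J M₂;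
  -1 / qn q 2 * √(qn q (l - j + m + 2 - e) * qn q (l + j - m + 1 - e) /
    (qn q (2 * (j + |e|) - 1) * qn q (2 * (j - |e|) + 1)))

end Coefficients

/-! ### The representations of the sphere and of the symmetry algebra -/

section Representations

variable (q : ℝ)

/-- A real number as a scalar. -/
local notation "r(" x ")" => ((x : ℝ) : ℂ)

/-- The image of `|l, m₁, m₂; j⟩_s` under `x₀`. -/
def x₀vec : Idx → FinSpinors := fun ⟨⟨L, M₁, M₂, J, _⟩, s⟩ =>
  let σ : ℝ := ((s : ℤ) : ℝ)
  r(cA₁ q J M₁ * cC₁ q L J M₂) • vec s (L + 1) M₁ M₂ (J + 1)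
  + r(-σ * cA₁ q J M₁ * cC₀ q L J M₂) • vec s L M₁ M₂ (J + 1)
  + r(cA₁ q J M₁ * cCm q L J M₂) • vec s (L - 1) M₁ M₂ (J + 1)
  + r(cA₀ q J M₁ * cH₁ q L J M₂) • vec s (L + 1) M₁ M₂ J
  + r(σ * cA₀ q J M₁ * cH₀ q L J M₂) • vec s L M₁ M₂ J
  + r(cA₀ q J M₁ * cH₁ q (L - 1) J M₂) • vec s (L - 1) M₁ M₂ J
  + r(cA₁ q (J - 1) M₁ * cCm q (L + 1) (J - 1) M₂) • vec s (L + 1) M₁ M₂ (J - 1)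
  + r(-σ * cA₁ q (J - 1) M₁ * cC₀ q L (J - 1) M₂) • vec s L M₁ M₂ (J - 1)
  + r(cA₁ q (J - 1) M₁ * cC₁ q (L - 1) (J - 1) M₂) • vec s (L - 1) M₁ M₂ (J - 1)

/-- The image of `|l, m₁, m₂; j⟩_s` under `x₁`. -/
def x₁vec : Idx → FinSpinors := fun ⟨⟨L, M₁, M₂, J, _⟩, s⟩ =>
  let σ : ℝ := ((s : ℤ) : ℝ)
  r(cB₁ q J M₁ * cC₁ q L J M₂) • vec s (L + 1) (M₁ + 1) M₂ (J + 1)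
  + r(-σ * cB₁ q J M₁ * cC₀ q L J M₂) • vec s L (M₁ + 1) M₂ (J + 1)
  + r(cB₁ q J M₁ * cCm q L J M₂) • vec s (L - 1) (M₁ + 1) M₂ (J + 1)
  + r(cB₀ q J M₁ * cH₁ q L J M₂) • vec s (L + 1) (M₁ + 1) M₂ J
  + r(σ * cB₀ q J M₁ * cH₀ q L J M₂) • vec s L (M₁ + 1) M₂ J
  + r(cB₀ q J M₁ * cH₁ q (L - 1) J M₂) • vec s (L - 1) (M₁ + 1) M₂ J
  + r(cBm q J M₁ * cCm q (L + 1) (J - 1) M₂) • vec s (L + 1) (M₁ + 1) M₂ (J - 1)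
  + r(-σ * cBm q J M₁ * cC₀ q L (J - 1) M₂) • vec s L (M₁ + 1) M₂ (J - 1)
  + r(cBm q J M₁ * cC₁ q (L - 1) (J - 1) M₂) • vec s (L - 1) (M₁ + 1) M₂ (J - 1)

/-- The image of `|l, m₁, m₂; j⟩_s` under `x₂`. -/
def x₂vec : Idx → FinSpinors := fun ⟨⟨L, M₁, M₂, J, _⟩, s⟩ =>
  let σ : ℝ := ((s : ℤ) : ℝ)
  r(cD₁ q L J M₂) • vec s (L + 1) M₁ (M₂ + 1) J
  + r(σ * cD₀ q L J M₂) • vec s L M₁ (M₂ + 1) J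
  + r(cDm q L J M₂) • vec s (L - 1) M₁ (M₂ + 1) J

/-- `K₁|l, m₁, m₂; j⟩ = q^{m₁}|l, m₁, m₂; j⟩`, `K₂|l, m₁, m₂; j⟩ = q^{m₂ - m₁}|l, m₁, m₂; j⟩`. -/
def Kvec (i : Fin 2) : Idx → FinSpinors := fun k =>
  r(![q ^ hf k.1.M₁, q ^ (hf k.1.M₂ - hf k.1.M₁)] i) • Finsupp.single k 1

/-- The images of `|l, m₁, m₂; j⟩_s` under `E₁` and `E₂`. -/
def Evec (i : Fin 2) : Idx → FinSpinors := fun ⟨⟨L, M₁, M₂, J, _⟩, s⟩ =>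
  let j := hf J; let m := hf M₁;
  ![r(√(qn q (j - m) * qn q (j + m + 1))) • vec s L (M₁ + 1) M₂ J,
    r(√(qn q (j - m + 1) * qn q (j - m + 2)) * ca q L J M₂) • vec s L (M₁ - 1) (M₂ + 1) (J + 1)
    + r(√(qn q (j + m) * qn q (j - m + 1)) * cb q L J M₂) • vec s L (M₁ - 1) (M₂ + 1) J
    + r(√(qn q (j + m) * qn q (j + m - 1)) * cc q L J M₂) • vec s L (M₁ - 1) (M₂ + 1) (J - 1)] i

variable {q}

/-- `π` is the direct sum on `H_+ ⊕ H_-` of the two chiral spinorial representations of the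
quantum 4-sphere. -/
structure IsChiralRep (π : SphereAlg q →⋆ₐ[ℂ] (Spinors →L[ℂ] Spinors)) : Prop where
  x₀ : ∀ k, π (PresentedAlg.gen _ .x0) (ket k) = incl (x₀vec q k)
  x₁ : ∀ k, π (PresentedAlg.gen _ .x1) (ket k) = incl (x₁vec q k)
  x₂ : ∀ k, π (PresentedAlg.gen _ .x2) (ket k) = incl (x₂vec q k)

/-- `ρ` is the `*`-representation of `U_q(so(5))` on the dense subspace `⊕ V_l ⊕ V_l`, two copies of
the sum of the irreducible representations with highest weights `(1/2, l)`. -/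
structure IsSpinorRep (ρ : Uq q →ₐ[ℂ] Module.End ℂ FinSpinors) : Prop where
  K : ∀ i k, ρ (Uq.K i) (Finsupp.single k 1) = Kvec q i k
  E : ∀ i k, ρ (Uq.E i) (Finsupp.single k 1) = Evec q i k
  star : ∀ (h : Uq q) (v w : FinSpinors),
    ⟪incl (ρ h v), incl w⟫_ℂ = ⟪incl v, incl (ρ (star h) w)⟫_ℂ

end Representations

/-! ### Multiplication operators on the Hilbert space -/

/-- The eigenvalue `l + 3/2` of `|D|`. -/
def dval (k : Idx) : ℝ := hf k.1.L + 3 / 2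

lemma one_le_dval (k : Idx) : 1 ≤ dval k := by
  have h : (0 : ℝ) ≤ (k.1.L : ℝ) := by
    exact_mod_cast k.1.valid.1.trans k.1.valid.2.1
  unfold dval hf
  linarith

lemma memℓp_two_iff (f : Idx → ℂ) : Memℓp f 2 ↔ Summable fun k => ‖f k‖ ^ 2 := by
  rw [memℓp_gen_iff (by norm_num)]
  norm_num

/-- The bounded diagonal operator with diagonal entries `w k`, `‖w k‖ ≤ 1`. -/
def boundedDiag (w : Idx → ℂ) (hw : ∀ k, ‖w k‖ ≤ 1) : Spinors →L[ℂ] Spinors :=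
  LinearMap.mkContinuous
    { toFun := fun f => ⟨fun k => w k * f k, by
        have hf := (memℓp_two_iff _).1 (lp.memℓp f)
        refine (memℓp_two_iff _).2 (hf.of_nonneg_of_le (fun k => by positivity) fun k => ?_)
        rw [norm_mul]
        gcongr
        exact mul_le_of_le_one_left (norm_nonneg _) (hw k)⟩
      map_add' := fun f g => by
        ext k; exact mul_add _ _ _
      map_smul' := fun c f => by
        ext k; exact mul_left_comm _ _ _ }
    1 (fun f => by
      rw [one_mul]
      refine lp.norm_le_of_tsum_le (by norm_num) (norm_nonneg _) ?_
      rw [lp.norm_rpow_eq_tsum (by norm_num) f]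
      have hf := (memℓp_gen_iff (p := 2) (by norm_num)).1 (lp.memℓp f)
      have hle : ∀ k, ‖w k * f k‖ ^ (2 : ENNReal).toReal ≤ ‖f k‖ ^ (2 : ENNReal).toReal :=
        fun k => by
          rw [norm_mul]
          gcongr
          exact mul_le_of_le_one_left (norm_nonneg _) (hw k)
      exact (hf.of_nonneg_of_le (fun k => by positivity) hle).tsum_le_tsum hle hf)

@[simp] lemma boundedDiag_apply (w : Idx → ℂ) (hw : ∀ k, ‖w k‖ ≤ 1) (f : Spinors) (k : Idx) :
    boundedDiag w hw f k = w k * f k := rfl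

/-- The grading `γ`, equal to `±1` on `H_±`. -/
def grading : Spinors →L[ℂ] Spinors :=
  boundedDiag (fun k => ((k.2 : ℤ) : ℂ)) fun k => by
    rcases Int.units_eq_one_or k.2 with h | h <;> simp [h]

/-- The bounded operator `|D|^{-p}`, `p ≥ 0`, with eigenvalues `(l + 3/2)^{-p}`. -/
def absDiracNegPow (p : ℝ) (hp : 0 ≤ p) : Spinors →L[ℂ] Spinors :=
  boundedDiag (fun k => ((dval k ^ (-p) : ℝ) : ℂ)) fun k => by
    rw [Complex.norm_real, Real.norm_of_nonneg
      (Real.rpow_nonneg (zero_le_one.trans (one_le_dval k)) _)]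
    exact Real.rpow_le_one_of_one_le_of_nonpos (one_le_dval k) (by linarith)

/-- The unbounded operator `f ↦ (k ↦ w k * f (e k))` with its maximal domain. -/
def unboundedMul (w : Idx → ℝ) (e : Idx → Idx) : Spinors →ₗ.[ℂ] Spinors where
  domain :=
    { carrier := {f | Memℓp (fun k => (w k : ℂ) * f (e k)) 2}
      add_mem' := fun {f g} hf hg => by
        have h := Memℓp.add hf hg
        refine (congrArg (fun F : Idx → ℂ => Memℓp F 2) (funext fun k => ?_)).mp h
        exact (mul_add _ _ _).symm
      zero_mem' := by
        refine (congrArg (fun F : Idx → ℂ => Memℓp F 2) (funext fun k => ?_)).mp zero_memℓp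
        exact (mul_zero _).symm
      smul_mem' := fun c f hf => by
        have h := Memℓp.const_smul hf c
        refine (congrArg (fun F : Idx → ℂ => Memℓp F 2) (funext fun k => ?_)).mp h
        exact mul_left_comm _ _ _ }
  toFun :=
    { toFun := fun f => ⟨fun k => (w k : ℂ) * (f : Spinors) (e k), f.2⟩
      map_add' := fun f g => by
        ext k; exact mul_add _ _ _
      map_smul' := fun c f => by
        ext k; exact mul_left_comm _ _ _ }

/-- The Dirac operator `D|l, m₁, m₂; j⟩_± = (l + 3/2)|l, m₁, m₂; j⟩_∓`, with its domain of
self-adjointness. -/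
def dirac : Spinors →ₗ.[ℂ] Spinors := unboundedMul dval Idx.flip

/-- `|D|`, the positive operator `|D||l, m₁, m₂; j⟩_± = (l + 3/2)|l, m₁, m₂; j⟩_±`. -/
def absDirac : Spinors →ₗ.[ℂ] Spinors := unboundedMul dval id

/-! ### The real structure -/

/-- `i^{2l+1} (-1)^{j+m₁}`. -/
def phase (k : Label) : ℂ := Complex.I ^ (2 * k.L + 2) * (-1) ^ (k.J + k.M₁ + 1)

lemma phase_eq (k : Label) : phase k = 1 ∨ phase k = -1 := by
  have h1 : Complex.I ^ (2 * k.L + 2) = (-1) ^ (k.L + 1) := by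
    rw [show 2 * k.L + 2 = 2 * (k.L + 1) by ring, zpow_mul]
    norm_cast
    simp
  rw [phase, h1, ← zpow_add₀ (by norm_num)]
  rcases Int.even_or_odd (k.L + 1 + (k.J + k.M₁ + 1)) with h | h
  · exact Or.inl h.neg_one_zpow
  · exact Or.inr h.neg_one_zpow

@[simp] lemma conj_phase (k : Label) : conj (phase k) = phase k := by
  rcases phase_eq k with h | h <;> simp [h]

@[simp] lemma norm_phase (k : Label) : ‖phase k‖ = 1 := by
  rcases phase_eq k with h | h <;> simp [h]

lemma phase_mul_phase_neg (k : Label) : phase k * phase k.neg = -1 := by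
  have h1 : Complex.I ^ (2 * k.L + 2) * Complex.I ^ (2 * k.L + 2) = 1 := by
    rw [← zpow_add₀ Complex.I_ne_zero, show 2 * k.L + 2 + (2 * k.L + 2) = 4 * (k.L + 1) by ring,
      zpow_mul]
    norm_cast
    simp
  have h2 : (-1 : ℂ) ^ (k.J + k.M₁ + 1) * (-1) ^ (k.J + (-k.M₁ - 1) + 1) = -1 := by
    rw [← zpow_add₀ (by norm_num),
      show k.J + k.M₁ + 1 + (k.J + (-k.M₁ - 1) + 1) = 2 * k.J + 1 by ring,
      zpow_add₀ (by norm_num), zpow_mul]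
    norm_num
  calc phase k * phase k.neg
      = (Complex.I ^ (2 * k.L + 2) * Complex.I ^ (2 * k.L + 2)) *
        ((-1 : ℂ) ^ (k.J + k.M₁ + 1) * (-1) ^ (k.J + (-k.M₁ - 1) + 1)) := by
        simp only [phase, Label.neg]; ring
    _ = -1 := by rw [h1, h2, one_mul]

/-- The action of `J` on coordinates: the coefficient of `|k⟩` in `J f` is the conjugate of the
coefficient of `|-k⟩` in `f`, times the phase of `-k`. -/
def realFun (f : Spinors) : Spinors :=
  ⟨fun k => phase k.1.neg * conj (f (Idx.neg k)), by
    refine (memℓp_two_iff _).2 ?_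
    have h := (Idx.negEquiv.summable_iff).2 ((memℓp_two_iff _).1 (lp.memℓp f))
    refine h.congr fun k => ?_
    simp [Idx.negEquiv]⟩

lemma realFun_apply (f : Spinors) (k : Idx) :
    realFun f k = phase k.1.neg * conj (f (Idx.neg k)) := rfl

lemma realFun_realFun (f : Spinors) : realFun (realFun f) = -f := by
  ext k
  rw [realFun_apply, realFun_apply, map_mul, conj_phase, Idx.neg_neg]
  change _ = - f k
  simp only [Idx.neg, Label.neg_neg, Complex.conj_conj]
  rw [← mul_assoc, mul_comm (phase _), phase_mul_phase_neg, neg_one_mul]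

/-- The real structure `J|l, m₁, m₂; j⟩_± = i^{2l+1} (-1)^{j+m₁} |l, -m₁, -m₂; j⟩_±`, an
antiunitary operator. -/
def realStr : Spinors ≃ₗᵢ⋆[ℂ] Spinors where
  toFun := realFun
  invFun f := -realFun f
  map_add' f g := by
    ext k; simp [realFun_apply, mul_add]
  map_smul' c f := by
    ext k; simp [realFun_apply]; ring
  left_inv f := by simp [realFun_realFun]
  right_inv f := by
    have h : realFun (-realFun f) = -realFun (realFun f) := by
      ext k; simp [realFun_apply]
    simp [h, realFun_realFun]
  norm_map' f := by
    have h2 : 0 < (2 : ENNReal).toReal := by norm_num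
    change ‖realFun f‖ = ‖f‖
    rw [lp.norm_eq_tsum_rpow h2, lp.norm_eq_tsum_rpow h2]
    congr 1
    rw [← Idx.negEquiv.tsum_eq (fun k => ‖f k‖ ^ (2 : ENNReal).toReal)]
    refine tsum_congr fun k => ?_
    simp [realFun_apply, Idx.negEquiv]

lemma realStr_ket (k : Idx) : realStr (ket k) = phase k.1 • ket (Idx.neg k) := by
  ext i
  change phase i.1.neg * conj ((ket k : Spinors) (Idx.neg i)) = phase k.1 * ket (Idx.neg k) i
  by_cases h : i = Idx.neg k
  · subst h
    simp [ket]
    simp [Idx.neg]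
  · have h' : Idx.neg i ≠ k := fun h' => h (by rw [← h', Idx.neg_neg])
    simp [ket, h, h']

/-- `J b J`. -/
def realConj (b : Spinors →L[ℂ] Spinors) : Spinors →L[ℂ] Spinors :=
  (realStr.toContinuousLinearEquiv : Spinors →L⋆[ℂ] Spinors).comp
    (b.comp (realStr.toContinuousLinearEquiv : Spinors →L⋆[ℂ] Spinors))

lemma realConj_apply (b : Spinors →L[ℂ] Spinors) (v : Spinors) :
    realConj b v = realStr (b (realStr v)) := rfl

/-- The antilinear operator
`T|l, m₁, m₂; j⟩_± = i^{2l+1} (-1)^{j+m₁} q^{m₁+3m₂} |l, -m₁, -m₂; j⟩_±` on finite linear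
combinations. -/
def twistedReal (q : ℝ) : FinSpinors →ₗ⋆[ℂ] FinSpinors where
  toFun v := v.sum fun k c => (conj c * (phase k.1 * ((q ^ (hf k.1.M₁ + 3 * hf k.1.M₂) : ℝ) : ℂ))) •
    Finsupp.single (Idx.neg k) (1 : ℂ)
  map_add' v w := by
    refine Finsupp.sum_add_index' (fun k => by simp) fun k a b => ?_
    rw [map_add, add_mul, add_smul]
  map_smul' c v := by
    rw [Finsupp.sum_smul_index' (fun k => by simp), Finsupp.smul_sum]
    refine Finsupp.sum_congr fun k _ => ?_
    rw [smul_eq_mul, map_mul, mul_assoc, mul_smul]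

lemma twistedReal_single (q : ℝ) (k : Idx) :
    twistedReal q (Finsupp.single k 1) =
      (phase k.1 * ((q ^ (hf k.1.M₁ + 3 * hf k.1.M₂) : ℝ) : ℂ)) •
        Finsupp.single (Idx.neg k) (1 : ℂ) := by
  refine (Finsupp.sum_single_index (a := k) (b := (1 : ℂ)) (h := fun k c =>
    (conj c * (phase k.1 * ((q ^ (hf k.1.M₁ + 3 * hf k.1.M₂) : ℝ) : ℂ))) •
      Finsupp.single (Idx.neg k) (1 : ℂ)) (by simp)).trans ?_
  rw [map_one, one_mul]

/-- `U` is the antiunitary part of the densely defined antilinear operator `T`: the closure of `T`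
has the polar decomposition `U P` with `P` positive, self-adjoint and injective. -/
def IsAntiunitaryPart (U : Spinors ≃ₗᵢ⋆[ℂ] Spinors) (T : FinSpinors →ₗ⋆[ℂ] FinSpinors) : Prop :=
  ∃ P : Spinors →ₗ.[ℂ] Spinors, IsSelfAdjoint P ∧
    (∀ x : P.domain, 0 ≤ (⟪(x : Spinors), P x⟫_ℂ).re) ∧
    (∀ x : P.domain, P x = 0 → x = 0) ∧
    closure (Set.range fun v : FinSpinors => (incl v, incl (T v))) =
      Set.range fun x : P.domain => ((x : Spinors), U (P x))

/-! ### Commutators, order-zero operators and the ideal -/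

/-- The bounded operator `S` extends the commutator `[A, T]`: `T` preserves the domain of the
unbounded operator `A`, and `A T v - T A v = S v` for all `v` in it. -/
def IsCommutator (A : Spinors →ₗ.[ℂ] Spinors) (T S : Spinors →L[ℂ] Spinors) : Prop :=
  ∀ v : A.domain, ∃ h : T v ∈ A.domain, A ⟨T v, h⟩ - T (A v) = S v

/-- The domain of the `n`-th power of the derivation `δ = [|D|, ·]`. -/
def domDeltaPow : ℕ → Set (Spinors →L[ℂ] Spinors)
  | 0 => Set.univ
  | n + 1 => {T | ∃ S ∈ domDeltaPow n, IsCommutator absDirac T S}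

/-- `OP⁰`, the smooth domain of `δ`. -/
def OP0 : Set (Spinors →L[ℂ] Spinors) := ⋂ n, domDeltaPow n

/-- Trace class operators: `T = ∑ₙ ⟨xₙ, ·⟩ yₙ` with `∑ₙ ‖xₙ‖ ‖yₙ‖ < ∞`. -/
def IsTraceClass (T : Spinors →L[ℂ] Spinors) : Prop :=
  ∃ x y : ℕ → Spinors, Summable (fun n => ‖x n‖ * ‖y n‖) ∧
    ∀ v, HasSum (fun n => ⟪x n, v⟫_ℂ • y n) (T v)

/-- The ideal of all `T ∈ OP⁰` such that `T|D|^{-p}` is of trace class for all `p > 2`. -/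
def idealI : Set (Spinors →L[ℂ] Spinors) :=
  {T | T ∈ OP0 ∧ ∀ (p : ℝ) (hp : 2 < p),
    IsTraceClass (T * absDiracNegPow p (zero_le_two.trans hp.le))}

end QSphere

end

open QSphere

open scoped ComplexConjugate InnerProductSpace

set_option linter.all false

noncomputable section

namespace QSphere

/-! ### The fibre operators of the lattice model and their relations -/

section

/-! Existence of the two representations. Replace the labels by integers `J, M, p, r` and a bit that
records the sign of `ε`: j = J + 1/2, m₁ = M + 1/2, l = J + p + r + 1/2, and m₂ - 1/2 is r - p or r
- p - 1. The admissible labels become the cone p, r ≥ 0, -J - 1 ≤ M ≤ J, and nearly every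
coefficient becomes a power of q times √(ν(a)ν(b)) over one or two factors ν(c), where ν(n) = 1 -
q^(2n); the exceptions A⁰ and H⁰ are already rational. Rescale the basis by the inverse products of
roots `gU` and `gW`. A coefficient that raises an index loses its root and one that lowers it
receives the full ν, so all generators and all their transposes become rational in q^J, q^M, q^p,
q^r and make sense on the whole integer lattice. The rescaling `Phi` is injective and intertwines
(`Phi_x₀`, …, `Phi_x₂t`, `Phi_E₁`, …, `Phi_F₂`). Because the gauge factors vanish outside the cone,
the boundary needs no separate treatment, and every relation turns into an identity of rational
functions.

For the sphere these identities are kept small by a factorisation. On the lattice x₀ and x₁ are sums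
of scalars depending on (J, M) times the same three fibre operators: C raises j, H preserves it, and
Cᵗ, the transpose of C, lowers it; x₂ is a fibre operator D. The fibre relations are that C, H and
Cᵗ q²-commute with D, that H commutes with C and Cᵗ across levels, that DᵗD = (1 - q⁴) + q⁴ DDᵗ, and
the two quadratic relations `fCt_fC` and `fC_fCt`. Rewriting words in the order D, C, H, Cᵗ leaves
identities in q^J and q^M only. The relation for [x₂*, x₂] follows from the others (`x₂L_adj_x₂L`),
and the remaining ones are adjoints. For the symmetry algebra the relations are checked on the
lattice directly, and the conjugate relations follow by transposition (`uFree_freeStar`).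

The commutators. All operators are finite sums of weighted shifts of the basis, and the weights
approach their limits exponentially fast. Up to weights of order q^J + q^(L-J), only two kinds of
shifts survive: in x₂ and x₂* a shift of r alone with weight depending on r (`colR`), and in x₀, x₁,
x₁* a shift of (J, M) with weight q^(2r) times a function of (J, M) (`rowR`). Conjugation by the
real structure reflects m₁ and m₂, hence exchanges p and r (`colR_rconj`, `rowR_rconj`). Shifts
acting on different coordinates commute exactly; the only pair that does not is q^(2r)(…) against
q^(2p)(…), and its products are of order q^(2r)q^(2p) = q^(2(L-J)). This is `IsMain.comm`. Operators
with columns of order q^J + q^(L-J) become trace class after multiplication by |D|^(-p), p > 2,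
because q^J sums the (J, m₁)-directions and the decay of |D|^(-p) the rest, or vice versa
(`summable_wq`); homogeneity for |D| puts them in OP⁰. As these operators form a two-sided ideal of
`admAlg`, commuting modulo the ideal passes to generated algebras (`commAlg`).

Terms that depend on the chirality are of order q^(2L) and preserve l. Therefore [D, ·] replaces a
shift by a bounded one of the same kind: a chirality-independent weight is multiplied by the shift
of l, and a difference of chirality-dependent weights, multiplied by l, still decays (`Good.dterm`,
`Tiny.dterm_le`).

The operator T is J times the diagonal operator q^(m₁+3m₂), which gives the polar decomposition. The
exponent m₁ + 3m₂ grows by 1 under E₁ and by 2 under E₂, which are the powers in S(E₁) and S(E₂);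
hence T Eᵢ = S(Eᵢ)* T once the reflected coefficients have been compared. The relation for Fᵢ
follows from T² = -1, and h ↦ S(h)* is an antilinear homomorphism. -/

/-- The fibre of the lattice model: labels `(p, r, b)` where `b` records the sign of `ε`. -/
abbrev Fib : Type := (ℤ × ℤ × Bool) →₀ ℂ

/-- A basis vector of the fibre. -/
def fb (p r : ℤ) (b : Bool) : Fib := Finsupp.single (p, r, b) 1

def fibOp (f : ℤ → ℤ → Bool → Fib) : Fib →ₗ[ℂ] Fib :=
  Finsupp.linearCombination ℂ fun i => f i.1 i.2.1 i.2.2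

@[simp] lemma fibOp_fb (f : ℤ → ℤ → Bool → Fib) (p r : ℤ) (b : Bool) :
    fibOp f (fb p r b) = f p r b := by
  simp [fibOp, fb]

lemma fib_ext {M : Type*} [AddCommGroup M] [Module ℂ M] {f g : Fib →ₗ[ℂ] M} (h : ∀ p r b, f (fb p r b) = g (fb p r b)) : f = g := by
  refine Finsupp.lhom_ext' fun ⟨p, r, b⟩ => LinearMap.ext_ring ?_
  exact h p r b

/-- `1 - q^(2n)`. -/
def nu (q : ℝ) (n : ℤ) : ℝ := 1 - q ^ (2 * n)

/-- The denominators of the coefficients of the fibre operators. -/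
def dn (q : ℝ) (J p r k : ℤ) : ℝ := nu q (2 * (J + p + r + k) + 1)


section shifts
variable (q : ℝ) (J p r k n : ℤ)
-- The denominators depend on the labels only through J + p + r. Collecting every shift in the last
-- argument leaves finitely many denominators `dn q J p r k`, whose nonvanishing can be supplied to
-- `field_simp` one `k` at a time.
lemma dn_J_add : dn q (J + n) p r k = dn q J p r (k + n) := by unfold dn; congr 1; ring
lemma dn_p_add : dn q J (p + n) r k = dn q J p r (k + n) := by unfold dn; congr 1; ring
lemma dn_r_add : dn q J p (r + n) k = dn q J p r (k + n) := by unfold dn; congr 1; ring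
end shifts

variable (q : ℝ)

/-- The common part of x₀ and x₁ that raises j by one; the terms come from C⁺, C⁻, C⁰ in this order,
the last with the chirality sign -s. The roots are missing because the basis is rescaled by `gW`. -/
def fC (J : ℤ) (s : ℝ) : Fib →ₗ[ℂ] Fib := fibOp fun p r b => match b with
  | true =>
    (-q ^ (2 * r) / dn q J p r 2) • fb p r true
    + (-q ^ (2 * J + 2 * r + 3) * nu q (2 * r) * nu q (2 * p) / dn q J p r 1) •
        fb (p - 1) (r - 1) true
    + (-s * nu q 2 * q ^ (4 * J + 2 * p + 6 * r + 6) * nu q (2 * p) /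
        (dn q J p r 1 * dn q J p r 2)) • fb (p - 1) r false
  | false =>
    (-q ^ (2 * r) / dn q J p r 2) • fb p r false
    + (-q ^ (2 * J + 2 * r + 1) * nu q (2 * r) * nu q (2 * p) / dn q J p r 1) •
        fb (p - 1) (r - 1) false
    + (s * nu q 2 * q ^ (2 * J + 2 * p + 2 * r + 1) * nu q (2 * r) /
        (dn q J p r 1 * dn q J p r 2)) • fb p (r - 1) true

/-- The operator x₂ in the rescaled basis; the terms come from D⁺, D⁻, D⁰. A step that lowers p
carries the factor ν(2p), so that p = 0 is not left. -/
def fD (J : ℤ) (s : ℝ) : Fib →ₗ[ℂ] Fib := fibOp fun p r b => match b with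
  | true =>
    (1 / dn q J p r 2) • fb p (r + 1) true
    + (-q ^ (2 * J + 4 * r + 5) * nu q (2 * p) * nu q (2 * J + 2 * p + 1) /
        dn q J p r 1) • fb (p - 1) r true
    + (s * nu q 2 * q ^ (4 * J + 2 * p + 4 * r + 6) * nu q (2 * p) /
        (dn q J p r 1 * dn q J p r 2)) • fb (p - 1) (r + 1) false
  | false =>
    (1 / dn q J p r 2) • fb p (r + 1) false
    + (-q ^ (2 * J + 4 * r + 3) * nu q (2 * p) * nu q (2 * J + 2 * p + 3) /
        dn q J p r 1) • fb (p - 1) r false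
    + (s * nu q 2 * q ^ (2 * J + 2 * p + 4 * r + 3) * nu q (2 * J + 2 * p + 3) /
        (dn q J p r 1 * dn q J p r 2)) • fb p r true


/-- The transpose of `fC q J s`, going from level `J + 1` to level `J`. -/
def fCt (J : ℤ) (s : ℝ) : Fib →ₗ[ℂ] Fib := fibOp fun p r b => match b with
  | true =>
    (-q ^ (2 * r) * nu q (2 * J + 2 * r + 5) * nu q (2 * J + 2 * p + 3) / dn q J p r 2) •
        fb p r true
    + (-q ^ (2 * J + 2 * r + 5) / dn q J p r 3) • fb (p + 1) (r + 1) true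
    + (s * nu q 2 * q ^ (2 * J + 2 * p + 2 * r + 3) * nu q (2 * J + 2 * r + 5) /
        (dn q J p r 2 * dn q J p r 3)) • fb p (r + 1) false
  | false =>
    (-q ^ (2 * r) * nu q (2 * J + 2 * r + 3) * nu q (2 * J + 2 * p + 5) / dn q J p r 2) •
        fb p r false
    + (-q ^ (2 * J + 2 * r + 3) / dn q J p r 3) • fb (p + 1) (r + 1) false
    + (-s * nu q 2 * q ^ (4 * J + 2 * p + 6 * r + 8) * nu q (2 * J + 2 * p + 5) /
        (dn q J p r 2 * dn q J p r 3)) • fb (p + 1) r true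

/-- The part common to x₀ and x₁ that preserves j; the terms come from H⁺ at l, H⁺ at l - 1, and H⁰.
Each preserves N and changes l by 1, -1, 0, so the first two flip the parity bit. -/
def fH (J : ℤ) (s : ℝ) : Fib →ₗ[ℂ] Fib := fibOp fun p r b => match b with
  | true =>
    (q ^ (2 * J + 2 * r + 3) / dn q J p r 2) • fb p (r + 1) false
    + (q ^ (2 * r) * nu q (2 * p) * nu q (2 * J + 2 * r + 3) / dn q J p r 1) • fb (p - 1) r false
    + (s * (q ^ (4 * J + 2 * p + 2 * r + 6) * nu q (2 * p) * nu q (2 * r + 2)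
          - q ^ (2 * p + 2 * r) * nu q (2 * J + 2 * p + 3) * nu q (2 * J + 2 * r + 3)) /
        (dn q J p r 1 * dn q J p r 2)) • fb p r true
  | false =>
    (q ^ (2 * r) / dn q J p r 2) • fb (p + 1) r true
    + (q ^ (2 * J + 2 * r + 1) * nu q (2 * J + 2 * p + 3) * nu q (2 * r) / dn q J p r 1) •
        fb p (r - 1) true
    + (s * (q ^ (2 * p + 2 * r + 2) * nu q (2 * J + 2 * p + 3) * nu q (2 * J + 2 * r + 3)
          - q ^ (4 * J + 2 * p + 2 * r + 4) * nu q (2 * p + 2) * nu q (2 * r)) /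
        (dn q J p r 1 * dn q J p r 2)) • fb p r false

/-- The transpose of `fD q J s`. -/
def fDt (J : ℤ) (s : ℝ) : Fib →ₗ[ℂ] Fib := fibOp fun p r b => match b with
  | true =>
    (nu q (2 * r) * nu q (2 * J + 2 * r + 3) / dn q J p r 1) • fb p (r - 1) true
    + (-q ^ (2 * J + 4 * r + 5) / dn q J p r 2) • fb (p + 1) r true
    + (s * nu q 2 * q ^ (2 * J + 2 * p + 4 * r + 3) * nu q (2 * J + 2 * r + 3) /
        (dn q J p r 1 * dn q J p r 2)) • fb p r false
  | false =>
    (nu q (2 * r) * nu q (2 * J + 2 * r + 1) / dn q J p r 1) • fb p (r - 1) false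
    + (-q ^ (2 * J + 4 * r + 3) / dn q J p r 2) • fb (p + 1) r false
    + (s * nu q 2 * q ^ (4 * J + 2 * p + 4 * r + 4) * nu q (2 * r) /
        (dn q J p r 1 * dn q J p r 2)) • fb (p + 1) (r - 1) true

variable {q}
lemma nu_ne (hq : q ∈ Set.Ioo (0:ℝ) 1) (n : ℤ) (hn : n ≠ 0) : nu q n ≠ 0 := by
  unfold nu
  rw [sub_ne_zero]
  intro h
  have := (zpow_eq_one_iff_right₀ hq.1.le hq.2.ne (n := 2 * n)).1 h.symm
  omega


/-- The argument is odd. The fibre identities therefore hold at all integer labels, admissible or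
not. -/
lemma dn_ne (hq : q ∈ Set.Ioo (0:ℝ) 1) (J p r k : ℤ) : dn q J p r k ≠ 0 :=
  nu_ne hq _ (by omega)

/-- Exponents linear in the labels are split into monomials in q^J, q^p, q^r, q^M, which are the
atoms of the final polynomial identities. -/
lemma zpow_two_mul_aux (q : ℝ) (n : ℤ) : q ^ (2 * n) = (q ^ n) ^ 2 := by
  rw [mul_comm, zpow_mul]; norm_cast
lemma zpow_four_mul_aux (q : ℝ) (n : ℤ) : q ^ (4 * n) = (q ^ n) ^ 4 := by
  rw [mul_comm, zpow_mul]; norm_cast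
lemma zpow_eight_mul_aux (q : ℝ) (n : ℤ) : q ^ (8 * n) = (q ^ n) ^ 8 := by
  rw [mul_comm, zpow_mul]; norm_cast
lemma zpow_six_mul_aux (q : ℝ) (n : ℤ) : q ^ (6 * n) = (q ^ n) ^ 6 := by
  rw [mul_comm, zpow_mul]; norm_cast


set_option maxHeartbeats 4000000 in
-- The fibre content of x₀x₂ = q²x₂x₀ and x₁x₂ = q²x₂x₁: the scalars in (J, M) do not see the fibre,
-- so each of C, H, Cᵗ has to q²-commute with D separately.
lemma fC_fD (hq : q ∈ Set.Ioo (0:ℝ) 1) (J : ℤ) (s : ℝ) (hs : s ^ 2 = 1) :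
    fC q J s ∘ₗ fD q J s = (q ^ 2) • (fD q (J + 1) s ∘ₗ fC q J s) := by
  refine fib_ext fun p r b => ?_
  have h0 := hq.1.ne'
  -- All shifted indices become the base label plus a nonnegative numeral, so that equal basis
  -- vectors reached along different paths are recognised as equal.
  obtain ⟨p, rfl⟩ : ∃ n, p = n + 2 := ⟨p - 2, by ring⟩
  obtain ⟨r, rfl⟩ : ∃ n, r = n + 2 := ⟨r - 2, by ring⟩
  have hd := dn_ne hq J p r
  have h2 := hd 2
  have h3 := hd 3
  have h4 := hd 4
  have h5 := hd 5
  have h6 := hd 6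
  have h7 := hd 7
  have h8 := hd 8
  have h9 := hd 9
  cases b
  all_goals
    simp only [fC, fD, LinearMap.add_apply, LinearMap.comp_apply, LinearMap.smul_apply,
      LinearMap.id_apply, fibOp_fb, map_add, LinearMap.map_smul_of_tower, smul_add, smul_smul,
      add_sub_assoc, add_assoc, add_zero, dn_J_add, dn_p_add, dn_r_add, Int.reduceAdd,
      Int.reduceSub]
    -- One identity per basis vector; after clearing denominators it is polynomial in q, q^J, q^p,
    -- q^r and s, with s² = 1.
    match_scalars
    all_goals
      try field_simp
      all_goals
        try simp only [dn, nu, zpow_add₀ h0, mul_add, ← mul_assoc, Int.reduceMul, zpow_two_mul_aux,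
          zpow_four_mul_aux, zpow_six_mul_aux, zpow_eight_mul_aux, zpow_ofNat, zpow_one]
        generalize q ^ J = x
        generalize q ^ p = y
        generalize q ^ r = z
        try simp only [hs]
        try ring

set_option maxHeartbeats 4000000 in
lemma fCt_fD (hq : q ∈ Set.Ioo (0:ℝ) 1) (J : ℤ) (s : ℝ) (hs : s ^ 2 = 1) :
    fCt q J s ∘ₗ fD q (J + 1) s = (q ^ 2) • (fD q J s ∘ₗ fCt q J s) := by
  refine fib_ext fun p r b => ?_
  have h0 := hq.1.ne'
  obtain ⟨p, rfl⟩ : ∃ n, p = n + 2 := ⟨p - 2, by ring⟩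
  obtain ⟨r, rfl⟩ : ∃ n, r = n + 2 := ⟨r - 2, by ring⟩
  have hd := dn_ne hq J p r
  have h2 := hd 2
  have h3 := hd 3
  have h4 := hd 4
  have h5 := hd 5
  have h6 := hd 6
  have h7 := hd 7
  have h8 := hd 8
  have h9 := hd 9
  cases b
  all_goals
    simp only [fCt, fD, LinearMap.add_apply, LinearMap.comp_apply, LinearMap.smul_apply,
      LinearMap.id_apply, fibOp_fb, map_add, LinearMap.map_smul_of_tower, smul_add, smul_smul,
      add_sub_assoc, add_assoc, add_zero, dn_J_add, dn_p_add, dn_r_add, Int.reduceAdd,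
      Int.reduceSub]
    match_scalars
    all_goals
      try field_simp
      all_goals
        try simp only [dn, nu, zpow_add₀ h0, mul_add, ← mul_assoc, Int.reduceMul, zpow_two_mul_aux,
          zpow_four_mul_aux, zpow_six_mul_aux, zpow_eight_mul_aux, zpow_ofNat, zpow_one]
        generalize q ^ J = x
        generalize q ^ p = y
        generalize q ^ r = z
        try simp only [hs]
        try ring

set_option maxHeartbeats 4000000 in
lemma fH_fD (hq : q ∈ Set.Ioo (0:ℝ) 1) (J : ℤ) (s : ℝ) (hs : s ^ 2 = 1) :
    fH q J s ∘ₗ fD q J s = (q ^ 2) • (fD q J s ∘ₗ fH q J s) := by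
  refine fib_ext fun p r b => ?_
  have h0 := hq.1.ne'
  obtain ⟨p, rfl⟩ : ∃ n, p = n + 2 := ⟨p - 2, by ring⟩
  obtain ⟨r, rfl⟩ : ∃ n, r = n + 2 := ⟨r - 2, by ring⟩
  have hd := dn_ne hq J p r
  have h2 := hd 2
  have h3 := hd 3
  have h4 := hd 4
  have h5 := hd 5
  have h6 := hd 6
  have h7 := hd 7
  have h8 := hd 8
  have h9 := hd 9
  cases b
  all_goals
    simp only [fH, fD, LinearMap.add_apply, LinearMap.comp_apply, LinearMap.smul_apply,
      LinearMap.id_apply, fibOp_fb, map_add, LinearMap.map_smul_of_tower, smul_add, smul_smul,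
      add_sub_assoc, add_assoc, add_zero, dn_J_add, dn_p_add, dn_r_add, Int.reduceAdd,
      Int.reduceSub]
    match_scalars
    all_goals
      try field_simp
      all_goals
        try simp only [dn, nu, zpow_add₀ h0, mul_add, ← mul_assoc, Int.reduceMul, zpow_two_mul_aux,
          zpow_four_mul_aux, zpow_six_mul_aux, zpow_eight_mul_aux, zpow_ofNat, zpow_one]
        generalize q ^ J = x
        generalize q ^ p = y
        generalize q ^ r = z
        try simp only [hs]
        try ring

set_option maxHeartbeats 4000000 in
-- The operators H at adjacent levels are intertwined by C. Together with the transposed statement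
-- this reduces quadratic words in C, H, Cᵗ to a normal order, up to the products Cᵗ C.
lemma fH_fC (hq : q ∈ Set.Ioo (0:ℝ) 1) (J : ℤ) (s : ℝ) (hs : s ^ 2 = 1) :
    fH q (J + 1) s ∘ₗ fC q J s = fC q J s ∘ₗ fH q J s := by
  refine fib_ext fun p r b => ?_
  have h0 := hq.1.ne'
  obtain ⟨p, rfl⟩ : ∃ n, p = n + 2 := ⟨p - 2, by ring⟩
  obtain ⟨r, rfl⟩ : ∃ n, r = n + 2 := ⟨r - 2, by ring⟩
  have hd := dn_ne hq J p r
  have h2 := hd 2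
  have h3 := hd 3
  have h4 := hd 4
  have h5 := hd 5
  have h6 := hd 6
  have h7 := hd 7
  have h8 := hd 8
  have h9 := hd 9
  cases b
  all_goals
    simp only [fH, fC, LinearMap.add_apply, LinearMap.comp_apply, LinearMap.smul_apply,
      LinearMap.id_apply, fibOp_fb, map_add, LinearMap.map_smul_of_tower, smul_add, smul_smul,
      add_sub_assoc, add_assoc, add_zero, dn_J_add, dn_p_add, dn_r_add, Int.reduceAdd,
      Int.reduceSub]
    match_scalars
    all_goals
      try field_simp
      all_goals
        try simp only [dn, nu, zpow_add₀ h0, mul_add, ← mul_assoc, Int.reduceMul, zpow_two_mul_aux,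
          zpow_four_mul_aux, zpow_six_mul_aux, zpow_eight_mul_aux, zpow_ofNat, zpow_one]
        generalize q ^ J = x
        generalize q ^ p = y
        generalize q ^ r = z
        try simp only [hs]
        try ring

set_option maxHeartbeats 4000000 in
lemma fCt_fH (hq : q ∈ Set.Ioo (0:ℝ) 1) (J : ℤ) (s : ℝ) (hs : s ^ 2 = 1) :
    fCt q J s ∘ₗ fH q (J + 1) s = fH q J s ∘ₗ fCt q J s := by
  refine fib_ext fun p r b => ?_
  have h0 := hq.1.ne'
  obtain ⟨p, rfl⟩ : ∃ n, p = n + 2 := ⟨p - 2, by ring⟩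
  obtain ⟨r, rfl⟩ : ∃ n, r = n + 2 := ⟨r - 2, by ring⟩
  have hd := dn_ne hq J p r
  have h2 := hd 2
  have h3 := hd 3
  have h4 := hd 4
  have h5 := hd 5
  have h6 := hd 6
  have h7 := hd 7
  have h8 := hd 8
  have h9 := hd 9
  cases b
  all_goals
    simp only [fH, fCt, LinearMap.add_apply, LinearMap.comp_apply, LinearMap.smul_apply,
      LinearMap.id_apply, fibOp_fb, map_add, LinearMap.map_smul_of_tower, smul_add, smul_smul,
      add_sub_assoc, add_assoc, add_zero, dn_J_add, dn_p_add, dn_r_add, Int.reduceAdd,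
      Int.reduceSub]
    match_scalars
    all_goals
      try field_simp
      all_goals
        try simp only [dn, nu, zpow_add₀ h0, mul_add, ← mul_assoc, Int.reduceMul, zpow_two_mul_aux,
          zpow_four_mul_aux, zpow_six_mul_aux, zpow_eight_mul_aux, zpow_ofNat, zpow_one]
        generalize q ^ J = x
        generalize q ^ p = y
        generalize q ^ r = z
        try simp only [hs]
        try ring

set_option maxHeartbeats 4000000 in
-- A q-oscillator relation, the same at every level and for both chiralities. Combined with the
-- sphere equation it yields the relation for [x₂*, x₂].
lemma fDt_fD (hq : q ∈ Set.Ioo (0:ℝ) 1) (J : ℤ) (s : ℝ) (hs : s ^ 2 = 1) :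
    fDt q J s ∘ₗ fD q J s = (1 - q ^ 4) • LinearMap.id + (q ^ 4) • (fD q J s ∘ₗ fDt q J s) := by
  refine fib_ext fun p r b => ?_
  have h0 := hq.1.ne'
  obtain ⟨p, rfl⟩ : ∃ n, p = n + 2 := ⟨p - 2, by ring⟩
  obtain ⟨r, rfl⟩ : ∃ n, r = n + 2 := ⟨r - 2, by ring⟩
  have hd := dn_ne hq J p r
  have h2 := hd 2
  have h3 := hd 3
  have h4 := hd 4
  have h5 := hd 5
  have h6 := hd 6
  have h7 := hd 7
  have h8 := hd 8
  have h9 := hd 9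
  cases b
  all_goals
    simp only [fDt, fD, LinearMap.add_apply, LinearMap.comp_apply, LinearMap.smul_apply,
      LinearMap.id_apply, fibOp_fb, map_add, LinearMap.map_smul_of_tower, smul_add, smul_smul,
      add_sub_assoc, add_assoc, add_zero, dn_J_add, dn_p_add, dn_r_add, Int.reduceAdd,
      Int.reduceSub]
    match_scalars
    all_goals
      try field_simp
      all_goals
        try simp only [dn, nu, zpow_add₀ h0, mul_add, ← mul_assoc, Int.reduceMul, zpow_two_mul_aux,
          zpow_four_mul_aux, zpow_six_mul_aux, zpow_eight_mul_aux, zpow_ofNat, zpow_one]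
        generalize q ^ J = x
        generalize q ^ p = y
        generalize q ^ r = z
        try simp only [hs]
        try ring

set_option maxHeartbeats 4000000 in
-- This allows Cᵗ C to be eliminated in favour of C Cᵗ and H². The coefficients involve J only,
-- which is what separates the fibre from the scalars in (J, M).
lemma fCt_fC (hq : q ∈ Set.Ioo (0:ℝ) 1) (J : ℤ) (s : ℝ) (hs : s ^ 2 = 1) :
    (nu q (2 * J + 6) * nu q (2 * J + 3) ^ 2) • (fCt q (J + 1) s ∘ₗ fC q (J + 1) s) =
      (nu q (2 * J + 2) * nu q (2 * J + 5) ^ 2) • (fC q J s ∘ₗ fCt q J s)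
      + (nu q 2 * nu q 1 ^ 2 * q ^ (4 * J + 4) * (1 + q ^ (4 * J + 8))) •
        (fH q (J + 1) s ∘ₗ fH q (J + 1) s) := by
  refine fib_ext fun p r b => ?_
  have h0 := hq.1.ne'
  obtain ⟨p, rfl⟩ : ∃ n, p = n + 2 := ⟨p - 2, by ring⟩
  obtain ⟨r, rfl⟩ : ∃ n, r = n + 2 := ⟨r - 2, by ring⟩
  have hd := dn_ne hq J p r
  have h2 := hd 2
  have h3 := hd 3
  have h4 := hd 4
  have h5 := hd 5
  have h6 := hd 6
  have h7 := hd 7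
  have h8 := hd 8
  have h9 := hd 9
  cases b
  all_goals
    simp only [fCt, fC, fH, LinearMap.add_apply, LinearMap.comp_apply, LinearMap.smul_apply,
      LinearMap.id_apply, fibOp_fb, map_add, LinearMap.map_smul_of_tower, smul_add, smul_smul,
      add_sub_assoc, add_assoc, add_zero, dn_J_add, dn_p_add, dn_r_add, Int.reduceAdd,
      Int.reduceSub]
    match_scalars
    all_goals
      try field_simp
      all_goals
        try simp only [dn, nu, zpow_add₀ h0, mul_add, ← mul_assoc, Int.reduceMul, zpow_two_mul_aux,
          zpow_four_mul_aux, zpow_six_mul_aux, zpow_eight_mul_aux, zpow_ofNat, zpow_one]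
        generalize q ^ J = x
        generalize q ^ p = y
        generalize q ^ r = z
        try simp only [hs]
        try ring

set_option maxHeartbeats 4000000 in
-- The fibre form of the sphere equation: at each level it expresses D Dᵗ through C Cᵗ and H², again
-- with coefficients free of p and r.
lemma fC_fCt (hq : q ∈ Set.Ioo (0:ℝ) 1) (J : ℤ) (s : ℝ) (hs : s ^ 2 = 1) :
    (nu q (2 * J + 2) * nu q (2 * J + 4) * nu q (2 * J + 5) ^ 2) • (fC q J s ∘ₗ fCt q J s)
      + (q ^ (4 * J + 4) * nu q 1 ^ 2 * (q ^ 4 * nu q (2 * J + 3) ^ 2 + nu q 2 * nu q (4 * J + 8))) •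
        (fH q (J + 1) s ∘ₗ fH q (J + 1) s)
      + (nu q (2 * J + 3) * nu q (2 * J + 5)) ^ 2 • (fD q (J + 1) s ∘ₗ fDt q (J + 1) s) =
      (nu q (2 * J + 3) * nu q (2 * J + 5)) ^ 2 • LinearMap.id := by
  refine fib_ext fun p r b => ?_
  have h0 := hq.1.ne'
  obtain ⟨p, rfl⟩ : ∃ n, p = n + 2 := ⟨p - 2, by ring⟩
  obtain ⟨r, rfl⟩ : ∃ n, r = n + 2 := ⟨r - 2, by ring⟩
  have hd := dn_ne hq J p r
  have h2 := hd 2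
  have h3 := hd 3
  have h4 := hd 4
  have h5 := hd 5
  have h6 := hd 6
  have h7 := hd 7
  have h8 := hd 8
  have h9 := hd 9
  cases b
  all_goals
    simp only [fCt, fC, fH, fD, fDt, LinearMap.add_apply, LinearMap.comp_apply, LinearMap.smul_apply,
      LinearMap.id_apply, fibOp_fb, map_add, LinearMap.map_smul_of_tower, smul_add, smul_smul,
      add_sub_assoc, add_assoc, add_zero, dn_J_add, dn_p_add, dn_r_add, Int.reduceAdd,
      Int.reduceSub]
    match_scalars
    all_goals
      try field_simp
      all_goals
        try simp only [dn, nu, zpow_add₀ h0, mul_add, ← mul_assoc, Int.reduceMul, zpow_two_mul_aux,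
          zpow_four_mul_aux, zpow_six_mul_aux, zpow_eight_mul_aux, zpow_ofNat, zpow_one]
        generalize q ^ J = x
        generalize q ^ p = y
        generalize q ^ r = z
        try simp only [hs]
        try ring

end

/-! ### The lattice model of the sphere and its relations -/

section

/-- The lattice model: a fibre over each `(M, J, s)`. -/
abbrev Lat : Type := (ℤ × ℤ × ℤˣ) →₀ Fib

def lv (M J : ℤ) (s : ℤˣ) : Fib →ₗ[ℂ] Lat := Finsupp.lsingle (M, J, s)

def latOp (f : ℤ → ℤ → ℤˣ → Fib →ₗ[ℂ] Lat) : Lat →ₗ[ℂ] Lat :=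
  Finsupp.lsum ℂ fun i => f i.1 i.2.1 i.2.2

@[simp] lemma latOp_lv (f : ℤ → ℤ → ℤˣ → Fib →ₗ[ℂ] Lat) (M J : ℤ) (s : ℤˣ) (w : Fib) :
    latOp f (lv M J s w) = f M J s w := by
  simp [latOp, lv]

/-- The sign `s` as a real number. -/
def sg (s : ℤˣ) : ℝ := ((s : ℤ) : ℝ)

lemma sg_sq (s : ℤˣ) : sg s ^ 2 = 1 := by
  rcases Int.units_eq_one_or s with h | h <;> simp [sg, h]

section
variable (q : ℝ)

/-- The parts that raise, preserve and lower j. The scalars are A⁺, A⁰ and A⁺ at j - 1 rescaled by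
`gU`: the raising one has lost its roots, the lowering one has gained two factors ν that vanish at M
= J and M = -J - 1. The transpose `fCt` is indexed by the level at which it ends, hence `J - 1`. -/
def lX0 : Lat →ₗ[ℂ] Lat := latOp fun M J s =>
  (q ^ (J + M + 1) / nu q (2 * J + 3)) • (lv M (J + 1) s ∘ₗ fC q J (sg s))
  + (q ^ (2 * J) * (q ^ (2 * (J + M + 1)) * nu q 2 * nu q (J - M) - nu q 1 * nu q (2 * J + 1)) /
      (nu q (2 * J + 1) * nu q (2 * J + 3))) • (lv M J s ∘ₗ fH q J (sg s))
  + (q ^ (J + M) * nu q (J - M) * nu q (J + M + 1) / nu q (2 * J + 1)) •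
      (lv M (J - 1) s ∘ₗ fCt q (J - 1) (sg s))

def lX1 : Lat →ₗ[ℂ] Lat := latOp fun M J s =>
  (1 / nu q (2 * J + 3)) • (lv (M + 1) (J + 1) s ∘ₗ fC q J (sg s))
  + (nu q 2 * q ^ (3 * J + M + 2) * nu q (J - M) / (nu q (2 * J + 1) * nu q (2 * J + 3))) •
      (lv (M + 1) J s ∘ₗ fH q J (sg s))
  + (-q ^ (2 * (J + M + 1) + 1) * nu q (J - M) * nu q (J - M - 1) / nu q (2 * J + 1)) •
      (lv (M + 1) (J - 1) s ∘ₗ fCt q (J - 1) (sg s))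

/-- The transpose of `lX1`. -/
def lX1t : Lat →ₗ[ℂ] Lat := latOp fun M J s =>
  (-q ^ (2 * (J + M + 1) + 1) / nu q (2 * J + 3)) • (lv (M - 1) (J + 1) s ∘ₗ fC q J (sg s))
  + (nu q 2 * q ^ (3 * J + M + 1) * nu q (J + M + 1) / (nu q (2 * J + 1) * nu q (2 * J + 3))) •
      (lv (M - 1) J s ∘ₗ fH q J (sg s))
  + (nu q (J + M + 1) * nu q (J + M) / nu q (2 * J + 1)) •
      (lv (M - 1) (J - 1) s ∘ₗ fCt q (J - 1) (sg s))

def lX2 : Lat →ₗ[ℂ] Lat := latOp fun M J s => lv M J s ∘ₗ fD q J (sg s)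

/-- The transpose of `lX2`. -/
def lX2t : Lat →ₗ[ℂ] Lat := latOp fun M J s => lv M J s ∘ₗ fDt q J (sg s)

end

variable {q : ℝ}

section
variable (hq : q ∈ Set.Ioo (0:ℝ) 1) (J : ℤ) (s : ℝ) (hs : s ^ 2 = 1) (w : Fib)
include hq hs

/-- The applied forms of the fibre relations serve as rewriting rules towards the normal order D, C,
H, Cᵗ. -/
lemma fH_fC_apply : fH q (J + 1) s (fC q J s w) = fC q J s (fH q J s w) :=
  LinearMap.congr_fun (fH_fC hq J s hs) w

lemma fCt_fH_apply : fCt q J s (fH q (J + 1) s w) = fH q J s (fCt q J s w) :=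
  LinearMap.congr_fun (fCt_fH hq J s hs) w

lemma fC_fD_apply : fC q J s (fD q J s w) = (q ^ 2) • fD q (J + 1) s (fC q J s w) :=
  LinearMap.congr_fun (fC_fD hq J s hs) w

lemma fCt_fD_apply : fCt q J s (fD q (J + 1) s w) = (q ^ 2) • fD q J s (fCt q J s w) :=
  LinearMap.congr_fun (fCt_fD hq J s hs) w

lemma fH_fD_apply : fH q J s (fD q J s w) = (q ^ 2) • fD q J s (fH q J s w) :=
  LinearMap.congr_fun (fH_fD hq J s hs) w

lemma fDt_fD_apply :
    fDt q J s (fD q J s w) = (1 - q ^ 4) • w + (q ^ 4) • fD q J s (fDt q J s w) :=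
  LinearMap.congr_fun (fDt_fD hq J s hs) w

/-- `fCt_fC` solved for Cᵗ C. Of the denominators only ν(2J + 8) has an even argument, which is the
reason for the condition on J. -/
lemma fCt_fC_apply (hJ : J + 4 ≠ 0) : fCt q (J + 2) s (fC q (J + 2) s w) =
    (nu q (2 * J + 4) * nu q (2 * J + 7) ^ 2 / (nu q (2 * J + 8) * nu q (2 * J + 5) ^ 2)) •
      fC q (J + 1) s (fCt q (J + 1) s w)
    + (nu q 2 * nu q 1 ^ 2 * q ^ (4 * J + 8) * (1 + q ^ (4 * J + 12)) /
      (nu q (2 * J + 8) * nu q (2 * J + 5) ^ 2)) • fH q (J + 2) s (fH q (J + 2) s w) := by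
  have n5 := nu_ne hq (2 * J + 5) (by omega)
  have n8 := nu_ne hq (2 * J + 8) (by omega)
  have h := LinearMap.congr_fun (fCt_fC hq (J + 1) s hs) w
  simp only [LinearMap.add_apply, LinearMap.smul_apply, LinearMap.comp_apply, mul_add, add_assoc,
    Int.reduceAdd, Int.reduceMul] at h
  rw [← sub_eq_zero] at h ⊢
  have h' := congrArg (fun z => (nu q (2 * J + 8) * nu q (2 * J + 5) ^ 2)⁻¹ • z) h
  simp only [smul_zero] at h'
  rw [← h']
  match_scalars <;> field_simp

lemma fD_fDt_apply : fD q (J + 2) s (fDt q (J + 2) s w) = w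
    - (nu q (2 * J + 4) * nu q (2 * J + 6) / nu q (2 * J + 5) ^ 2) •
      fC q (J + 1) s (fCt q (J + 1) s w)
    - (q ^ (4 * J + 8) * nu q 1 ^ 2 *
        (q ^ 4 * nu q (2 * J + 5) ^ 2 + nu q 2 * nu q (4 * J + 12)) /
      (nu q (2 * J + 5) * nu q (2 * J + 7)) ^ 2) • fH q (J + 2) s (fH q (J + 2) s w) := by
  have n5 := nu_ne hq (2 * J + 5) (by omega)
  have n7 := nu_ne hq (2 * J + 7) (by omega)
  have h := LinearMap.congr_fun (fC_fCt hq (J + 1) s hs) w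
  simp only [LinearMap.add_apply, LinearMap.smul_apply, LinearMap.comp_apply, mul_add, add_assoc,
    Int.reduceAdd, Int.reduceMul, LinearMap.id_apply] at h
  rw [← sub_eq_zero] at h ⊢
  have h' := congrArg (fun z => ((nu q (2 * J + 5) * nu q (2 * J + 7)) ^ 2)⁻¹ • z) h
  simp only [smul_zero] at h'
  rw [← h']
  match_scalars <;> field_simp
  all_goals ring

end

lemma zpow_three_mul_aux (q : ℝ) (n : ℤ) : q ^ (3 * n) = (q ^ n) ^ 3 := by
  rw [mul_comm, zpow_mul]; norm_cast


set_option maxHeartbeats 1000000 in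
-- In normal order both sides are combinations of the same fibre words, with coefficients rational
-- in q^J and q^M. The condition on J serves only to keep ν(2J + 4) away from zero in the
-- elimination of Cᵗ C.
lemma lX0_lX1 (hq : q ∈ Set.Ioo (0:ℝ) 1) (M J : ℤ) (hJ : 0 ≤ J) (s : ℤˣ) (w : Fib) :
    lX0 q (lX1 q (lv M J s w)) = (q ^ 2) • lX1 q (lX0 q (lv M J s w)) := by
  have hs := sg_sq s
  obtain ⟨J, rfl⟩ : ∃ n, J = n + 2 := ⟨J - 2, by ring⟩
  have h0 := hq.1.ne'
  have n3 := nu_ne hq (2 * J + 3) (by omega)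
  have n5 := nu_ne hq (2 * J + 5) (by omega)
  have n7 := nu_ne hq (2 * J + 7) (by omega)
  have n8 := nu_ne hq (2 * J + 8) (by omega)
  have n9 := nu_ne hq (2 * J + 9) (by omega)
  have e1 := fH_fC_apply hq (J + 2) (sg s) hs w
  have e2 := fCt_fH_apply hq (J + 1) (sg s) hs w
  have e3 := fCt_fC_apply hq J (sg s) hs w (by omega)
  simp only [add_assoc, Int.reduceAdd] at e1 e2
  simp only [lX0, lX1, latOp_lv, LinearMap.add_apply, LinearMap.smul_apply,
    LinearMap.comp_apply, map_add, map_sub, smul_add, LinearMap.map_smul_of_tower, add_assoc, add_sub_assoc,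
    sub_add_eq_add_sub, add_sub_cancel_right, sub_add_cancel, Int.reduceAdd, Int.reduceSub, mul_add, Int.reduceMul, add_zero, e1, e2, e3, smul_smul]
  match_scalars
  all_goals
    field_simp
    all_goals
      simp only [nu, zpow_add₀ h0, zpow_sub₀ h0, mul_add, mul_sub, ← mul_assoc, Int.reduceMul,
        zpow_two_mul_aux, zpow_three_mul_aux, zpow_four_mul_aux, zpow_six_mul_aux, zpow_eight_mul_aux, zpow_ofNat, zpow_one]
      have hJ := zpow_ne_zero J h0
      have hM := zpow_ne_zero M h0
      generalize q ^ J = x at *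
      generalize q ^ M = y at *
      try field_simp
      all_goals try ring

set_option maxHeartbeats 1000000 in
-- Since x₂ acts on the fibre alone and each of C, H, Cᵗ commutes with it up to the same factor q²,
-- the scalars in (J, M) play no role.
lemma lX0_lX2 (hq : q ∈ Set.Ioo (0:ℝ) 1) (M J : ℤ) (hJ : 0 ≤ J) (s : ℤˣ) (w : Fib) :
    lX0 q (lX2 q (lv M J s w)) = (q ^ 2) • lX2 q (lX0 q (lv M J s w)) := by
  have hs := sg_sq s
  obtain ⟨J, rfl⟩ : ∃ n, J = n + 2 := ⟨J - 2, by ring⟩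
  have h0 := hq.1.ne'
  have n3 := nu_ne hq (2 * J + 3) (by omega)
  have n5 := nu_ne hq (2 * J + 5) (by omega)
  have n7 := nu_ne hq (2 * J + 7) (by omega)
  have n8 := nu_ne hq (2 * J + 8) (by omega)
  have n9 := nu_ne hq (2 * J + 9) (by omega)
  have e4 := fC_fD_apply hq (J + 2) (sg s) hs w
  have e5 := fCt_fD_apply hq (J + 1) (sg s) hs w
  have e6 := fH_fD_apply hq (J + 2) (sg s) hs w
  simp only [add_assoc, Int.reduceAdd] at e4 e5
  simp only [lX0, lX2, latOp_lv, LinearMap.add_apply, LinearMap.smul_apply,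
    LinearMap.comp_apply, map_add, map_sub, smul_add, LinearMap.map_smul_of_tower, add_assoc, add_sub_assoc,
    sub_add_eq_add_sub, add_sub_cancel_right, sub_add_cancel, Int.reduceAdd, Int.reduceSub, mul_add, Int.reduceMul, add_zero, e4, e5, e6, smul_smul]
  match_scalars <;> ring

set_option maxHeartbeats 1000000 in
lemma lX1_lX2 (hq : q ∈ Set.Ioo (0:ℝ) 1) (M J : ℤ) (hJ : 0 ≤ J) (s : ℤˣ) (w : Fib) :
    lX1 q (lX2 q (lv M J s w)) = (q ^ 2) • lX2 q (lX1 q (lv M J s w)) := by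
  have hs := sg_sq s
  obtain ⟨J, rfl⟩ : ∃ n, J = n + 2 := ⟨J - 2, by ring⟩
  have h0 := hq.1.ne'
  have n3 := nu_ne hq (2 * J + 3) (by omega)
  have n5 := nu_ne hq (2 * J + 5) (by omega)
  have n7 := nu_ne hq (2 * J + 7) (by omega)
  have n8 := nu_ne hq (2 * J + 8) (by omega)
  have n9 := nu_ne hq (2 * J + 9) (by omega)
  have e4 := fC_fD_apply hq (J + 2) (sg s) hs w
  have e5 := fCt_fD_apply hq (J + 1) (sg s) hs w
  have e6 := fH_fD_apply hq (J + 2) (sg s) hs w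
  simp only [add_assoc, Int.reduceAdd] at e4 e5
  simp only [lX1, lX2, latOp_lv, LinearMap.add_apply, LinearMap.smul_apply,
    LinearMap.comp_apply, map_add, map_sub, smul_add, LinearMap.map_smul_of_tower, add_assoc, add_sub_assoc,
    sub_add_eq_add_sub, add_sub_cancel_right, sub_add_cancel, Int.reduceAdd, Int.reduceSub, mul_add, Int.reduceMul, add_zero, e4, e5, e6, smul_smul]
  match_scalars <;> ring

set_option maxHeartbeats 1000000 in
lemma lX1t_lX2 (hq : q ∈ Set.Ioo (0:ℝ) 1) (M J : ℤ) (hJ : 0 ≤ J) (s : ℤˣ) (w : Fib) :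
    lX1t q (lX2 q (lv M J s w)) = (q ^ 2) • lX2 q (lX1t q (lv M J s w)) := by
  have hs := sg_sq s
  obtain ⟨J, rfl⟩ : ∃ n, J = n + 2 := ⟨J - 2, by ring⟩
  have h0 := hq.1.ne'
  have n3 := nu_ne hq (2 * J + 3) (by omega)
  have n5 := nu_ne hq (2 * J + 5) (by omega)
  have n7 := nu_ne hq (2 * J + 7) (by omega)
  have n8 := nu_ne hq (2 * J + 8) (by omega)
  have n9 := nu_ne hq (2 * J + 9) (by omega)
  have e4 := fC_fD_apply hq (J + 2) (sg s) hs w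
  have e5 := fCt_fD_apply hq (J + 1) (sg s) hs w
  have e6 := fH_fD_apply hq (J + 2) (sg s) hs w
  simp only [add_assoc, Int.reduceAdd] at e4 e5
  simp only [lX1t, lX2, latOp_lv, LinearMap.add_apply, LinearMap.smul_apply,
    LinearMap.comp_apply, map_add, map_sub, smul_add, LinearMap.map_smul_of_tower, add_assoc, add_sub_assoc,
    sub_add_eq_add_sub, add_sub_cancel_right, sub_add_cancel, Int.reduceAdd, Int.reduceSub, mul_add, Int.reduceMul, add_zero, e4, e5, e6, smul_smul]
  match_scalars <;> ring

set_option maxHeartbeats 1000000 in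
lemma lX1t_lX1 (hq : q ∈ Set.Ioo (0:ℝ) 1) (M J : ℤ) (hJ : 0 ≤ J) (s : ℤˣ) (w : Fib) :
    lX1t q (lX1 q (lv M J s w)) - lX1 q (lX1t q (lv M J s w)) =
      (1 - q ^ 4) • lX0 q (lX0 q (lv M J s w)) := by
  have hs := sg_sq s
  obtain ⟨J, rfl⟩ : ∃ n, J = n + 2 := ⟨J - 2, by ring⟩
  have h0 := hq.1.ne'
  have n3 := nu_ne hq (2 * J + 3) (by omega)
  have n5 := nu_ne hq (2 * J + 5) (by omega)
  have n7 := nu_ne hq (2 * J + 7) (by omega)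
  have n8 := nu_ne hq (2 * J + 8) (by omega)
  have n9 := nu_ne hq (2 * J + 9) (by omega)
  have e1 := fH_fC_apply hq (J + 2) (sg s) hs w
  have e2 := fCt_fH_apply hq (J + 1) (sg s) hs w
  have e3 := fCt_fC_apply hq J (sg s) hs w (by omega)
  simp only [add_assoc, Int.reduceAdd] at e1 e2
  simp only [lX0, lX1, lX1t, latOp_lv, LinearMap.add_apply, LinearMap.smul_apply,
    LinearMap.comp_apply, map_add, map_sub, smul_add, LinearMap.map_smul_of_tower, add_assoc, add_sub_assoc,
    sub_add_eq_add_sub, add_sub_cancel_right, sub_add_cancel, Int.reduceAdd, Int.reduceSub, mul_add, Int.reduceMul, add_zero, e1, e2, e3, smul_smul]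
  match_scalars
  all_goals
    field_simp
    all_goals
      simp only [nu, zpow_add₀ h0, zpow_sub₀ h0, mul_add, mul_sub, ← mul_assoc, Int.reduceMul,
        zpow_two_mul_aux, zpow_three_mul_aux, zpow_four_mul_aux, zpow_six_mul_aux, zpow_eight_mul_aux, zpow_ofNat, zpow_one]
      have hJ := zpow_ne_zero J h0
      have hM := zpow_ne_zero M h0
      generalize q ^ J = x at *
      generalize q ^ M = y at *
      try field_simp
      all_goals try ring

set_option maxHeartbeats 1000000 in
-- After D Dᵗ and Cᵗ C are eliminated, everything is a combination of normally ordered words; all of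
-- them except the identity cancel.
lemma lX_radius (hq : q ∈ Set.Ioo (0:ℝ) 1) (M J : ℤ) (hJ : 0 ≤ J) (s : ℤˣ) (w : Fib) :
    lX0 q (lX0 q (lv M J s w)) + lX1 q (lX1t q (lv M J s w)) + lX2 q (lX2t q (lv M J s w)) =
      lv M J s w := by
  have hs := sg_sq s
  obtain ⟨J, rfl⟩ : ∃ n, J = n + 2 := ⟨J - 2, by ring⟩
  have h0 := hq.1.ne'
  have n3 := nu_ne hq (2 * J + 3) (by omega)
  have n5 := nu_ne hq (2 * J + 5) (by omega)
  have n7 := nu_ne hq (2 * J + 7) (by omega)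
  have n8 := nu_ne hq (2 * J + 8) (by omega)
  have n9 := nu_ne hq (2 * J + 9) (by omega)
  have e1 := fH_fC_apply hq (J + 2) (sg s) hs w
  have e2 := fCt_fH_apply hq (J + 1) (sg s) hs w
  have e3 := fCt_fC_apply hq J (sg s) hs w (by omega)
  simp only [add_assoc, Int.reduceAdd] at e1 e2
  have e4 := fD_fDt_apply hq J (sg s) hs w
  simp only [lX0, lX1, lX1t, lX2, lX2t, latOp_lv, LinearMap.add_apply, LinearMap.smul_apply,
    LinearMap.comp_apply, map_add, map_sub, smul_add, LinearMap.map_smul_of_tower, add_assoc, add_sub_assoc,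
    sub_add_eq_add_sub, add_sub_cancel_right, sub_add_cancel, Int.reduceAdd, Int.reduceSub, mul_add, Int.reduceMul, add_zero, e1, e2, e3, e4, smul_smul]
  match_scalars
  all_goals
    field_simp
    all_goals
      simp only [nu, zpow_add₀ h0, zpow_sub₀ h0, mul_add, mul_sub, ← mul_assoc, Int.reduceMul,
        zpow_two_mul_aux, zpow_three_mul_aux, zpow_four_mul_aux, zpow_six_mul_aux, zpow_eight_mul_aux, zpow_ofNat, zpow_one]
      have hJ := zpow_ne_zero J h0
      have hM := zpow_ne_zero M h0
      generalize q ^ J = x at *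
      generalize q ^ M = y at *
      try field_simp
      all_goals try ring

end

/-! ### Normal forms of the coefficients: integer powers of q and roots of ν -/

section

variable {q : ℝ} (hq : q ∈ Set.Ioo (0:ℝ) 1)
include hq

lemma nu_pos {n : ℤ} (hn : 0 < n) : 0 < nu q n := by
  unfold nu
  have := zpow_lt_one₀ hq.1 hq.2 (n := 2 * n) (by omega)
  linarith

lemma nu_nonneg {n : ℤ} (hn : 0 ≤ n) : 0 ≤ nu q n := by
  rcases hn.eq_or_lt with h | h
  · simp [nu, ← h]
  · exact (nu_pos hq h).le

/-- Every q-number splits into a power of q and ν. The integer `x` is carried besides the real `X`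
because arguments built from half-integers are integers only after simplification. -/
lemma qn_eq {X : ℝ} (x : ℤ) (hX : X = x) : qn q X = q ^ (1 - X) * (nu q x / nu q 1) := by
  have h1 := (nu_pos hq (n := 1) one_pos).ne'
  have h0 := hq.1.ne'
  have e : nu q x = 1 - q ^ X * q ^ X := by
    rw [nu, hX, Real.rpow_intCast, two_mul, zpow_add₀ h0]
  have e1 : nu q 1 = 1 - q * q := by simp [nu]; norm_cast; ring
  have h2 : q - q⁻¹ ≠ 0 := by
    intro h
    apply h1
    rw [e1]
    field_simp at h
    linarith
  have h3 : q ^ X ≠ 0 := (Real.rpow_pos_of_pos hq.1 _).ne'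
  rw [e1] at h1
  rw [qn, e, e1, Real.rpow_sub hq.1, Real.rpow_one, Real.rpow_neg hq.1.le]
  have h4 : q - q⁻¹ = - (1 - q * q) / q := by field_simp; ring
  rw [h4]
  field_simp
  ring

/-- The exponent may be a half-integer here; it becomes integral only in combination with the
remaining factors of a coefficient. -/
lemma sqrt_qn {X Y : ℝ} (x y : ℤ) (hX : X = x) (hY : Y = y) :
    √(qn q X * qn q Y) = q ^ (1 - (X + Y) / 2) * (√(nu q x * nu q y) / nu q 1) := by
  have h1 := nu_pos hq (n := 1) one_pos
  rw [qn_eq hq x hX, qn_eq hq y hY]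
  have h2 : q ^ (1 - X) * q ^ (1 - Y) = (q ^ (1 - (X + Y) / 2)) ^ 2 := by
    rw [← Real.rpow_add hq.1, ← Real.rpow_natCast, ← Real.rpow_mul hq.1.le]
    congr 1; push_cast; ring
  rw [show q ^ (1 - X) * (nu q x / nu q 1) * (q ^ (1 - Y) * (nu q y / nu q 1)) =
    (q ^ (1 - (X + Y) / 2) / nu q 1) ^ 2 * (nu q x * nu q y) by rw [div_pow, ← h2]; field_simp]
  rw [Real.sqrt_mul (sq_nonneg _), Real.sqrt_sq (div_nonneg (Real.rpow_nonneg hq.1.le _) h1.le)]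
  field_simp

/-- Normal form of the coefficients with one denominator. -/
lemma sqrt_div {E X Y Z : ℝ} (e x y z : ℤ) (hX : X = x) (hY : Y = y) (hZ : Z = z)
    (hE : E + Z - (X + Y) / 2 = e) :
    q ^ E * (√(qn q X * qn q Y) / qn q Z) = q ^ e * (√(nu q x * nu q y) / nu q z) := by
  have h1 := (nu_pos hq (n := 1) one_pos).ne'
  have h3 : q ^ (1 - Z) ≠ 0 := (Real.rpow_pos_of_pos hq.1 _).ne'
  have h4 : q ^ E * q ^ (1 - (X + Y) / 2) = q ^ e * q ^ (1 - Z) := by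
    rw [← Real.rpow_intCast, ← Real.rpow_add hq.1, ← Real.rpow_add hq.1, ← hE]
    congr 1; ring
  rw [sqrt_qn hq x y hX hY, qn_eq hq z hZ]
  calc _ = (q ^ E * q ^ (1 - (X + Y) / 2)) * (√(nu q x * nu q y) / nu q z) / q ^ (1 - Z) := by
        field_simp
    _ = _ := by rw [h4]; field_simp

/-- Normal form of the coefficients with two denominators. -/
lemma sqrt_div_mul {E X Y Z W : ℝ} (e x y z w : ℤ) (hX : X = x) (hY : Y = y) (hZ : Z = z)
    (hW : W = w) (hE : E + Z + W - 1 - (X + Y) / 2 = e) :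
    q ^ E * (√(qn q X * qn q Y) / (qn q Z * qn q W)) =
      q ^ e * nu q 1 * (√(nu q x * nu q y) / (nu q z * nu q w)) := by
  have h1 := (nu_pos hq (n := 1) one_pos).ne'
  have h3 : q ^ (1 - W) ≠ 0 := (Real.rpow_pos_of_pos hq.1 _).ne'
  have h4 : q ^ E = q ^ (E + W - 1) * q ^ (1 - W) := by
    rw [← Real.rpow_add hq.1]; congr 1; ring
  have h5 := sqrt_div hq (E := E + W - 1) e x y z hX hY hZ (by rw [← hE]; ring)
  rw [qn_eq hq w hW]
  calc _ = q ^ (E + W - 1) * (√(qn q X * qn q Y) / qn q Z) * nu q 1 / nu q w := by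
        rw [h4]; field_simp
    _ = _ := by rw [h5]; field_simp

/-- Absorbs the factor [2], or [4ε] = ±[2], in front of D⁰ and C⁰. -/
lemma rpow_mul_qn_two {E : ℝ} : qn q 2 * nu q 1 = q⁻¹ * nu q 2 := by
  have h1 := (nu_pos hq (n := 1) one_pos).ne'
  rw [qn_eq hq (X := 2) 2 (by norm_num), show (1 - 2 : ℝ) = -1 by norm_num, Real.rpow_neg_one]
  field_simp

section U
variable (J M : ℤ)

/-- The offsets 1/2 in j and m₁ cancel in the total exponent of q, here and for the other
coefficients; this is the integrality condition of `sqrt_div`. -/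
lemma cA₁_eq : cA₁ q J M =
    q ^ (J + M + 1) * (√(nu q (J + M + 2) * nu q (J - M + 1)) / nu q (2 * J + 3)) := by
  unfold cA₁
  apply sqrt_div hq <;> simp only [hf] <;> push_cast <;> ring

lemma cB₁_eq : cB₁ q J M = √(nu q (J + M + 2) * nu q (J + M + 3)) / nu q (2 * J + 3) := by
  unfold cB₁
  refine (sqrt_div hq 0 (J + M + 2) (J + M + 3) (2 * J + 3) ?_ ?_ ?_ ?_).trans (by simp) <;>
    simp only [hf] <;> push_cast <;> ring

lemma cB₀_eq : cB₀ q J M = nu q 2 * q ^ (3 * J + M + 2) *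
    (√(nu q (J - M) * nu q (J + M + 2)) / (nu q (2 * J + 1) * nu q (2 * J + 3))) := by
  unfold cB₀
  rw [mul_assoc, sqrt_div_mul hq (3 * J + M + 2) (J - M) (J + M + 2) (2 * J + 1) (2 * J + 3)]
  · have : nu q 2 = (1 + q ^ 2) * nu q 1 := by simp [nu]; norm_cast; ring
    rw [this]; ring
  all_goals simp only [hf] <;> push_cast <;> ring

lemma cBm_eq : cBm q J M = -q ^ (2 * (J + M + 1) + 1) *
    (√(nu q (J - M) * nu q (J - M - 1)) / nu q (2 * J + 1)) := by
  unfold cBm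
  simp only [neg_mul, neg_inj]
  apply sqrt_div hq <;> simp only [hf] <;> push_cast <;> ring

lemma cA₀_eq : cA₀ q J M = q ^ (2 * J) *
    ((q ^ (2 * (J + M + 1)) * nu q 2 * nu q (J - M) - nu q 1 * nu q (2 * J + 1)) /
      (nu q (2 * J + 1) * nu q (2 * J + 3))) := by
  have h1 := (nu_pos hq (n := 1) one_pos).ne'
  have h3 := nu_ne hq (2 * J + 1) (by omega)
  have h5 := nu_ne hq (2 * J + 3) (by omega)
  have h0 := hq.1.ne'
  simp only [cA₀]
  rw [qn_eq hq (X := hf J - hf M) (J - M) (by simp only [hf]; push_cast; ring),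
    qn_eq hq (X := 2) 2 (by norm_num), qn_eq hq (X := 2 * hf J) (2 * J + 1) (by simp only [hf]; push_cast; ring),
    qn_eq hq (X := 2 * hf J + 2) (2 * J + 3) (by simp only [hf]; push_cast; ring)]
  rw [show hf J + hf M + 1 = ((J + M + 2 : ℤ) : ℝ) by simp only [hf]; push_cast; ring,
    show 1 - (hf J - hf M) = ((1 - J + M : ℤ) : ℝ) by simp only [hf]; push_cast; ring,
    show (1 - 2 : ℝ) = ((-1 : ℤ) : ℝ) by norm_num,
    show (-2 : ℝ) = ((-2 : ℤ) : ℝ) by norm_num,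
    show 1 - 2 * hf J = ((-2 * J : ℤ) : ℝ) by simp only [hf]; push_cast; ring,
    show 1 - (2 * hf J + 2) = ((-2 * J - 2 : ℤ) : ℝ) by simp only [hf]; push_cast; ring]
  simp only [Real.rpow_intCast, zpow_add₀ h0, zpow_sub₀ h0, mul_add, zpow_two_mul_aux, neg_mul, zpow_neg, zpow_ofNat, zpow_one, mul_one]
  field_simp

end U

section W
variable (J p r : ℤ)

omit hq in
-- In the coordinates (J, p, r) the parity that determines ε is the choice between N = r - p and N =
-- r - p - 1, so from here on ε is a numeral in each of the two cases.
lemma eps_true : eps (J + p + r) J (r - p) = 1 / 2 := by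
  rw [eps, if_pos ⟨p, by ring⟩]

omit hq in
lemma eps_false : eps (J + p + r) J (r - p - 1) = -1 / 2 := by
  rw [eps, if_neg]
  rw [Int.not_even_iff_odd]
  exact ⟨p, by ring⟩

lemma cC₁_true : cC₁ q (J + p + r) J (r - p) = -q ^ (2 * r) *
    (√(nu q (2 * J + 2 * r + 5) * nu q (2 * J + 2 * p + 3)) / dn q J p r 2) := by
  simp only [cC₁, eps_true, neg_mul, neg_inj, dn]
  apply sqrt_div hq <;> simp only [hf] <;> push_cast <;> ring

lemma cC₁_false : cC₁ q (J + p + r) J (r - p - 1) = -q ^ (2 * r) *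
    (√(nu q (2 * J + 2 * r + 3) * nu q (2 * J + 2 * p + 5)) / dn q J p r 2) := by
  simp only [cC₁, eps_false, neg_mul, neg_inj, dn]
  apply sqrt_div hq <;> simp only [hf] <;> push_cast <;> ring

lemma cCm_true : cCm q (J + p + r) J (r - p) = -q ^ (2 * J + 2 * r + 3) *
    (√(nu q (2 * r) * nu q (2 * p)) / dn q J p r 1) := by
  simp only [cCm, eps_true, neg_mul, neg_inj, dn]
  apply sqrt_div hq <;> simp only [hf] <;> push_cast <;> ring

lemma cCm_false : cCm q (J + p + r) J (r - p - 1) = -q ^ (2 * J + 2 * r + 1) *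
    (√(nu q (2 * r) * nu q (2 * p)) / dn q J p r 1) := by
  simp only [cCm, eps_false, neg_mul, neg_inj, dn]
  apply sqrt_div hq <;> simp only [hf] <;> push_cast <;> ring

lemma cC₀_true : cC₀ q (J + p + r) J (r - p) = nu q 2 * q ^ (4 * J + 2 * p + 6 * r + 6) *
    (√(nu q (2 * J + 2 * p + 3) * nu q (2 * p)) / (dn q J p r 1 * dn q J p r 2)) := by
  have h0 := hq.1.ne'
  simp only [cC₀, eps_true]
  rw [mul_assoc, sqrt_div_mul hq (4 * J + 2 * p + 6 * r + 7) (2 * J + 2 * p + 3) (2 * p)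
    (2 * (J + p + r + 1) + 1) (2 * (J + p + r + 2) + 1), show (4 * (1 / 2) : ℝ) = 2 by norm_num,
    show 4 * J + 2 * p + 6 * r + 7 = (4 * J + 2 * p + 6 * r + 6) + 1 by ring, zpow_add_one₀ h0]
  · have := rpow_mul_qn_two hq (E := 0)
    calc _ = (qn q 2 * nu q 1) * q * (q ^ (4 * J + 2 * p + 6 * r + 6)) *
        (√(nu q (2 * J + 2 * p + 3) * nu q (2 * p)) / (dn q J p r 1 * dn q J p r 2)) := by
          simp only [dn]; ring
      _ = _ := by rw [this]; field_simp
  all_goals simp only [hf] <;> push_cast <;> ring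

lemma qn_neg (z : ℝ) : qn q (-z) = - qn q z := by
  simp only [qn, neg_neg]; ring

lemma cC₀_false : cC₀ q (J + p + r) J (r - p - 1) = -nu q 2 * q ^ (2 * J + 2 * p + 2 * r + 1) *
    (√(nu q (2 * J + 2 * r + 3) * nu q (2 * r)) / (dn q J p r 1 * dn q J p r 2)) := by
  have h0 := hq.1.ne'
  simp only [cC₀, eps_false]
  rw [mul_assoc, sqrt_div_mul hq (2 * J + 2 * p + 2 * r + 2) (2 * J + 2 * r + 3) (2 * r)
    (2 * (J + p + r + 1) + 1) (2 * (J + p + r + 2) + 1),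
    show (4 * (-1 / 2) : ℝ) = -2 by norm_num, qn_neg hq,
    show 2 * J + 2 * p + 2 * r + 2 = (2 * J + 2 * p + 2 * r + 1) + 1 by ring, zpow_add_one₀ h0]
  · have := rpow_mul_qn_two hq (E := 0)
    calc _ = -(qn q 2 * nu q 1) * q * (q ^ (2 * J + 2 * p + 2 * r + 1)) *
        (√(nu q (2 * J + 2 * r + 3) * nu q (2 * r)) / (dn q J p r 1 * dn q J p r 2)) := by
          simp only [dn]; ring
      _ = _ := by rw [this]; field_simp
  all_goals simp only [hf] <;> push_cast <;> ring

lemma cH₁_true : cH₁ q (J + p + r) J (r - p) = q ^ (2 * J + 2 * r + 3) *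
    (√(nu q (2 * J + 2 * p + 3) * nu q (2 * r + 2)) / dn q J p r 2) := by
  simp only [cH₁, eps_true, dn]
  apply sqrt_div hq <;> simp only [hf] <;> push_cast <;> ring

lemma cH₁_false : cH₁ q (J + p + r) J (r - p - 1) = q ^ (2 * r) *
    (√(nu q (2 * p + 2) * nu q (2 * J + 2 * r + 3)) / dn q J p r 2) := by
  simp only [cH₁, eps_false, dn]
  apply sqrt_div hq <;> simp only [hf] <;> push_cast <;> ring

lemma qn_mul_qn {E X Y Z W : ℝ} (e x y z w : ℤ) (hX : X = x) (hY : Y = y) (hZ : Z = z)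
    (hW : W = w) (hE : E + Z + W - X - Y = e) :
    q ^ E * qn q X * qn q Y / (qn q Z * qn q W) =
      q ^ e * nu q x * nu q y / (nu q z * nu q w) := by
  have h1 := (nu_pos hq (n := 1) one_pos).ne'
  have h4 : q ^ E * (q ^ (1 - X) * q ^ (1 - Y)) = q ^ e * (q ^ (1 - Z) * q ^ (1 - W)) := by
    simp only [← Real.rpow_intCast, ← Real.rpow_add hq.1, ← hE]
    congr 1; ring
  have h3 : q ^ (1 - W) ≠ 0 := (Real.rpow_pos_of_pos hq.1 _).ne'
  have h5 : q ^ (1 - Z) ≠ 0 := (Real.rpow_pos_of_pos hq.1 _).ne'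
  rw [qn_eq hq x hX, qn_eq hq y hY, qn_eq hq z hZ, qn_eq hq w hW]
  calc _ = (q ^ E * (q ^ (1 - X) * q ^ (1 - Y))) * (nu q x * nu q y) / (nu q z * nu q w) /
        (q ^ (1 - Z) * q ^ (1 - W)) := by field_simp
    _ = _ := by rw [h4]; field_simp

lemma qn_mul_qn' {X Y Z W : ℝ} (e x y z w : ℤ) (hX : X = x) (hY : Y = y) (hZ : Z = z)
    (hW : W = w) (hE : Z + W - X - Y = e) :
    qn q X * qn q Y / (qn q Z * qn q W) =
      q ^ e * nu q x * nu q y / (nu q z * nu q w) := by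
  rw [← qn_mul_qn hq (E := 0) e x y z w hX hY hZ hW (by rw [← hE]; ring), Real.rpow_zero, one_mul]

lemma cH₀_true : cH₀ q (J + p + r) J (r - p) =
    (q ^ (4 * J + 2 * p + 2 * r + 6) * nu q (2 * p) * nu q (2 * r + 2)
      - q ^ (2 * p + 2 * r) * nu q (2 * J + 2 * p + 3) * nu q (2 * J + 2 * r + 3)) /
        (dn q J p r 1 * dn q J p r 2) := by
  simp only [cH₀, eps_true, dn]
  rw [sub_div, sub_div]
  congr 1
  · apply qn_mul_qn' hq <;> simp only [hf] <;> push_cast <;> ring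
  · apply qn_mul_qn hq <;> simp only [hf] <;> push_cast <;> ring

lemma cH₀_false : cH₀ q (J + p + r) J (r - p - 1) =
    (q ^ (2 * p + 2 * r + 2) * nu q (2 * J + 2 * p + 3) * nu q (2 * J + 2 * r + 3)
      - q ^ (4 * J + 2 * p + 2 * r + 4) * nu q (2 * p + 2) * nu q (2 * r)) /
        (dn q J p r 1 * dn q J p r 2) := by
  simp only [cH₀, eps_false, dn]
  rw [sub_div, sub_div]
  congr 1
  · apply qn_mul_qn' hq <;> simp only [hf] <;> push_cast <;> ring
  · apply qn_mul_qn hq <;> simp only [hf] <;> push_cast <;> ring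

lemma cD₁_true : cD₁ q (J + p + r) J (r - p) =
    √(nu q (2 * J + 2 * r + 5) * nu q (2 * r + 2)) / dn q J p r 2 := by
  simp only [cD₁, eps_true, dn]
  refine (sqrt_div hq 0 (2 * J + 2 * r + 5) (2 * r + 2) (2 * (J + p + r + 2) + 1)
    ?_ ?_ ?_ ?_).trans (by simp) <;> simp only [hf] <;> push_cast <;> ring

lemma cD₁_false : cD₁ q (J + p + r) J (r - p - 1) =
    √(nu q (2 * J + 2 * r + 3) * nu q (2 * r + 2)) / dn q J p r 2 := by
  simp only [cD₁, eps_false, dn]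
  refine (sqrt_div hq 0 (2 * J + 2 * r + 3) (2 * r + 2) (2 * (J + p + r + 2) + 1)
    ?_ ?_ ?_ ?_).trans (by simp) <;> simp only [hf] <;> push_cast <;> ring

lemma cDm_true : cDm q (J + p + r) J (r - p) = -q ^ (2 * J + 4 * r + 5) *
    (√(nu q (2 * p) * nu q (2 * J + 2 * p + 1)) / dn q J p r 1) := by
  simp only [cDm, eps_true, neg_mul, neg_inj, dn]
  apply sqrt_div hq <;> simp only [hf] <;> push_cast <;> ring

lemma cDm_false : cDm q (J + p + r) J (r - p - 1) = -q ^ (2 * J + 4 * r + 3) *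
    (√(nu q (2 * p) * nu q (2 * J + 2 * p + 3)) / dn q J p r 1) := by
  simp only [cDm, eps_false, neg_mul, neg_inj, dn]
  apply sqrt_div hq <;> simp only [hf] <;> push_cast <;> ring

lemma cD₀_true : cD₀ q (J + p + r) J (r - p) = nu q 2 * q ^ (4 * J + 2 * p + 4 * r + 6) *
    (√(nu q (2 * p) * nu q (2 * r + 2)) / (dn q J p r 1 * dn q J p r 2)) := by
  have h0 := hq.1.ne'
  simp only [cD₀, eps_true]
  rw [mul_assoc, sqrt_div_mul hq (4 * J + 2 * p + 4 * r + 7) (2 * p) (2 * r + 2)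
    (2 * (J + p + r + 1) + 1) (2 * (J + p + r + 2) + 1),
    show 4 * J + 2 * p + 4 * r + 7 = (4 * J + 2 * p + 4 * r + 6) + 1 by ring, zpow_add_one₀ h0]
  · have := rpow_mul_qn_two hq (E := 0)
    calc _ = (qn q 2 * nu q 1) * q * (q ^ (4 * J + 2 * p + 4 * r + 6)) *
        (√(nu q (2 * p) * nu q (2 * r + 2)) / (dn q J p r 1 * dn q J p r 2)) := by
          simp only [dn]; ring
      _ = _ := by rw [this]; field_simp
  all_goals simp only [hf] <;> push_cast <;> ring

lemma cD₀_false : cD₀ q (J + p + r) J (r - p - 1) = nu q 2 * q ^ (2 * J + 2 * p + 4 * r + 3) *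
    (√(nu q (2 * J + 2 * p + 3) * nu q (2 * J + 2 * r + 3)) / (dn q J p r 1 * dn q J p r 2)) := by
  have h0 := hq.1.ne'
  simp only [cD₀, eps_false]
  rw [mul_assoc, sqrt_div_mul hq (2 * J + 2 * p + 4 * r + 4) (2 * J + 2 * p + 3)
    (2 * J + 2 * r + 3) (2 * (J + p + r + 1) + 1) (2 * (J + p + r + 2) + 1),
    show 2 * J + 2 * p + 4 * r + 4 = (2 * J + 2 * p + 4 * r + 3) + 1 by ring, zpow_add_one₀ h0]
  · have := rpow_mul_qn_two hq (E := 0)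
    calc _ = (qn q 2 * nu q 1) * q * (q ^ (2 * J + 2 * p + 4 * r + 3)) *
        (√(nu q (2 * J + 2 * p + 3) * nu q (2 * J + 2 * r + 3)) /
          (dn q J p r 1 * dn q J p r 2)) := by
          simp only [dn]; ring
      _ = _ := by rw [this]; field_simp
  all_goals simp only [hf] <;> push_cast <;> ring

end W

end

/-! ### The gauge factors that remove the square roots -/

section

/-- The inverse of `∏ √ν(c i + s)`, `0 ≤ i < k`; it vanishes for `k < 0`. -/
def ig (q : ℝ) (c s k : ℤ) : ℝ :=
  if k < 0 then 0 else (∏ i ∈ Finset.range k.toNat, √(nu q (c * i + s)))⁻¹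

/-- The gauge factor of a fibre vector. -/
def gW (q : ℝ) (J p r : ℤ) : Bool → ℝ
  | true => ig q 2 2 p * ig q 2 2 r * ig q 2 1 (J + r + 2) * ig q 2 1 (J + p + 1)
  | false => ig q 2 2 p * ig q 2 2 r * ig q 2 1 (J + r + 1) * ig q 2 1 (J + p + 2)

/-- The gauge factor of the labels `(J, M)`. -/
def gU (q : ℝ) (J M : ℤ) : ℝ := ig q 1 1 (J - M) * ig q 1 1 (J + M + 1)

section
variable {q : ℝ} (J p r a b : ℤ)

lemma gW_true (ha : J + r + 2 = a) (hb : J + p + 1 = b) :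
    gW q J p r true = ig q 2 2 p * ig q 2 2 r * ig q 2 1 a * ig q 2 1 b := by
  subst ha hb; rfl

lemma gW_false (ha : J + r + 1 = a) (hb : J + p + 2 = b) :
    gW q J p r false = ig q 2 2 p * ig q 2 2 r * ig q 2 1 a * ig q 2 1 b := by
  subst ha hb; rfl

lemma ig_neg (q : ℝ) (c s : ℤ) {k : ℤ} (hk : k < 0) : ig q c s k = 0 := if_pos hk

/-- Each of the two roots is absorbed by the gauge factor whose index changes; `R` collects the
factors common to source and target. -/
lemma gauge_two {x y g₁ g₂ r₁ r₂ : ℝ} (hx : 0 ≤ x) (h₁ : √x * g₁ = r₁) (h₂ : √y * g₂ = r₂)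
    (K D R : ℝ) : K * (√(x * y) / D) * (g₁ * g₂ * R) = K / D * (r₁ * r₂ * R) := by
  rw [Real.sqrt_mul hx, ← h₁, ← h₂]; ring

end

lemma dn_p_sub (q : ℝ) (J p r k n : ℤ) : dn q J (p - n) r k = dn q J p r (k - n) := by
  unfold dn; congr 1; ring
lemma dn_r_sub (q : ℝ) (J p r k n : ℤ) : dn q J p (r - n) k = dn q J p r (k - n) := by
  unfold dn; congr 1; ring

section
variable {q : ℝ} (hq : q ∈ Set.Ioo (0:ℝ) 1)
include hq

/-- The root cancels the new last factor of the product. This is why coefficients that raise an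
index contain no ν in the gauge. -/
lemma ig_up (c s k k' n : ℤ) (hk : 0 ≤ k) (hk' : k' = k + 1) (hn : n = c * k + s)
    (hcs : 0 ≤ c ∧ 0 < s) : √(nu q n) * ig q c s k' = ig q c s k := by
  obtain ⟨m, rfl⟩ := Int.eq_ofNat_of_zero_le hk
  subst hk' hn
  have h : 0 < nu q (c * (m : ℤ) + s) :=
    nu_pos hq (by have h1 := mul_nonneg hcs.1 hk; have h2 := hcs.2; exact add_pos_of_nonneg_of_pos h1 h2)
  have h' := (Real.sqrt_pos.2 h).ne'
  rw [ig, ig, if_neg (by omega), if_neg (by omega)]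
  rw [show ((m : ℤ) + 1).toNat = m + 1 by omega, show ((m : ℤ)).toNat = m by omega,
    Finset.prod_range_succ, mul_inv]
  field_simp

lemma ig_pos (c s k : ℤ) (hk : 0 ≤ k) (hcs : 0 ≤ c ∧ 0 < s) : 0 < ig q c s k := by
  rw [ig, if_neg (by omega)]
  refine inv_pos.2 (Finset.prod_pos fun i _ => Real.sqrt_pos.2 (nu_pos hq ?_))
  have := mul_nonneg hcs.1 (Int.natCast_nonneg i)
  omega

/-- `ig_up` read backwards: multiplying by the root once more gives a full ν. -/
lemma ig_down_aux (c s k k' n : ℤ) (hk : 1 ≤ k) (hk' : k' = k - 1) (hn : n = c * (k - 1) + s)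
    (hcs : 0 ≤ c ∧ 0 < s) : √(nu q n) * ig q c s k' = nu q n * ig q c s k := by
  have h := ig_up hq c s k' k n (by omega) (by omega) (by rw [hn, hk']) hcs
  have h0 : 0 ≤ nu q n := nu_nonneg hq (by
    have := mul_nonneg hcs.1 (show 0 ≤ k - 1 by omega); omega)
  rw [← h, ← mul_assoc, Real.mul_self_sqrt h0]

/-- For step equal to offset the value k = 0 is allowed, because the ν involved is ν(0) = 0. This is
the mechanism that keeps the lattice operators inside the cone. -/
lemma ig_down (c k k' n : ℤ) (hk : 0 ≤ k) (hk' : k' = k - 1) (hn : n = c * k) (hc : 0 < c) :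
    √(nu q n) * ig q c c k' = nu q n * ig q c c k := by
  rcases hk.eq_or_lt with h | h
  · have : nu q n = 0 := by simp [nu, hn, ← h]
    simp [this]
  · exact ig_down_aux hq c c k k' n (by omega) hk' (by rw [hn]; ring) ⟨hc.le, hc⟩

/-- Here the factor is ν(2k - 1), which does not vanish at k = 0, so k ≥ 1 is needed. -/
lemma ig_down_one (k k' n : ℤ) (hk : 1 ≤ k) (hk' : k' = k - 1) (hn : n = 2 * k - 1) :
    √(nu q n) * ig q 2 1 k' = nu q n * ig q 2 1 k :=
  ig_down_aux hq 2 1 k k' n hk hk' (by rw [hn]; ring) (by norm_num)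

section
variable {J p r : ℤ} (hJ : 0 ≤ J) (hp : 0 ≤ p) (hr : 0 ≤ r)
include hJ hp hr

/-- The pattern of all gauge lemmas: coefficient times gauge of the target equals lattice
coefficient times gauge of the source. `h1` and `h2` absorb the two roots, the other two factors of
`gW` are unchanged. The labels `L`, `M` enter through equations so that the lemma applies to any
form in which they appear. -/
lemma gauge_C₁_true {L M : ℤ} (hL : L = J + p + r) (hM : M = r - p) :
    cC₁ q L J M * gW q (J + 1) p r true =
      (-q ^ (2 * r) / dn q J p r 2) * gW q J p r true := by
  subst hL hM
  have hn : cC₁ q (J + p + r) J (r - p) = -q ^ (2 * r) *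
      (√(nu q (2 * J + 2 * r + 5) * nu q (2 * J + 2 * p + 3)) / dn q J p r 2) := by
    exact cC₁_true hq J p r
  have h1 := ig_up hq 2 1 (J + r + 2) (J + 1 + r + 2) (2 * J + 2 * r + 5) (by omega) (by ring) (by ring) (by norm_num)
  have h2 := ig_up hq 2 1 (J + p + 1) (J + 1 + p + 1) (2 * J + 2 * p + 3) (by omega) (by ring) (by ring) (by norm_num)
  have h3 := gauge_two (nu_nonneg hq (by omega)) h1 h2 (-q ^ (2 * r)) (dn q J p r 2)
    (ig q 2 2 p * ig q 2 2 r)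
  rw [hn, gW_true (J + 1) p r (J + 1 + r + 2) (J + 1 + p + 1) (by ring) (by ring),
    gW_true J p r (J + r + 2) (J + p + 1) (by ring) (by ring)]
  linear_combination h3

lemma gauge_Cm_true {L M : ℤ} (hL : L = J + p + r) (hM : M = r - p) :
    cCm q L J M * gW q (J + 1) (p - 1) (r - 1) true =
      (-q ^ (2 * J + 2 * r + 3) * nu q (2 * r) * nu q (2 * p) / dn q J p r 1) * gW q J p r true := by
  subst hL hM
  have hn : cCm q (J + p + r) J (r - p) = -q ^ (2 * J + 2 * r + 3) *
      (√(nu q (2 * r) * nu q (2 * p)) / dn q J p r 1) := by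
    exact cCm_true hq J p r
  have h1 := ig_down hq 2 r (r - 1) (2 * r) (by omega) (by ring) (by ring) (by norm_num)
  have h2 := ig_down hq 2 p (p - 1) (2 * p) (by omega) (by ring) (by ring) (by norm_num)
  have h3 := gauge_two (nu_nonneg hq (by omega)) h1 h2 (-q ^ (2 * J + 2 * r + 3)) (dn q J p r 1)
    (ig q 2 1 (J + r + 2) * ig q 2 1 (J + p + 1))
  rw [hn, gW_true (J + 1) (p - 1) (r - 1) (J + r + 2) (J + p + 1) (by ring) (by ring),
    gW_true J p r (J + r + 2) (J + p + 1) (by ring) (by ring)]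
  linear_combination h3

lemma gauge_C₀_true {L M : ℤ} (hL : L = J + p + r) (hM : M = r - p) :
    cC₀ q L J M * gW q (J + 1) (p - 1) r false =
      (nu q 2 * q ^ (4 * J + 2 * p + 6 * r + 6) * nu q (2 * p) / (dn q J p r 1 * dn q J p r 2)) * gW q J p r true := by
  subst hL hM
  have hn : cC₀ q (J + p + r) J (r - p) = nu q 2 * q ^ (4 * J + 2 * p + 6 * r + 6) *
      (√(nu q (2 * J + 2 * p + 3) * nu q (2 * p)) / (dn q J p r 1 * dn q J p r 2)) := by
    exact cC₀_true hq J p r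
  have h1 := ig_up hq 2 1 (J + p + 1) (J + 1 + p - 1 + 2) (2 * J + 2 * p + 3) (by omega) (by ring) (by ring) (by norm_num)
  have h2 := ig_down hq 2 p (p - 1) (2 * p) (by omega) (by ring) (by ring) (by norm_num)
  have h3 := gauge_two (nu_nonneg hq (by omega)) h1 h2 (nu q 2 * q ^ (4 * J + 2 * p + 6 * r + 6)) ((dn q J p r 1 * dn q J p r 2))
    (ig q 2 2 r * ig q 2 1 (J + r + 2))
  rw [hn, gW_false (J + 1) (p - 1) r (J + r + 2) (J + 1 + p - 1 + 2) (by ring) (by ring),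
    gW_true J p r (J + r + 2) (J + p + 1) (by ring) (by ring)]
  linear_combination h3

/-- The same coefficient with source and target exchanged; the transposed step lowers indices and
therefore acquires the factors ν. -/
lemma gauge_Ct₁_true {L M : ℤ} (hL : L = J + p + r) (hM : M = r - p) :
    cC₁ q L J M * gW q J p r true =
      (-q ^ (2 * r) * nu q (2 * J + 2 * r + 5) * nu q (2 * J + 2 * p + 3) / dn q J p r 2) * gW q (J + 1) p r true := by
  subst hL hM
  have hn : cC₁ q (J + p + r) J (r - p) = -q ^ (2 * r) *
      (√(nu q (2 * J + 2 * r + 5) * nu q (2 * J + 2 * p + 3)) / dn q J p r 2) := by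
    exact cC₁_true hq J p r
  have h1 := ig_down_one hq (J + 1 + r + 2) (J + r + 2) (2 * J + 2 * r + 5) (by omega) (by ring) (by ring)
  have h2 := ig_down_one hq (J + 1 + p + 1) (J + p + 1) (2 * J + 2 * p + 3) (by omega) (by ring) (by ring)
  have h3 := gauge_two (nu_nonneg hq (by omega)) h1 h2 (-q ^ (2 * r)) (dn q J p r 2)
    (ig q 2 2 p * ig q 2 2 r)
  rw [hn, gW_true J p r (J + r + 2) (J + p + 1) (by ring) (by ring),
    gW_true (J + 1) p r (J + 1 + r + 2) (J + 1 + p + 1) (by ring) (by ring)]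
  linear_combination h3

lemma gauge_Ctm_true {L M : ℤ} (hL : L = J + (p + 1) + (r + 1)) (hM : M = (r + 1) - (p + 1)) :
    cCm q L J M * gW q J (p + 1) (r + 1) true =
      (-q ^ (2 * J + 2 * r + 5) / dn q J p r 3) * gW q (J + 1) p r true := by
  subst hL hM
  have hn : cCm q (J + (p + 1) + (r + 1)) J ((r + 1) - (p + 1)) = -q ^ (2 * J + 2 * r + 5) *
      (√(nu q (2 * r + 2) * nu q (2 * p + 2)) / dn q J p r 3) := by
    rw [cCm_true hq J (p + 1) (r + 1)]; simp only [dn_p_add, dn_r_add, dn_p_sub, dn_r_sub]; ring_nf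
  have h1 := ig_up hq 2 2 r (r + 1) (2 * r + 2) (by omega) (by ring) (by ring) (by norm_num)
  have h2 := ig_up hq 2 2 p (p + 1) (2 * p + 2) (by omega) (by ring) (by ring) (by norm_num)
  have h3 := gauge_two (nu_nonneg hq (by omega)) h1 h2 (-q ^ (2 * J + 2 * r + 5)) (dn q J p r 3)
    (ig q 2 1 (J + 1 + r + 2) * ig q 2 1 (J + 1 + p + 1))
  rw [hn, gW_true J (p + 1) (r + 1) (J + 1 + r + 2) (J + 1 + p + 1) (by ring) (by ring),
    gW_true (J + 1) p r (J + 1 + r + 2) (J + 1 + p + 1) (by ring) (by ring)]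
  linear_combination h3

lemma gauge_Ct₀_true {L M : ℤ} (hL : L = J + p + (r + 1)) (hM : M = (r + 1) - p - 1) :
    cC₀ q L J M * gW q J p (r + 1) false =
      (-nu q 2 * q ^ (2 * J + 2 * p + 2 * r + 3) * nu q (2 * J + 2 * r + 5) / (dn q J p r 2 * dn q J p r 3)) * gW q (J + 1) p r true := by
  subst hL hM
  have hn : cC₀ q (J + p + (r + 1)) J ((r + 1) - p - 1) = -nu q 2 * q ^ (2 * J + 2 * p + 2 * r + 3) *
      (√(nu q (2 * J + 2 * r + 5) * nu q (2 * r + 2)) / (dn q J p r 2 * dn q J p r 3)) := by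
    rw [cC₀_false hq J p (r + 1)]; simp only [dn_p_add, dn_r_add, dn_p_sub, dn_r_sub]; ring_nf
  have h1 := ig_down_one hq (J + 1 + r + 2) (J + r + 1 + 1) (2 * J + 2 * r + 5) (by omega) (by ring) (by ring)
  have h2 := ig_up hq 2 2 r (r + 1) (2 * r + 2) (by omega) (by ring) (by ring) (by norm_num)
  have h3 := gauge_two (nu_nonneg hq (by omega)) h1 h2 (-nu q 2 * q ^ (2 * J + 2 * p + 2 * r + 3)) ((dn q J p r 2 * dn q J p r 3))
    (ig q 2 2 p * ig q 2 1 (J + 1 + p + 1))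
  rw [hn, gW_false J p (r + 1) (J + r + 1 + 1) (J + 1 + p + 1) (by ring) (by ring),
    gW_true (J + 1) p r (J + 1 + r + 2) (J + 1 + p + 1) (by ring) (by ring)]
  linear_combination h3

lemma gauge_H₁_true {L M : ℤ} (hL : L = J + p + r) (hM : M = r - p) :
    cH₁ q L J M * gW q J p (r + 1) false =
      (q ^ (2 * J + 2 * r + 3) / dn q J p r 2) * gW q J p r true := by
  subst hL hM
  have hn : cH₁ q (J + p + r) J (r - p) = q ^ (2 * J + 2 * r + 3) *
      (√(nu q (2 * J + 2 * p + 3) * nu q (2 * r + 2)) / dn q J p r 2) := by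
    exact cH₁_true hq J p r
  have h1 := ig_up hq 2 1 (J + p + 1) (J + p + 2) (2 * J + 2 * p + 3) (by omega) (by ring) (by ring) (by norm_num)
  have h2 := ig_up hq 2 2 r (r + 1) (2 * r + 2) (by omega) (by ring) (by ring) (by norm_num)
  have h3 := gauge_two (nu_nonneg hq (by omega)) h1 h2 (q ^ (2 * J + 2 * r + 3)) (dn q J p r 2)
    (ig q 2 2 p * ig q 2 1 (J + r + 2))
  rw [hn, gW_false J p (r + 1) (J + r + 2) (J + p + 2) (by ring) (by ring),
    gW_true J p r (J + r + 2) (J + p + 1) (by ring) (by ring)]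
  linear_combination h3

lemma gauge_Hm_true {L M : ℤ} (hL : L = J + (p - 1) + r) (hM : M = r - (p - 1) - 1) :
    cH₁ q L J M * gW q J (p - 1) r false =
      (q ^ (2 * r) * nu q (2 * p) * nu q (2 * J + 2 * r + 3) / dn q J p r 1) * gW q J p r true := by
  subst hL hM
  have hn : cH₁ q (J + (p - 1) + r) J (r - (p - 1) - 1) = q ^ (2 * r) *
      (√(nu q (2 * p) * nu q (2 * J + 2 * r + 3)) / dn q J p r 1) := by
    rw [cH₁_false hq J (p - 1) r]; simp only [dn_p_add, dn_r_add, dn_p_sub, dn_r_sub]; ring_nf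
  have h1 := ig_down hq 2 p (p - 1) (2 * p) (by omega) (by ring) (by ring) (by norm_num)
  have h2 := ig_down_one hq (J + r + 2) (J + r + 1) (2 * J + 2 * r + 3) (by omega) (by ring) (by ring)
  have h3 := gauge_two (nu_nonneg hq (by omega)) h1 h2 (q ^ (2 * r)) (dn q J p r 1)
    (ig q 2 2 r * ig q 2 1 (J + p + 1))
  rw [hn, gW_false J (p - 1) r (J + r + 1) (J + p + 1) (by ring) (by ring),
    gW_true J p r (J + r + 2) (J + p + 1) (by ring) (by ring)]
  linear_combination h3

lemma gauge_D₁_true {L M : ℤ} (hL : L = J + p + r) (hM : M = r - p) :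
    cD₁ q L J M * gW q J p (r + 1) true =
      (1 / dn q J p r 2) * gW q J p r true := by
  subst hL hM
  have hn : cD₁ q (J + p + r) J (r - p) = 1 *
      (√(nu q (2 * J + 2 * r + 5) * nu q (2 * r + 2)) / dn q J p r 2) := by
    rw [one_mul]; exact cD₁_true hq J p r
  have h1 := ig_up hq 2 1 (J + r + 2) (J + r + 1 + 2) (2 * J + 2 * r + 5) (by omega) (by ring) (by ring) (by norm_num)
  have h2 := ig_up hq 2 2 r (r + 1) (2 * r + 2) (by omega) (by ring) (by ring) (by norm_num)
  have h3 := gauge_two (nu_nonneg hq (by omega)) h1 h2 (1) (dn q J p r 2)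
    (ig q 2 2 p * ig q 2 1 (J + p + 1))
  rw [hn, gW_true J p (r + 1) (J + r + 1 + 2) (J + p + 1) (by ring) (by ring),
    gW_true J p r (J + r + 2) (J + p + 1) (by ring) (by ring)]
  linear_combination h3

lemma gauge_Dm_true {L M : ℤ} (hL : L = J + p + r) (hM : M = r - p) :
    cDm q L J M * gW q J (p - 1) r true =
      (-q ^ (2 * J + 4 * r + 5) * nu q (2 * p) * nu q (2 * J + 2 * p + 1) / dn q J p r 1) * gW q J p r true := by
  subst hL hM
  have hn : cDm q (J + p + r) J (r - p) = -q ^ (2 * J + 4 * r + 5) *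
      (√(nu q (2 * p) * nu q (2 * J + 2 * p + 1)) / dn q J p r 1) := by
    exact cDm_true hq J p r
  have h1 := ig_down hq 2 p (p - 1) (2 * p) (by omega) (by ring) (by ring) (by norm_num)
  have h2 := ig_down_one hq (J + p + 1) (J + p - 1 + 1) (2 * J + 2 * p + 1) (by omega) (by ring) (by ring)
  have h3 := gauge_two (nu_nonneg hq (by omega)) h1 h2 (-q ^ (2 * J + 4 * r + 5)) (dn q J p r 1)
    (ig q 2 2 r * ig q 2 1 (J + r + 2))
  rw [hn, gW_true J (p - 1) r (J + r + 2) (J + p - 1 + 1) (by ring) (by ring),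
    gW_true J p r (J + r + 2) (J + p + 1) (by ring) (by ring)]
  linear_combination h3

lemma gauge_D₀_true {L M : ℤ} (hL : L = J + p + r) (hM : M = r - p) :
    cD₀ q L J M * gW q J (p - 1) (r + 1) false =
      (nu q 2 * q ^ (4 * J + 2 * p + 4 * r + 6) * nu q (2 * p) / (dn q J p r 1 * dn q J p r 2)) * gW q J p r true := by
  subst hL hM
  have hn : cD₀ q (J + p + r) J (r - p) = nu q 2 * q ^ (4 * J + 2 * p + 4 * r + 6) *
      (√(nu q (2 * p) * nu q (2 * r + 2)) / (dn q J p r 1 * dn q J p r 2)) := by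
    exact cD₀_true hq J p r
  have h1 := ig_down hq 2 p (p - 1) (2 * p) (by omega) (by ring) (by ring) (by norm_num)
  have h2 := ig_up hq 2 2 r (r + 1) (2 * r + 2) (by omega) (by ring) (by ring) (by norm_num)
  have h3 := gauge_two (nu_nonneg hq (by omega)) h1 h2 (nu q 2 * q ^ (4 * J + 2 * p + 4 * r + 6)) ((dn q J p r 1 * dn q J p r 2))
    (ig q 2 1 (J + r + 2) * ig q 2 1 (J + p + 1))
  rw [hn, gW_false J (p - 1) (r + 1) (J + r + 2) (J + p + 1) (by ring) (by ring),
    gW_true J p r (J + r + 2) (J + p + 1) (by ring) (by ring)]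
  linear_combination h3

lemma gauge_Dt₁_true {L M : ℤ} (hL : L = J + p + (r - 1)) (hM : M = (r - 1) - p) :
    cD₁ q L J M * gW q J p (r - 1) true =
      (nu q (2 * r) * nu q (2 * J + 2 * r + 3) / dn q J p r 1) * gW q J p r true := by
  subst hL hM
  have hn : cD₁ q (J + p + (r - 1)) J ((r - 1) - p) = 1 *
      (√(nu q (2 * J + 2 * r + 3) * nu q (2 * r)) / dn q J p r 1) := by
    rw [cD₁_true hq J p (r - 1)]; simp only [dn_p_add, dn_r_add, dn_p_sub, dn_r_sub]; ring_nf
  have h1 := ig_down_one hq (J + r + 2) (J + r - 1 + 2) (2 * J + 2 * r + 3) (by omega) (by ring) (by ring)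
  have h2 := ig_down hq 2 r (r - 1) (2 * r) (by omega) (by ring) (by ring) (by norm_num)
  have h3 := gauge_two (nu_nonneg hq (by omega)) h1 h2 (1) (dn q J p r 1)
    (ig q 2 2 p * ig q 2 1 (J + p + 1))
  rw [hn, gW_true J p (r - 1) (J + r - 1 + 2) (J + p + 1) (by ring) (by ring),
    gW_true J p r (J + r + 2) (J + p + 1) (by ring) (by ring)]
  linear_combination h3

lemma gauge_Dtm_true {L M : ℤ} (hL : L = J + (p + 1) + r) (hM : M = r - (p + 1)) :
    cDm q L J M * gW q J (p + 1) r true =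
      (-q ^ (2 * J + 4 * r + 5) / dn q J p r 2) * gW q J p r true := by
  subst hL hM
  have hn : cDm q (J + (p + 1) + r) J (r - (p + 1)) = -q ^ (2 * J + 4 * r + 5) *
      (√(nu q (2 * p + 2) * nu q (2 * J + 2 * p + 3)) / dn q J p r 2) := by
    rw [cDm_true hq J (p + 1) r]; simp only [dn_p_add, dn_r_add, dn_p_sub, dn_r_sub]; ring_nf
  have h1 := ig_up hq 2 2 p (p + 1) (2 * p + 2) (by omega) (by ring) (by ring) (by norm_num)
  have h2 := ig_up hq 2 1 (J + p + 1) (J + p + 1 + 1) (2 * J + 2 * p + 3) (by omega) (by ring) (by ring) (by norm_num)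
  have h3 := gauge_two (nu_nonneg hq (by omega)) h1 h2 (-q ^ (2 * J + 4 * r + 5)) (dn q J p r 2)
    (ig q 2 2 r * ig q 2 1 (J + r + 2))
  rw [hn, gW_true J (p + 1) r (J + r + 2) (J + p + 1 + 1) (by ring) (by ring),
    gW_true J p r (J + r + 2) (J + p + 1) (by ring) (by ring)]
  linear_combination h3

lemma gauge_Dt₀_true {L M : ℤ} (hL : L = J + p + r) (hM : M = r - p - 1) :
    cD₀ q L J M * gW q J p r false =
      (nu q 2 * q ^ (2 * J + 2 * p + 4 * r + 3) * nu q (2 * J + 2 * r + 3) / (dn q J p r 1 * dn q J p r 2)) * gW q J p r true := by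
  subst hL hM
  have hn : cD₀ q (J + p + r) J (r - p - 1) = nu q 2 * q ^ (2 * J + 2 * p + 4 * r + 3) *
      (√(nu q (2 * J + 2 * p + 3) * nu q (2 * J + 2 * r + 3)) / (dn q J p r 1 * dn q J p r 2)) := by
    exact cD₀_false hq J p r
  have h1 := ig_up hq 2 1 (J + p + 1) (J + p + 2) (2 * J + 2 * p + 3) (by omega) (by ring) (by ring) (by norm_num)
  have h2 := ig_down_one hq (J + r + 2) (J + r + 1) (2 * J + 2 * r + 3) (by omega) (by ring) (by ring)
  have h3 := gauge_two (nu_nonneg hq (by omega)) h1 h2 (nu q 2 * q ^ (2 * J + 2 * p + 4 * r + 3)) ((dn q J p r 1 * dn q J p r 2))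
    (ig q 2 2 p * ig q 2 2 r)
  rw [hn, gW_false J p r (J + r + 1) (J + p + 2) (by ring) (by ring),
    gW_true J p r (J + r + 2) (J + p + 1) (by ring) (by ring)]
  linear_combination h3

lemma gauge_C₁_false {L M : ℤ} (hL : L = J + p + r) (hM : M = r - p - 1) :
    cC₁ q L J M * gW q (J + 1) p r false =
      (-q ^ (2 * r) / dn q J p r 2) * gW q J p r false := by
  subst hL hM
  have hn : cC₁ q (J + p + r) J (r - p - 1) = -q ^ (2 * r) *
      (√(nu q (2 * J + 2 * r + 3) * nu q (2 * J + 2 * p + 5)) / dn q J p r 2) := by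
    exact cC₁_false hq J p r
  have h1 := ig_up hq 2 1 (J + r + 1) (J + 1 + r + 1) (2 * J + 2 * r + 3) (by omega) (by ring) (by ring) (by norm_num)
  have h2 := ig_up hq 2 1 (J + p + 2) (J + 1 + p + 2) (2 * J + 2 * p + 5) (by omega) (by ring) (by ring) (by norm_num)
  have h3 := gauge_two (nu_nonneg hq (by omega)) h1 h2 (-q ^ (2 * r)) (dn q J p r 2)
    (ig q 2 2 p * ig q 2 2 r)
  rw [hn, gW_false (J + 1) p r (J + 1 + r + 1) (J + 1 + p + 2) (by ring) (by ring),
    gW_false J p r (J + r + 1) (J + p + 2) (by ring) (by ring)]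
  linear_combination h3

lemma gauge_Cm_false {L M : ℤ} (hL : L = J + p + r) (hM : M = r - p - 1) :
    cCm q L J M * gW q (J + 1) (p - 1) (r - 1) false =
      (-q ^ (2 * J + 2 * r + 1) * nu q (2 * r) * nu q (2 * p) / dn q J p r 1) * gW q J p r false := by
  subst hL hM
  have hn : cCm q (J + p + r) J (r - p - 1) = -q ^ (2 * J + 2 * r + 1) *
      (√(nu q (2 * r) * nu q (2 * p)) / dn q J p r 1) := by
    exact cCm_false hq J p r
  have h1 := ig_down hq 2 r (r - 1) (2 * r) (by omega) (by ring) (by ring) (by norm_num)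
  have h2 := ig_down hq 2 p (p - 1) (2 * p) (by omega) (by ring) (by ring) (by norm_num)
  have h3 := gauge_two (nu_nonneg hq (by omega)) h1 h2 (-q ^ (2 * J + 2 * r + 1)) (dn q J p r 1)
    (ig q 2 1 (J + r + 1) * ig q 2 1 (J + p + 2))
  rw [hn, gW_false (J + 1) (p - 1) (r - 1) (J + r + 1) (J + p + 2) (by ring) (by ring),
    gW_false J p r (J + r + 1) (J + p + 2) (by ring) (by ring)]
  linear_combination h3

lemma gauge_C₀_false {L M : ℤ} (hL : L = J + p + r) (hM : M = r - p - 1) :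
    cC₀ q L J M * gW q (J + 1) p (r - 1) true =
      (-nu q 2 * q ^ (2 * J + 2 * p + 2 * r + 1) * nu q (2 * r) / (dn q J p r 1 * dn q J p r 2)) * gW q J p r false := by
  subst hL hM
  have hn : cC₀ q (J + p + r) J (r - p - 1) = -nu q 2 * q ^ (2 * J + 2 * p + 2 * r + 1) *
      (√(nu q (2 * J + 2 * r + 3) * nu q (2 * r)) / (dn q J p r 1 * dn q J p r 2)) := by
    exact cC₀_false hq J p r
  have h1 := ig_up hq 2 1 (J + r + 1) (J + 1 + r - 1 + 2) (2 * J + 2 * r + 3) (by omega) (by ring) (by ring) (by norm_num)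
  have h2 := ig_down hq 2 r (r - 1) (2 * r) (by omega) (by ring) (by ring) (by norm_num)
  have h3 := gauge_two (nu_nonneg hq (by omega)) h1 h2 (-nu q 2 * q ^ (2 * J + 2 * p + 2 * r + 1)) ((dn q J p r 1 * dn q J p r 2))
    (ig q 2 2 p * ig q 2 1 (J + p + 2))
  rw [hn, gW_true (J + 1) p (r - 1) (J + 1 + r - 1 + 2) (J + p + 2) (by ring) (by ring),
    gW_false J p r (J + r + 1) (J + p + 2) (by ring) (by ring)]
  linear_combination h3

lemma gauge_Ct₁_false {L M : ℤ} (hL : L = J + p + r) (hM : M = r - p - 1) :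
    cC₁ q L J M * gW q J p r false =
      (-q ^ (2 * r) * nu q (2 * J + 2 * r + 3) * nu q (2 * J + 2 * p + 5) / dn q J p r 2) * gW q (J + 1) p r false := by
  subst hL hM
  have hn : cC₁ q (J + p + r) J (r - p - 1) = -q ^ (2 * r) *
      (√(nu q (2 * J + 2 * r + 3) * nu q (2 * J + 2 * p + 5)) / dn q J p r 2) := by
    exact cC₁_false hq J p r
  have h1 := ig_down_one hq (J + 1 + r + 1) (J + r + 1) (2 * J + 2 * r + 3) (by omega) (by ring) (by ring)
  have h2 := ig_down_one hq (J + 1 + p + 2) (J + p + 2) (2 * J + 2 * p + 5) (by omega) (by ring) (by ring)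
  have h3 := gauge_two (nu_nonneg hq (by omega)) h1 h2 (-q ^ (2 * r)) (dn q J p r 2)
    (ig q 2 2 p * ig q 2 2 r)
  rw [hn, gW_false J p r (J + r + 1) (J + p + 2) (by ring) (by ring),
    gW_false (J + 1) p r (J + 1 + r + 1) (J + 1 + p + 2) (by ring) (by ring)]
  linear_combination h3

lemma gauge_Ctm_false {L M : ℤ} (hL : L = J + (p + 1) + (r + 1)) (hM : M = (r + 1) - (p + 1) - 1) :
    cCm q L J M * gW q J (p + 1) (r + 1) false =
      (-q ^ (2 * J + 2 * r + 3) / dn q J p r 3) * gW q (J + 1) p r false := by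
  subst hL hM
  have hn : cCm q (J + (p + 1) + (r + 1)) J ((r + 1) - (p + 1) - 1) = -q ^ (2 * J + 2 * r + 3) *
      (√(nu q (2 * r + 2) * nu q (2 * p + 2)) / dn q J p r 3) := by
    rw [cCm_false hq J (p + 1) (r + 1)]; simp only [dn_p_add, dn_r_add, dn_p_sub, dn_r_sub]; ring_nf
  have h1 := ig_up hq 2 2 r (r + 1) (2 * r + 2) (by omega) (by ring) (by ring) (by norm_num)
  have h2 := ig_up hq 2 2 p (p + 1) (2 * p + 2) (by omega) (by ring) (by ring) (by norm_num)
  have h3 := gauge_two (nu_nonneg hq (by omega)) h1 h2 (-q ^ (2 * J + 2 * r + 3)) (dn q J p r 3)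
    (ig q 2 1 (J + 1 + r + 1) * ig q 2 1 (J + 1 + p + 2))
  rw [hn, gW_false J (p + 1) (r + 1) (J + 1 + r + 1) (J + 1 + p + 2) (by ring) (by ring),
    gW_false (J + 1) p r (J + 1 + r + 1) (J + 1 + p + 2) (by ring) (by ring)]
  linear_combination h3

lemma gauge_Ct₀_false {L M : ℤ} (hL : L = J + (p + 1) + r) (hM : M = r - (p + 1)) :
    cC₀ q L J M * gW q J (p + 1) r true =
      (nu q 2 * q ^ (4 * J + 2 * p + 6 * r + 8) * nu q (2 * J + 2 * p + 5) / (dn q J p r 2 * dn q J p r 3)) * gW q (J + 1) p r false := by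
  subst hL hM
  have hn : cC₀ q (J + (p + 1) + r) J (r - (p + 1)) = nu q 2 * q ^ (4 * J + 2 * p + 6 * r + 8) *
      (√(nu q (2 * J + 2 * p + 5) * nu q (2 * p + 2)) / (dn q J p r 2 * dn q J p r 3)) := by
    rw [cC₀_true hq J (p + 1) r]; simp only [dn_p_add, dn_r_add, dn_p_sub, dn_r_sub]; ring_nf
  have h1 := ig_down_one hq (J + 1 + p + 2) (J + p + 1 + 1) (2 * J + 2 * p + 5) (by omega) (by ring) (by ring)
  have h2 := ig_up hq 2 2 p (p + 1) (2 * p + 2) (by omega) (by ring) (by ring) (by norm_num)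
  have h3 := gauge_two (nu_nonneg hq (by omega)) h1 h2 (nu q 2 * q ^ (4 * J + 2 * p + 6 * r + 8)) ((dn q J p r 2 * dn q J p r 3))
    (ig q 2 2 r * ig q 2 1 (J + 1 + r + 1))
  rw [hn, gW_true J (p + 1) r (J + 1 + r + 1) (J + p + 1 + 1) (by ring) (by ring),
    gW_false (J + 1) p r (J + 1 + r + 1) (J + 1 + p + 2) (by ring) (by ring)]
  linear_combination h3

lemma gauge_H₁_false {L M : ℤ} (hL : L = J + p + r) (hM : M = r - p - 1) :
    cH₁ q L J M * gW q J (p + 1) r true =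
      (q ^ (2 * r) / dn q J p r 2) * gW q J p r false := by
  subst hL hM
  have hn : cH₁ q (J + p + r) J (r - p - 1) = q ^ (2 * r) *
      (√(nu q (2 * p + 2) * nu q (2 * J + 2 * r + 3)) / dn q J p r 2) := by
    exact cH₁_false hq J p r
  have h1 := ig_up hq 2 2 p (p + 1) (2 * p + 2) (by omega) (by ring) (by ring) (by norm_num)
  have h2 := ig_up hq 2 1 (J + r + 1) (J + r + 2) (2 * J + 2 * r + 3) (by omega) (by ring) (by ring) (by norm_num)
  have h3 := gauge_two (nu_nonneg hq (by omega)) h1 h2 (q ^ (2 * r)) (dn q J p r 2)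
    (ig q 2 2 r * ig q 2 1 (J + p + 2))
  rw [hn, gW_true J (p + 1) r (J + r + 2) (J + p + 2) (by ring) (by ring),
    gW_false J p r (J + r + 1) (J + p + 2) (by ring) (by ring)]
  linear_combination h3

lemma gauge_Hm_false {L M : ℤ} (hL : L = J + p + (r - 1)) (hM : M = (r - 1) - p) :
    cH₁ q L J M * gW q J p (r - 1) true =
      (q ^ (2 * J + 2 * r + 1) * nu q (2 * J + 2 * p + 3) * nu q (2 * r) / dn q J p r 1) * gW q J p r false := by
  subst hL hM
  have hn : cH₁ q (J + p + (r - 1)) J ((r - 1) - p) = q ^ (2 * J + 2 * r + 1) *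
      (√(nu q (2 * J + 2 * p + 3) * nu q (2 * r)) / dn q J p r 1) := by
    rw [cH₁_true hq J p (r - 1)]; simp only [dn_p_add, dn_r_add, dn_p_sub, dn_r_sub]; ring_nf
  have h1 := ig_down_one hq (J + p + 2) (J + p + 1) (2 * J + 2 * p + 3) (by omega) (by ring) (by ring)
  have h2 := ig_down hq 2 r (r - 1) (2 * r) (by omega) (by ring) (by ring) (by norm_num)
  have h3 := gauge_two (nu_nonneg hq (by omega)) h1 h2 (q ^ (2 * J + 2 * r + 1)) (dn q J p r 1)
    (ig q 2 2 p * ig q 2 1 (J + r + 1))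
  rw [hn, gW_true J p (r - 1) (J + r + 1) (J + p + 1) (by ring) (by ring),
    gW_false J p r (J + r + 1) (J + p + 2) (by ring) (by ring)]
  linear_combination h3

lemma gauge_D₁_false {L M : ℤ} (hL : L = J + p + r) (hM : M = r - p - 1) :
    cD₁ q L J M * gW q J p (r + 1) false =
      (1 / dn q J p r 2) * gW q J p r false := by
  subst hL hM
  have hn : cD₁ q (J + p + r) J (r - p - 1) = 1 *
      (√(nu q (2 * J + 2 * r + 3) * nu q (2 * r + 2)) / dn q J p r 2) := by
    rw [one_mul]; exact cD₁_false hq J p r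
  have h1 := ig_up hq 2 1 (J + r + 1) (J + r + 1 + 1) (2 * J + 2 * r + 3) (by omega) (by ring) (by ring) (by norm_num)
  have h2 := ig_up hq 2 2 r (r + 1) (2 * r + 2) (by omega) (by ring) (by ring) (by norm_num)
  have h3 := gauge_two (nu_nonneg hq (by omega)) h1 h2 (1) (dn q J p r 2)
    (ig q 2 2 p * ig q 2 1 (J + p + 2))
  rw [hn, gW_false J p (r + 1) (J + r + 1 + 1) (J + p + 2) (by ring) (by ring),
    gW_false J p r (J + r + 1) (J + p + 2) (by ring) (by ring)]
  linear_combination h3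

lemma gauge_Dm_false {L M : ℤ} (hL : L = J + p + r) (hM : M = r - p - 1) :
    cDm q L J M * gW q J (p - 1) r false =
      (-q ^ (2 * J + 4 * r + 3) * nu q (2 * p) * nu q (2 * J + 2 * p + 3) / dn q J p r 1) * gW q J p r false := by
  subst hL hM
  have hn : cDm q (J + p + r) J (r - p - 1) = -q ^ (2 * J + 4 * r + 3) *
      (√(nu q (2 * p) * nu q (2 * J + 2 * p + 3)) / dn q J p r 1) := by
    exact cDm_false hq J p r
  have h1 := ig_down hq 2 p (p - 1) (2 * p) (by omega) (by ring) (by ring) (by norm_num)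
  have h2 := ig_down_one hq (J + p + 2) (J + p - 1 + 2) (2 * J + 2 * p + 3) (by omega) (by ring) (by ring)
  have h3 := gauge_two (nu_nonneg hq (by omega)) h1 h2 (-q ^ (2 * J + 4 * r + 3)) (dn q J p r 1)
    (ig q 2 2 r * ig q 2 1 (J + r + 1))
  rw [hn, gW_false J (p - 1) r (J + r + 1) (J + p - 1 + 2) (by ring) (by ring),
    gW_false J p r (J + r + 1) (J + p + 2) (by ring) (by ring)]
  linear_combination h3

lemma gauge_D₀_false {L M : ℤ} (hL : L = J + p + r) (hM : M = r - p - 1) :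
    cD₀ q L J M * gW q J p r true =
      (nu q 2 * q ^ (2 * J + 2 * p + 4 * r + 3) * nu q (2 * J + 2 * p + 3) / (dn q J p r 1 * dn q J p r 2)) * gW q J p r false := by
  subst hL hM
  have hn : cD₀ q (J + p + r) J (r - p - 1) = nu q 2 * q ^ (2 * J + 2 * p + 4 * r + 3) *
      (√(nu q (2 * J + 2 * p + 3) * nu q (2 * J + 2 * r + 3)) / (dn q J p r 1 * dn q J p r 2)) := by
    exact cD₀_false hq J p r
  have h1 := ig_down_one hq (J + p + 2) (J + p + 1) (2 * J + 2 * p + 3) (by omega) (by ring) (by ring)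
  have h2 := ig_up hq 2 1 (J + r + 1) (J + r + 2) (2 * J + 2 * r + 3) (by omega) (by ring) (by ring) (by norm_num)
  have h3 := gauge_two (nu_nonneg hq (by omega)) h1 h2 (nu q 2 * q ^ (2 * J + 2 * p + 4 * r + 3)) ((dn q J p r 1 * dn q J p r 2))
    (ig q 2 2 p * ig q 2 2 r)
  rw [hn, gW_true J p r (J + r + 2) (J + p + 1) (by ring) (by ring),
    gW_false J p r (J + r + 1) (J + p + 2) (by ring) (by ring)]
  linear_combination h3

lemma gauge_Dt₁_false {L M : ℤ} (hL : L = J + p + (r - 1)) (hM : M = (r - 1) - p - 1) :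
    cD₁ q L J M * gW q J p (r - 1) false =
      (nu q (2 * r) * nu q (2 * J + 2 * r + 1) / dn q J p r 1) * gW q J p r false := by
  subst hL hM
  have hn : cD₁ q (J + p + (r - 1)) J ((r - 1) - p - 1) = 1 *
      (√(nu q (2 * J + 2 * r + 1) * nu q (2 * r)) / dn q J p r 1) := by
    rw [cD₁_false hq J p (r - 1)]; simp only [dn_p_add, dn_r_add, dn_p_sub, dn_r_sub]; ring_nf
  have h1 := ig_down_one hq (J + r + 1) (J + r - 1 + 1) (2 * J + 2 * r + 1) (by omega) (by ring) (by ring)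
  have h2 := ig_down hq 2 r (r - 1) (2 * r) (by omega) (by ring) (by ring) (by norm_num)
  have h3 := gauge_two (nu_nonneg hq (by omega)) h1 h2 (1) (dn q J p r 1)
    (ig q 2 2 p * ig q 2 1 (J + p + 2))
  rw [hn, gW_false J p (r - 1) (J + r - 1 + 1) (J + p + 2) (by ring) (by ring),
    gW_false J p r (J + r + 1) (J + p + 2) (by ring) (by ring)]
  linear_combination h3

lemma gauge_Dtm_false {L M : ℤ} (hL : L = J + (p + 1) + r) (hM : M = r - (p + 1) - 1) :
    cDm q L J M * gW q J (p + 1) r false =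
      (-q ^ (2 * J + 4 * r + 3) / dn q J p r 2) * gW q J p r false := by
  subst hL hM
  have hn : cDm q (J + (p + 1) + r) J (r - (p + 1) - 1) = -q ^ (2 * J + 4 * r + 3) *
      (√(nu q (2 * p + 2) * nu q (2 * J + 2 * p + 5)) / dn q J p r 2) := by
    rw [cDm_false hq J (p + 1) r]; simp only [dn_p_add, dn_r_add, dn_p_sub, dn_r_sub]; ring_nf
  have h1 := ig_up hq 2 2 p (p + 1) (2 * p + 2) (by omega) (by ring) (by ring) (by norm_num)
  have h2 := ig_up hq 2 1 (J + p + 2) (J + p + 1 + 2) (2 * J + 2 * p + 5) (by omega) (by ring) (by ring) (by norm_num)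
  have h3 := gauge_two (nu_nonneg hq (by omega)) h1 h2 (-q ^ (2 * J + 4 * r + 3)) (dn q J p r 2)
    (ig q 2 2 r * ig q 2 1 (J + r + 1))
  rw [hn, gW_false J (p + 1) r (J + r + 1) (J + p + 1 + 2) (by ring) (by ring),
    gW_false J p r (J + r + 1) (J + p + 2) (by ring) (by ring)]
  linear_combination h3

lemma gauge_Dt₀_false {L M : ℤ} (hL : L = J + (p + 1) + (r - 1)) (hM : M = (r - 1) - (p + 1)) :
    cD₀ q L J M * gW q J (p + 1) (r - 1) true =
      (nu q 2 * q ^ (4 * J + 2 * p + 4 * r + 4) * nu q (2 * r) / (dn q J p r 1 * dn q J p r 2)) * gW q J p r false := by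
  subst hL hM
  have hn : cD₀ q (J + (p + 1) + (r - 1)) J ((r - 1) - (p + 1)) = nu q 2 * q ^ (4 * J + 2 * p + 4 * r + 4) *
      (√(nu q (2 * p + 2) * nu q (2 * r)) / (dn q J p r 1 * dn q J p r 2)) := by
    rw [cD₀_true hq J (p + 1) (r - 1)]; simp only [dn_p_add, dn_r_add, dn_p_sub, dn_r_sub]; ring_nf
  have h1 := ig_up hq 2 2 p (p + 1) (2 * p + 2) (by omega) (by ring) (by ring) (by norm_num)
  have h2 := ig_down hq 2 r (r - 1) (2 * r) (by omega) (by ring) (by ring) (by norm_num)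
  have h3 := gauge_two (nu_nonneg hq (by omega)) h1 h2 (nu q 2 * q ^ (4 * J + 2 * p + 4 * r + 4)) ((dn q J p r 1 * dn q J p r 2))
    (ig q 2 1 (J + r + 1) * ig q 2 1 (J + p + 2))
  rw [hn, gW_true J (p + 1) (r - 1) (J + r + 1) (J + p + 2) (by ring) (by ring),
    gW_false J p r (J + r + 1) (J + p + 2) (by ring) (by ring)]
  linear_combination h3

end

end

end

section

/-! ### Weighted shifts on finite linear combinations -/

/-- A weighted shift: the shift of the labels `(l, m₁, m₂, j)` and the weight. -/
abbrev WShift : Type := (ℤ × ℤ × ℤ × ℤ) × (ℤ → ℤ → ℤ → ℤ → ℤˣ → ℝ)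

/-- The transposed weighted shift. -/
def WShift.adj (t : WShift) : WShift :=
  (-t.1, fun L M₁ M₂ J s => t.2 (L - t.1.1) (M₁ - t.1.2.1) (M₂ - t.1.2.2.1) (J - t.1.2.2.2) s)

def wsF (t : WShift) : FinSpinors →ₗ[ℂ] FinSpinors :=
  Finsupp.linearCombination ℂ fun k : Idx => t.2 k.1.L k.1.M₁ k.1.M₂ k.1.J k.2 •
    vec k.2 (k.1.L + t.1.1) (k.1.M₁ + t.1.2.1) (k.1.M₂ + t.1.2.2.1) (k.1.J + t.1.2.2.2)

def opF (l : List WShift) : FinSpinors →ₗ[ℂ] FinSpinors := (l.map wsF).sum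

lemma wsF_single (t : WShift) (k : Idx) : wsF t (Finsupp.single k 1) =
    t.2 k.1.L k.1.M₁ k.1.M₂ k.1.J k.2 •
      vec k.2 (k.1.L + t.1.1) (k.1.M₁ + t.1.2.1) (k.1.M₂ + t.1.2.2.1) (k.1.J + t.1.2.2.2) := by
  simp [wsF]

lemma wsF_vec (t : WShift) (s : ℤˣ) {L M₁ M₂ J : ℤ} (h : IsLabel L M₁ M₂ J) :
    wsF t (vec s L M₁ M₂ J) = t.2 L M₁ M₂ J s •
      vec s (L + t.1.1) (M₁ + t.1.2.1) (M₂ + t.1.2.2.1) (J + t.1.2.2.2) := by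
  rw [vec, dif_pos h, wsF_single]

/-- In the new coordinates the conditions on (p, r) and on (J, M) decouple. The condition J ≥ 0 is
implied, since the last two add up to 2J + 1 ≥ 0. -/
lemma isLabel_true {J M p r : ℤ} :
    IsLabel (J + p + r) M (r - p) J ↔ (0 ≤ p ∧ 0 ≤ r ∧ 0 ≤ J - M ∧ 0 ≤ J + M + 1) := by
  unfold IsLabel
  rw [abs_le, abs_le]
  omega

lemma isLabel_false {J M p r : ℤ} :
    IsLabel (J + p + r) M (r - p - 1) J ↔ (0 ≤ p ∧ 0 ≤ r ∧ 0 ≤ J - M ∧ 0 ≤ J + M + 1) := by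
  unfold IsLabel
  rw [abs_le, abs_le]
  omega

lemma fin_ext {E : Type*} [AddCommGroup E] [Module ℂ E] {f g : FinSpinors →ₗ[ℂ] E}
    (h₁ : ∀ (s : ℤˣ) (J M p r : ℤ), 0 ≤ J → 0 ≤ p → 0 ≤ r → 0 ≤ J - M → 0 ≤ J + M + 1 →
      f (vec s (J + p + r) M (r - p) J) = g (vec s (J + p + r) M (r - p) J))
    (h₂ : ∀ (s : ℤˣ) (J M p r : ℤ), 0 ≤ J → 0 ≤ p → 0 ≤ r → 0 ≤ J - M → 0 ≤ J + M + 1 →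
      f (vec s (J + p + r) M (r - p - 1) J) = g (vec s (J + p + r) M (r - p - 1) J)) : f = g := by
  refine Finsupp.lhom_ext' fun k => LinearMap.ext_ring ?_
  obtain ⟨⟨L, M, N, J, h⟩, s⟩ := k
  have hv : (Finsupp.lsingle (⟨L, M, N, J, h⟩, s) : ℂ →ₗ[ℂ] FinSpinors) 1 = vec s L M N J := by
    rw [vec, dif_pos h]; rfl
  simp only [LinearMap.comp_apply, hv]
  rcases Int.even_or_odd' (L - J - N) with ⟨p, hp | hp⟩
  · obtain ⟨r, rfl⟩ : ∃ r, N = r - p := ⟨N + p, by ring⟩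
    obtain rfl : L = J + p + r := by omega
    have := isLabel_true.1 h
    exact h₁ s J M p r (by omega) (by omega) (by omega) (by omega) (by omega)
  · obtain ⟨r, rfl⟩ : ∃ r, N = r - p - 1 := ⟨N + p + 1, by ring⟩
    obtain rfl : L = J + p + r := by omega
    have := isLabel_false.1 h
    exact h₂ s J M p r (by omega) (by omega) (by omega) (by omega) (by omega)

/-! ### The embedding into the lattice model -/

section Embedding
variable (q : ℝ)

/-- Division by 2 rounds down, so it yields p for both parities of L - J - N; then r = L - J - p.
The vector is multiplied by its gauge factor. -/
def Phi : FinSpinors →ₗ[ℂ] Lat := Finsupp.linearCombination ℂ fun k : Idx =>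
  (gU q k.1.J k.1.M₁ * gW q k.1.J ((k.1.L - k.1.J - k.1.M₂) / 2)
      (k.1.L - k.1.J - (k.1.L - k.1.J - k.1.M₂) / 2) (decide (Even (k.1.L - k.1.J - k.1.M₂)))) •
    lv k.1.M₁ k.1.J k.2 (fb ((k.1.L - k.1.J - k.1.M₂) / 2)
      (k.1.L - k.1.J - (k.1.L - k.1.J - k.1.M₂) / 2) (decide (Even (k.1.L - k.1.J - k.1.M₂))))

lemma lv_smul_smul (a b : ℝ) (M J : ℤ) (s : ℤˣ) (w : Fib) :
    a • b • lv M J s w = (a * b) • lv M J s w := by module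

/-- This holds for inadmissible labels too: then `vec` is zero, and so is one of the gauge factors,
since some index of `ig` is negative. The intertwining lemmas thus need no boundary cases. -/
lemma Phi_true (s : ℤˣ) (J M p r : ℤ) {L N : ℤ} (hL : L = J + p + r) (hN : N = r - p) :
    Phi q (vec s L M N J) = (gU q J M * gW q J p r true) • lv M J s (fb p r true) := by
  subst hL hN
  by_cases h : IsLabel (J + p + r) M (r - p) J
  · have e : J + p + r - J - (r - p) = 2 * p := by ring
    have e2 : J + p + r - J - p = r := by ring
    rw [vec, dif_pos h]
    simp only [Phi, Finsupp.linearCombination_single, one_smul, e,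
      Int.mul_ediv_cancel_left p two_ne_zero, e2, even_two_mul, decide_true]
  · rw [vec, dif_neg h, map_zero]
    rw [isLabel_true] at h
    have : p < 0 ∨ r < 0 ∨ J - M < 0 ∨ J + M + 1 < 0 := by omega
    rcases this with h | h | h | h <;> simp [gU, gW, ig_neg, h]

lemma Phi_false (s : ℤˣ) (J M p r : ℤ) {L N : ℤ} (hL : L = J + p + r) (hN : N = r - p - 1) :
    Phi q (vec s L M N J) = (gU q J M * gW q J p r false) • lv M J s (fb p r false) := by
  subst hL hN
  by_cases h : IsLabel (J + p + r) M (r - p - 1) J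
  · have e : J + p + r - J - (r - p - 1) = 2 * p + 1 := by ring
    have e1 : (2 * p + 1) / 2 = p := by omega
    have e2 : J + p + r - J - p = r := by ring
    have e3 : ¬ Even (2 * p + 1) := by rw [Int.not_even_iff_odd]; exact ⟨p, rfl⟩
    rw [vec, dif_pos h]
    simp only [Phi, Finsupp.linearCombination_single, one_smul, e, e1, e2, e3, decide_false]
  · rw [vec, dif_neg h, map_zero]
    rw [isLabel_false] at h
    have : p < 0 ∨ r < 0 ∨ J - M < 0 ∨ J + M + 1 < 0 := by omega
    rcases this with h | h | h | h <;> simp [gU, gW, ig_neg, h]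

end Embedding

section
variable {q : ℝ} (hq : q ∈ Set.Ioo (0:ℝ) 1)
include hq

lemma gU_pos {J M : ℤ} (h₁ : 0 ≤ J - M) (h₂ : 0 ≤ J + M + 1) : 0 < gU q J M :=
  mul_pos (ig_pos hq _ _ _ h₁ (by norm_num)) (ig_pos hq _ _ _ h₂ (by norm_num))

lemma gW_pos {J p r : ℤ} (hJ : 0 ≤ J) (hp : 0 ≤ p) (hr : 0 ≤ r) (b : Bool) : 0 < gW q J p r b := by
  cases b <;> refine mul_pos (mul_pos (mul_pos ?_ ?_) ?_) ?_ <;>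
    exact ig_pos hq _ _ _ (by omega) (by norm_num)

/-- The gauge factors are positive on admissible labels, so division by them gives a left inverse.
Operator identities on finite combinations may therefore be tested on the lattice. -/
lemma Phi_injective : Function.Injective (Phi q) := by
  let Psi : Lat →ₗ[ℂ] FinSpinors := Finsupp.lsum ℂ fun i : ℤ × ℤ × ℤˣ =>
    Finsupp.linearCombination ℂ fun j : ℤ × ℤ × Bool =>
      (gU q i.2.1 i.1 * gW q i.2.1 j.1 j.2.1 j.2.2)⁻¹ •
        vec i.2.2 (i.2.1 + j.1 + j.2.1) i.1 (j.2.1 - j.1 - if j.2.2 then 0 else 1) i.2.1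
  have hPsi : Psi ∘ₗ Phi q = LinearMap.id := by
    refine fin_ext ?_ ?_ <;> intro s J M p r hJ hp hr hu hu'
    · have h1 := (mul_pos (gU_pos hq hu hu') (gW_pos hq hJ hp hr true)).ne'
      rw [LinearMap.comp_apply, Phi_true q s J M p r rfl rfl, LinearMap.map_smul_of_tower]
      simp [Psi, lv, fb, smul_smul, mul_inv_cancel₀ h1]
      rw [← mul_inv_rev, mul_inv_cancel₀ h1, one_smul]
    · have h1 := (mul_pos (gU_pos hq hu hu') (gW_pos hq hJ hp hr false)).ne'
      rw [LinearMap.comp_apply, Phi_false q s J M p r rfl rfl, LinearMap.map_smul_of_tower]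
      simp [Psi, lv, fb, smul_smul, mul_inv_cancel₀ h1]
      rw [← mul_inv_rev, mul_inv_cancel₀ h1, one_smul]
  exact Function.LeftInverse.injective (g := Psi) fun v => LinearMap.congr_fun hPsi v

lemma ig_up_up (k k₁ k₂ n m : ℤ) (hk : 0 ≤ k) (hk₁ : k₁ = k + 2) (hn : n = k + 1) (hm : m = k + 2) :
    √(nu q n * nu q m) * ig q 1 1 k₁ = ig q 1 1 k := by
  rw [Real.sqrt_mul (nu_nonneg hq (by omega)), mul_assoc,
    ig_up hq 1 1 (k + 1) k₁ m (by omega) (by omega) (by omega) (by norm_num),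
    ig_up hq 1 1 k (k + 1) n (by omega) (by omega) (by omega) (by norm_num)]

/-- Two steps down in the same product, as needed where m₁ and j change together. The case n = 0 is
separate because the second step would start at -1. -/
lemma ig_down_down (k k₁ n m : ℤ) (hk : 0 ≤ k) (hk₁ : k₁ = k - 2) (hn : n = k) (hm : m = k - 1) :
    √(nu q n * nu q m) * ig q 1 1 k₁ = nu q n * nu q m * ig q 1 1 k := by
  subst hn hm
  by_cases h : n = 0
  · subst h; simp [nu]
  rw [Real.sqrt_mul (nu_nonneg hq (by omega)), mul_assoc,
    ig_down hq 1 (n - 1) k₁ (n - 1) (by omega) (by omega) (by omega) (by norm_num),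
    mul_left_comm, ig_down hq 1 n (n - 1) n (by omega) (by omega) (by omega) (by norm_num)]
  ring

lemma gauge_one {x g r : ℝ} (h : √x * g = r) (K D R : ℝ) :
    K * (√x / D) * (g * R) = K / D * (r * R) := by
  rw [← h]; ring

section
variable {J M : ℤ} (hu : 0 ≤ J - M) (hu' : 0 ≤ J + M + 1)
include hu hu'

lemma gauge_A₁ : cA₁ q J M * gU q (J + 1) M = (q ^ (J + M + 1) / nu q (2 * J + 3)) * gU q J M := by
  have h1 := ig_up hq 1 1 (J + M + 1) (J + 1 + M + 1) (J + M + 2) hu' (by ring) (by ring) (by norm_num)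
  have h2 := ig_up hq 1 1 (J - M) (J + 1 - M) (J - M + 1) hu (by ring) (by ring) (by norm_num)
  have h3 := gauge_two (nu_nonneg hq (by omega)) h1 h2 (q ^ (J + M + 1)) (nu q (2 * J + 3)) 1
  rw [cA₁_eq hq, gU, gU]
  linear_combination h3

lemma gauge_A₁' : cA₁ q (J - 1) M * gU q (J - 1) M =
    (q ^ (J + M) * nu q (J - M) * nu q (J + M + 1) / nu q (2 * J + 1)) * gU q J M := by
  have h1 := ig_down hq 1 (J + M + 1) (J - 1 + M + 1) (J + M + 1) hu' (by ring) (by ring) (by norm_num)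
  have h2 := ig_down hq 1 (J - M) (J - 1 - M) (J - M) hu (by ring) (by ring) (by norm_num)
  have h3 := gauge_two (nu_nonneg hq (by omega)) h1 h2 (q ^ (J + M)) (nu q (2 * J + 1)) 1
  rw [cA₁_eq hq, gU, gU, show J - 1 + M + 1 = J + M by ring, show J - 1 + M + 2 = J + M + 1 by ring,
    show J - 1 - M + 1 = J - M by ring, show 2 * (J - 1) + 3 = 2 * J + 1 by ring]
  rw [show J - 1 + M + 1 = J + M by ring] at h3
  linear_combination h3

lemma gauge_B₁ : cB₁ q J M * gU q (J + 1) (M + 1) = (1 / nu q (2 * J + 3)) * gU q J M := by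
  have h1 := ig_up_up hq (J + M + 1) (J + M + 3) (J + M + 3) (J + M + 2) (J + M + 3) hu' (by ring)
    (by ring) (by ring)
  have h3 := gauge_one hq h1 1 (nu q (2 * J + 3)) (ig q 1 1 (J - M))
  rw [cB₁_eq hq, gU, gU, show J + 1 - (M + 1) = J - M by ring,
    show J + 1 + (M + 1) + 1 = J + M + 3 by ring]
  linear_combination h3

lemma gauge_B₁' : cB₁ q (J - 1) (M - 1) * gU q (J - 1) (M - 1) =
    (nu q (J + M + 1) * nu q (J + M) / nu q (2 * J + 1)) * gU q J M := by
  have h1 := ig_down_down hq (J + M + 1) (J + M - 1) (J + M + 1) (J + M) hu' (by ring)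
    (by ring) (by ring)
  have h3 := gauge_one hq h1 1 (nu q (2 * J + 1)) (ig q 1 1 (J - M))
  rw [cB₁_eq hq, gU, gU, show J - 1 - (M - 1) = J - M by ring,
    show J - 1 + (M - 1) + 1 = J + M - 1 by ring, show J - 1 + (M - 1) + 2 = J + M by ring,
    show J - 1 + (M - 1) + 3 = J + M + 1 by ring, show 2 * (J - 1) + 3 = 2 * J + 1 by ring,
    mul_comm (nu q (J + M))]
  linear_combination h3

lemma gauge_B₀ : cB₀ q J M * gU q J (M + 1) = (nu q 2 * q ^ (3 * J + M + 2) * nu q (J - M) /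
    (nu q (2 * J + 1) * nu q (2 * J + 3))) * gU q J M := by
  have h1 := ig_down hq 1 (J - M) (J - (M + 1)) (J - M) hu (by ring) (by ring) (by norm_num)
  have h2 := ig_up hq 1 1 (J + M + 1) (J + (M + 1) + 1) (J + M + 2) hu' (by ring) (by ring)
    (by norm_num)
  have h3 := gauge_two (nu_nonneg hq (by omega)) h1 h2 (nu q 2 * q ^ (3 * J + M + 2))
    (nu q (2 * J + 1) * nu q (2 * J + 3)) 1
  rw [cB₀_eq hq, gU, gU]
  linear_combination h3

lemma gauge_B₀' : cB₀ q J (M - 1) * gU q J (M - 1) = (nu q 2 * q ^ (3 * J + M + 1) *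
    nu q (J + M + 1) / (nu q (2 * J + 1) * nu q (2 * J + 3))) * gU q J M := by
  have h1 := ig_up hq 1 1 (J - M) (J - (M - 1)) (J - (M - 1)) hu (by ring) (by ring) (by norm_num)
  have h2 := ig_down hq 1 (J + M + 1) (J + (M - 1) + 1) (J + M + 1) hu' (by ring) (by ring)
    (by norm_num)
  have h3 := gauge_two (nu_nonneg hq (by omega)) h1 h2 (nu q 2 * q ^ (3 * J + M + 1))
    (nu q (2 * J + 1) * nu q (2 * J + 3)) 1
  rw [cB₀_eq hq, gU, gU, show 3 * J + (M - 1) + 2 = 3 * J + M + 1 by ring,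
    show J + (M - 1) + 2 = J + M + 1 by ring]
  linear_combination h3

lemma gauge_Bm : cBm q J M * gU q (J - 1) (M + 1) = (-q ^ (2 * (J + M + 1) + 1) * nu q (J - M) *
    nu q (J - M - 1) / nu q (2 * J + 1)) * gU q J M := by
  have h1 := ig_down_down hq (J - M) (J - M - 2) (J - M) (J - M - 1) hu (by ring)
    (by ring) (by ring)
  have h3 := gauge_one hq h1 (-q ^ (2 * (J + M + 1) + 1)) (nu q (2 * J + 1)) (ig q 1 1 (J + M + 1))
  rw [cBm_eq hq, gU, gU, show J - 1 - (M + 1) = J - M - 2 by ring,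
    show J - 1 + (M + 1) + 1 = J + M + 1 by ring]
  linear_combination h3

lemma gauge_Bm' : cBm q (J + 1) (M - 1) * gU q (J + 1) (M - 1) =
    (-q ^ (2 * (J + M + 1) + 1) / nu q (2 * J + 3)) * gU q J M := by
  have h1 := ig_up_up hq (J - M) (J - M + 2) (J - M + 2) (J - M + 1) (J - M + 2) hu (by ring)
    (by ring) (by ring)
  have h3 := gauge_one hq h1 (-q ^ (2 * (J + M + 1) + 1)) (nu q (2 * J + 3)) (ig q 1 1 (J + M + 1))
  rw [cBm_eq hq, gU, gU, show J + 1 - (M - 1) - 1 = J - M + 1 by ring,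
    show J + 1 - (M - 1) = J - M + 2 by ring, show J + 1 + (M - 1) + 1 = J + M + 1 by ring,
    show 2 * (J + 1) + 1 = 2 * J + 3 by ring, mul_comm (nu q (J - M + 2))]
  linear_combination h3

lemma gauge_A₀ : cA₀ q J M * gU q J M =
    (q ^ (2 * J) * (q ^ (2 * (J + M + 1)) * nu q 2 * nu q (J - M) - nu q 1 * nu q (2 * J + 1)) /
      (nu q (2 * J + 1) * nu q (2 * J + 3))) * gU q J M := by
  rw [cA₀_eq hq]; ring

end

section
variable {J p r : ℤ} (hJ : 0 ≤ J) (hp : 0 ≤ p) (hr : 0 ≤ r)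
include hJ hp hr

lemma gauge_H₀_true {L M : ℤ} (hL : L = J + p + r) (hM : M = r - p) :
    cH₀ q L J M * gW q J p r true =
      ((q ^ (4 * J + 2 * p + 2 * r + 6) * nu q (2 * p) * nu q (2 * r + 2)
          - q ^ (2 * p + 2 * r) * nu q (2 * J + 2 * p + 3) * nu q (2 * J + 2 * r + 3)) /
        (dn q J p r 1 * dn q J p r 2)) * gW q J p r true := by
  subst hL hM; rw [cH₀_true hq]

lemma gauge_H₀_false {L M : ℤ} (hL : L = J + p + r) (hM : M = r - p - 1) :
    cH₀ q L J M * gW q J p r false =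
      ((q ^ (2 * p + 2 * r + 2) * nu q (2 * J + 2 * p + 3) * nu q (2 * J + 2 * r + 3)
          - q ^ (4 * J + 2 * p + 2 * r + 4) * nu q (2 * p + 2) * nu q (2 * r)) /
        (dn q J p r 1 * dn q J p r 2)) * gW q J p r false := by
  subst hL hM; rw [cH₀_false hq]

end

omit hq in
-- The gauge identity for the fibre coefficient is needed only at target levels J' ≥ 0. For J' < 0
-- one of J' - M' and J' + M' + 1 is negative, so `gU` vanishes there; then `hα` forces α' g = 0 and
-- both sides are zero.
lemma gauge_mul {J' M' : ℤ} {α α' γ γ' g h' h : ℝ} (hα : α * gU q J' M' = α' * g)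
    (hγ : 0 ≤ J' → γ * h' = γ' * h) : (α * γ) * (gU q J' M' * h') = (α' * γ') * (g * h) := by
  by_cases hJ : 0 ≤ J'
  · linear_combination (γ * h') * hα + (α' * g) * hγ hJ
  · have h0 : gU q J' M' = 0 := by
      have : J' - M' < 0 ∨ J' + M' + 1 < 0 := by omega
      rcases this with h | h <;> simp [gU, ig_neg, h]
    rw [h0] at hα ⊢
    linear_combination (γ' * h) * hα

omit hq in
lemma gauge_mul_sign {J' M' : ℤ} {α α' γ γ' g h' h : ℝ} (κ : ℝ) (hα : α * gU q J' M' = α' * g)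
    (hγ : 0 ≤ J' → γ * h' = γ' * h) :
    (κ * α * γ) * (gU q J' M' * h') = (κ * α' * γ') * (g * h) := by
  linear_combination κ * gauge_mul hα hγ

end

/-! ### The generators of the sphere on finite linear combinations -/

section
variable (q : ℝ)

def x₀L : List WShift :=
  [((1, 0, 0, 1), fun L M₁ M₂ J _ => cA₁ q J M₁ * cC₁ q L J M₂),
   ((0, 0, 0, 1), fun L M₁ M₂ J s => -sg s * cA₁ q J M₁ * cC₀ q L J M₂),
   ((-1, 0, 0, 1), fun L M₁ M₂ J _ => cA₁ q J M₁ * cCm q L J M₂),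
   ((1, 0, 0, 0), fun L M₁ M₂ J _ => cA₀ q J M₁ * cH₁ q L J M₂),
   ((0, 0, 0, 0), fun L M₁ M₂ J s => sg s * cA₀ q J M₁ * cH₀ q L J M₂),
   ((-1, 0, 0, 0), fun L M₁ M₂ J _ => cA₀ q J M₁ * cH₁ q (L - 1) J M₂),
   ((1, 0, 0, -1), fun L M₁ M₂ J _ => cA₁ q (J - 1) M₁ * cCm q (L + 1) (J - 1) M₂),
   ((0, 0, 0, -1), fun L M₁ M₂ J s => -sg s * cA₁ q (J - 1) M₁ * cC₀ q L (J - 1) M₂),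
   ((-1, 0, 0, -1), fun L M₁ M₂ J _ => cA₁ q (J - 1) M₁ * cC₁ q (L - 1) (J - 1) M₂)]

def x₁L : List WShift :=
  [((1, 1, 0, 1), fun L M₁ M₂ J _ => cB₁ q J M₁ * cC₁ q L J M₂),
   ((0, 1, 0, 1), fun L M₁ M₂ J s => -sg s * cB₁ q J M₁ * cC₀ q L J M₂),
   ((-1, 1, 0, 1), fun L M₁ M₂ J _ => cB₁ q J M₁ * cCm q L J M₂),
   ((1, 1, 0, 0), fun L M₁ M₂ J _ => cB₀ q J M₁ * cH₁ q L J M₂),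
   ((0, 1, 0, 0), fun L M₁ M₂ J s => sg s * cB₀ q J M₁ * cH₀ q L J M₂),
   ((-1, 1, 0, 0), fun L M₁ M₂ J _ => cB₀ q J M₁ * cH₁ q (L - 1) J M₂),
   ((1, 1, 0, -1), fun L M₁ M₂ J _ => cBm q J M₁ * cCm q (L + 1) (J - 1) M₂),
   ((0, 1, 0, -1), fun L M₁ M₂ J s => -sg s * cBm q J M₁ * cC₀ q L (J - 1) M₂),
   ((-1, 1, 0, -1), fun L M₁ M₂ J _ => cBm q J M₁ * cC₁ q (L - 1) (J - 1) M₂)]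

def x₂L : List WShift :=
  [((1, 0, 1, 0), fun L _ M₂ J _ => cD₁ q L J M₂),
   ((0, 0, 1, 0), fun L _ M₂ J s => sg s * cD₀ q L J M₂),
   ((-1, 0, 1, 0), fun L _ M₂ J _ => cDm q L J M₂)]

end

section
variable {q : ℝ} (hq : q ∈ Set.Ioo (0:ℝ) 1)
include hq

/-- The nine shifts match, one by one, the nine terms of the lattice operator (three levels times
three fibre terms); `t1`, …, `t9` are the corresponding products of a gauge identity in (J, M) and
one in the fibre. -/
lemma Phi_x₀ (v : FinSpinors) : Phi q (opF (x₀L q) v) = lX0 q (Phi q v) := by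
  suffices h : (Phi q ∘ₗ opF (x₀L q) : FinSpinors →ₗ[ℂ] Lat) = lX0 q ∘ₗ Phi q from LinearMap.congr_fun h v
  refine fin_ext (E := Lat) ?_ ?_ <;> intro s J M p r hJ hp hr hu hu'
  · have hl := isLabel_true.2 ⟨hp, hr, hu, hu'⟩
    have t1 := gauge_mul (gauge_A₁ hq hu hu') (fun hJ' => gauge_C₁_true hq hJ hp hr (L := J + p + r) (M := r - p) (by ring) (by ring))
    have t2 := gauge_mul_sign (-sg s) (gauge_A₁ hq hu hu') (fun hJ' => gauge_C₀_true hq hJ hp hr (L := J + p + r) (M := r - p) (by ring) (by ring))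
    have t3 := gauge_mul (gauge_A₁ hq hu hu') (fun hJ' => gauge_Cm_true hq hJ hp hr (L := J + p + r) (M := r - p) (by ring) (by ring))
    have t4 := gauge_mul (gauge_A₀ hq hu hu') (fun hJ' => gauge_H₁_true hq hJ hp hr (L := J + p + r) (M := r - p) (by ring) (by ring))
    have t5 := gauge_mul_sign (sg s) (gauge_A₀ hq hu hu') (fun hJ' => gauge_H₀_true hq hJ hp hr (L := J + p + r) (M := r - p) (by ring) (by ring))
    have t6 := gauge_mul (gauge_A₀ hq hu hu') (fun hJ' => gauge_Hm_true hq hJ hp hr (L := J + p + r - 1) (M := r - p) (by ring) (by ring))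
    -- The terms that lower j are transposes of those that raise it from J - 1 to J, so the fibre
    -- lemma is used at level J - 1.
    have c7 := fun hJ' : 0 ≤ J - 1 => gauge_Ctm_true hq (J := J - 1) hJ' hp hr (L := J + p + r + 1) (M := r - p) (by ring) (by ring)
    rw [sub_add_cancel] at c7
    have t7 := gauge_mul (gauge_A₁' hq hu hu') (fun hJ' => c7 hJ')
    have c8 := fun hJ' : 0 ≤ J - 1 => gauge_Ct₀_true hq (J := J - 1) hJ' hp hr (L := J + p + r) (M := r - p) (by ring) (by ring)
    rw [sub_add_cancel] at c8
    have t8 := gauge_mul_sign (-sg s) (gauge_A₁' hq hu hu') (fun hJ' => c8 hJ')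
    have c9 := fun hJ' : 0 ≤ J - 1 => gauge_Ct₁_true hq (J := J - 1) hJ' hp hr (L := J + p + r - 1) (M := r - p) (by ring) (by ring)
    rw [sub_add_cancel] at c9
    have t9 := gauge_mul (gauge_A₁' hq hu hu') (fun hJ' => c9 hJ')
    simp only [LinearMap.comp_apply, opF, x₀L, List.map_cons, List.map_nil, List.sum_cons, List.sum_nil,
      LinearMap.add_apply, LinearMap.zero_apply, wsF_vec _ s hl, add_zero, sub_zero, neg_zero,
      sub_neg_eq_add, ← sub_eq_add_neg, add_sub_cancel_right, sub_add_cancel, neg_neg, Prod.fst_neg, Prod.snd_neg, map_add, LinearMap.map_smul_of_tower]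
    rw [Phi_true q s (J + 1) M p r (L := J + p + r + 1) (N := r - p) (by ring) (by ring),
      Phi_false q s (J + 1) M (p - 1) r (L := J + p + r) (N := r - p) (by ring) (by ring),
      Phi_true q s (J + 1) M (p - 1) (r - 1) (L := J + p + r - 1) (N := r - p) (by ring) (by ring),
      Phi_false q s J M p (r + 1) (L := J + p + r + 1) (N := r - p) (by ring) (by ring),
      Phi_true q s J M p r (L := J + p + r) (N := r - p) (by ring) (by ring),
      Phi_false q s J M (p - 1) r (L := J + p + r - 1) (N := r - p) (by ring) (by ring),
      Phi_true q s (J - 1) M (p + 1) (r + 1) (L := J + p + r + 1) (N := r - p) (by ring) (by ring),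
      Phi_false q s (J - 1) M p (r + 1) (L := J + p + r) (N := r - p) (by ring) (by ring),
      Phi_true q s (J - 1) M p r (L := J + p + r - 1) (N := r - p) (by ring) (by ring)]
    simp only [lv_smul_smul]
    rw [t1, t2, t3, t4, t5, t6, t7, t8, t9]
    simp only [lX0, fC, fH, fCt, latOp_lv, LinearMap.add_apply, LinearMap.smul_apply, LinearMap.comp_apply,
      LinearMap.map_smul_of_tower, fibOp_fb, map_add, sub_add_cancel]
    module
  · have hl := isLabel_false.2 ⟨hp, hr, hu, hu'⟩
    have t1 := gauge_mul (gauge_A₁ hq hu hu') (fun hJ' => gauge_C₁_false hq hJ hp hr (L := J + p + r) (M := r - p - 1) (by ring) (by ring))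
    have t2 := gauge_mul_sign (-sg s) (gauge_A₁ hq hu hu') (fun hJ' => gauge_C₀_false hq hJ hp hr (L := J + p + r) (M := r - p - 1) (by ring) (by ring))
    have t3 := gauge_mul (gauge_A₁ hq hu hu') (fun hJ' => gauge_Cm_false hq hJ hp hr (L := J + p + r) (M := r - p - 1) (by ring) (by ring))
    have t4 := gauge_mul (gauge_A₀ hq hu hu') (fun hJ' => gauge_H₁_false hq hJ hp hr (L := J + p + r) (M := r - p - 1) (by ring) (by ring))
    have t5 := gauge_mul_sign (sg s) (gauge_A₀ hq hu hu') (fun hJ' => gauge_H₀_false hq hJ hp hr (L := J + p + r) (M := r - p - 1) (by ring) (by ring))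
    have t6 := gauge_mul (gauge_A₀ hq hu hu') (fun hJ' => gauge_Hm_false hq hJ hp hr (L := J + p + r - 1) (M := r - p - 1) (by ring) (by ring))
    have c7 := fun hJ' : 0 ≤ J - 1 => gauge_Ctm_false hq (J := J - 1) hJ' hp hr (L := J + p + r + 1) (M := r - p - 1) (by ring) (by ring)
    rw [sub_add_cancel] at c7
    have t7 := gauge_mul (gauge_A₁' hq hu hu') (fun hJ' => c7 hJ')
    have c8 := fun hJ' : 0 ≤ J - 1 => gauge_Ct₀_false hq (J := J - 1) hJ' hp hr (L := J + p + r) (M := r - p - 1) (by ring) (by ring)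
    rw [sub_add_cancel] at c8
    have t8 := gauge_mul_sign (-sg s) (gauge_A₁' hq hu hu') (fun hJ' => c8 hJ')
    have c9 := fun hJ' : 0 ≤ J - 1 => gauge_Ct₁_false hq (J := J - 1) hJ' hp hr (L := J + p + r - 1) (M := r - p - 1) (by ring) (by ring)
    rw [sub_add_cancel] at c9
    have t9 := gauge_mul (gauge_A₁' hq hu hu') (fun hJ' => c9 hJ')
    simp only [LinearMap.comp_apply, opF, x₀L, List.map_cons, List.map_nil, List.sum_cons, List.sum_nil,
      LinearMap.add_apply, LinearMap.zero_apply, wsF_vec _ s hl, add_zero, sub_zero, neg_zero,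
      sub_neg_eq_add, ← sub_eq_add_neg, add_sub_cancel_right, sub_add_cancel, neg_neg, Prod.fst_neg, Prod.snd_neg, map_add, LinearMap.map_smul_of_tower]
    rw [Phi_false q s (J + 1) M p r (L := J + p + r + 1) (N := r - p - 1) (by ring) (by ring),
      Phi_true q s (J + 1) M p (r - 1) (L := J + p + r) (N := r - p - 1) (by ring) (by ring),
      Phi_false q s (J + 1) M (p - 1) (r - 1) (L := J + p + r - 1) (N := r - p - 1) (by ring) (by ring),
      Phi_true q s J M (p + 1) r (L := J + p + r + 1) (N := r - p - 1) (by ring) (by ring),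
      Phi_false q s J M p r (L := J + p + r) (N := r - p - 1) (by ring) (by ring),
      Phi_true q s J M p (r - 1) (L := J + p + r - 1) (N := r - p - 1) (by ring) (by ring),
      Phi_false q s (J - 1) M (p + 1) (r + 1) (L := J + p + r + 1) (N := r - p - 1) (by ring) (by ring),
      Phi_true q s (J - 1) M (p + 1) r (L := J + p + r) (N := r - p - 1) (by ring) (by ring),
      Phi_false q s (J - 1) M p r (L := J + p + r - 1) (N := r - p - 1) (by ring) (by ring)]
    simp only [lv_smul_smul]
    rw [t1, t2, t3, t4, t5, t6, t7, t8, t9]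
    simp only [lX0, fC, fH, fCt, latOp_lv, LinearMap.add_apply, LinearMap.smul_apply, LinearMap.comp_apply,
      LinearMap.map_smul_of_tower, fibOp_fb, map_add, sub_add_cancel]
    module

lemma Phi_x₁ (v : FinSpinors) : Phi q (opF (x₁L q) v) = lX1 q (Phi q v) := by
  suffices h : (Phi q ∘ₗ opF (x₁L q) : FinSpinors →ₗ[ℂ] Lat) = lX1 q ∘ₗ Phi q from LinearMap.congr_fun h v
  refine fin_ext (E := Lat) ?_ ?_ <;> intro s J M p r hJ hp hr hu hu'
  · have hl := isLabel_true.2 ⟨hp, hr, hu, hu'⟩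
    have t1 := gauge_mul (gauge_B₁ hq hu hu') (fun hJ' => gauge_C₁_true hq hJ hp hr (L := J + p + r) (M := r - p) (by ring) (by ring))
    have t2 := gauge_mul_sign (-sg s) (gauge_B₁ hq hu hu') (fun hJ' => gauge_C₀_true hq hJ hp hr (L := J + p + r) (M := r - p) (by ring) (by ring))
    have t3 := gauge_mul (gauge_B₁ hq hu hu') (fun hJ' => gauge_Cm_true hq hJ hp hr (L := J + p + r) (M := r - p) (by ring) (by ring))
    have t4 := gauge_mul (gauge_B₀ hq hu hu') (fun hJ' => gauge_H₁_true hq hJ hp hr (L := J + p + r) (M := r - p) (by ring) (by ring))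
    have t5 := gauge_mul_sign (sg s) (gauge_B₀ hq hu hu') (fun hJ' => gauge_H₀_true hq hJ hp hr (L := J + p + r) (M := r - p) (by ring) (by ring))
    have t6 := gauge_mul (gauge_B₀ hq hu hu') (fun hJ' => gauge_Hm_true hq hJ hp hr (L := J + p + r - 1) (M := r - p) (by ring) (by ring))
    have c7 := fun hJ' : 0 ≤ J - 1 => gauge_Ctm_true hq (J := J - 1) hJ' hp hr (L := J + p + r + 1) (M := r - p) (by ring) (by ring)
    rw [sub_add_cancel] at c7
    have t7 := gauge_mul (gauge_Bm hq hu hu') (fun hJ' => c7 hJ')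
    have c8 := fun hJ' : 0 ≤ J - 1 => gauge_Ct₀_true hq (J := J - 1) hJ' hp hr (L := J + p + r) (M := r - p) (by ring) (by ring)
    rw [sub_add_cancel] at c8
    have t8 := gauge_mul_sign (-sg s) (gauge_Bm hq hu hu') (fun hJ' => c8 hJ')
    have c9 := fun hJ' : 0 ≤ J - 1 => gauge_Ct₁_true hq (J := J - 1) hJ' hp hr (L := J + p + r - 1) (M := r - p) (by ring) (by ring)
    rw [sub_add_cancel] at c9
    have t9 := gauge_mul (gauge_Bm hq hu hu') (fun hJ' => c9 hJ')
    simp only [LinearMap.comp_apply, opF, x₁L, List.map_cons, List.map_nil, List.sum_cons, List.sum_nil,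
      LinearMap.add_apply, LinearMap.zero_apply, wsF_vec _ s hl, add_zero, sub_zero, neg_zero,
      sub_neg_eq_add, ← sub_eq_add_neg, add_sub_cancel_right, sub_add_cancel, neg_neg, Prod.fst_neg, Prod.snd_neg, map_add, LinearMap.map_smul_of_tower]
    rw [Phi_true q s (J + 1) (M + 1) p r (L := J + p + r + 1) (N := r - p) (by ring) (by ring),
      Phi_false q s (J + 1) (M + 1) (p - 1) r (L := J + p + r) (N := r - p) (by ring) (by ring),
      Phi_true q s (J + 1) (M + 1) (p - 1) (r - 1) (L := J + p + r - 1) (N := r - p) (by ring) (by ring),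
      Phi_false q s J (M + 1) p (r + 1) (L := J + p + r + 1) (N := r - p) (by ring) (by ring),
      Phi_true q s J (M + 1) p r (L := J + p + r) (N := r - p) (by ring) (by ring),
      Phi_false q s J (M + 1) (p - 1) r (L := J + p + r - 1) (N := r - p) (by ring) (by ring),
      Phi_true q s (J - 1) (M + 1) (p + 1) (r + 1) (L := J + p + r + 1) (N := r - p) (by ring) (by ring),
      Phi_false q s (J - 1) (M + 1) p (r + 1) (L := J + p + r) (N := r - p) (by ring) (by ring),
      Phi_true q s (J - 1) (M + 1) p r (L := J + p + r - 1) (N := r - p) (by ring) (by ring),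
      Phi_true q s J M p r (L := J + p + r) (N := r - p) (by ring) (by ring)]
    simp only [lv_smul_smul]
    rw [t1, t2, t3, t4, t5, t6, t7, t8, t9]
    simp only [lX1, fC, fH, fCt, latOp_lv, LinearMap.add_apply, LinearMap.smul_apply, LinearMap.comp_apply,
      LinearMap.map_smul_of_tower, fibOp_fb, map_add, sub_add_cancel]
    module
  · have hl := isLabel_false.2 ⟨hp, hr, hu, hu'⟩
    have t1 := gauge_mul (gauge_B₁ hq hu hu') (fun hJ' => gauge_C₁_false hq hJ hp hr (L := J + p + r) (M := r - p - 1) (by ring) (by ring))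
    have t2 := gauge_mul_sign (-sg s) (gauge_B₁ hq hu hu') (fun hJ' => gauge_C₀_false hq hJ hp hr (L := J + p + r) (M := r - p - 1) (by ring) (by ring))
    have t3 := gauge_mul (gauge_B₁ hq hu hu') (fun hJ' => gauge_Cm_false hq hJ hp hr (L := J + p + r) (M := r - p - 1) (by ring) (by ring))
    have t4 := gauge_mul (gauge_B₀ hq hu hu') (fun hJ' => gauge_H₁_false hq hJ hp hr (L := J + p + r) (M := r - p - 1) (by ring) (by ring))
    have t5 := gauge_mul_sign (sg s) (gauge_B₀ hq hu hu') (fun hJ' => gauge_H₀_false hq hJ hp hr (L := J + p + r) (M := r - p - 1) (by ring) (by ring))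
    have t6 := gauge_mul (gauge_B₀ hq hu hu') (fun hJ' => gauge_Hm_false hq hJ hp hr (L := J + p + r - 1) (M := r - p - 1) (by ring) (by ring))
    have c7 := fun hJ' : 0 ≤ J - 1 => gauge_Ctm_false hq (J := J - 1) hJ' hp hr (L := J + p + r + 1) (M := r - p - 1) (by ring) (by ring)
    rw [sub_add_cancel] at c7
    have t7 := gauge_mul (gauge_Bm hq hu hu') (fun hJ' => c7 hJ')
    have c8 := fun hJ' : 0 ≤ J - 1 => gauge_Ct₀_false hq (J := J - 1) hJ' hp hr (L := J + p + r) (M := r - p - 1) (by ring) (by ring)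
    rw [sub_add_cancel] at c8
    have t8 := gauge_mul_sign (-sg s) (gauge_Bm hq hu hu') (fun hJ' => c8 hJ')
    have c9 := fun hJ' : 0 ≤ J - 1 => gauge_Ct₁_false hq (J := J - 1) hJ' hp hr (L := J + p + r - 1) (M := r - p - 1) (by ring) (by ring)
    rw [sub_add_cancel] at c9
    have t9 := gauge_mul (gauge_Bm hq hu hu') (fun hJ' => c9 hJ')
    simp only [LinearMap.comp_apply, opF, x₁L, List.map_cons, List.map_nil, List.sum_cons, List.sum_nil,
      LinearMap.add_apply, LinearMap.zero_apply, wsF_vec _ s hl, add_zero, sub_zero, neg_zero,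
      sub_neg_eq_add, ← sub_eq_add_neg, add_sub_cancel_right, sub_add_cancel, neg_neg, Prod.fst_neg, Prod.snd_neg, map_add, LinearMap.map_smul_of_tower]
    rw [Phi_false q s (J + 1) (M + 1) p r (L := J + p + r + 1) (N := r - p - 1) (by ring) (by ring),
      Phi_true q s (J + 1) (M + 1) p (r - 1) (L := J + p + r) (N := r - p - 1) (by ring) (by ring),
      Phi_false q s (J + 1) (M + 1) (p - 1) (r - 1) (L := J + p + r - 1) (N := r - p - 1) (by ring) (by ring),
      Phi_true q s J (M + 1) (p + 1) r (L := J + p + r + 1) (N := r - p - 1) (by ring) (by ring),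
      Phi_false q s J (M + 1) p r (L := J + p + r) (N := r - p - 1) (by ring) (by ring),
      Phi_true q s J (M + 1) p (r - 1) (L := J + p + r - 1) (N := r - p - 1) (by ring) (by ring),
      Phi_false q s (J - 1) (M + 1) (p + 1) (r + 1) (L := J + p + r + 1) (N := r - p - 1) (by ring) (by ring),
      Phi_true q s (J - 1) (M + 1) (p + 1) r (L := J + p + r) (N := r - p - 1) (by ring) (by ring),
      Phi_false q s (J - 1) (M + 1) p r (L := J + p + r - 1) (N := r - p - 1) (by ring) (by ring),
      Phi_false q s J M p r (L := J + p + r) (N := r - p - 1) (by ring) (by ring)]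
    simp only [lv_smul_smul]
    rw [t1, t2, t3, t4, t5, t6, t7, t8, t9]
    simp only [lX1, fC, fH, fCt, latOp_lv, LinearMap.add_apply, LinearMap.smul_apply, LinearMap.comp_apply,
      LinearMap.map_smul_of_tower, fibOp_fb, map_add, sub_add_cancel]
    module

lemma Phi_x₁t (v : FinSpinors) : Phi q (opF ((x₁L q).map WShift.adj) v) = lX1t q (Phi q v) := by
  suffices h : (Phi q ∘ₗ opF ((x₁L q).map WShift.adj) : FinSpinors →ₗ[ℂ] Lat) = lX1t q ∘ₗ Phi q from LinearMap.congr_fun h v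
  refine fin_ext (E := Lat) ?_ ?_ <;> intro s J M p r hJ hp hr hu hu'
  · have hl := isLabel_true.2 ⟨hp, hr, hu, hu'⟩
    have c1 := fun hJ' : 0 ≤ J - 1 => gauge_Ct₁_true hq (J := J - 1) hJ' hp hr (L := J + p + r - 1) (M := r - p) (by ring) (by ring)
    rw [sub_add_cancel] at c1
    have t1 := gauge_mul (gauge_B₁' hq hu hu') (fun hJ' => c1 hJ')
    have c2 := fun hJ' : 0 ≤ J - 1 => gauge_Ct₀_true hq (J := J - 1) hJ' hp hr (L := J + p + r) (M := r - p) (by ring) (by ring)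
    rw [sub_add_cancel] at c2
    have t2 := gauge_mul_sign (-sg s) (gauge_B₁' hq hu hu') (fun hJ' => c2 hJ')
    have c3 := fun hJ' : 0 ≤ J - 1 => gauge_Ctm_true hq (J := J - 1) hJ' hp hr (L := J + p + r + 1) (M := r - p) (by ring) (by ring)
    rw [sub_add_cancel] at c3
    have t3 := gauge_mul (gauge_B₁' hq hu hu') (fun hJ' => c3 hJ')
    have t4 := gauge_mul (gauge_B₀' hq hu hu') (fun hJ' => gauge_Hm_true hq hJ hp hr (L := J + p + r - 1) (M := r - p) (by ring) (by ring))
    have t5 := gauge_mul_sign (sg s) (gauge_B₀' hq hu hu') (fun hJ' => gauge_H₀_true hq hJ hp hr (L := J + p + r) (M := r - p) (by ring) (by ring))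
    have t6 := gauge_mul (gauge_B₀' hq hu hu') (fun hJ' => gauge_H₁_true hq hJ hp hr (L := J + p + r) (M := r - p) (by ring) (by ring))
    have t7 := gauge_mul (gauge_Bm' hq hu hu') (fun hJ' => gauge_Cm_true hq hJ hp hr (L := J + p + r) (M := r - p) (by ring) (by ring))
    have t8 := gauge_mul_sign (-sg s) (gauge_Bm' hq hu hu') (fun hJ' => gauge_C₀_true hq hJ hp hr (L := J + p + r) (M := r - p) (by ring) (by ring))
    have t9 := gauge_mul (gauge_Bm' hq hu hu') (fun hJ' => gauge_C₁_true hq hJ hp hr (L := J + p + r) (M := r - p) (by ring) (by ring))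
    simp only [LinearMap.comp_apply, opF, x₁L, WShift.adj, List.map_cons, List.map_nil, List.sum_cons, List.sum_nil,
      LinearMap.add_apply, LinearMap.zero_apply, wsF_vec _ s hl, add_zero, sub_zero, neg_zero,
      sub_neg_eq_add, ← sub_eq_add_neg, add_sub_cancel_right, sub_add_cancel, neg_neg, Prod.fst_neg, Prod.snd_neg, map_add, LinearMap.map_smul_of_tower]
    rw [Phi_true q s (J - 1) (M - 1) p r (L := J + p + r - 1) (N := r - p) (by ring) (by ring),
      Phi_false q s (J - 1) (M - 1) p (r + 1) (L := J + p + r) (N := r - p) (by ring) (by ring),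
      Phi_true q s (J - 1) (M - 1) (p + 1) (r + 1) (L := J + p + r + 1) (N := r - p) (by ring) (by ring),
      Phi_false q s J (M - 1) (p - 1) r (L := J + p + r - 1) (N := r - p) (by ring) (by ring),
      Phi_true q s J (M - 1) p r (L := J + p + r) (N := r - p) (by ring) (by ring),
      Phi_false q s J (M - 1) p (r + 1) (L := J + p + r + 1) (N := r - p) (by ring) (by ring),
      Phi_true q s (J + 1) (M - 1) (p - 1) (r - 1) (L := J + p + r - 1) (N := r - p) (by ring) (by ring),
      Phi_false q s (J + 1) (M - 1) (p - 1) r (L := J + p + r) (N := r - p) (by ring) (by ring),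
      Phi_true q s (J + 1) (M - 1) p r (L := J + p + r + 1) (N := r - p) (by ring) (by ring),
      Phi_true q s J M p r (L := J + p + r) (N := r - p) (by ring) (by ring)]
    simp only [lv_smul_smul]
    rw [t1, t2, t3, t4, t5, t6, t7, t8, t9]
    simp only [lX1t, fC, fH, fCt, latOp_lv, LinearMap.add_apply, LinearMap.smul_apply, LinearMap.comp_apply,
      LinearMap.map_smul_of_tower, fibOp_fb, map_add, sub_add_cancel]
    module
  · have hl := isLabel_false.2 ⟨hp, hr, hu, hu'⟩
    have c1 := fun hJ' : 0 ≤ J - 1 => gauge_Ct₁_false hq (J := J - 1) hJ' hp hr (L := J + p + r - 1) (M := r - p - 1) (by ring) (by ring)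
    rw [sub_add_cancel] at c1
    have t1 := gauge_mul (gauge_B₁' hq hu hu') (fun hJ' => c1 hJ')
    have c2 := fun hJ' : 0 ≤ J - 1 => gauge_Ct₀_false hq (J := J - 1) hJ' hp hr (L := J + p + r) (M := r - p - 1) (by ring) (by ring)
    rw [sub_add_cancel] at c2
    have t2 := gauge_mul_sign (-sg s) (gauge_B₁' hq hu hu') (fun hJ' => c2 hJ')
    have c3 := fun hJ' : 0 ≤ J - 1 => gauge_Ctm_false hq (J := J - 1) hJ' hp hr (L := J + p + r + 1) (M := r - p - 1) (by ring) (by ring)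
    rw [sub_add_cancel] at c3
    have t3 := gauge_mul (gauge_B₁' hq hu hu') (fun hJ' => c3 hJ')
    have t4 := gauge_mul (gauge_B₀' hq hu hu') (fun hJ' => gauge_Hm_false hq hJ hp hr (L := J + p + r - 1) (M := r - p - 1) (by ring) (by ring))
    have t5 := gauge_mul_sign (sg s) (gauge_B₀' hq hu hu') (fun hJ' => gauge_H₀_false hq hJ hp hr (L := J + p + r) (M := r - p - 1) (by ring) (by ring))
    have t6 := gauge_mul (gauge_B₀' hq hu hu') (fun hJ' => gauge_H₁_false hq hJ hp hr (L := J + p + r) (M := r - p - 1) (by ring) (by ring))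
    have t7 := gauge_mul (gauge_Bm' hq hu hu') (fun hJ' => gauge_Cm_false hq hJ hp hr (L := J + p + r) (M := r - p - 1) (by ring) (by ring))
    have t8 := gauge_mul_sign (-sg s) (gauge_Bm' hq hu hu') (fun hJ' => gauge_C₀_false hq hJ hp hr (L := J + p + r) (M := r - p - 1) (by ring) (by ring))
    have t9 := gauge_mul (gauge_Bm' hq hu hu') (fun hJ' => gauge_C₁_false hq hJ hp hr (L := J + p + r) (M := r - p - 1) (by ring) (by ring))
    simp only [LinearMap.comp_apply, opF, x₁L, WShift.adj, List.map_cons, List.map_nil, List.sum_cons, List.sum_nil,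
      LinearMap.add_apply, LinearMap.zero_apply, wsF_vec _ s hl, add_zero, sub_zero, neg_zero,
      sub_neg_eq_add, ← sub_eq_add_neg, add_sub_cancel_right, sub_add_cancel, neg_neg, Prod.fst_neg, Prod.snd_neg, map_add, LinearMap.map_smul_of_tower]
    rw [Phi_false q s (J - 1) (M - 1) p r (L := J + p + r - 1) (N := r - p - 1) (by ring) (by ring),
      Phi_true q s (J - 1) (M - 1) (p + 1) r (L := J + p + r) (N := r - p - 1) (by ring) (by ring),
      Phi_false q s (J - 1) (M - 1) (p + 1) (r + 1) (L := J + p + r + 1) (N := r - p - 1) (by ring) (by ring),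
      Phi_true q s J (M - 1) p (r - 1) (L := J + p + r - 1) (N := r - p - 1) (by ring) (by ring),
      Phi_false q s J (M - 1) p r (L := J + p + r) (N := r - p - 1) (by ring) (by ring),
      Phi_true q s J (M - 1) (p + 1) r (L := J + p + r + 1) (N := r - p - 1) (by ring) (by ring),
      Phi_false q s (J + 1) (M - 1) (p - 1) (r - 1) (L := J + p + r - 1) (N := r - p - 1) (by ring) (by ring),
      Phi_true q s (J + 1) (M - 1) p (r - 1) (L := J + p + r) (N := r - p - 1) (by ring) (by ring),
      Phi_false q s (J + 1) (M - 1) p r (L := J + p + r + 1) (N := r - p - 1) (by ring) (by ring),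
      Phi_false q s J M p r (L := J + p + r) (N := r - p - 1) (by ring) (by ring)]
    simp only [lv_smul_smul]
    rw [t1, t2, t3, t4, t5, t6, t7, t8, t9]
    simp only [lX1t, fC, fH, fCt, latOp_lv, LinearMap.add_apply, LinearMap.smul_apply, LinearMap.comp_apply,
      LinearMap.map_smul_of_tower, fibOp_fb, map_add, sub_add_cancel]
    module

lemma Phi_x₂ (v : FinSpinors) : Phi q (opF (x₂L q) v) = lX2 q (Phi q v) := by
  suffices h : (Phi q ∘ₗ opF (x₂L q) : FinSpinors →ₗ[ℂ] Lat) = lX2 q ∘ₗ Phi q from LinearMap.congr_fun h v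
  refine fin_ext (E := Lat) ?_ ?_ <;> intro s J M p r hJ hp hr hu hu'
  · have hl := isLabel_true.2 ⟨hp, hr, hu, hu'⟩
    have t1 := gauge_mul (q := q) (J' := J) (M' := M) (α := 1) (α' := 1) (g := gU q J M) rfl
      (fun _ => gauge_D₁_true hq hJ hp hr (L := J + p + r) (M := r - p) (by ring) (by ring))
    have t2 := gauge_mul (q := q) (J' := J) (M' := M) (α := sg s) (α' := sg s) (g := gU q J M) rfl
      (fun _ => gauge_D₀_true hq hJ hp hr (L := J + p + r) (M := r - p) (by ring) (by ring))
    have t3 := gauge_mul (q := q) (J' := J) (M' := M) (α := 1) (α' := 1) (g := gU q J M) rfl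
      (fun _ => gauge_Dm_true hq hJ hp hr (L := J + p + r) (M := r - p) (by ring) (by ring))
    simp only [one_mul] at t1 t3
    simp only [LinearMap.comp_apply, opF, x₂L, List.map_cons, List.map_nil, List.sum_cons, List.sum_nil,
      LinearMap.add_apply, LinearMap.zero_apply, wsF_vec _ s hl, add_zero, sub_zero, neg_zero,
      sub_neg_eq_add, ← sub_eq_add_neg, add_sub_cancel_right, sub_add_cancel, neg_neg, Prod.fst_neg, Prod.snd_neg, map_add, LinearMap.map_smul_of_tower]
    rw [Phi_true q s J M p (r + 1) (L := J + p + r + 1) (N := r - p + 1) (by ring) (by ring),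
      Phi_false q s J M (p - 1) (r + 1) (L := J + p + r) (N := r - p + 1) (by ring) (by ring),
      Phi_true q s J M (p - 1) r (L := J + p + r - 1) (N := r - p + 1) (by ring) (by ring),
      Phi_true q s J M p r (L := J + p + r) (N := r - p) (by ring) (by ring)]
    simp only [lv_smul_smul]
    rw [t1, t2, t3]
    simp only [lX2, fD, latOp_lv, LinearMap.add_apply, LinearMap.smul_apply, LinearMap.comp_apply,
      LinearMap.map_smul_of_tower, fibOp_fb, map_add, sub_add_cancel]
    module
  · have hl := isLabel_false.2 ⟨hp, hr, hu, hu'⟩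
    have t1 := gauge_mul (q := q) (J' := J) (M' := M) (α := 1) (α' := 1) (g := gU q J M) rfl
      (fun _ => gauge_D₁_false hq hJ hp hr (L := J + p + r) (M := r - p - 1) (by ring) (by ring))
    have t2 := gauge_mul (q := q) (J' := J) (M' := M) (α := sg s) (α' := sg s) (g := gU q J M) rfl
      (fun _ => gauge_D₀_false hq hJ hp hr (L := J + p + r) (M := r - p - 1) (by ring) (by ring))
    have t3 := gauge_mul (q := q) (J' := J) (M' := M) (α := 1) (α' := 1) (g := gU q J M) rfl
      (fun _ => gauge_Dm_false hq hJ hp hr (L := J + p + r) (M := r - p - 1) (by ring) (by ring))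
    simp only [one_mul] at t1 t3
    simp only [LinearMap.comp_apply, opF, x₂L, List.map_cons, List.map_nil, List.sum_cons, List.sum_nil,
      LinearMap.add_apply, LinearMap.zero_apply, wsF_vec _ s hl, add_zero, sub_zero, neg_zero,
      sub_neg_eq_add, ← sub_eq_add_neg, add_sub_cancel_right, sub_add_cancel, neg_neg, Prod.fst_neg, Prod.snd_neg, map_add, LinearMap.map_smul_of_tower]
    rw [Phi_false q s J M p (r + 1) (L := J + p + r + 1) (N := r - p) (by ring) (by ring),
      Phi_true q s J M p r (L := J + p + r) (N := r - p) (by ring) (by ring),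
      Phi_false q s J M (p - 1) r (L := J + p + r - 1) (N := r - p) (by ring) (by ring),
      Phi_false q s J M p r (L := J + p + r) (N := r - p - 1) (by ring) (by ring)]
    simp only [lv_smul_smul]
    rw [t1, t2, t3]
    simp only [lX2, fD, latOp_lv, LinearMap.add_apply, LinearMap.smul_apply, LinearMap.comp_apply,
      LinearMap.map_smul_of_tower, fibOp_fb, map_add, sub_add_cancel]
    module

lemma Phi_x₂t (v : FinSpinors) : Phi q (opF ((x₂L q).map WShift.adj) v) = lX2t q (Phi q v) := by
  suffices h : (Phi q ∘ₗ opF ((x₂L q).map WShift.adj) : FinSpinors →ₗ[ℂ] Lat) = lX2t q ∘ₗ Phi q from LinearMap.congr_fun h v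
  refine fin_ext (E := Lat) ?_ ?_ <;> intro s J M p r hJ hp hr hu hu'
  · have hl := isLabel_true.2 ⟨hp, hr, hu, hu'⟩
    have t1 := gauge_mul (q := q) (J' := J) (M' := M) (α := 1) (α' := 1) (g := gU q J M) rfl
      (fun _ => gauge_Dt₁_true hq hJ hp hr (L := J + p + r - 1) (M := r - p - 1) (by ring) (by ring))
    have t2 := gauge_mul (q := q) (J' := J) (M' := M) (α := sg s) (α' := sg s) (g := gU q J M) rfl
      (fun _ => gauge_Dt₀_true hq hJ hp hr (L := J + p + r) (M := r - p - 1) (by ring) (by ring))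
    have t3 := gauge_mul (q := q) (J' := J) (M' := M) (α := 1) (α' := 1) (g := gU q J M) rfl
      (fun _ => gauge_Dtm_true hq hJ hp hr (L := J + p + r + 1) (M := r - p - 1) (by ring) (by ring))
    simp only [one_mul] at t1 t3
    simp only [LinearMap.comp_apply, opF, x₂L, WShift.adj, List.map_cons, List.map_nil, List.sum_cons, List.sum_nil,
      LinearMap.add_apply, LinearMap.zero_apply, wsF_vec _ s hl, add_zero, sub_zero, neg_zero,
      sub_neg_eq_add, ← sub_eq_add_neg, add_sub_cancel_right, sub_add_cancel, neg_neg, Prod.fst_neg, Prod.snd_neg, map_add, LinearMap.map_smul_of_tower]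
    rw [Phi_true q s J M p (r - 1) (L := J + p + r - 1) (N := r - p - 1) (by ring) (by ring),
      Phi_false q s J M p r (L := J + p + r) (N := r - p - 1) (by ring) (by ring),
      Phi_true q s J M (p + 1) r (L := J + p + r + 1) (N := r - p - 1) (by ring) (by ring),
      Phi_true q s J M p r (L := J + p + r) (N := r - p) (by ring) (by ring)]
    simp only [lv_smul_smul]
    rw [t1, t2, t3]
    simp only [lX2t, fDt, latOp_lv, LinearMap.add_apply, LinearMap.smul_apply, LinearMap.comp_apply,
      LinearMap.map_smul_of_tower, fibOp_fb, map_add, sub_add_cancel]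
    module
  · have hl := isLabel_false.2 ⟨hp, hr, hu, hu'⟩
    have t1 := gauge_mul (q := q) (J' := J) (M' := M) (α := 1) (α' := 1) (g := gU q J M) rfl
      (fun _ => gauge_Dt₁_false hq hJ hp hr (L := J + p + r - 1) (M := r - p - 1 - 1) (by ring) (by ring))
    have t2 := gauge_mul (q := q) (J' := J) (M' := M) (α := sg s) (α' := sg s) (g := gU q J M) rfl
      (fun _ => gauge_Dt₀_false hq hJ hp hr (L := J + p + r) (M := r - p - 1 - 1) (by ring) (by ring))
    have t3 := gauge_mul (q := q) (J' := J) (M' := M) (α := 1) (α' := 1) (g := gU q J M) rfl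
      (fun _ => gauge_Dtm_false hq hJ hp hr (L := J + p + r + 1) (M := r - p - 1 - 1) (by ring) (by ring))
    simp only [one_mul] at t1 t3
    simp only [LinearMap.comp_apply, opF, x₂L, WShift.adj, List.map_cons, List.map_nil, List.sum_cons, List.sum_nil,
      LinearMap.add_apply, LinearMap.zero_apply, wsF_vec _ s hl, add_zero, sub_zero, neg_zero,
      sub_neg_eq_add, ← sub_eq_add_neg, add_sub_cancel_right, sub_add_cancel, neg_neg, Prod.fst_neg, Prod.snd_neg, map_add, LinearMap.map_smul_of_tower]
    rw [Phi_false q s J M p (r - 1) (L := J + p + r - 1) (N := r - p - 1 - 1) (by ring) (by ring),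
      Phi_true q s J M (p + 1) (r - 1) (L := J + p + r) (N := r - p - 1 - 1) (by ring) (by ring),
      Phi_false q s J M (p + 1) r (L := J + p + r + 1) (N := r - p - 1 - 1) (by ring) (by ring),
      Phi_false q s J M p r (L := J + p + r) (N := r - p - 1) (by ring) (by ring)]
    simp only [lv_smul_smul]
    rw [t1, t2, t3]
    simp only [lX2t, fDt, latOp_lv, LinearMap.add_apply, LinearMap.smul_apply, LinearMap.comp_apply,
      LinearMap.map_smul_of_tower, fibOp_fb, map_add, sub_add_cancel]
    module

end

end

section

/-! ### Transposes of weighted shifts -/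

lemma incl_single (k : Idx) : incl (Finsupp.single k 1) = ket k := by
  simp [incl]

lemma inner_ket (k : Idx) (f : Spinors) : ⟪ket k, f⟫_ℂ = f k := by
  rw [ket, lp.inner_single_left]
  simp

lemma ket_apply (k i : Idx) : (ket k : Spinors) i = if i = k then 1 else 0 := by
  rw [ket, lp.single_apply]
  by_cases h : i = k
  · subst h; simp
  · simp [h]

lemma incl_apply (v : FinSpinors) (k : Idx) : (incl v : Spinors) k = v k := by
  induction v using Finsupp.induction_linear with
  | zero => simp
  | add f g hf hg => rw [map_add, Finsupp.add_apply, ← hf, ← hg]; rfl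
  | single i c =>
    rw [show Finsupp.single i c = c • Finsupp.single i (1 : ℂ) by simp, map_smul, incl_single,
      Finsupp.smul_apply]
    change c * (ket i : Spinors) k = _
    rw [ket_apply, Finsupp.single_apply]
    simp [eq_comm]

lemma inner_single_incl (k : Idx) (w : FinSpinors) :
    ⟪incl (Finsupp.single k 1), incl w⟫_ℂ = w k := by
  rw [incl_single, inner_ket, incl_apply]

lemma vec_apply (s : ℤˣ) (L M₁ M₂ J : ℤ) (k : Idx) : vec s L M₁ M₂ J k =
    if k.1.L = L ∧ k.1.M₁ = M₁ ∧ k.1.M₂ = M₂ ∧ k.1.J = J ∧ k.2 = s then 1 else 0 := by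
  obtain ⟨⟨L', M', N', J', h'⟩, s'⟩ := k
  unfold vec
  split_ifs with h1 h2 h2
  · obtain ⟨rfl, rfl, rfl, rfl, rfl⟩ := h2
    simp
  · rw [Finsupp.single_apply, if_neg]
    rintro h
    rw [Prod.ext_iff, Label.ext_iff] at h
    exact h2 ⟨h.1.1.symm, h.1.2.1.symm, h.1.2.2.1.symm, h.1.2.2.2.symm, h.2.symm⟩
  · obtain ⟨rfl, rfl, rfl, rfl, rfl⟩ := h2
    exact absurd h' h1
  · simp

/-- By sesquilinearity the adjoint relation needs to be known only for matrix entries. -/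
lemma IsTranspose_ext {A B : FinSpinors →ₗ[ℂ] FinSpinors}
    (h : ∀ k i, B (Finsupp.single k 1) i = conj (A (Finsupp.single i 1) k)) (v w : FinSpinors) :
    ⟪incl (A v), incl w⟫_ℂ = ⟪incl v, incl (B w)⟫_ℂ := by
  induction v using Finsupp.induction_linear with
  | zero => simp
  | add f g hf hg => rw [map_add, map_add, map_add, inner_add_left, inner_add_left, hf, hg]
  | single i c =>
    induction w using Finsupp.induction_linear with
    | zero => simp
    | add f g hf hg => rw [map_add, map_add, map_add, inner_add_right, inner_add_right, hf, hg]
    | single k d =>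
      rw [show Finsupp.single i c = c • Finsupp.single i (1 : ℂ) by simp,
        show Finsupp.single k d = d • Finsupp.single k (1 : ℂ) by simp]
      simp only [map_smul, inner_smul_left, inner_smul_right]
      rw [inner_single_incl, h, ← inner_conj_symm, inner_single_incl]

lemma wsF_adj_single (t : WShift) (k i : Idx) :
    wsF t.adj (Finsupp.single k 1) i = conj (wsF t (Finsupp.single i 1) k) := by
  rw [wsF_single, wsF_single, Finsupp.smul_apply, Finsupp.smul_apply, vec_apply, vec_apply]
  by_cases h : k.1.L = i.1.L + t.1.1 ∧ k.1.M₁ = i.1.M₁ + t.1.2.1 ∧ k.1.M₂ = i.1.M₂ + t.1.2.2.1 ∧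
      k.1.J = i.1.J + t.1.2.2.2 ∧ k.2 = i.2
  · obtain ⟨h1, h2, h3, h4, h5⟩ := h
    rw [if_pos (by simp [WShift.adj, h1, h2, h3, h4, h5]), if_pos ⟨h1, h2, h3, h4, h5⟩]
    simp [WShift.adj, h1, h2, h3, h4, h5]
  · rw [if_neg (c := k.1.L = _ ∧ _) h, if_neg]
    · simp
    · simp only [WShift.adj, Prod.fst_neg, Prod.snd_neg]
      intro h'
      apply h
      refine ⟨?_, ?_, ?_, ?_, h'.2.2.2.2.symm⟩ <;> omega

lemma opF_nil : opF [] = 0 := rfl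

lemma opF_cons (t : WShift) (l : List WShift) : opF (t :: l) = wsF t + opF l := by
  simp [opF]

lemma opF_adj_single (l : List WShift) (k i : Idx) :
    opF (l.map WShift.adj) (Finsupp.single k 1) i = conj (opF l (Finsupp.single i 1) k) := by
  induction l with
  | nil => simp [opF_nil]
  | cons t l ih =>
    rw [List.map_cons, opF_cons, opF_cons, LinearMap.add_apply, LinearMap.add_apply,
      Finsupp.add_apply, Finsupp.add_apply, ih, wsF_adj_single, map_add]

lemma inner_opF (l : List WShift) (v w : FinSpinors) :
    ⟪incl (opF l v), incl w⟫_ℂ = ⟪incl v, incl (opF (l.map WShift.adj) w)⟫_ℂ :=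
  IsTranspose_ext (opF_adj_single l) v w

lemma WShift.ext' {t t' : WShift} (h₁ : t.1 = t'.1)
    (h₂ : ∀ L M₁ M₂ J s, t.2 L M₁ M₂ J s = t'.2 L M₁ M₂ J s) : t = t' :=
  Prod.ext h₁ (by funext L M₁ M₂ J s; exact h₂ L M₁ M₂ J s)

/-- The symmetry of x₀. Its nine shifts are listed so that transposition reverses the list: the
first is the transpose of the last, and the middle one is its own transpose. -/
lemma opF_x₀L_adj (q : ℝ) : opF ((x₀L q).map WShift.adj) = opF (x₀L q) := by
  have h : (x₀L q).map WShift.adj = (x₀L q).reverse := by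
    simp only [x₀L, List.map_cons, List.map_nil, List.reverse_cons, List.reverse_nil,
      List.nil_append, List.cons_append]
    congr 1
    · refine WShift.ext' ?_ ?_ <;> simp [WShift.adj]
    all_goals congr 1
    · refine WShift.ext' ?_ ?_ <;> simp [WShift.adj]
    all_goals congr 1
    · refine WShift.ext' ?_ ?_ <;> simp [WShift.adj]
    all_goals congr 1
    · refine WShift.ext' ?_ ?_ <;> simp [WShift.adj]
    all_goals congr 1
    · refine WShift.ext' ?_ ?_ <;> simp [WShift.adj]
    all_goals congr 1
    · refine WShift.ext' ?_ ?_ <;> simp [WShift.adj]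
    all_goals congr 1
    · refine WShift.ext' ?_ ?_ <;> simp [WShift.adj]
    all_goals congr 1
    · refine WShift.ext' ?_ ?_ <;> simp [WShift.adj]
    all_goals congr 1
    · refine WShift.ext' ?_ ?_ <;> simp [WShift.adj]
  rw [h, opF, opF, List.map_reverse, List.sum_reverse]

/-! ### The relations of the sphere on finite linear combinations -/

/-- The image of `Phi` only involves levels J ≥ 0, so lattice relations that fail to make sense
elsewhere still suffice. -/
lemma lat_ext {A B : Lat →ₗ[ℂ] Lat} (h : ∀ M J s w, 0 ≤ J → A (lv M J s w) = B (lv M J s w))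
    (q : ℝ) (v : FinSpinors) : A (Phi q v) = B (Phi q v) := by
  suffices h : (A ∘ₗ Phi q : FinSpinors →ₗ[ℂ] Lat) = B ∘ₗ Phi q from LinearMap.congr_fun h v
  refine fin_ext (E := Lat) ?_ ?_ <;> intro s J M p r hJ hp hr hu hu'
  · simp only [LinearMap.comp_apply, Phi_true q s J M p r rfl rfl, LinearMap.map_smul_of_tower,
      h _ _ _ _ hJ]
  · simp only [LinearMap.comp_apply, Phi_false q s J M p r rfl rfl, LinearMap.map_smul_of_tower,
      h _ _ _ _ hJ]

section
variable {q : ℝ} (hq : q ∈ Set.Ioo (0:ℝ) 1)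
include hq

local notation "X₀" => opF (x₀L q)
local notation "X₁" => opF (x₁L q)
local notation "X₂" => opF (x₂L q)
local notation "Y₁" => opF (List.map WShift.adj (x₁L q))
local notation "Y₂" => opF (List.map WShift.adj (x₂L q))

lemma x₀L_x₁L (v : FinSpinors) : X₀ (X₁ v) = (q ^ 2) • X₁ (X₀ v) := by
  apply Phi_injective hq
  simp only [LinearMap.map_smul_of_tower, Phi_x₀ hq, Phi_x₁ hq]
  exact lat_ext (A := lX0 q ∘ₗ lX1 q) (B := (q ^ 2) • (lX1 q ∘ₗ lX0 q))
    (fun M J s w hJ => lX0_lX1 hq M J hJ s w) q v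

lemma x₀L_x₂L (v : FinSpinors) : X₀ (X₂ v) = (q ^ 2) • X₂ (X₀ v) := by
  apply Phi_injective hq
  simp only [LinearMap.map_smul_of_tower, Phi_x₀ hq, Phi_x₂ hq]
  exact lat_ext (A := lX0 q ∘ₗ lX2 q) (B := (q ^ 2) • (lX2 q ∘ₗ lX0 q))
    (fun M J s w hJ => lX0_lX2 hq M J hJ s w) q v

lemma x₁L_x₂L (v : FinSpinors) : X₁ (X₂ v) = (q ^ 2) • X₂ (X₁ v) := by
  apply Phi_injective hq
  simp only [LinearMap.map_smul_of_tower, Phi_x₁ hq, Phi_x₂ hq]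
  exact lat_ext (A := lX1 q ∘ₗ lX2 q) (B := (q ^ 2) • (lX2 q ∘ₗ lX1 q))
    (fun M J s w hJ => lX1_lX2 hq M J hJ s w) q v

lemma x₁L_adj_x₂L (v : FinSpinors) : Y₁ (X₂ v) = (q ^ 2) • X₂ (Y₁ v) := by
  apply Phi_injective hq
  simp only [LinearMap.map_smul_of_tower, Phi_x₁t hq, Phi_x₂ hq]
  exact lat_ext (A := lX1t q ∘ₗ lX2 q) (B := (q ^ 2) • (lX2 q ∘ₗ lX1t q))
    (fun M J s w hJ => lX1t_lX2 hq M J hJ s w) q v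

lemma x₁L_adj_x₁L (v : FinSpinors) : Y₁ (X₁ v) = (1 - q ^ 4) • X₀ (X₀ v) + X₁ (Y₁ v) := by
  apply Phi_injective hq
  simp only [LinearMap.map_smul_of_tower, map_add, Phi_x₁t hq, Phi_x₁ hq, Phi_x₀ hq]
  exact lat_ext (A := lX1t q ∘ₗ lX1 q) (B := (1 - q ^ 4) • (lX0 q ∘ₗ lX0 q) + lX1 q ∘ₗ lX1t q)
    (fun M J s w hJ => by
      have h := lX1t_lX1 hq M J hJ s w
      simp only [LinearMap.comp_apply, LinearMap.add_apply, LinearMap.smul_apply, ← h]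
      module) q v

lemma xL_radius (v : FinSpinors) : X₀ (X₀ v) + X₁ (Y₁ v) + X₂ (Y₂ v) = v := by
  apply Phi_injective hq
  simp only [map_add, Phi_x₁t hq, Phi_x₁ hq, Phi_x₀ hq, Phi_x₂ hq, Phi_x₂t hq]
  exact lat_ext (A := lX0 q ∘ₗ lX0 q + lX1 q ∘ₗ lX1t q + lX2 q ∘ₗ lX2t q) (B := LinearMap.id)
    (fun M J s w hJ => lX_radius hq M J hJ s w) q v

lemma lX2t_lX2 (M J : ℤ) (s : ℤˣ) (w : Fib) : lX2t q (lX2 q (lv M J s w)) =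
    (1 - q ^ 4) • lv M J s w + (q ^ 4) • lX2 q (lX2t q (lv M J s w)) := by
  simp only [lX2, lX2t, LinearMap.comp_apply, latOp_lv]
  rw [fDt_fD_apply hq J _ (sg_sq s), map_add, LinearMap.map_smul_of_tower,
    LinearMap.map_smul_of_tower]

lemma x₂L_adj_x₂L_aux (v : FinSpinors) :
    Y₂ (X₂ v) = (1 - q ^ 4) • v + (q ^ 4) • X₂ (Y₂ v) := by
  apply Phi_injective hq
  simp only [map_add, LinearMap.map_smul_of_tower, Phi_x₂ hq, Phi_x₂t hq]
  exact lat_ext (A := lX2t q ∘ₗ lX2 q)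
    (B := (1 - q ^ 4) • LinearMap.id + (q ^ 4) • (lX2 q ∘ₗ lX2t q))
    (fun M J s w hJ => by
      simp only [LinearMap.comp_apply, LinearMap.add_apply, LinearMap.smul_apply,
        LinearMap.id_apply]
      exact lX2t_lX2 hq M J s w) q v

/-- By the oscillator relation, x₂*x₂ - x₂x₂* = (1 - q⁴)(1 - x₂x₂*). The sphere equation turns this
into (1 - q⁴)(x₀² + x₁x₁*), and (1 - q⁴)x₀² is [x₁*, x₁]. -/
lemma x₂L_adj_x₂L (v : FinSpinors) :
    Y₂ (X₂ v) - X₂ (Y₂ v) = Y₁ (X₁ v) - (q ^ 4) • X₁ (Y₁ v) := by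
  have h1 := x₂L_adj_x₂L_aux hq v
  have h2 := xL_radius hq v
  have h3 := x₁L_adj_x₁L hq v
  have h4 : v = (1 - q ^ 4) • v + (q ^ 4) • v := by module
  rw [h1, h3, sub_eq_iff_eq_add]
  nth_rw 1 [← h2]
  module

end

end

section

/-! ### Bounded weighted shifts -/

lemma two_toReal_pos : 0 < (2 : ENNReal).toReal := by norm_num

lemma hasSum_ket (f : Spinors) : HasSum (fun k => f k • ket k) f := by
  have h := lp.hasSum_single (p := 2) (by norm_num) f
  have e : (fun k => f k • ket k) = fun k => lp.single 2 k (f k) := by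
    funext k
    ext i
    rw [lp.coeFn_smul, Pi.smul_apply, ket_apply, lp.single_apply]
    by_cases hi : i = k
    · subst hi; simp
    · simp [hi]
  rwa [e]

lemma clm_ext {A B : Spinors →L[ℂ] Spinors} (h : ∀ k, A (ket k) = B (ket k)) : A = B := by
  ext1 f
  have h1 := (hasSum_ket f).mapL A
  have h2 := (hasSum_ket f).mapL B
  simp only [map_smul, h] at h1 h2
  exact h1.unique h2

/-- Since `φ` is injective where the weight is nonzero, each coordinate of `f` contributes at most
once. -/
lemma sum_pull_le (c : Idx → ℝ) (φ : Idx → Idx) (C : ℝ) (hC : ∀ k, |c k| ≤ C)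
    (hφ : Set.InjOn φ {k | c k ≠ 0}) (f : Spinors) (S : Finset Idx) :
    ∑ k ∈ S, ‖(c k : ℂ) * f (φ k)‖ ^ (2 : ENNReal).toReal ≤ (C * ‖f‖) ^ (2 : ENNReal).toReal := by
  have hf := lp.sum_rpow_le_norm_rpow two_toReal_pos f ((S.filter fun k => c k ≠ 0).image φ)
  have hinj : Set.InjOn φ (S.filter fun k => c k ≠ 0 : Finset Idx) := fun a ha b hb h =>
    hφ (Finset.mem_filter.1 ha).2 (Finset.mem_filter.1 hb).2 h
  rw [Finset.sum_image hinj] at hf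
  simp only [ENNReal.toReal_ofNat, Real.rpow_ofNat] at hf ⊢
  calc ∑ k ∈ S, ‖(c k : ℂ) * f (φ k)‖ ^ 2
      = ∑ k ∈ S with c k ≠ 0, ‖(c k : ℂ) * f (φ k)‖ ^ 2 := by
        rw [Finset.sum_filter_of_ne]
        intro k _ h h0
        simp [h0] at h
    _ ≤ ∑ k ∈ S with c k ≠ 0, C ^ 2 * ‖f (φ k)‖ ^ 2 := by
        refine Finset.sum_le_sum fun k _ => ?_
        rw [norm_mul, mul_pow, Complex.norm_real, Real.norm_eq_abs]
        have := hC k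
        gcongr
    _ ≤ (C * ‖f‖) ^ 2 := by
        rw [← Finset.mul_sum, mul_pow]
        gcongr

open Classical in
/-- The operator `f ↦ (k ↦ c k * f (φ k))`, for bounded `c` and `φ` injective where `c ≠ 0`. -/
def pull (c : Idx → ℝ) (φ : Idx → Idx) : Spinors →L[ℂ] Spinors :=
  if h : (∃ C, ∀ k, |c k| ≤ C) ∧ Set.InjOn φ {k | c k ≠ 0} then
    LinearMap.mkContinuous
      { toFun := fun f => ⟨fun k => (c k : ℂ) * f (φ k),
          memℓp_gen' (sum_pull_le c φ _ h.1.choose_spec h.2 f)⟩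
        map_add' := fun f g => by ext k; exact mul_add _ _ _
        map_smul' := fun z f => by ext k; exact mul_left_comm _ _ _ }
      (max h.1.choose 0) (fun f => lp.norm_le_of_forall_sum_le two_toReal_pos
        (mul_nonneg (le_max_right _ _) (norm_nonneg _))
        (sum_pull_le c φ _ (fun k => (h.1.choose_spec k).trans (le_max_left _ _)) h.2 f))
  -- A default value; it lets the operator of a weighted shift be written down before its weight is
  -- known to be bounded.
  else 0

lemma pull_apply {c : Idx → ℝ} {φ : Idx → Idx} (hc : ∃ C, ∀ k, |c k| ≤ C)
    (hφ : Set.InjOn φ {k | c k ≠ 0}) (f : Spinors) (k : Idx) :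
    pull c φ f k = c k * f (φ k) := by
  rw [pull, dif_pos ⟨hc, hφ⟩]
  rfl

namespace WShift

/-- `|weight| ≤ C w` wherever source and target are labels. -/
def Le (t : WShift) (w : ℤ → ℤ → ℝ) : Prop :=
  ∃ C, ∀ L M₁ M₂ J s, IsLabel L M₁ M₂ J →
    IsLabel (L + t.1.1) (M₁ + t.1.2.1) (M₂ + t.1.2.2.1) (J + t.1.2.2.2) →
      |t.2 L M₁ M₂ J s| ≤ C * w L J

def Bdd (t : WShift) : Prop := t.Le fun _ _ => 1

/-- `k` is shifted to a label. -/
def Src (t : WShift) (k : Idx) : Prop :=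
  IsLabel (k.1.L - t.1.1) (k.1.M₁ - t.1.2.1) (k.1.M₂ - t.1.2.2.1) (k.1.J - t.1.2.2.2)

instance (t : WShift) (k : Idx) : Decidable (t.Src k) := by unfold Src; infer_instance

/-- The value `k` off the domain is a placeholder; `srcWt` vanishes there. -/
def src (t : WShift) (k : Idx) : Idx := if h : t.Src k then (⟨_, _, _, _, h⟩, k.2) else k

def wt (t : WShift) (k : Idx) : ℝ := t.2 k.1.L k.1.M₁ k.1.M₂ k.1.J k.2

def srcWt (t : WShift) (k : Idx) : ℝ := if t.Src k then t.wt (t.src k) else 0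

end WShift

/-- The shift in pulled-back form: a coordinate of the image is read off at the unique label that is
shifted to it. -/
def wsB (t : WShift) : Spinors →L[ℂ] Spinors := pull t.srcWt t.src

def opB (l : List WShift) : Spinors →L[ℂ] Spinors := (l.map wsB).sum

lemma WShift.src_injOn (t : WShift) : Set.InjOn t.src {k | t.srcWt k ≠ 0} := by
  intro k hk i hi h
  have hk' : t.Src k := by by_contra h; exact hk (by simp [srcWt, h])
  have hi' : t.Src i := by by_contra h; exact hi (by simp [srcWt, h])
  simp only [src, dif_pos hk', dif_pos hi', Prod.ext_iff, Label.ext_iff] at h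
  ext
  · have := h.1.1; omega
  · have := h.1.2.1; omega
  · have := h.1.2.2.1; omega
  · have := h.1.2.2.2; omega
  · simp [h.2]

lemma WShift.Bdd.srcWt {t : WShift} (h : t.Bdd) : ∃ C, ∀ k, |t.srcWt k| ≤ C := by
  obtain ⟨C, hC⟩ := h
  refine ⟨max C 0, fun k => ?_⟩
  unfold WShift.srcWt
  split_ifs with h
  · refine le_max_of_le_left ?_
    have := hC (t.src k).1.L (t.src k).1.M₁ (t.src k).1.M₂ (t.src k).1.J (t.src k).2
      (t.src k).1.valid (by simpa [src, dif_pos h] using k.1.valid)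
    simpa [wt] using this
  · simp

lemma wsB_apply {t : WShift} (h : t.Bdd) (f : Spinors) (k : Idx) :
    wsB t f k = t.srcWt k * f (t.src k) := pull_apply h.srcWt t.src_injOn f k

lemma wsB_ket {t : WShift} (h : t.Bdd) (k : Idx) :
    wsB t (ket k) = incl (wsF t (Finsupp.single k 1)) := by
  ext i
  rw [wsB_apply h, incl_apply, wsF_single, Finsupp.smul_apply, vec_apply, ket_apply]
  unfold WShift.srcWt
  by_cases h1 : t.Src i
  · rw [if_pos h1]
    by_cases h2 : t.src i = k
    · rw [if_pos h2, if_pos]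
      · subst h2
        simp [WShift.wt]
      · subst h2
        simp [WShift.src, dif_pos h1]
    · rw [if_neg h2, if_neg]
      · simp
      · rintro ⟨e1, e2, e3, e4, e5⟩
        apply h2
        simp only [WShift.src, dif_pos h1]
        ext
        · simp [e1]
        · simp [e2]
        · simp [e3]
        · simp [e4]
        · simp [e5]
  · rw [if_neg h1, Complex.ofReal_zero, zero_mul, if_neg]
    · simp
    · rintro ⟨e1, e2, e3, e4, e5⟩
      apply h1
      have := k.1.valid
      unfold WShift.Src
      rwa [e1, e2, e3, e4, add_sub_cancel_right, add_sub_cancel_right, add_sub_cancel_right,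
        add_sub_cancel_right]

lemma opB_ket {l : List WShift} (h : ∀ t ∈ l, t.Bdd) (k : Idx) :
    opB l (ket k) = incl (opF l (Finsupp.single k 1)) := by
  induction l with
  | nil => simp [opB, opF]
  | cons t l ih =>
    simp only [opB, opF, List.map_cons, List.sum_cons, ContinuousLinearMap.add_apply,
      LinearMap.add_apply, map_add, wsB_ket (h t (by simp))]
    exact congrArg _ (ih fun t ht => h t (by simp [ht]))

lemma opB_incl {l : List WShift} (h : ∀ t ∈ l, t.Bdd) (v : FinSpinors) :
    opB l (incl v) = incl (opF l v) := by
  have : (opB l : Spinors →ₗ[ℂ] Spinors) ∘ₗ incl = incl ∘ₗ opF l := by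
    refine Finsupp.lhom_ext' fun k => LinearMap.ext_ring ?_
    simp only [LinearMap.comp_apply, Finsupp.lsingle_apply, incl_single]
    exact opB_ket h k
  exact LinearMap.congr_fun this v

lemma WShift.Bdd.adj {t : WShift} (h : t.Bdd) : t.adj.Bdd := by
  obtain ⟨C, hC⟩ := h
  refine ⟨C, fun L M₁ M₂ J s h1 h2 => ?_⟩
  simp only [WShift.adj, Prod.fst_neg, Prod.snd_neg, ← sub_eq_add_neg] at h2 ⊢
  exact hC _ _ _ _ s h2 (by simpa using h1)

/-- A bounded operator is determined by its matrix, so the adjoint may be recognised from the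
conjugate transpose. -/
lemma star_eq_of_coord {A B : Spinors →L[ℂ] Spinors}
    (h : ∀ k i, (B (ket k) : Spinors) i = conj ((A (ket i) : Spinors) k)) : star A = B := by
  refine clm_ext fun k => ?_
  ext i
  rw [h, ContinuousLinearMap.star_eq_adjoint, ← inner_ket, ContinuousLinearMap.adjoint_inner_right,
    ← inner_ket, inner_conj_symm]

lemma star_opB {l : List WShift} (h : ∀ t ∈ l, t.Bdd) : star (opB l) = opB (l.map WShift.adj) := by
  have h' : ∀ t ∈ l.map WShift.adj, t.Bdd := fun t ht => by
    obtain ⟨t', ht', rfl⟩ := List.mem_map.1 ht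
    exact (h t' ht').adj
  refine star_eq_of_coord fun k i => ?_
  rw [opB_ket h, opB_ket h', incl_apply, incl_apply, opF_adj_single]

/-! ### Commutators with diagonal operators -/

lemma hasSum_apply (A : Spinors →L[ℂ] Spinors) (f : Spinors) (i : Idx) :
    HasSum (fun k => f k * (A (ket k) : Spinors) i) (A f i) := by
  have h := ((hasSum_ket f).mapL A).mapL (innerSL ℂ (ket i))
  rw [innerSL_apply_apply, inner_ket] at h
  refine h.congr_fun fun k => ?_
  rw [map_smul, innerSL_apply_apply, inner_smul_right, inner_ket]

/-- The identity of matrix entries is summed against the coordinates of a vector v in the domain.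
The right-hand side then consists of the coordinates of T(Av) + Sv, which is a vector of the Hilbert
space; so the left-hand side is square-summable, which says that Tv is in the domain. -/
lemma isCommutator_of_coord {w : Idx → ℝ} {e : Equiv.Perm Idx} {T S : Spinors →L[ℂ] Spinors}
    (h : ∀ k i, (w i : ℂ) * (T (ket k) : Spinors) (e i) =
      w (e.symm k) * (T (ket (e.symm k)) : Spinors) i + (S (ket k) : Spinors) i) :
    IsCommutator (unboundedMul w e) T S := by
  intro v
  have key : (fun i => (w i : ℂ) * T v (e i)) =
      (T (unboundedMul w e v) + S v : Spinors) := by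
    funext i
    have h1 := (hasSum_apply T (v : Spinors) (e i)).mul_left (w i : ℂ)
    have h2 := (hasSum_apply T (unboundedMul w e v) i)
    have h3 := hasSum_apply S (v : Spinors) i
    -- Reindexing makes all three series run over the coordinates of `v`: the coordinate of Av at
    -- e⁻¹(k) is w(e⁻¹k) times that of v at k.
    rw [← e.symm.hasSum_iff] at h2
    have h4 := h2.add h3
    refine h1.unique ?_
    refine h4.congr_fun fun k => ?_
    rw [Function.comp_apply]
    have h5 : (unboundedMul w e v : Spinors) (e.symm k) = w (e.symm k) * (v : Spinors) k := by
      change (w (e.symm k) : ℂ) * (v : Spinors) (e (e.symm k)) = _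
      rw [e.apply_symm_apply]
    rw [h5]
    first
    | linear_combination (v : Spinors) k * h k i
    | linear_combination -(v : Spinors) k * h k i
  have hm : T v ∈ (unboundedMul w e).domain := by
    change Memℓp (fun i => (w i : ℂ) * T v (e i)) 2
    rw [key]
    exact lp.memℓp _
  refine ⟨hm, ?_⟩
  rw [sub_eq_iff_eq_add, add_comm]
  ext i
  exact congrFun key i

end

section

/-! ### The algebra of commutators -/

namespace IsCommutator
variable {A : Spinors →ₗ.[ℂ] Spinors} {T T' S S' : Spinors →L[ℂ] Spinors}

lemma add (h : IsCommutator A T S) (h' : IsCommutator A T' S') :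
    IsCommutator A (T + T') (S + S') := by
  intro v
  obtain ⟨m, e⟩ := h v
  obtain ⟨m', e'⟩ := h' v
  refine ⟨A.domain.add_mem m m', ?_⟩
  have : A ⟨(T + T') v, A.domain.add_mem m m'⟩ = A ⟨T v, m⟩ + A ⟨T' v, m'⟩ :=
    A.map_add ⟨T v, m⟩ ⟨T' v, m'⟩
  rw [this, ContinuousLinearMap.add_apply, ContinuousLinearMap.add_apply, ← e, ← e']
  abel

lemma smul (h : IsCommutator A T S) (c : ℂ) : IsCommutator A (c • T) (c • S) := by
  intro v
  obtain ⟨m, e⟩ := h v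
  refine ⟨A.domain.smul_mem c m, ?_⟩
  have : A ⟨(c • T) v, A.domain.smul_mem c m⟩ = c • A ⟨T v, m⟩ := A.map_smul c ⟨T v, m⟩
  rw [this, ContinuousLinearMap.smul_apply, ContinuousLinearMap.smul_apply, ← e, smul_sub]

/-- The Leibniz rule; the domain is preserved first by the right factor and then by the left one. -/
lemma mul (h : IsCommutator A T S) (h' : IsCommutator A T' S') :
    IsCommutator A (T * T') (S * T' + T * S') := by
  intro v
  obtain ⟨m', e'⟩ := h' v
  obtain ⟨m, e⟩ := h ⟨T' v, m'⟩
  refine ⟨m, ?_⟩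
  have e2 : A ⟨T (T' v), m⟩ = S (T' v) + T (A ⟨T' v, m'⟩) := by rw [← e]; simp
  have e3 : A ⟨T' v, m'⟩ = S' v + T' (A v) := by rw [← e']; simp
  change A ⟨T (T' v), m⟩ - T (T' (A v)) = S (T' v) + T (S' v)
  rw [e2, e3, map_add]
  abel

lemma of_algebraMap (c : ℂ) :
    IsCommutator A (algebraMap ℂ (Spinors →L[ℂ] Spinors) c) 0 := by
  intro v
  refine ⟨by rw [Algebra.algebraMap_eq_smul_one]; exact A.domain.smul_mem c v.2, ?_⟩
  have : A ⟨c • (v : Spinors), A.domain.smul_mem c v.2⟩ = c • A v := A.map_smul c v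
  simp only [Algebra.algebraMap_eq_smul_one]
  exact sub_eq_zero.2 this

end IsCommutator

/-! ### Operators of finite degree -/

/-- The span of the operators that are homogeneous for the grading by the eigenvalues of `|D|`. -/
def Graded : Submodule ℂ (Spinors →L[ℂ] Spinors) :=
  Submodule.span ℂ {T | ∃ d : ℂ, IsCommutator absDirac T (d • T)}

/-- The derivation δ multiplies a homogeneous operator by its degree, hence maps the span of such
operators to itself. Iteration places the span in OP⁰. -/
lemma Graded.exists_isCommutator {T : Spinors →L[ℂ] Spinors} (h : T ∈ Graded) :
    ∃ S ∈ Graded, IsCommutator absDirac T S := by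
  induction h using Submodule.span_induction with
  | mem T h =>
    obtain ⟨d, hd⟩ := h
    exact ⟨d • T, Graded.smul_mem d (Submodule.subset_span ⟨d, hd⟩), hd⟩
  | zero => exact ⟨0, Graded.zero_mem, by simpa using IsCommutator.of_algebraMap (A := absDirac) 0⟩
  | add T T' _ _ h h' =>
    obtain ⟨S, hS, h⟩ := h
    obtain ⟨S', hS', h'⟩ := h'
    exact ⟨S + S', Graded.add_mem hS hS', h.add h'⟩
  | smul c T _ h =>
    obtain ⟨S, hS, h⟩ := h
    exact ⟨c • S, Graded.smul_mem c hS, h.smul c⟩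

lemma Graded.mem_OP0 {T : Spinors →L[ℂ] Spinors} (h : T ∈ Graded) : T ∈ OP0 := by
  refine Set.mem_iInter.2 fun n => ?_
  induction n generalizing T with
  | zero => trivial
  | succ n ih =>
    obtain ⟨S, hS, hT⟩ := Graded.exists_isCommutator h
    exact ⟨S, ih hS, hT⟩

/-- By the Leibniz rule degrees add. -/
lemma Graded.mul {T S : Spinors →L[ℂ] Spinors} (hT : T ∈ Graded) (hS : S ∈ Graded) :
    T * S ∈ Graded := by
  have h := Submodule.mul_mem_mul hT hS
  rw [Graded, Submodule.span_mul_span] at h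
  refine Submodule.span_mono ?_ h
  rintro _ ⟨A, ⟨a, ha⟩, B, ⟨b, hb⟩, rfl⟩
  refine ⟨a + b, ?_⟩
  have := ha.mul hb
  simpa [add_smul] using this

lemma Graded.algebraMap_mem (c : ℂ) : algebraMap ℂ (Spinors →L[ℂ] Spinors) c ∈ Graded :=
  Submodule.subset_span ⟨0, by simpa using IsCommutator.of_algebraMap (A := absDirac) c⟩

/-! ### Operators with rapidly decreasing columns -/

section Decay
variable (w : Idx → ℝ)

/-- Operators whose columns are bounded by a multiple of `w`. -/
def Decay : Submodule ℂ (Spinors →L[ℂ] Spinors) where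
  carrier := {T | ∃ C, ∀ k, ‖T (ket k)‖ ≤ C * w k}
  zero_mem' := ⟨0, fun k => by simp⟩
  add_mem' := by
    rintro T S ⟨C, hC⟩ ⟨C', hC'⟩
    refine ⟨C + C', fun k => (norm_add_le _ _).trans ?_⟩
    rw [add_mul]
    exact add_le_add (hC k) (hC' k)
  smul_mem' := by
    rintro c T ⟨C, hC⟩
    refine ⟨‖c‖ * C, fun k => ?_⟩
    rw [ContinuousLinearMap.smul_apply, norm_smul, mul_assoc]
    exact mul_le_mul_of_nonneg_left (hC k) (norm_nonneg _)

variable {w}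

/-- Any bounded operator may stand on the left, since the columns of the product are images of
columns. Right multiplication mixes columns, which is why `admAlg` asks for it separately. -/
lemma Decay.mul_left {T : Spinors →L[ℂ] Spinors} (hT : T ∈ Decay w) (A : Spinors →L[ℂ] Spinors) :
    A * T ∈ Decay w := by
  obtain ⟨C, hC⟩ := hT
  refine ⟨‖A‖ * C, fun k => (A.le_opNorm _).trans ?_⟩
  rw [mul_assoc]
  exact mul_le_mul_of_nonneg_left (hC k) (norm_nonneg _)

variable (w)

/-- Graded operators that stabilise the decay condition by right multiplication. -/
def admAlg : Subalgebra ℂ (Spinors →L[ℂ] Spinors) where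
  carrier := {A | A ∈ Graded ∧ ∀ T ∈ Decay w, T * A ∈ Decay w}
  mul_mem' := fun {A B} hA hB => ⟨Graded.mul hA.1 hB.1, fun T hT => by
    rw [← mul_assoc]; exact hB.2 _ (hA.2 _ hT)⟩
  add_mem' := fun {A B} hA hB => ⟨Graded.add_mem hA.1 hB.1, fun T hT => by
    rw [mul_add]; exact (Decay w).add_mem (hA.2 _ hT) (hB.2 _ hT)⟩
  algebraMap_mem' c := ⟨Graded.algebraMap_mem c, fun T hT => by
    rw [← Algebra.commutes]; exact Decay.mul_left hT _⟩

/-- A two-sided ideal of `admAlg w`, used in place of `idealI`: membership is an estimate of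
columns, and for the weight `wq q` it implies membership in `idealI` by `smallIdeal_le`. -/
def smallIdeal : Submodule ℂ (Spinors →L[ℂ] Spinors) := Graded ⊓ Decay w

variable {w}

lemma smallIdeal.mul_left {A T : Spinors →L[ℂ] Spinors} (hA : A ∈ admAlg w)
    (hT : T ∈ smallIdeal w) : A * T ∈ smallIdeal w := ⟨Graded.mul hA.1 hT.1, Decay.mul_left hT.2 A⟩

lemma smallIdeal.mul_right {A T : Spinors →L[ℂ] Spinors} (hA : A ∈ admAlg w)
    (hT : T ∈ smallIdeal w) : T * A ∈ smallIdeal w := ⟨Graded.mul hT.1 hA.1, hA.2 _ hT.2⟩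

lemma smallIdeal.mem_admAlg {T : Spinors →L[ℂ] Spinors} (hT : T ∈ smallIdeal w) :
    T ∈ admAlg w := ⟨hT.1, fun S _ => Decay.mul_left hT.2 S⟩

/-- The admissible operators that commute with `s` modulo the ideal. -/
def commAlg (w : Idx → ℝ) (s : Set (Spinors →L[ℂ] Spinors)) (hs : s ⊆ admAlg w) :
    Subalgebra ℂ (Spinors →L[ℂ] Spinors) where
  carrier := {a | a ∈ admAlg w ∧ ∀ b ∈ s, a * b - b * a ∈ smallIdeal w}
  mul_mem' := fun {a a'} h h' => ⟨(admAlg w).mul_mem h.1 h'.1, fun b hb => by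
    rw [show a * a' * b - b * (a * a') = a * (a' * b - b * a') + (a * b - b * a) * a' by
      noncomm_ring]
    exact (smallIdeal w).add_mem (smallIdeal.mul_left h.1 (h'.2 b hb))
      (smallIdeal.mul_right h'.1 (h.2 b hb))⟩
  add_mem' := fun {a a'} h h' => ⟨(admAlg w).add_mem h.1 h'.1, fun b hb => by
    rw [show (a + a') * b - b * (a + a') = (a * b - b * a) + (a' * b - b * a') by noncomm_ring]
    exact (smallIdeal w).add_mem (h.2 b hb) (h'.2 b hb)⟩
  algebraMap_mem' c := ⟨(admAlg w).algebraMap_mem c, fun b _ => by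
    rw [Algebra.commutes, sub_self]; exact (smallIdeal w).zero_mem⟩

lemma smallIdeal.mem_commAlg {T : Spinors →L[ℂ] Spinors} (hT : T ∈ smallIdeal w)
    {s : Set (Spinors →L[ℂ] Spinors)} (hs : s ⊆ admAlg w) : T ∈ commAlg w s hs :=
  ⟨smallIdeal.mem_admAlg hT, fun b hb => (smallIdeal w).sub_mem (smallIdeal.mul_right (hs hb) hT)
    (smallIdeal.mul_left (hs hb) hT)⟩

/-- Commuting modulo the ideal is symmetric, and the elements that commute with a given one form a
subalgebra. Hence it is enough to know the commutators with the generators on both sides. -/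
lemma commAlg.adjoin {s : Set (Spinors →L[ℂ] Spinors)} {hs : s ⊆ admAlg w}
    {a b : Spinors →L[ℂ] Spinors} (ha : a ∈ commAlg w s hs) (hb : b ∈ Algebra.adjoin ℂ s) :
    a * b - b * a ∈ smallIdeal w := by
  have h : Algebra.adjoin ℂ s ≤ commAlg w {a} (Set.singleton_subset_iff.2 ha.1) := by
    refine Algebra.adjoin_le fun b hb => ⟨hs hb, fun a' ha' => ?_⟩
    rw [Set.mem_singleton_iff.1 ha', ← neg_sub]
    exact (smallIdeal w).neg_mem (ha.2 b hb)
  rw [← neg_sub]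
  exact (smallIdeal w).neg_mem ((h hb).2 a rfl)

end Decay

/-! ### Trace class operators -/

/-- For given J and n = L - J there are 2J + 2 values of m₁, 2n + 2 values of m₂ and two
chiralities. This code turns sums over labels into double sums with these multiplicities. -/
abbrev IdxCode : Type := Σ x : ℕ × ℕ, Fin (2 * x.1 + 2) × Fin (2 * x.2 + 2) × ℤˣ

def Idx.code (k : Idx) : IdxCode :=
  ⟨(k.1.J.toNat, (k.1.L - k.1.J).toNat),
    ⟨(k.1.J + k.1.M₁ + 1).toNat, by
      have h := k.1.valid
      unfold IsLabel at h
      rw [abs_le, abs_le] at h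
      dsimp only
      omega⟩,
    ⟨(k.1.L - k.1.J + k.1.M₂ + 1).toNat, by
      have h := k.1.valid
      unfold IsLabel at h
      rw [abs_le, abs_le] at h
      dsimp only
      omega⟩, k.2⟩

lemma IsLabel.bounds {L M₁ M₂ J : ℤ} (h : IsLabel L M₁ M₂ J) :
    0 ≤ J ∧ J ≤ L ∧ -J - 1 ≤ M₁ ∧ M₁ ≤ J ∧ -(L - J) - 1 ≤ M₂ ∧ M₂ ≤ L - J := by
  unfold IsLabel at h
  rw [abs_le, abs_le] at h
  omega

lemma isLabel_iff {L M₁ M₂ J : ℤ} : IsLabel L M₁ M₂ J ↔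
    0 ≤ J ∧ J ≤ L ∧ -J - 1 ≤ M₁ ∧ M₁ ≤ J ∧ -(L - J) - 1 ≤ M₂ ∧ M₂ ≤ L - J := by
  unfold IsLabel
  rw [abs_le, abs_le]
  omega

lemma Idx.code_injective : Function.Injective Idx.code := by
  rintro ⟨⟨L, M, N, J, h⟩, s⟩ ⟨⟨L', M', N', J', h'⟩, s'⟩ e
  have hb := h.bounds
  have hb' := h'.bounds
  unfold Idx.code at e
  rw [Sigma.mk.injEq] at e
  obtain ⟨e1, e2⟩ := e
  simp only [Prod.mk.injEq] at e1
  obtain rfl : J = J' := by omega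
  obtain rfl : L = L' := by omega
  rw [heq_eq_eq] at e2
  simp only [Prod.mk.injEq, Fin.mk.injEq] at e2
  obtain rfl : M = M' := by omega
  obtain rfl : N = N' := by omega
  rw [e2.2.2]

instance : Countable Idx := Idx.code_injective.countable

instance : Infinite Idx := by
  refine Infinite.of_injective (fun n : ℕ => ((⟨n, 0, 0, 0, by rw [isLabel_iff]; omega⟩, 1) : Idx)) ?_
  intro m n h
  simpa using h

/-- T = ∑ ⟨k| · ⟩ T|k⟩ over the orthonormal basis is a decomposition of the required form, once the
basis is enumerated by ℕ. -/
lemma isTraceClass_of_summable {T : Spinors →L[ℂ] Spinors} (h : Summable fun k => ‖T (ket k)‖) :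
    IsTraceClass T := by
  obtain ⟨hd⟩ := nonempty_denumerable Idx
  let e := (Denumerable.eqv Idx).symm
  refine ⟨fun n => ket (e n), fun n => T (ket (e n)), ?_, fun v => ?_⟩
  · refine (e.summable_iff.2 h).congr fun n => ?_
    have : ‖ket (e n)‖ = 1 := by rw [ket, lp.norm_single (by norm_num), norm_one]
    rw [Function.comp_apply, this, one_mul]
  · have := e.hasSum_iff.2 ((hasSum_ket v).mapL T)
    refine this.congr_fun fun n => ?_
    simp [inner_ket]

lemma dval_eq (k : Idx) : dval k = k.1.L + 2 := by
  unfold dval hf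
  ring

/-- `q ^ (j - 1/2) + q ^ (l - j)`. -/
def wq (q : ℝ) (k : Idx) : ℝ := q ^ k.1.J + q ^ (k.1.L - k.1.J)

section
variable {q : ℝ} (hq : q ∈ Set.Ioo (0:ℝ) 1)
include hq

/-- With n = L - J, the sum is bounded by products of ∑ (2J + 2) q^J and ∑ (2n + 2)(n + 1)^(-p), and
the same with J and n exchanged. -/
lemma summable_wq {p : ℝ} (hp : 2 < p) : Summable fun k => wq q k * dval k ^ (-p) := by
  let F : ℕ × ℕ → ℝ := fun x => (q ^ x.1 + q ^ x.2) * ((x.1 : ℝ) + x.2 + 2) ^ (-p)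
  have hF0 : ∀ x, 0 ≤ F x := fun x => by
    have := hq.1
    positivity
  have hA : Summable fun n : ℕ => ((2 * n + 2 : ℕ) : ℝ) * q ^ n := by
    have h1 := summable_pow_mul_geometric_of_norm_lt_one (R := ℝ) 1 (r := q)
      (by rw [Real.norm_of_nonneg hq.1.le]; exact hq.2)
    have h2 := summable_geometric_of_lt_one hq.1.le hq.2
    refine ((h1.mul_left 2).add (h2.mul_left 2)).congr fun n => ?_
    push_cast
    ring
  have hB : Summable fun n : ℕ => ((2 * n + 2 : ℕ) : ℝ) * ((n : ℝ) + 1) ^ (-p) := by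
    -- The multiplicity costs one power, so that convergence needs 1 - p < -1, which is p > 2.
    have h1 := (summable_nat_add_iff 1).2 (Real.summable_nat_rpow.2 (show 1 - p < -1 by linarith))
    refine (h1.mul_left 2).congr fun n => ?_
    rw [show 1 - p = 1 + -p by ring, Real.rpow_add (by positivity), Real.rpow_one]
    push_cast
    ring
  have hA0 : 0 ≤ fun n : ℕ => ((2 * n + 2 : ℕ) : ℝ) * q ^ n := fun n => by
    have := hq.1
    simp only [Pi.zero_apply]
    positivity
  have hB0 : 0 ≤ fun n : ℕ => ((2 * n + 2 : ℕ) : ℝ) * ((n : ℝ) + 1) ^ (-p) := fun n => by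
    simp only [Pi.zero_apply]
    positivity
  have hAB := hA.mul_of_nonneg hB hA0 hB0
  have hBA := hB.mul_of_nonneg hA hB0 hA0
  have hG : Summable fun x : IdxCode => F x.1 := by
    rw [summable_sigma_of_nonneg fun x => hF0 x.1]
    refine ⟨fun x => Summable.of_finite, ?_⟩
    refine ((hAB.add hBA).mul_left 2).of_nonneg_of_le (fun x => tsum_nonneg fun _ => hF0 x)
      fun x => ?_
    rw [tsum_fintype]
    dsimp only
    rw [Finset.sum_const, nsmul_eq_mul]
    simp only [Finset.card_univ, Fintype.card_prod, Fintype.card_fin, Fintype.card_units_int]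
    -- The eigenvalue of |D| is J + n + 2; it is compared with the coordinate in which the other
    -- factor does not decay.
    have h1 : ((x.1 : ℝ) + x.2 + 2) ^ (-p) ≤ ((x.1 : ℝ) + 1) ^ (-p) :=
      Real.rpow_le_rpow_of_nonpos (by positivity) (by linarith [Nat.cast_nonneg (α := ℝ) x.2]) (by linarith)
    have h2 : ((x.1 : ℝ) + x.2 + 2) ^ (-p) ≤ ((x.2 : ℝ) + 1) ^ (-p) :=
      Real.rpow_le_rpow_of_nonpos (by positivity) (by linarith [Nat.cast_nonneg (α := ℝ) x.1]) (by linarith)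
    have h0 := hq.1
    calc _ = 2 * ((((2 * x.1 + 2 : ℕ) : ℝ) * q ^ x.1) * (((2 * x.2 + 2 : ℕ) : ℝ) *
            ((x.1 : ℝ) + x.2 + 2) ^ (-p)) + (((2 * x.1 + 2 : ℕ) : ℝ) *
            ((x.1 : ℝ) + x.2 + 2) ^ (-p)) * (((2 * x.2 + 2 : ℕ) : ℝ) * q ^ x.2)) := by
          simp only [F]; push_cast; ring
      _ ≤ _ := by gcongr
  refine (hG.comp_injective Idx.code_injective).congr fun k => ?_
  have hb := k.1.valid.bounds
  obtain ⟨a, ha⟩ := Int.eq_ofNat_of_zero_le hb.1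
  obtain ⟨b, hb⟩ := Int.eq_ofNat_of_zero_le (sub_nonneg.2 hb.2.1)
  have hL : k.1.L = a + b := by omega
  simp only [Function.comp_apply, Idx.code, F, wq, dval_eq]
  rw [hb, ha, hL]
  simp

lemma smallIdeal_le {T : Spinors →L[ℂ] Spinors} (hT : T ∈ smallIdeal (wq q)) : T ∈ idealI := by
  refine ⟨Graded.mem_OP0 hT.1, fun p hp => isTraceClass_of_summable ?_⟩
  obtain ⟨C, hC⟩ := hT.2
  refine ((summable_wq hq hp).mul_left C).of_nonneg_of_le (fun k => norm_nonneg _) fun k => ?_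
  have h : absDiracNegPow p (zero_le_two.trans hp.le) (ket k) = ((dval k ^ (-p) : ℝ) : ℂ) • ket k := by
    ext i
    rw [absDiracNegPow, boundedDiag_apply, lp.coeFn_smul, Pi.smul_apply, ket_apply, smul_eq_mul]
    by_cases hi : i = k
    · rw [hi]
    · simp [hi]
  have h0 : 0 ≤ dval k ^ (-p) := Real.rpow_nonneg (zero_le_one.trans (one_le_dval k)) _
  rw [ContinuousLinearMap.mul_apply, h, map_smul, norm_smul, Complex.norm_real,
    Real.norm_of_nonneg h0, ← mul_assoc, mul_comm]
  exact mul_le_mul_of_nonneg_right (hC k) h0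

end

end

section

/-! ### Weighted shifts as admissible operators -/

namespace WShift

/-- The shifted label is a label. -/
def Tgt (t : WShift) (k : Idx) : Prop :=
  IsLabel (k.1.L + t.1.1) (k.1.M₁ + t.1.2.1) (k.1.M₂ + t.1.2.2.1) (k.1.J + t.1.2.2.2)

def tgt (t : WShift) (k : Idx) (h : t.Tgt k) : Idx := (⟨_, _, _, _, h⟩, k.2)

variable {t t' : WShift} {w w' : ℤ → ℤ → ℝ}

lemma Le.mono (h : t.Le w) {C : ℝ} (hw : ∀ L J, 0 ≤ J → J ≤ L → 0 ≤ w L J ∧ w L J ≤ C * w' L J) :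
    t.Le w' := by
  obtain ⟨D, hD⟩ := h
  refine ⟨|D| * C, fun L M₁ M₂ J s h1 h2 => (hD _ _ _ _ s h1 h2).trans ?_⟩
  have := hw L J h1.bounds.1 h1.bounds.2.1
  rw [mul_assoc]
  exact (mul_le_mul_of_nonneg_right (le_abs_self D) this.1).trans
    (mul_le_mul_of_nonneg_left this.2 (abs_nonneg D))

lemma Le.congr (h : t.Le w) (h₁ : t'.1 = t.1)
    (h₂ : ∃ c, ∀ L M₁ M₂ J s, |t'.2 L M₁ M₂ J s| ≤ c * |t.2 L M₁ M₂ J s|) : t'.Le w := by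
  obtain ⟨D, hD⟩ := h
  obtain ⟨c, hc⟩ := h₂
  refine ⟨|c| * D, fun L M₁ M₂ J s h1 h2 => (hc _ _ _ _ _).trans ?_⟩
  rw [h₁] at h2
  rw [mul_assoc]
  exact (mul_le_mul_of_nonneg_right (le_abs_self c) (abs_nonneg _)).trans
    (mul_le_mul_of_nonneg_left (hD _ _ _ _ s h1 h2) (abs_nonneg c))

lemma Le.add {sh : ℤ × ℤ × ℤ × ℤ} {f g : ℤ → ℤ → ℤ → ℤ → ℤˣ → ℝ} (hf : Le (sh, f) w)
    (hg : Le (sh, g) w) : Le (sh, fun L M₁ M₂ J s => f L M₁ M₂ J s + g L M₁ M₂ J s) w := by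
  obtain ⟨C, hC⟩ := hf
  obtain ⟨D, hD⟩ := hg
  refine ⟨C + D, fun L M₁ M₂ J s h1 h2 => (abs_add_le _ _).trans ?_⟩
  rw [add_mul]
  exact add_le_add (hC _ _ _ _ s h1 h2) (hD _ _ _ _ s h1 h2)

lemma Le.const_mul {sh : ℤ × ℤ × ℤ × ℤ} {f : ℤ → ℤ → ℤ → ℤ → ℤˣ → ℝ} (hf : Le (sh, f) w)
    (c : ℝ) : Le (sh, fun L M₁ M₂ J s => c * f L M₁ M₂ J s) w :=
  hf.congr rfl ⟨|c|, fun L M₁ M₂ J s => (abs_mul _ _).le⟩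

lemma Le.adj (h : t.Le w)
    (hw : ∃ C, ∀ L J, 0 ≤ J → J ≤ L → 0 ≤ J - t.1.2.2.2 → J - t.1.2.2.2 ≤ L - t.1.1 →
      0 ≤ w (L - t.1.1) (J - t.1.2.2.2) ∧ w (L - t.1.1) (J - t.1.2.2.2) ≤ C * w' L J) :
    t.adj.Le w' := by
  obtain ⟨D, hD⟩ := h
  obtain ⟨C, hC⟩ := hw
  refine ⟨|D| * C, fun L M₁ M₂ J s h1 h2 => ?_⟩
  simp only [WShift.adj, Prod.fst_neg, Prod.snd_neg, ← sub_eq_add_neg] at h2 ⊢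
  refine (hD _ _ _ _ s h2 (by simpa using h1)).trans ?_
  have := hC L J h1.bounds.1 h1.bounds.2.1 h2.bounds.1 h2.bounds.2.1
  rw [mul_assoc]
  exact (mul_le_mul_of_nonneg_right (le_abs_self D) this.1).trans
    (mul_le_mul_of_nonneg_left this.2 (abs_nonneg D))

/-- The conjugate of a weighted shift by the real structure. -/
def rconj (t : WShift) : WShift :=
  ((t.1.1, -t.1.2.1, -t.1.2.2.1, t.1.2.2.2), fun L M₁ M₂ J s =>
    -(-1) ^ (t.1.1 + t.1.2.1 + t.1.2.2.2) * t.2 L (-M₁ - 1) (-M₂ - 1) J s)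

lemma Le.rconj (h : t.Le w) : t.rconj.Le w := by
  obtain ⟨C, hC⟩ := h
  refine ⟨C, fun L M₁ M₂ J s h1 h2 => ?_⟩
  rw [isLabel_iff] at h1 h2
  simp only [WShift.rconj] at h2 ⊢
  rw [abs_mul, abs_neg, abs_neg_one_zpow, one_mul]
  exact hC _ _ _ _ s (isLabel_iff.2 (by omega)) (isLabel_iff.2 (by omega))

/-- The weighted shift with `[D, t] = γ₅ dterm t`, where `γ₅` flips the sign. -/
def dterm (t : WShift) : WShift :=
  (t.1, fun L M₁ M₂ J s => (L + t.1.1 + 2) * t.2 L M₁ M₂ J s - (L + 2) * t.2 L M₁ M₂ J (-s))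

end WShift

lemma wsB_ket_of {t : WShift} (h : t.Bdd) {k : Idx} (hk : t.Tgt k) :
    wsB t (ket k) = (t.wt k : ℂ) • ket (t.tgt k hk) := by
  rw [wsB_ket h, wsF_single, vec, dif_pos (show IsLabel _ _ _ _ from hk), LinearMap.map_smul_of_tower, incl_single]
  exact (Complex.coe_smul _ _).symm

lemma wsB_ket_zero {t : WShift} (h : t.Bdd) {k : Idx} (hk : ¬ t.Tgt k) : wsB t (ket k) = 0 := by
  rw [wsB_ket h, wsF_single, vec, dif_neg (show ¬ IsLabel _ _ _ _ from hk), smul_zero, map_zero]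

lemma wsB_ket_apply {t : WShift} (h : t.Bdd) (k i : Idx) : (wsB t (ket k) : Spinors) i =
    if i.1.L = k.1.L + t.1.1 ∧ i.1.M₁ = k.1.M₁ + t.1.2.1 ∧ i.1.M₂ = k.1.M₂ + t.1.2.2.1 ∧
      i.1.J = k.1.J + t.1.2.2.2 ∧ i.2 = k.2 then (t.wt k : ℂ) else 0 := by
  rw [wsB_ket h, incl_apply, wsF_single, Finsupp.smul_apply, vec_apply]
  split_ifs <;> simp [WShift.wt]

lemma norm_ket (k : Idx) : ‖ket k‖ = 1 := by
  rw [ket, lp.norm_single (by norm_num), norm_one]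

lemma wsB_isCommutator {t : WShift} (h : t.Bdd) :
    IsCommutator absDirac (wsB t) ((t.1.1 : ℂ) • wsB t) := by
  refine isCommutator_of_coord (e := Equiv.refl Idx) fun k i => ?_
  rw [ContinuousLinearMap.smul_apply, lp.coeFn_smul, Pi.smul_apply]
  simp only [Equiv.refl_apply, Equiv.refl_symm, wsB_ket_apply h]
  split_ifs with hh
  · rw [dval_eq, dval_eq, hh.1]
    push_cast
    rw [smul_eq_mul]
    ring
  · simp

lemma wsB_graded {t : WShift} (h : t.Bdd) : wsB t ∈ Graded :=
  Submodule.subset_span ⟨_, wsB_isCommutator h⟩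

/-- Exchanges H₊ and H₋; it is the sign of D. -/
def flipB : Spinors →L[ℂ] Spinors := pull (fun _ => 1) Idx.flip

lemma flipB_apply (f : Spinors) (k : Idx) : flipB f k = f (Idx.flip k) := by
  have hi : Function.Injective Idx.flip := Idx.flipEquiv.injective
  rw [flipB, pull_apply ⟨1, by simp⟩ hi.injOn]
  simp

lemma flip_eq_iff {i k : Idx} : Idx.flip i = k ↔ i = Idx.flip k :=
  ⟨fun h => by rw [← h, Idx.flip_flip], fun h => by rw [h, Idx.flip_flip]⟩

lemma flipB_ket (k : Idx) : flipB (ket k) = ket (Idx.flip k) := by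
  ext i
  rw [flipB_apply, ket_apply, ket_apply]
  simp only [flip_eq_iff]

lemma dval_flip (k : Idx) : dval (Idx.flip k) = dval k := rfl

lemma flipB_graded : flipB ∈ Graded := by
  refine Submodule.subset_span ⟨0, ?_⟩
  refine isCommutator_of_coord (e := Equiv.refl Idx) fun k i => ?_
  simp only [Equiv.refl_apply, Equiv.refl_symm, flipB_ket, ket_apply, zero_smul]
  rw [ContinuousLinearMap.zero_apply, lp.coeFn_zero, Pi.zero_apply, add_zero]
  split_ifs with hh
  · rw [hh, dval_flip]
  · simp

/-- In D t the weight is evaluated at chirality s and the eigenvalue after the shift; in t D the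
chirality is flipped first, so the weight is evaluated at -s and the eigenvalue before the shift.
The difference is `dterm`. -/
lemma wsB_isCommutator_dirac {t : WShift} (h : t.Bdd) (hd : t.dterm.Bdd) :
    IsCommutator dirac (wsB t) (flipB * wsB t.dterm) := by
  refine isCommutator_of_coord (e := Idx.flipEquiv) fun k i => ?_
  rw [ContinuousLinearMap.mul_apply, flipB_apply]
  change (dval i : ℂ) * (wsB t (ket k) : Spinors) (Idx.flip i) =
    dval (Idx.flip k) * (wsB t (ket (Idx.flip k)) : Spinors) i +
      (wsB t.dterm (ket k) : Spinors) (Idx.flip i)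
  have e3 : (wsB t.dterm (ket k) : Spinors) (Idx.flip i) =
      if (Idx.flip i).1.L = k.1.L + t.1.1 ∧ (Idx.flip i).1.M₁ = k.1.M₁ + t.1.2.1 ∧
        (Idx.flip i).1.M₂ = k.1.M₂ + t.1.2.2.1 ∧ (Idx.flip i).1.J = k.1.J + t.1.2.2.2 ∧
        (Idx.flip i).2 = k.2 then (t.dterm.wt k : ℂ) else 0 := wsB_ket_apply hd k (Idx.flip i)
  have e2 : (wsB t (ket (Idx.flip k)) : Spinors) i =
      if (Idx.flip i).1.L = k.1.L + t.1.1 ∧ (Idx.flip i).1.M₁ = k.1.M₁ + t.1.2.1 ∧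
        (Idx.flip i).1.M₂ = k.1.M₂ + t.1.2.2.1 ∧ (Idx.flip i).1.J = k.1.J + t.1.2.2.2 ∧
        (Idx.flip i).2 = k.2 then (t.wt (Idx.flip k) : ℂ) else 0 := by
    rw [wsB_ket_apply h]
    refine if_congr ?_ rfl rfl
    simp [Idx.flip, neg_eq_iff_eq_neg]
  rw [e2, e3, wsB_ket_apply h, dval_flip, dval_eq, dval_eq]
  by_cases hh : (Idx.flip i).1.L = k.1.L + t.1.1 ∧ (Idx.flip i).1.M₁ = k.1.M₁ + t.1.2.1 ∧
        (Idx.flip i).1.M₂ = k.1.M₂ + t.1.2.2.1 ∧ (Idx.flip i).1.J = k.1.J + t.1.2.2.2 ∧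
        (Idx.flip i).2 = k.2
  · rw [if_pos hh, if_pos hh, if_pos hh]
    have e : i.1.L = k.1.L + t.1.1 := hh.1
    rw [e]
    simp only [Idx.flip, WShift.dterm, WShift.wt]
    push_cast
    ring
  · rw [if_neg hh, if_neg hh, if_neg hh]
    simp

section Adm
variable {q : ℝ} (hq : q ∈ Set.Ioo (0:ℝ) 1)

def wS (q : ℝ) : ℤ → ℤ → ℝ := fun L J => q ^ J + q ^ (L - J)

lemma wq_eq (k : Idx) : wq q k = wS q k.1.L k.1.J := rfl

include hq

lemma zpow_le_one_of_nonneg {n : ℤ} (h : 0 ≤ n) : q ^ n ≤ 1 := zpow_le_one₀ hq.1 hq.2.le h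

lemma wS_pos (L J : ℤ) : 0 < wS q L J := add_pos (zpow_pos hq.1 _) (zpow_pos hq.1 _)

/-- A bounded shift of the labels changes the weight by a bounded factor. This makes the decay
condition stable under right multiplication by weighted shifts. -/
lemma wS_shift (L J a b : ℤ) : wS q (L + a) (J + b) ≤ (q ^ b + q ^ (a - b)) * wS q L J := by
  unfold wS
  have h0 := hq.1.ne'
  rw [show L + a - (J + b) = (L - J) + (a - b) by ring, zpow_add₀ h0, zpow_add₀ h0 (L - J)]
  have h1 := (zpow_pos hq.1 J).le
  have h2 := (zpow_pos hq.1 (L - J)).le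
  have h3 := (zpow_pos hq.1 b).le
  have h4 := (zpow_pos hq.1 (a - b)).le
  nlinarith [mul_nonneg h1 h4, mul_nonneg h2 h3]

lemma WShift.Le.bdd {t : WShift} (h : t.Le (wS q)) : t.Bdd :=
  h.mono (C := 2) fun L J h1 h2 => ⟨(wS_pos hq L J).le, by
    have := zpow_le_one_of_nonneg hq h1
    have := zpow_le_one_of_nonneg hq (sub_nonneg.2 h2)
    unfold wS
    linarith⟩

lemma WShift.Le.adj_small {t : WShift} (h : t.Le (wS q)) : t.adj.Le (wS q) :=
  h.adj ⟨_, fun L J _ _ _ _ => ⟨(wS_pos hq _ _).le, by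
    simpa only [sub_eq_add_neg] using wS_shift hq L J (-t.1.1) (-t.1.2.2.2)⟩⟩

lemma wsB_mem_admAlg {t : WShift} (h : t.Bdd) : wsB t ∈ admAlg (wq q) := by
  refine ⟨wsB_graded h, fun S ⟨C, hC⟩ => ?_⟩
  obtain ⟨D, hD⟩ := id h
  refine ⟨|D| * (|C| * (q ^ t.1.2.2.2 + q ^ (t.1.1 - t.1.2.2.2))), fun k => ?_⟩
  rw [ContinuousLinearMap.mul_apply]
  have hw := (wS_pos hq k.1.L k.1.J).le
  have h3 := (zpow_pos hq.1 t.1.2.2.2).le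
  have h4 := (zpow_pos hq.1 (t.1.1 - t.1.2.2.2)).le
  by_cases hk : t.Tgt k
  · rw [wsB_ket_of h hk, map_smul, norm_smul, Complex.norm_real, Real.norm_eq_abs, mul_assoc]
    have h1 := hD _ _ _ _ k.2 k.1.valid hk
    rw [mul_one] at h1
    refine mul_le_mul (h1.trans (le_abs_self D)) ((hC _).trans ?_) (norm_nonneg _) (abs_nonneg D)
    rw [wq_eq, wq_eq, mul_assoc]
    exact mul_le_mul (le_abs_self C) (wS_shift hq _ _ _ _) (wS_pos hq _ _).le (abs_nonneg C)
  · rw [wsB_ket_zero h hk, map_zero, norm_zero, wq_eq]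
    positivity

lemma flipB_mem_admAlg : flipB ∈ admAlg (wq q) := by
  refine ⟨flipB_graded, fun S ⟨C, hC⟩ => ⟨C, fun k => ?_⟩⟩
  rw [ContinuousLinearMap.mul_apply, flipB_ket]
  exact hC _

lemma wsB_mem_smallIdeal {t : WShift} (h : t.Le (wS q)) : wsB t ∈ smallIdeal (wq q) := by
  refine ⟨wsB_graded (h.bdd hq), ?_⟩
  obtain ⟨D, hD⟩ := id h
  refine ⟨|D|, fun k => ?_⟩
  have hw := (wS_pos hq k.1.L k.1.J).le
  by_cases hk : t.Tgt k
  · rw [wsB_ket_of (h.bdd hq) hk, norm_smul, norm_ket, mul_one, Complex.norm_real,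
      Real.norm_eq_abs]
    exact (hD _ _ _ _ k.2 k.1.valid hk).trans (mul_le_mul_of_nonneg_right (le_abs_self D) hw)
  · rw [wsB_ket_zero (h.bdd hq) hk, norm_zero, wq_eq]
    positivity

/-- The commutator of two admissible operators modulo the ideal depends only on their classes, so
both may be replaced by their leading parts. -/
lemma comm_congr {a a' b b' : Spinors →L[ℂ] Spinors} (ha : a ∈ admAlg (wq q))
    (hb' : b' ∈ admAlg (wq q)) (haa : a - a' ∈ smallIdeal (wq q))
    (hbb : b - b' ∈ smallIdeal (wq q)) (h : a' * b' - b' * a' ∈ smallIdeal (wq q)) :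
    a * b - b * a ∈ smallIdeal (wq q) := by
  have e : a * b - b * a = (a * (b - b') - (b - b') * a) +
      ((a - a') * b' - b' * (a - a')) + (a' * b' - b' * a') := by noncomm_ring
  rw [e]
  refine Submodule.add_mem _ (Submodule.add_mem _ (Submodule.sub_mem _ ?_ ?_)
    (Submodule.sub_mem _ ?_ ?_)) h
  · exact smallIdeal.mul_left ha hbb
  · exact smallIdeal.mul_right ha hbb
  · exact smallIdeal.mul_right hb' haa
  · exact smallIdeal.mul_left hb' haa

lemma wsB_sub_mem {t y : WShift} (ht : t.Bdd) (hy : y.Bdd) (h₁ : y.1 = t.1)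
    (h : WShift.Le (t.1, fun L M₁ M₂ J s => t.2 L M₁ M₂ J s - y.2 L M₁ M₂ J s) (wS q)) :
    wsB t - wsB y ∈ smallIdeal (wq q) := by
  have e : wsB t - wsB y = wsB (t.1, fun L M₁ M₂ J s => t.2 L M₁ M₂ J s - y.2 L M₁ M₂ J s) := by
    refine clm_ext fun k => ?_
    ext i
    rw [ContinuousLinearMap.sub_apply, lp.coeFn_sub, Pi.sub_apply, wsB_ket_apply ht,
      wsB_ket_apply hy, wsB_ket_apply (h.bdd hq), h₁]
    split_ifs
    · simp [WShift.wt]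
    · simp
  rw [e]
  exact wsB_mem_smallIdeal hq h

end Adm

/-! ### Conjugation by the real structure -/

lemma phase_eq_zpow (k : Label) : phase k = (-1) ^ (k.L + k.J + k.M₁) := by
  have h1 : Complex.I ^ (2 * k.L + 2) = (-1) ^ (k.L + 1) := by
    rw [show 2 * k.L + 2 = 2 * (k.L + 1) by ring, zpow_mul]
    norm_cast
    simp
  rw [phase, h1, ← zpow_add₀ (by norm_num),
    show k.L + 1 + (k.J + k.M₁ + 1) = (k.L + k.J + k.M₁) + 2 * 1 by ring,
    zpow_add₀ (by norm_num), zpow_mul]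
  norm_num

/-- Conjugation reflects m₁ and m₂. The sign -1 is J² = -1, in the form that the phases at a label
and at its reflection multiply to -1; the other sign compares the phases of source and target. -/
lemma realConj_wsB {t : WShift} (h : t.Bdd) : realConj (wsB t) = wsB t.rconj := by
  refine clm_ext fun k => ?_
  rw [realConj_apply, realStr_ket, map_smul]
  by_cases hk : t.Tgt (Idx.neg k)
  · have hk' : t.rconj.Tgt k := by
      have h1 := isLabel_iff.1 hk
      refine isLabel_iff.2 ?_
      simp only [Idx.neg, Label.neg, WShift.rconj] at h1 ⊢
      omega
    rw [wsB_ket_of h hk, wsB_ket_of h.rconj hk', smul_smul, map_smulₛₗ, realStr_ket, smul_smul]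
    have e1 : Idx.neg (t.tgt (Idx.neg k) hk) = t.rconj.tgt k hk' := by
      simp only [Idx.neg, Label.neg, WShift.tgt, WShift.rconj]
      ext <;> simp <;> ring
    have e2 : phase (t.tgt (Idx.neg k) hk).1 =
        phase k.1.neg * (-1) ^ (t.1.1 + t.1.2.1 + t.1.2.2.2) := by
      rw [phase_eq_zpow, phase_eq_zpow, ← zpow_add₀ (by norm_num)]
      congr 1
      simp only [Idx.neg, WShift.tgt]
      ring
    have e3 : t.rconj.wt k = -(-1) ^ (t.1.1 + t.1.2.1 + t.1.2.2.2) * t.wt (Idx.neg k) := rfl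
    rw [e1, e2, e3]
    congr 1
    rw [map_mul, conj_phase, Complex.conj_ofReal]
    push_cast
    linear_combination ((t.wt (Idx.neg k) : ℂ) * (-1) ^ (t.1.1 + t.1.2.1 + t.1.2.2.2)) *
      phase_mul_phase_neg k.1
  · have hk' : ¬ t.rconj.Tgt k := fun hk' => hk <| by
      have h1 := isLabel_iff.1 hk'
      refine isLabel_iff.2 ?_
      simp only [Idx.neg, Label.neg, WShift.rconj] at h1 ⊢
      omega
    rw [wsB_ket_zero h hk, wsB_ket_zero h.rconj hk', smul_zero, map_zero]

lemma realConj_add (a b : Spinors →L[ℂ] Spinors) : realConj (a + b) = realConj a + realConj b := by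
  ext1 v
  simp [realConj_apply]

lemma realStr_realStr (v : Spinors) : realStr (realStr v) = -v := realFun_realFun v

/-- The sign comes from inserting J² = -1 between the factors. It is harmless, since only membership
in a generated algebra is needed. -/
lemma realConj_mul (a b : Spinors →L[ℂ] Spinors) :
    realConj (a * b) = -(realConj a * realConj b) := by
  ext1 v
  simp [realConj_apply, realStr_realStr]

lemma realConj_algebraMap (c : ℂ) : realConj (algebraMap ℂ _ c) = algebraMap ℂ _ (-conj c) := by
  ext1 v
  rw [realConj_apply, Algebra.algebraMap_eq_smul_one, Algebra.algebraMap_eq_smul_one,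
    ContinuousLinearMap.smul_apply, ContinuousLinearMap.smul_apply, map_smulₛₗ]
  simp [realStr_realStr]

end

section

/-! ### Leading parts of the generators -/

/-- With `pp`, this recovers the coordinates r and p from the labels, for both parities. -/
def rr (L N J : ℤ) : ℤ := L - J - (L - J - N) / 2

def pp (L N J : ℤ) : ℤ := (L - J - N) / 2

/-- The shift moves r by δ and fixes p, J, M and the parity; the weight depends on r alone. -/
def colR (δ : ℤ) (f : ℤ → ℝ) : WShift := ((δ, 0, δ, 0), fun L _ N J _ => f (rr L N J))

def colP (δ : ℤ) (f : ℤ → ℝ) : WShift := ((δ, 0, -δ, 0), fun L _ N J _ => f (pp L N J))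

/-- The shift moves (J, M) and fixes p, r and the parity; the dependence on r is the factor q^(2r).
-/
def rowR (q : ℝ) (δ m : ℤ) (g : ℤ → ℤ → ℝ) : WShift :=
  ((δ, m, 0, δ), fun L M N J _ => q ^ (2 * rr L N J) * g J M)

def rowP (q : ℝ) (δ m : ℤ) (g : ℤ → ℤ → ℝ) : WShift :=
  ((δ, m, 0, δ), fun L M N J _ => q ^ (2 * pp L N J) * g J M)

/-- `f` is bounded on the `n ≥ 0` with `n + δ ≥ 0`. -/
def ColBdd (f : ℤ → ℝ) (δ : ℤ) : Prop := ∃ C, ∀ n, 0 ≤ n → 0 ≤ n + δ → |f n| ≤ C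

def IsRow (J M : ℤ) : Prop := 0 ≤ J ∧ -J - 1 ≤ M ∧ M ≤ J

def RowBdd (g : ℤ → ℤ → ℝ) (δ m : ℤ) : Prop :=
  ∃ C, ∀ J M, IsRow J M → IsRow (J + δ) (M + m) → |g J M| ≤ C

lemma colR_adj (δ : ℤ) (f : ℤ → ℝ) : (colR δ f).adj = colR (-δ) fun n => f (n - δ) := by
  refine WShift.ext' (by simp [colR, WShift.adj]) fun L M N J s => ?_
  simp only [colR, WShift.adj]
  congr 1
  unfold rr
  omega

lemma rowR_adj (q : ℝ) (δ m : ℤ) (g : ℤ → ℤ → ℝ) :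
    (rowR q δ m g).adj = rowR q (-δ) (-m) fun J M => g (J - δ) (M - m) := by
  refine WShift.ext' (by simp [rowR, WShift.adj]) fun L M N J s => ?_
  simp only [rowR, WShift.adj]
  congr 3
  unfold rr
  omega

/-- The reflection N ↦ -N - 1 changes the parity of L - J - N and exchanges p and r. -/
lemma colR_rconj (δ : ℤ) (f : ℤ → ℝ) :
    (colR δ f).rconj = colP δ fun n => -(-1) ^ (δ + 0 + 0) * f n := by
  refine WShift.ext' (by simp [colR, colP, WShift.rconj]) fun L M N J s => ?_
  simp only [colR, colP, WShift.rconj]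
  congr 2
  unfold rr pp
  omega

lemma rowR_rconj (q : ℝ) (δ m : ℤ) (g : ℤ → ℤ → ℝ) :
    (rowR q δ m g).rconj = rowP q δ (-m) fun J M => -(-1) ^ (δ + m + δ) * g J (-M - 1) := by
  refine WShift.ext' (by simp [rowR, rowP, WShift.rconj]) fun L M N J s => ?_
  simp only [rowR, rowP, WShift.rconj]
  rw [mul_left_comm, show rr L (-N - 1) J = pp L N J by unfold rr pp; omega]

lemma ColBdd.rconj {f : ℤ → ℝ} {δ : ℤ} (h : ColBdd f δ) (e : ℤ) :
    ColBdd (fun n => -(-1) ^ e * f n) δ := by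
  obtain ⟨C, hC⟩ := h
  refine ⟨C, fun n h1 h2 => ?_⟩
  rw [abs_mul, abs_neg, abs_neg_one_zpow, one_mul]
  exact hC n h1 h2

lemma RowBdd.rconj {g : ℤ → ℤ → ℝ} {δ m : ℤ} (h : RowBdd g δ m) (e : ℤ) :
    RowBdd (fun J M => -(-1) ^ e * g J (-M - 1)) δ (-m) := by
  obtain ⟨C, hC⟩ := h
  refine ⟨C, fun J M h1 h2 => ?_⟩
  rw [abs_mul, abs_neg, abs_neg_one_zpow, one_mul]
  unfold IsRow at *
  exact hC _ _ (by omega) (by omega)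

lemma ColBdd.adj {f : ℤ → ℝ} {δ : ℤ} (h : ColBdd f δ) : ColBdd (fun n => f (n - δ)) (-δ) := by
  obtain ⟨C, hC⟩ := h
  exact ⟨C, fun n h1 h2 => hC _ (by omega) (by omega)⟩

lemma RowBdd.adj {g : ℤ → ℤ → ℝ} {δ m : ℤ} (h : RowBdd g δ m) :
    RowBdd (fun J M => g (J - δ) (M - m)) (-δ) (-m) := by
  obtain ⟨C, hC⟩ := h
  refine ⟨C, fun J M h1 h2 => ?_⟩
  unfold IsRow at *
  exact hC _ _ (by omega) (by omega)

lemma IsLabel.rr_nonneg {L M N J : ℤ} (h : IsLabel L M N J) : 0 ≤ rr L N J := by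
  have := h.bounds
  unfold rr
  omega

lemma IsLabel.pp_nonneg {L M N J : ℤ} (h : IsLabel L M N J) : 0 ≤ pp L N J := by
  have := h.bounds
  unfold pp
  omega

lemma IsLabel.isRow {L M N J : ℤ} (h : IsLabel L M N J) : IsRow J M := by
  have := h.bounds
  unfold IsRow
  omega

lemma ColBdd.colR_bdd {f : ℤ → ℝ} {δ : ℤ} (h : ColBdd f δ) : (colR δ f).Bdd := by
  obtain ⟨C, hC⟩ := h
  refine ⟨C, fun L M N J s h1 h2 => ?_⟩
  simp only [colR] at h2 ⊢
  rw [mul_one]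
  refine hC _ h1.rr_nonneg ?_
  have := h2.rr_nonneg
  unfold rr at *
  omega

lemma ColBdd.colP_bdd {f : ℤ → ℝ} {δ : ℤ} (h : ColBdd f δ) : (colP δ f).Bdd := by
  obtain ⟨C, hC⟩ := h
  refine ⟨C, fun L M N J s h1 h2 => ?_⟩
  simp only [colP] at h2 ⊢
  rw [mul_one]
  refine hC _ h1.pp_nonneg ?_
  have := h2.pp_nonneg
  unfold pp at *
  omega

/-- The hypothesis on labels says that whenever the composite shift ends at a label, both
intermediate positions are labels. This holds when the shifts act on independent coordinates, the
label set being a product; it excludes that one order of composition vanishes at the boundary and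
the other does not. -/
lemma wsB_comm {t t' : WShift} (h : t.Bdd) (h' : t'.Bdd)
    (h₁ : ∀ L M N J, IsLabel L M N J → IsLabel (L + t.1.1 + t'.1.1) (M + t.1.2.1 + t'.1.2.1)
      (N + t.1.2.2.1 + t'.1.2.2.1) (J + t.1.2.2.2 + t'.1.2.2.2) →
      IsLabel (L + t.1.1) (M + t.1.2.1) (N + t.1.2.2.1) (J + t.1.2.2.2) ∧
      IsLabel (L + t'.1.1) (M + t'.1.2.1) (N + t'.1.2.2.1) (J + t'.1.2.2.2))
    (h₂ : ∀ L M N J s,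
      t.2 (L + t'.1.1) (M + t'.1.2.1) (N + t'.1.2.2.1) (J + t'.1.2.2.2) s * t'.2 L M N J s =
      t'.2 (L + t.1.1) (M + t.1.2.1) (N + t.1.2.2.1) (J + t.1.2.2.2) s * t.2 L M N J s) :
    wsB t * wsB t' = wsB t' * wsB t := by
  refine clm_ext fun k => ?_
  rw [ContinuousLinearMap.mul_apply, ContinuousLinearMap.mul_apply]
  by_cases hk : IsLabel (k.1.L + t.1.1 + t'.1.1) (k.1.M₁ + t.1.2.1 + t'.1.2.1)
      (k.1.M₂ + t.1.2.2.1 + t'.1.2.2.1) (k.1.J + t.1.2.2.2 + t'.1.2.2.2)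
  · obtain ⟨a, a'⟩ := h₁ _ _ _ _ k.1.valid hk
    have b : t'.Tgt (t.tgt k a) := hk
    have b' : t.Tgt (t'.tgt k a') := by
      unfold WShift.Tgt WShift.tgt
      dsimp only
      convert hk using 1 <;> ring
    rw [wsB_ket_of h' (show t'.Tgt k from a'), wsB_ket_of h (show t.Tgt k from a), map_smul,
      map_smul, wsB_ket_of h b', wsB_ket_of h' b, smul_smul, smul_smul]
    have e : t.tgt _ b' = t'.tgt _ b := by
      unfold WShift.tgt
      ext <;> simp <;> ring
    rw [e]
    congr 1
    have := h₂ k.1.L k.1.M₁ k.1.M₂ k.1.J k.2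
    rw [← Complex.ofReal_mul, ← Complex.ofReal_mul]
    congr 1
    unfold WShift.wt WShift.tgt
    dsimp only
    linarith
  · have e : wsB t' (wsB t (ket k)) = 0 := by
      by_cases a : t.Tgt k
      · rw [wsB_ket_of h a, map_smul, wsB_ket_zero h' (show ¬ t'.Tgt (t.tgt k a) from hk), smul_zero]
      · rw [wsB_ket_zero h a, map_zero]
    have e' : wsB t (wsB t' (ket k)) = 0 := by
      by_cases a : t'.Tgt k
      · rw [wsB_ket_of h' a, map_smul, wsB_ket_zero h (k := t'.tgt k a), smul_zero]
        unfold WShift.Tgt WShift.tgt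
        dsimp only
        convert hk using 2 <;> ring
      · rw [wsB_ket_zero h' a, map_zero]
    rw [e, e']

section
variable {q : ℝ} (hq : q ∈ Set.Ioo (0:ℝ) 1)
include hq

lemma RowBdd.rowR_bdd {g : ℤ → ℤ → ℝ} {δ m : ℤ} (h : RowBdd g δ m) : (rowR q δ m g).Bdd := by
  obtain ⟨C, hC⟩ := h
  refine ⟨C, fun L M N J s h1 h2 => ?_⟩
  simp only [rowR] at h2 ⊢
  rw [mul_one, abs_mul, abs_of_pos (zpow_pos hq.1 _)]
  have h3 := hC _ _ h1.isRow h2.isRow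
  have h4 := zpow_le_one_of_nonneg hq (n := 2 * rr L N J) (by have := h1.rr_nonneg; omega)
  calc _ ≤ 1 * |g J M| := by gcongr
    _ ≤ C := by rwa [one_mul]

lemma RowBdd.rowP_bdd {g : ℤ → ℤ → ℝ} {δ m : ℤ} (h : RowBdd g δ m) : (rowP q δ m g).Bdd := by
  obtain ⟨C, hC⟩ := h
  refine ⟨C, fun L M N J s h1 h2 => ?_⟩
  simp only [rowP] at h2 ⊢
  rw [mul_one, abs_mul, abs_of_pos (zpow_pos hq.1 _)]
  have h3 := hC _ _ h1.isRow h2.isRow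
  have h4 := zpow_le_one_of_nonneg hq (n := 2 * pp L N J) (by have := h1.pp_nonneg; omega)
  calc _ ≤ 1 * |g J M| := by gcongr
    _ ≤ C := by rwa [one_mul]

omit hq in
lemma zpow_rr_pp (q : ℝ) (h0 : q ≠ 0) (L N J : ℤ) (h : pp L N J + rr L N J = L - J) :
    q ^ (2 * rr L N J) * q ^ (2 * pp L N J) = q ^ (2 * (L - J)) := by
  rw [← zpow_add₀ h0, ← h]
  congr 1
  ring

lemma zpow_two_le_wS {L J : ℤ} (h : J ≤ L) : q ^ (2 * (L - J)) ≤ wS q L J := by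
  unfold wS
  have h1 : q ^ (2 * (L - J)) ≤ q ^ (L - J) :=
    zpow_le_zpow_right_of_le_one₀ hq.1 hq.2.le (by omega)
  have := zpow_pos hq.1 J
  linarith

/-- Both factors move (J, M), so they need not commute. But neither changes p or r, so each product
carries q^(2r)q^(2p) = q^(2(L-J)) and is small by itself. -/
lemma rowR_mul_rowP {g g' : ℤ → ℤ → ℝ} {δ m δ' m' : ℤ} (h : RowBdd g δ m) (h' : RowBdd g' δ' m') :
    wsB (rowR q δ m g) * wsB (rowP q δ' m' g') ∈ smallIdeal (wq q) ∧
    wsB (rowP q δ' m' g') * wsB (rowR q δ m g) ∈ smallIdeal (wq q) := by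
  have hb := h.rowR_bdd hq
  have hb' := h'.rowP_bdd hq
  obtain ⟨C, hC⟩ := h
  obtain ⟨C', hC'⟩ := h'
  refine ⟨⟨Graded.mul (wsB_graded hb) (wsB_graded hb'), |C| * |C'|, fun k => ?_⟩,
    ⟨Graded.mul (wsB_graded hb') (wsB_graded hb), |C| * |C'|, fun k => ?_⟩⟩
  · rw [ContinuousLinearMap.mul_apply]
    have hw := (wS_pos hq k.1.L k.1.J).le
    by_cases a : (rowP q δ' m' g').Tgt k
    · rw [wsB_ket_of hb' a, map_smul]
      by_cases b : (rowR q δ m g).Tgt ((rowP q δ' m' g').tgt k a)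
      · rw [wsB_ket_of hb b, norm_smul, norm_smul, norm_ket, mul_one, Complex.norm_real,
          Complex.norm_real, Real.norm_eq_abs, Real.norm_eq_abs]
        have h1 := hC' _ _ k.1.valid.isRow (IsLabel.isRow a)
        have h2 := hC _ _ (IsLabel.isRow a) (IsLabel.isRow b)
        have e : rr (k.1.L + δ') (k.1.M₂ + 0) (k.1.J + δ') = rr k.1.L k.1.M₂ k.1.J := by
          unfold rr; omega
        have e2 := zpow_rr_pp q hq.1.ne' k.1.L k.1.M₂ k.1.J (by unfold rr pp; omega)
        have e3 := zpow_two_le_wS hq k.1.valid.bounds.2.1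
        simp only [WShift.wt, WShift.tgt, rowP, rowR] at h1 h2 ⊢
        rw [e, abs_mul, abs_mul, abs_of_pos (zpow_pos hq.1 _), abs_of_pos (zpow_pos hq.1 _)]
        calc _ = q ^ (2 * (k.1.L - k.1.J)) * (|g (k.1.J + δ') (k.1.M₁ + m')| * |g' k.1.J k.1.M₁|) := by
              rw [← e2]; ring
          _ ≤ wS q k.1.L k.1.J * (|C| * |C'|) := by
              have := h1.trans (le_abs_self _)
              have := h2.trans (le_abs_self _)
              gcongr
          _ = _ := mul_comm _ _
      · rw [wsB_ket_zero hb b, smul_zero, norm_zero, wq_eq]; positivity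
    · rw [wsB_ket_zero hb' a, map_zero, norm_zero, wq_eq]; positivity
  · rw [ContinuousLinearMap.mul_apply]
    have hw := (wS_pos hq k.1.L k.1.J).le
    by_cases a : (rowR q δ m g).Tgt k
    · rw [wsB_ket_of hb a, map_smul]
      by_cases b : (rowP q δ' m' g').Tgt ((rowR q δ m g).tgt k a)
      · rw [wsB_ket_of hb' b, norm_smul, norm_smul, norm_ket, mul_one, Complex.norm_real,
          Complex.norm_real, Real.norm_eq_abs, Real.norm_eq_abs]
        have h1 := hC _ _ k.1.valid.isRow (IsLabel.isRow a)
        have h2 := hC' _ _ (IsLabel.isRow a) (IsLabel.isRow b)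
        have e : pp (k.1.L + δ) (k.1.M₂ + 0) (k.1.J + δ) = pp k.1.L k.1.M₂ k.1.J := by
          unfold pp; omega
        have e2 := zpow_rr_pp q hq.1.ne' k.1.L k.1.M₂ k.1.J (by unfold rr pp; omega)
        have e3 := zpow_two_le_wS hq k.1.valid.bounds.2.1
        simp only [WShift.wt, WShift.tgt, rowP, rowR] at h1 h2 ⊢
        rw [e, abs_mul, abs_mul, abs_of_pos (zpow_pos hq.1 _), abs_of_pos (zpow_pos hq.1 _)]
        calc _ = q ^ (2 * (k.1.L - k.1.J)) * (|g k.1.J k.1.M₁| * |g' (k.1.J + δ) (k.1.M₁ + m)|) := by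
              rw [← e2]; ring
          _ ≤ wS q k.1.L k.1.J * (|C| * |C'|) := by
              have := h1.trans (le_abs_self _)
              have := h2.trans (le_abs_self _)
              gcongr
          _ = _ := mul_comm _ _
      · rw [wsB_ket_zero hb' b, smul_zero, norm_zero, wq_eq]; positivity
    · rw [wsB_ket_zero hb a, map_zero, norm_zero, wq_eq]; positivity

end

/-- The leading parts: shifts of `(j + ..., r)` with decoupled weights. -/
def IsMain (q : ℝ) (y : WShift) : Prop :=
  (∃ δ f, ColBdd f δ ∧ y = colR δ f) ∨ ∃ δ m g, RowBdd g δ m ∧ y = rowR q δ m g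

section
variable {q : ℝ}

lemma IsMain.adj {y : WShift} (h : IsMain q y) : IsMain q y.adj := by
  rcases h with ⟨δ, f, h, rfl⟩ | ⟨δ, m, g, h, rfl⟩
  · exact Or.inl ⟨_, _, h.adj, colR_adj δ f⟩
  · exact Or.inr ⟨_, _, _, h.adj, rowR_adj q δ m g⟩

lemma IsMain.const_mul {y : WShift} (h : IsMain q y) (c : ℝ) :
    IsMain q (y.1, fun L M N J s => c * y.2 L M N J s) := by
  rcases h with ⟨δ, f, ⟨C, hC⟩, rfl⟩ | ⟨δ, m, g, ⟨C, hC⟩, rfl⟩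
  · refine Or.inl ⟨δ, fun n => c * f n, ⟨|c| * C, fun n h1 h2 => ?_⟩, rfl⟩
    rw [abs_mul]
    exact mul_le_mul_of_nonneg_left (hC n h1 h2) (abs_nonneg c)
  · refine Or.inr ⟨δ, m, fun J M => c * g J M, ⟨|c| * C, fun J M h1 h2 => ?_⟩, ?_⟩
    · rw [abs_mul]
      exact mul_le_mul_of_nonneg_left (hC J M h1 h2) (abs_nonneg c)
    · exact WShift.ext' rfl fun L M N J s => mul_left_comm _ _ _

variable (hq : q ∈ Set.Ioo (0:ℝ) 1)
include hq

lemma IsMain.bdd {y : WShift} (h : IsMain q y) : y.Bdd := by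
  rcases h with ⟨δ, f, h, rfl⟩ | ⟨δ, m, g, h, rfl⟩
  · exact h.colR_bdd
  · exact h.rowR_bdd hq

/-- The conjugated operator moves p or (J, M), with weights in p and (J, M). It therefore commutes
with shifts of r, and a shift of p commutes with those of (J, M) weighted by q^(2r); only two shifts
of (J, M) collide, and then both products lie in the ideal. -/
lemma IsMain.comm {y y' : WShift} (h : IsMain q y) (h' : IsMain q y') :
    wsB y * wsB y'.rconj - wsB y'.rconj * wsB y ∈ smallIdeal (wq q) := by
  rcases h with ⟨δ, f, h, rfl⟩ | ⟨δ, m, g, h, rfl⟩ <;>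
  rcases h' with ⟨δ', f', h', rfl⟩ | ⟨δ', m', g', h', rfl⟩
  · rw [colR_rconj, wsB_comm h.colR_bdd (h'.rconj _).colP_bdd, sub_self]
    · exact Submodule.zero_mem _
    · intro L M N J h1 h2
      simp only [isLabel_iff, colR, colP] at h1 h2 ⊢
      omega
    · intro L M N J s
      simp only [colR, colP]
      rw [show rr (L + δ') (N + -δ') (J + 0) = rr L N J by unfold rr; omega,
        show pp (L + δ) (N + δ) (J + 0) = pp L N J by unfold pp; omega, mul_comm]
  · rw [rowR_rconj, wsB_comm h.colR_bdd ((h'.rconj _).rowP_bdd hq), sub_self]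
    · exact Submodule.zero_mem _
    · intro L M N J h1 h2
      simp only [isLabel_iff, colR, rowP] at h1 h2 ⊢
      omega
    · intro L M N J s
      simp only [colR, rowP]
      rw [show rr (L + δ') (N + 0) (J + δ') = rr L N J by unfold rr; omega,
        show pp (L + δ) (N + δ) (J + 0) = pp L N J by unfold pp; omega, mul_comm, add_zero, add_zero]
  · rw [colR_rconj, wsB_comm (h.rowR_bdd hq) (h'.rconj _).colP_bdd, sub_self]
    · exact Submodule.zero_mem _
    · intro L M N J h1 h2
      simp only [isLabel_iff, rowR, colP] at h1 h2 ⊢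
      omega
    · intro L M N J s
      simp only [rowR, colP]
      rw [show rr (L + δ') (N + -δ') (J + 0) = rr L N J by unfold rr; omega,
        show pp (L + δ) (N + 0) (J + δ) = pp L N J by unfold pp; omega, mul_comm]
      simp only [add_zero]
  · rw [rowR_rconj]
    have := rowR_mul_rowP hq h (h'.rconj (δ' + m' + δ'))
    exact Submodule.sub_mem _ this.1 this.2

end

/-- `t` does not depend on the sign and is small up to a leading part. -/
def Good (q : ℝ) (t : WShift) : Prop :=
  (∀ L M N J s s', t.2 L M N J s = t.2 L M N J s') ∧ t.Bdd ∧
    (t.Le (wS q) ∨ ∃ y : ℤ → ℤ → ℤ → ℤ → ℤˣ → ℝ, IsMain q (t.1, y) ∧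
      WShift.Le (t.1, fun L M N J s => t.2 L M N J s - y L M N J s) (wS q))

/-- The terms that may depend on the chirality. The bound q^(2L) is stronger than smallness, so as
to survive the factor l + 3/2 in the commutator with D. -/
def Tiny (q : ℝ) (t : WShift) : Prop := t.1.1 = 0 ∧ t.Le fun L _ => q ^ (2 * L)

section
variable {q : ℝ} {t : WShift}

lemma WShift.Bdd.const_mul (h : t.Bdd) (c : ℝ) :
    WShift.Bdd (t.1, fun L M N J s => c * t.2 L M N J s) :=
  WShift.Le.const_mul (sh := t.1) h c

lemma Good.const_mul (h : Good q t) (c : ℝ) : Good q (t.1, fun L M N J s => c * t.2 L M N J s) := by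
  obtain ⟨h1, h2, h3⟩ := h
  refine ⟨fun L M N J s s' => congrArg (c * ·) (h1 L M N J s s'), h2.const_mul c, ?_⟩
  rcases h3 with h3 | ⟨y, hy, h3⟩
  · exact Or.inl (WShift.Le.const_mul (sh := t.1) h3 c)
  · refine Or.inr ⟨fun L M N J s => c * y L M N J s, hy.const_mul c, ?_⟩
    have := h3.const_mul c
    simpa only [mul_sub] using this

/-- If the weight ignores the chirality, the terms proportional to L cancel, and `dterm` is the
weight times the shift of L. -/
lemma Good.dterm (h : Good q t) : Good q t.dterm := by
  have e : t.dterm = (t.1, fun L M N J s => (t.1.1 : ℝ) * t.2 L M N J s) := by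
    refine WShift.ext' rfl fun L M N J s => ?_
    simp only [WShift.dterm]
    rw [h.1 L M N J (-s) s]
    ring
  rw [e]
  exact h.const_mul _

variable (hq : q ∈ Set.Ioo (0:ℝ) 1)
include hq

lemma Good.adj (h : Good q t) : Good q t.adj := by
  obtain ⟨h1, h2, h3⟩ := h
  refine ⟨fun L M N J s s' => h1 _ _ _ _ s s', h2.adj, ?_⟩
  rcases h3 with h3 | ⟨y, hy, h3⟩
  · exact Or.inl (h3.adj_small hq)
  · exact Or.inr ⟨_, hy.adj, h3.adj_small hq⟩

lemma Tiny.le (h : Tiny q t) : t.Le (wS q) := by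
  refine h.2.mono (C := 1) fun L J h1 h2 => ⟨(zpow_pos hq.1 _).le, ?_⟩
  rw [one_mul]
  have h3 : q ^ (2 * L) ≤ q ^ J := zpow_le_zpow_right_of_le_one₀ hq.1 hq.2.le (by omega)
  have := zpow_pos hq.1 (L - J)
  unfold wS
  linarith

lemma Tiny.adj (h : Tiny q t) : Tiny q t.adj := by
  refine ⟨by simp [WShift.adj, h.1], h.2.adj ⟨1, fun L J _ _ _ _ => ?_⟩⟩
  rw [h.1, sub_zero, one_mul]
  exact ⟨(zpow_pos hq.1 _).le, le_rfl⟩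

lemma exists_linear_mul_zpow_le : ∃ C, ∀ L : ℤ, 0 ≤ L → ((L : ℝ) + 2) * q ^ L ≤ C := by
  have h1 := summable_pow_mul_geometric_of_norm_lt_one (R := ℝ) 1 (r := q)
      (by rw [Real.norm_of_nonneg hq.1.le]; exact hq.2)
  obtain ⟨C, hC⟩ := h1.tendsto_atTop_zero.bddAbove_range
  refine ⟨C + 2, fun L hL => ?_⟩
  obtain ⟨n, rfl⟩ := Int.eq_ofNat_of_zero_le hL
  have h2 := hC ⟨n, rfl⟩
  have h3 : q ^ n ≤ 1 := pow_le_one₀ hq.1.le hq.2.le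
  simp only [pow_one] at h2
  push_cast
  rw [zpow_natCast, add_mul]
  linarith

/-- Of q^(2L) = q^L q^L one factor compensates for L + 2 and the other is at most q^J. -/
lemma Tiny.dterm_le (h : Tiny q t) : t.dterm.Le (wS q) := by
  obtain ⟨h0, C, hC⟩ := h
  obtain ⟨D, hD⟩ := exists_linear_mul_zpow_le hq
  refine ⟨2 * |C| * D, fun L M N J s h1 h2 => ?_⟩
  have hb := h1.bounds
  have a1 := (hC L M N J s h1 h2).trans (mul_le_mul_of_nonneg_right (le_abs_self C) (zpow_pos hq.1 _).le)
  have a2 := (hC L M N J (-s) h1 h2).trans (mul_le_mul_of_nonneg_right (le_abs_self C) (zpow_pos hq.1 _).le)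
  have a3 := hD L (by omega)
  have hL : (0 : ℝ) ≤ (L : ℝ) + 2 := by
    have : (0 : ℝ) ≤ (L : ℝ) := by exact_mod_cast hb.1.trans hb.2.1
    linarith
  have a4 : q ^ L ≤ wS q L J := by
    have h3 : q ^ L ≤ q ^ J := zpow_le_zpow_right_of_le_one₀ hq.1 hq.2.le hb.2.1
    have := zpow_pos hq.1 (L - J)
    unfold wS
    linarith
  have hD0 : 0 ≤ D := le_trans (mul_nonneg hL (zpow_pos hq.1 _).le) a3
  simp only [WShift.dterm, h0, Int.cast_zero, add_zero]
  calc _ ≤ ((L : ℝ) + 2) * (|t.2 L M N J s| + |t.2 L M N J (-s)|) := by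
        rw [← mul_sub, abs_mul, abs_of_nonneg hL]
        exact mul_le_mul_of_nonneg_left (abs_sub _ _) hL
    _ ≤ ((L : ℝ) + 2) * (|C| * q ^ (2 * L) + |C| * q ^ (2 * L)) := by gcongr
    _ = 2 * |C| * (((L : ℝ) + 2) * q ^ L) * q ^ L := by
        rw [show 2 * L = L + L by ring, zpow_add₀ hq.1.ne']; ring
    _ ≤ 2 * |C| * D * wS q L J := by
        have := (zpow_pos hq.1 L).le
        gcongr

end

def Cls (q : ℝ) (t : WShift) : Prop := Good q t ∨ Tiny q t

/-- The conjugates of the weighted shifts that can occur. The algebra they generate contains JbJ for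
every b, so commutators have to be estimated only against these. -/
def conjSet (q : ℝ) : Set (Spinors →L[ℂ] Spinors) := {T | ∃ t, Cls q t ∧ T = realConj (wsB t)}

section
variable {q : ℝ} {t : WShift} (hq : q ∈ Set.Ioo (0:ℝ) 1)
include hq

lemma Cls.bdd (h : Cls q t) : t.Bdd := h.elim (fun h => h.2.1) fun h => (h.le hq).bdd hq

lemma Cls.adj (h : Cls q t) : Cls q t.adj :=
  h.elim (fun h => Or.inl (h.adj hq)) fun h => Or.inr (h.adj hq)

lemma Cls.dterm_bdd (h : Cls q t) : t.dterm.Bdd :=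
  h.elim (fun h => h.dterm.2.1) fun h => (h.dterm_le hq).bdd hq

lemma conjSet_subset : conjSet q ⊆ admAlg (wq q) := by
  rintro _ ⟨t, ht, rfl⟩
  rw [realConj_wsB (ht.bdd hq)]
  exact wsB_mem_admAlg hq (ht.bdd hq).rconj

/-- If one of the two operators is small, both products are in the ideal. Otherwise both are
replaced by their leading parts, to which `IsMain.comm` applies. -/
lemma Good.mem_commAlg (h : Good q t) : wsB t ∈ commAlg (wq q) _ (conjSet_subset hq) := by
  refine ⟨wsB_mem_admAlg hq h.2.1, ?_⟩
  rintro _ ⟨t', ht', rfl⟩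
  have hb' := ht'.bdd hq
  rw [realConj_wsB hb']
  have small : t'.Le (wS q) → wsB t * wsB t'.rconj - wsB t'.rconj * wsB t ∈ smallIdeal (wq q) :=
    fun hs => Submodule.sub_mem _
      (smallIdeal.mul_left (wsB_mem_admAlg hq h.2.1) (wsB_mem_smallIdeal hq hs.rconj))
      (smallIdeal.mul_right (wsB_mem_admAlg hq h.2.1) (wsB_mem_smallIdeal hq hs.rconj))
  rcases ht' with ht' | ht'
  · obtain ⟨-, -, h' | ⟨y', hy', hs'⟩⟩ := ht'
    · exact small h'
    · obtain ⟨-, -, h | ⟨y, hy, hs⟩⟩ := id h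
      · exact Submodule.sub_mem _
          (smallIdeal.mul_right (wsB_mem_admAlg hq hb'.rconj) (wsB_mem_smallIdeal hq h))
          (smallIdeal.mul_left (wsB_mem_admAlg hq hb'.rconj) (wsB_mem_smallIdeal hq h))
      · refine comm_congr hq (wsB_mem_admAlg hq h.2.1) (wsB_mem_admAlg hq (hy'.bdd hq).rconj)
          (wsB_sub_mem hq h.2.1 (hy.bdd hq) rfl hs)
          (wsB_sub_mem hq hb'.rconj (hy'.bdd hq).rconj rfl ?_) (hy.comm hq hy')
        have := hs'.rconj
        simpa only [WShift.rconj, mul_sub] using this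
  · exact small (ht'.le hq)

lemma Cls.mem_commAlg (h : Cls q t) : wsB t ∈ commAlg (wq q) _ (conjSet_subset hq) := by
  rcases h with h | h
  · exact h.mem_commAlg hq
  · exact smallIdeal.mem_commAlg (wsB_mem_smallIdeal hq (h.le hq)) (conjSet_subset hq)

lemma Cls.dterm_mem_commAlg (h : Cls q t) :
    wsB t.dterm ∈ commAlg (wq q) _ (conjSet_subset hq) := by
  rcases h with h | h
  · exact h.dterm.mem_commAlg hq
  · exact smallIdeal.mem_commAlg (wsB_mem_smallIdeal hq (h.dterm_le hq)) (conjSet_subset hq)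

/-- The exchange of chiralities commutes exactly with shifts whose weight ignores the chirality, and
the remaining ones lie in the ideal. -/
lemma flipB_mem_commAlg : flipB ∈ commAlg (wq q) _ (conjSet_subset hq) := by
  refine ⟨flipB_mem_admAlg hq, ?_⟩
  rintro _ ⟨t, ht, rfl⟩
  have hb := ht.bdd hq
  rw [realConj_wsB hb]
  rcases ht with ht | ht
  · have e : flipB * wsB t.rconj = wsB t.rconj * flipB := by
      refine clm_ext fun k => ?_
      rw [ContinuousLinearMap.mul_apply, ContinuousLinearMap.mul_apply, flipB_ket]
      by_cases hk : t.rconj.Tgt k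
      · rw [wsB_ket_of hb.rconj hk, wsB_ket_of hb.rconj (show t.rconj.Tgt (Idx.flip k) from hk),
          map_smul, flipB_ket]
        congr 2
        simp only [WShift.wt, WShift.rconj, Idx.flip]
        rw [ht.1]
      · rw [wsB_ket_zero hb.rconj hk,
          wsB_ket_zero hb.rconj (show ¬ t.rconj.Tgt (Idx.flip k) from hk), map_zero]
    rw [e, sub_self]
    exact Submodule.zero_mem _
  · have hs := wsB_mem_smallIdeal hq (ht.le hq).rconj
    exact Submodule.sub_mem _ (smallIdeal.mul_left (flipB_mem_admAlg hq) hs)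
      (smallIdeal.mul_right (flipB_mem_admAlg hq) hs)

variable {l : List WShift} (hl : ∀ t ∈ l, Cls q t)
include hl

lemma opB_mem_commAlg : opB l ∈ commAlg (wq q) _ (conjSet_subset hq) := by
  refine Subalgebra.list_sum_mem _ fun T hT => ?_
  obtain ⟨t, ht, rfl⟩ := List.mem_map.1 hT
  exact (hl t ht).mem_commAlg hq

lemma opB_isCommutator_dirac : ∃ da ∈ commAlg (wq q) _ (conjSet_subset hq),
    IsCommutator dirac (opB l) da := by
  induction l with
  | nil =>
    refine ⟨0, Subalgebra.zero_mem _, ?_⟩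
    simpa [opB] using IsCommutator.of_algebraMap (A := dirac) 0
  | cons t l ih =>
    obtain ⟨da, hda, h⟩ := ih fun t ht => hl t (by simp [ht])
    have ht := hl t (by simp)
    refine ⟨flipB * wsB t.dterm + da, Subalgebra.add_mem _ (Subalgebra.mul_mem _
      (flipB_mem_commAlg hq) (ht.dterm_mem_commAlg hq)) hda, ?_⟩
    simp only [opB, List.map_cons, List.sum_cons]
    exact (wsB_isCommutator_dirac (ht.bdd hq) (ht.dterm_bdd hq)).add h

lemma realConj_opB_mem : realConj (opB l) ∈ Algebra.adjoin ℂ (conjSet q) := by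
  induction l with
  | nil =>
    have : realConj (opB []) = 0 := by
      have := realConj_algebraMap 0
      simpa [opB] using this
    rw [this]
    exact Subalgebra.zero_mem _
  | cons t l ih =>
    simp only [opB, List.map_cons, List.sum_cons]
    rw [realConj_add]
    exact Subalgebra.add_mem _ (Algebra.subset_adjoin ⟨t, hl t (by simp), rfl⟩)
      (ih fun t ht => hl t (by simp [ht]))

end

end

section

/-! ### Estimates of the coefficients -/

lemma WShift.Le.of_true_false {t : WShift} {w : ℤ → ℤ → ℝ} (C : ℝ)
    (h₁ : ∀ (s : ℤˣ) (J M p r : ℤ), 0 ≤ J → 0 ≤ p → 0 ≤ r → IsRow J M →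
      IsRow (J + t.1.2.2.2) (M + t.1.2.1) →
      |t.2 (J + p + r) M (r - p) J s| ≤ C * w (J + p + r) J)
    (h₂ : ∀ (s : ℤˣ) (J M p r : ℤ), 0 ≤ J → 0 ≤ p → 0 ≤ r → IsRow J M →
      IsRow (J + t.1.2.2.2) (M + t.1.2.1) →
      |t.2 (J + p + r) M (r - p - 1) J s| ≤ C * w (J + p + r) J) : t.Le w := by
  refine ⟨C, fun L M N J s h h' => ?_⟩
  rcases Int.even_or_odd' (L - J - N) with ⟨p, hp | hp⟩
  · obtain ⟨r, rfl⟩ : ∃ r, N = r - p := ⟨N + p, by ring⟩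
    obtain rfl : L = J + p + r := by omega
    have := isLabel_true.1 h
    exact h₁ s J M p r h.bounds.1 (by omega) (by omega) h.isRow h'.isRow
  · obtain ⟨r, rfl⟩ : ∃ r, N = r - p - 1 := ⟨N + p + 1, by ring⟩
    obtain rfl : L = J + p + r := by omega
    have := isLabel_false.1 h
    exact h₂ s J M p r h.bounds.1 (by omega) (by omega) h.isRow h'.isRow

section
variable {q : ℝ} (hq : q ∈ Set.Ioo (0:ℝ) 1)
include hq

lemma nu_le_one {n : ℤ} : nu q n ≤ 1 := by
  have := zpow_pos hq.1 (2 * n)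
  unfold nu
  linarith

lemma nu_mono {m n : ℤ} (h : m ≤ n) : nu q m ≤ nu q n := by
  have : q ^ (2 * n) ≤ q ^ (2 * m) := zpow_le_zpow_right_of_le_one₀ hq.1 hq.2.le (by omega)
  unfold nu
  linarith

/-- As ν is monotone with values at most 1, the root lies between ν at the smaller argument and 1;
this two-sided bound gives the rate of convergence to the leading part. -/
lemma nu_mul_mem {m n k : ℤ} (hk : 0 ≤ k) (h : k ≤ m) (h' : k ≤ n) :
    nu q k ≤ √(nu q m * nu q n) ∧ √(nu q m * nu q n) ≤ 1 := by
  have h0 := nu_nonneg hq hk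
  have h1 := nu_mono hq h
  have h2 := nu_mono hq h'
  have h3 := nu_le_one hq (n := m)
  have h4 := nu_le_one hq (n := n)
  refine ⟨Real.le_sqrt_of_sq_le ?_, Real.sqrt_le_one.2 ?_⟩
  · rw [sq]
    exact mul_le_mul h1 h2 h0 (h0.trans h1)
  · exact mul_le_one₀ h3 (h0.trans h2) h4

lemma sqrt_nu_mem {m n : ℤ} (h : 0 ≤ m) (h' : 0 ≤ n) : |√(nu q m * nu q n)| ≤ 1 := by
  rw [abs_of_nonneg (Real.sqrt_nonneg _)]
  exact (nu_mul_mem hq le_rfl h h').2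

lemma abs_div_nu_le {x B : ℝ} {n : ℤ} (hx : |x| ≤ B) (hn : 1 ≤ n) :
    |x / nu q n| ≤ B * (nu q 1)⁻¹ := by
  have h1 := nu_pos hq (n := 1) one_pos
  have h2 := nu_mono hq hn
  rw [abs_div, abs_of_pos (h1.trans_le h2), div_eq_mul_inv]
  exact mul_le_mul hx (inv_anti₀ h1 h2) (inv_nonneg.2 (h1.trans_le h2).le)
    ((abs_nonneg _).trans hx)

lemma abs_div_nu_nu_le {x B : ℝ} {m n : ℤ} (hx : |x| ≤ B) (hm : 1 ≤ m) (hn : 1 ≤ n) :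
    |x / (nu q m * nu q n)| ≤ B * (nu q 1)⁻¹ * (nu q 1)⁻¹ := by
  rw [← div_div]
  exact abs_div_nu_le hq (abs_div_nu_le hq hx hm) hn

lemma abs_zpow_mul_le {e e₀ : ℤ} {x B : ℝ} (he : e₀ ≤ e) (hx : |x| ≤ B) :
    |q ^ e * x| ≤ B * q ^ e₀ := by
  have h1 : q ^ e ≤ q ^ e₀ := zpow_le_zpow_right_of_le_one₀ hq.1 hq.2.le he
  have h2 := zpow_pos hq.1 e
  rw [abs_mul, abs_of_pos h2, mul_comm]
  exact mul_le_mul hx h1 h2.le ((abs_nonneg _).trans hx)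

/-- Both x and ν(n) lie in the interval [ν(k), 1], whose length is q^(2k). -/
lemma abs_div_nu_sub_one_le {x : ℝ} {k n : ℤ} (hx : nu q k ≤ x ∧ x ≤ 1) (hk : 1 ≤ k) (h : k ≤ n) :
    |x / nu q n - 1| ≤ (nu q 1)⁻¹ * q ^ (2 * k) := by
  have h1 := nu_pos hq (n := n) (by omega)
  have h2 := nu_mono hq h
  have h3 := nu_le_one hq (n := n)
  have e : x / nu q n - 1 = (x - nu q n) / nu q n := by field_simp
  have h4 : |x - nu q n| ≤ q ^ (2 * k) := by
    have : nu q k = 1 - q ^ (2 * k) := rfl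
    rw [abs_le]
    constructor <;> linarith
  rw [e, mul_comm]
  exact abs_div_nu_le hq h4 (by omega)

end

/-- A constant that bounds all coefficients. -/
def bnd (q : ℝ) : ℝ := 2 * ((nu q 1)⁻¹ + (nu q 1)⁻¹ * (nu q 1)⁻¹)

section
variable {q : ℝ} (hq : q ∈ Set.Ioo (0:ℝ) 1)
include hq

lemma inv_nu_le_bnd : 1 * (nu q 1)⁻¹ ≤ bnd q ∧ 1 * (nu q 1)⁻¹ * (nu q 1)⁻¹ ≤ bnd q ∧
    2 * (nu q 1)⁻¹ * (nu q 1)⁻¹ ≤ bnd q ∧ 0 ≤ bnd q := by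
  have h1 := inv_pos.2 (nu_pos hq (n := 1) one_pos)
  have h2 := mul_pos h1 h1
  unfold bnd
  refine ⟨?_, ?_, ?_, ?_⟩ <;> linarith

lemma abs_nu_two_mul_le {x B : ℝ} (hx : |x| ≤ B) : |nu q 2 * x| ≤ B := by
  have h1 := nu_pos hq (n := 2) two_pos
  have h2 := nu_le_one hq (n := 2)
  rw [abs_mul, abs_of_pos h1]
  calc _ ≤ 1 * |x| := by gcongr
    _ ≤ B := by rwa [one_mul]

section Row
variable {J M : ℤ} (h : IsRow J M)
include h

lemma abs_cA₁_le : |cA₁ q J M| ≤ bnd q := by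
  unfold IsRow at h
  rw [cA₁_eq hq]
  refine (abs_zpow_mul_le hq (e₀ := 0) (by omega)
    (abs_div_nu_le hq (sqrt_nu_mem hq (by omega) (by omega)) (by omega))).trans ?_
  rw [zpow_zero, mul_one]
  exact (inv_nu_le_bnd hq).1

lemma abs_cB₁_le : |cB₁ q J M| ≤ bnd q := by
  unfold IsRow at h
  rw [cB₁_eq hq]
  exact (abs_div_nu_le hq (sqrt_nu_mem hq (by omega) (by omega)) (by omega)).trans
    (inv_nu_le_bnd hq).1

/-- The coefficient is read at the end of the step, because the lowering terms of x₁ are treated as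
transposes of raising ones. -/
lemma abs_cBm_le : |cBm q (J + 1) (M - 1)| ≤ bnd q := by
  unfold IsRow at h
  rw [cBm_eq hq, neg_mul, abs_neg]
  refine (abs_zpow_mul_le hq (e₀ := 0) (by omega)
    (abs_div_nu_le hq (sqrt_nu_mem hq (by omega) (by omega)) (by omega))).trans ?_
  rw [zpow_zero, mul_one]
  exact (inv_nu_le_bnd hq).1

/-- The exponent 3J + M + 2 is at least 2J, since M ≥ -J - 1. The factor q^(2J) makes the part of x₁
that preserves j small. -/
lemma abs_cB₀_le (h' : IsRow J (M + 1)) : |cB₀ q J M| ≤ bnd q * q ^ (2 * J) := by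
  unfold IsRow at h h'
  rw [cB₀_eq hq, mul_assoc]
  refine abs_nu_two_mul_le hq ((abs_zpow_mul_le hq (e₀ := 2 * J) (by omega)
    (abs_div_nu_nu_le hq (sqrt_nu_mem hq (by omega) (by omega)) (by omega) (by omega))).trans ?_)
  exact mul_le_mul_of_nonneg_right (inv_nu_le_bnd hq).2.1 (zpow_pos hq.1 _).le

lemma abs_cA₀_le : |cA₀ q J M| ≤ bnd q * q ^ (2 * J) := by
  unfold IsRow at h
  rw [cA₀_eq hq]
  have h1 : |q ^ (2 * (J + M + 1)) * nu q 2 * nu q (J - M) - nu q 1 * nu q (2 * J + 1)| ≤ 2 := by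
    have a1 : |q ^ (2 * (J + M + 1)) * (nu q 2 * nu q (J - M))| ≤ 1 * q ^ (0 : ℤ) :=
      abs_zpow_mul_le hq (by omega) (abs_nu_two_mul_le hq (by
        rw [abs_of_nonneg (nu_nonneg hq (by omega))]; exact nu_le_one hq))
    have a2 : |nu q 1 * nu q (2 * J + 1)| ≤ 1 := by
      rw [abs_of_nonneg (mul_nonneg (nu_nonneg hq (by omega)) (nu_nonneg hq (by omega)))]
      exact mul_le_one₀ (nu_le_one hq) (nu_nonneg hq (by omega)) (nu_le_one hq)
    rw [zpow_zero, mul_one] at a1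
    rw [mul_assoc]
    refine (abs_sub _ _).trans ?_
    linarith
  refine (abs_zpow_mul_le hq le_rfl (abs_div_nu_nu_le hq h1 (by omega) (by omega))).trans ?_
  exact mul_le_mul_of_nonneg_right (inv_nu_le_bnd hq).2.2.1 (zpow_pos hq.1 _).le

end Row

section Fibre
variable {J p r : ℤ} (hJ : 0 ≤ J) (hp : 0 ≤ p) (hr : 0 ≤ r)
include hJ hp hr

lemma abs_zpow_div_dn_le {e e₀ : ℤ} {x : ℝ} {k : ℤ} (he : e₀ ≤ e) (hk : 0 ≤ k) (hx : |x| ≤ 1) :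
    |q ^ e * (x / dn q J p r k)| ≤ bnd q * q ^ e₀ := by
  unfold dn
  refine (abs_zpow_mul_le hq he (abs_div_nu_le hq hx (by omega))).trans ?_
  exact mul_le_mul_of_nonneg_right (inv_nu_le_bnd hq).1 (zpow_pos hq.1 _).le

lemma abs_zpow_div_dn_dn_le {e e₀ : ℤ} {x : ℝ} (he : e₀ ≤ e) (hx : |x| ≤ 1) :
    |nu q 2 * q ^ e * (x / (dn q J p r 1 * dn q J p r 2))| ≤ bnd q * q ^ e₀ := by
  unfold dn
  rw [mul_assoc]
  refine abs_nu_two_mul_le hq ((abs_zpow_mul_le hq he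
    (abs_div_nu_nu_le hq hx (by omega) (by omega))).trans ?_)
  exact mul_le_mul_of_nonneg_right (inv_nu_le_bnd hq).2.1 (zpow_pos hq.1 _).le

/-- The leading part of C⁺ is -q^(2r): both arguments under the root, and that of the denominator,
are at least J + 1, so the quotient differs from 1 by a multiple of q^(2(J+1)). -/
lemma abs_cC₁_add_le {x : ℝ} (hx : nu q (J + 1) ≤ x ∧ x ≤ 1) :
    |-q ^ (2 * r) * (x / dn q J p r 2) + q ^ (2 * r)| ≤ bnd q * q ^ J := by
  have e : -q ^ (2 * r) * (x / dn q J p r 2) + q ^ (2 * r) =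
      -(q ^ (2 * r) * (x / dn q J p r 2 - 1)) := by ring
  rw [e, abs_neg]
  unfold dn
  refine (abs_zpow_mul_le hq (e₀ := 0) (by omega)
    (abs_div_nu_sub_one_le hq hx (by omega) (by omega))).trans ?_
  rw [zpow_zero, mul_one]
  have h1 : q ^ (2 * (J + 1)) ≤ q ^ J := zpow_le_zpow_right_of_le_one₀ hq.1 hq.2.le (by omega)
  have h2 := inv_nu_le_bnd hq
  rw [one_mul] at h2
  exact mul_le_mul h2.1 h1 (zpow_pos hq.1 _).le h2.2.2.2

lemma abs_cC₁_true_le : |cC₁ q (J + p + r) J (r - p) + q ^ (2 * r)| ≤ bnd q * q ^ J := by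
  rw [cC₁_true hq]
  exact abs_cC₁_add_le hq hJ hp hr (nu_mul_mem hq (by omega) (by omega) (by omega))

lemma abs_cC₁_false_le : |cC₁ q (J + p + r) J (r - p - 1) + q ^ (2 * r)| ≤ bnd q * q ^ J := by
  rw [cC₁_false hq]
  exact abs_cC₁_add_le hq hJ hp hr (nu_mul_mem hq (by omega) (by omega) (by omega))

lemma abs_cCm_true_le : |cCm q (J + p + r) J (r - p)| ≤ bnd q * q ^ J := by
  rw [cCm_true hq, neg_mul, abs_neg]
  exact abs_zpow_div_dn_le hq hJ hp hr (by omega) (by omega) (sqrt_nu_mem hq (by omega) (by omega))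

lemma abs_cCm_false_le : |cCm q (J + p + r) J (r - p - 1)| ≤ bnd q * q ^ J := by
  rw [cCm_false hq, neg_mul, abs_neg]
  exact abs_zpow_div_dn_le hq hJ hp hr (by omega) (by omega) (sqrt_nu_mem hq (by omega) (by omega))

lemma abs_cC₀_true_le : |cC₀ q (J + p + r) J (r - p)| ≤ bnd q * q ^ (2 * (J + p + r)) := by
  rw [cC₀_true hq]
  exact abs_zpow_div_dn_dn_le hq hJ hp hr (by omega) (sqrt_nu_mem hq (by omega) (by omega))

lemma abs_cC₀_false_le : |cC₀ q (J + p + r) J (r - p - 1)| ≤ bnd q * q ^ (2 * (J + p + r)) := by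
  rw [cC₀_false hq, neg_mul, neg_mul, abs_neg]
  exact abs_zpow_div_dn_dn_le hq hJ hp hr (by omega) (sqrt_nu_mem hq (by omega) (by omega))

lemma abs_cH₁_true_le : |cH₁ q (J + p + r) J (r - p)| ≤ bnd q := by
  rw [cH₁_true hq]
  refine (abs_zpow_div_dn_le hq hJ hp hr (e₀ := 0) (by omega) (by omega)
    (sqrt_nu_mem hq (by omega) (by omega))).trans ?_
  rw [zpow_zero, mul_one]

lemma abs_cH₁_false_le : |cH₁ q (J + p + r) J (r - p - 1)| ≤ bnd q := by
  rw [cH₁_false hq]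
  refine (abs_zpow_div_dn_le hq hJ hp hr (e₀ := 0) (by omega) (by omega)
    (sqrt_nu_mem hq (by omega) (by omega))).trans ?_
  rw [zpow_zero, mul_one]

lemma abs_zpow_mul_nu_nu_le {e e₀ a b : ℤ} (he : e₀ ≤ e) (ha : 0 ≤ a) (hb : 0 ≤ b) :
    |q ^ e * nu q a * nu q b| ≤ q ^ e₀ := by
  rw [mul_assoc]
  refine (abs_zpow_mul_le hq he (B := 1) ?_).trans (by rw [one_mul])
  rw [abs_of_nonneg (mul_nonneg (nu_nonneg hq ha) (nu_nonneg hq hb))]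
  exact mul_le_one₀ (nu_le_one hq) (nu_nonneg hq hb) (nu_le_one hq)

/-- The factor q^(2(p+r)) combines with the q^(2J) of A⁰ and B⁰ to the q^(2L) required of
chirality-dependent terms. -/
lemma abs_cH₀_aux {x y : ℝ} (hx : |x| ≤ q ^ (2 * (p + r))) (hy : |y| ≤ q ^ (2 * (p + r))) :
    |(x - y) / (dn q J p r 1 * dn q J p r 2)| ≤ bnd q * q ^ (2 * (p + r)) := by
  have h1 : |x - y| ≤ 2 * q ^ (2 * (p + r)) := (abs_sub _ _).trans (by linarith)
  unfold dn
  refine (abs_div_nu_nu_le hq h1 (by omega) (by omega)).trans ?_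
  have h2 := mul_le_mul_of_nonneg_right (inv_nu_le_bnd hq).2.2.1 (zpow_pos hq.1 (2 * (p + r))).le
  linarith

lemma abs_cH₀_true_le : |cH₀ q (J + p + r) J (r - p)| ≤ bnd q * q ^ (2 * (p + r)) := by
  rw [cH₀_true hq]
  exact abs_cH₀_aux hq hJ hp hr
    (abs_zpow_mul_nu_nu_le hq hJ hp hr (by omega) (by omega) (by omega))
    (abs_zpow_mul_nu_nu_le hq hJ hp hr (by omega) (by omega) (by omega))

lemma abs_cH₀_false_le : |cH₀ q (J + p + r) J (r - p - 1)| ≤ bnd q * q ^ (2 * (p + r)) := by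
  rw [cH₀_false hq]
  exact abs_cH₀_aux hq hJ hp hr
    (abs_zpow_mul_nu_nu_le hq hJ hp hr (by omega) (by omega) (by omega))
    (abs_zpow_mul_nu_nu_le hq hJ hp hr (by omega) (by omega) (by omega))

/-- Of the two roots in D⁺ only √ν(2r + 2) persists for large J; the other root over the denominator
tends to 1 at rate q^(2(J+1)). -/
lemma abs_cD₁_aux {a : ℤ} (ha : J + 1 ≤ a) :
    |√(nu q a * nu q (2 * r + 2)) / dn q J p r 2 - √(nu q (2 * r + 2))| ≤ bnd q * q ^ J := by
  have h0 := nu_nonneg hq (n := a) (by omega)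
  have e : √(nu q a * nu q (2 * r + 2)) / dn q J p r 2 - √(nu q (2 * r + 2)) =
      √(nu q (2 * r + 2)) * (√(nu q a) / dn q J p r 2 - 1) := by
    rw [Real.sqrt_mul h0]; ring
  have h1 : nu q (J + 1) ≤ √(nu q a) ∧ √(nu q a) ≤ 1 := by
    refine ⟨Real.le_sqrt_of_sq_le ?_, Real.sqrt_le_one.2 (nu_le_one hq)⟩
    have a1 := nu_mono hq ha
    have a2 := nu_nonneg hq (n := J + 1) (by omega)
    have a3 := nu_le_one hq (n := J + 1)
    nlinarith
  have h3 := abs_div_nu_sub_one_le hq h1 (n := 2 * (J + p + r + 2) + 1) (by omega) (by omega)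
  have h4 : q ^ (2 * (J + 1)) ≤ q ^ J := zpow_le_zpow_right_of_le_one₀ hq.1 hq.2.le (by omega)
  have h5 := inv_nu_le_bnd hq
  rw [one_mul] at h5
  have h6 : √(nu q (2 * r + 2)) ≤ 1 := Real.sqrt_le_one.2 (nu_le_one hq)
  rw [e, abs_mul, abs_of_nonneg (Real.sqrt_nonneg _)]
  unfold dn
  calc _ ≤ 1 * ((nu q 1)⁻¹ * q ^ (2 * (J + 1))) := by gcongr
    _ ≤ bnd q * q ^ J := by
      rw [one_mul]
      exact mul_le_mul h5.1 h4 (zpow_pos hq.1 _).le h5.2.2.2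

lemma abs_cD₁_true_le :
    |cD₁ q (J + p + r) J (r - p) - √(nu q (2 * r + 2))| ≤ bnd q * q ^ J := by
  rw [cD₁_true hq]
  exact abs_cD₁_aux hq hJ hp hr (by omega)

lemma abs_cD₁_false_le :
    |cD₁ q (J + p + r) J (r - p - 1) - √(nu q (2 * r + 2))| ≤ bnd q * q ^ J := by
  rw [cD₁_false hq]
  exact abs_cD₁_aux hq hJ hp hr (by omega)

lemma abs_cDm_true_le : |cDm q (J + p + r) J (r - p)| ≤ bnd q * q ^ J := by
  rw [cDm_true hq, neg_mul, abs_neg]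
  exact abs_zpow_div_dn_le hq hJ hp hr (by omega) (by omega) (sqrt_nu_mem hq (by omega) (by omega))

lemma abs_cDm_false_le : |cDm q (J + p + r) J (r - p - 1)| ≤ bnd q * q ^ J := by
  rw [cDm_false hq, neg_mul, abs_neg]
  exact abs_zpow_div_dn_le hq hJ hp hr (by omega) (by omega) (sqrt_nu_mem hq (by omega) (by omega))

lemma abs_cD₀_true_le : |cD₀ q (J + p + r) J (r - p)| ≤ bnd q * q ^ (2 * (J + p + r)) := by
  rw [cD₀_true hq]
  exact abs_zpow_div_dn_dn_le hq hJ hp hr (by omega) (sqrt_nu_mem hq (by omega) (by omega))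

lemma abs_cD₀_false_le : |cD₀ q (J + p + r) J (r - p - 1)| ≤ bnd q * q ^ (2 * (J + p + r)) := by
  rw [cD₀_false hq]
  exact abs_zpow_div_dn_dn_le hq hJ hp hr (by omega) (sqrt_nu_mem hq (by omega) (by omega))

end Fibre

end

/-! ### The generators are admissible -/

lemma rr_true (J p r : ℤ) : rr (J + p + r) (r - p) J = r := by unfold rr; omega

lemma rr_false (J p r : ℤ) : rr (J + p + r) (r - p - 1) J = r := by unfold rr; omega

lemma abs_sg (s : ℤˣ) : |sg s| = 1 := by
  rcases Int.units_eq_one_or s with h | h <;> simp [sg, h]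

section
variable {q : ℝ} (hq : q ∈ Set.Ioo (0:ℝ) 1)
include hq

lemma le_wS_of_le {t : WShift} (h : t.Le fun _ J => q ^ J) : t.Le (wS q) :=
  h.mono (C := 1) fun L J _ _ => ⟨(zpow_pos hq.1 _).le, by
    have := zpow_pos hq.1 (L - J)
    unfold wS
    linarith⟩

lemma abs_mul_le_mul {x y B C : ℝ} (hx : |x| ≤ B) (hy : |y| ≤ C) : |x * y| ≤ B * C := by
  rw [abs_mul]
  exact mul_le_mul hx hy (abs_nonneg _) ((abs_nonneg _).trans hx)

/-- The only part of x₀ and x₁ with a nonzero leading term, together with its transpose: it is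
q^(2r) times -α(J, M). Boundedness follows by adding the remainder to it. -/
lemma good_C₁ {α : ℤ → ℤ → ℝ} {m : ℤ} (h : RowBdd α 1 m) :
    Good q ((1, m, 0, 1), fun L M N J _ => α J M * cC₁ q L J N) := by
  have hn : RowBdd (fun J M => -α J M) 1 m := by simpa [RowBdd] using h
  have hd : WShift.Le ((1, m, 0, 1), fun L M N J _ => α J M * cC₁ q L J N
      - q ^ (2 * rr L N J) * -α J M) (wS q) := by
    obtain ⟨C, hC⟩ := h
    refine le_wS_of_le hq (.of_true_false (C * bnd q) ?_ ?_) <;>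
      intro s J M p r hJ hp hr h1 h2 <;> dsimp only at h2 ⊢
    · rw [rr_true, show α J M * cC₁ q (J + p + r) J (r - p) - q ^ (2 * r) * -α J M =
        α J M * (cC₁ q (J + p + r) J (r - p) + q ^ (2 * r)) by ring, mul_assoc]
      exact abs_mul_le_mul hq (hC J M h1 h2) (abs_cC₁_true_le hq hJ hp hr)
    · rw [rr_false, show α J M * cC₁ q (J + p + r) J (r - p - 1) - q ^ (2 * r) * -α J M =
        α J M * (cC₁ q (J + p + r) J (r - p - 1) + q ^ (2 * r)) by ring, mul_assoc]
      exact abs_mul_le_mul hq (hC J M h1 h2) (abs_cC₁_false_le hq hJ hp hr)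
  refine ⟨fun L M N J s s' => rfl, ?_, Or.inr ⟨fun L M N J _ => q ^ (2 * rr L N J) * -α J M,
    Or.inr ⟨1, m, _, hn, rfl⟩, hd⟩⟩
  have := (hd.bdd hq).add (hn.rowR_bdd hq)
  simp only [rowR, sub_add_cancel] at this
  exact this

lemma tiny_C₀ {α : ℤ → ℤ → ℝ} {m : ℤ} (h : RowBdd α 1 m) :
    Tiny q ((0, m, 0, 1), fun L M N J s => -sg s * α J M * cC₀ q L J N) := by
  obtain ⟨C, hC⟩ := h
  refine ⟨rfl, .of_true_false (C * bnd q) ?_ ?_⟩ <;>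
    intro s J M p r hJ hp hr h1 h2 <;> dsimp only at h2 ⊢ <;>
    rw [neg_mul, neg_mul, abs_neg, mul_assoc, abs_mul, abs_sg, one_mul, mul_assoc]
  · exact abs_mul_le_mul hq (hC J M h1 h2) (abs_cC₀_true_le hq hJ hp hr)
  · exact abs_mul_le_mul hq (hC J M h1 h2) (abs_cC₀_false_le hq hJ hp hr)

lemma good_of_le {sh : ℤ × ℤ × ℤ × ℤ} {f : ℤ → ℤ → ℤ → ℤ → ℝ}
    (h : WShift.Le (sh, fun L M N J _ => f L M N J) (wS q)) :
    Good q (sh, fun L M N J _ => f L M N J) :=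
  ⟨fun _ _ _ _ _ _ => rfl, h.bdd hq, Or.inl h⟩

lemma good_Cm {α : ℤ → ℤ → ℝ} {m : ℤ} (h : RowBdd α 1 m) :
    Good q ((-1, m, 0, 1), fun L M N J _ => α J M * cCm q L J N) := by
  obtain ⟨C, hC⟩ := h
  refine good_of_le hq (le_wS_of_le hq (.of_true_false (C * bnd q) ?_ ?_)) <;>
    intro s J M p r hJ hp hr h1 h2 <;> dsimp only at h2 ⊢ <;> rw [mul_assoc]
  · exact abs_mul_le_mul hq (hC J M h1 h2) (abs_cCm_true_le hq hJ hp hr)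
  · exact abs_mul_le_mul hq (hC J M h1 h2) (abs_cCm_false_le hq hJ hp hr)

variable {α : ℤ → ℤ → ℝ} {m : ℤ}
  (h : ∃ C, ∀ J M, IsRow J M → IsRow J (M + m) → |α J M| ≤ C * q ^ (2 * J))
include h

lemma good_H₁ : Good q ((1, m, 0, 0), fun L M N J _ => α J M * cH₁ q L J N) := by
  obtain ⟨C, hC⟩ := h
  have hC0 : ∀ J M, IsRow J M → IsRow J (M + m) → |α J M| ≤ |C| * q ^ J := fun J M h1 h2 => by
    refine (hC J M h1 h2).trans (mul_le_mul (le_abs_self C) ?_ (zpow_pos hq.1 _).le (abs_nonneg C))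
    have := h1.1
    exact zpow_le_zpow_right_of_le_one₀ hq.1 hq.2.le (by omega)
  refine good_of_le hq (le_wS_of_le hq (.of_true_false (|C| * bnd q) ?_ ?_)) <;>
    intro s J M p r hJ hp hr h1 h2 <;> dsimp only at h2 ⊢ <;> rw [mul_right_comm] <;>
    rw [add_zero] at h2
  · exact abs_mul_le_mul hq (hC0 J M h1 h2) (abs_cH₁_true_le hq hJ hp hr)
  · exact abs_mul_le_mul hq (hC0 J M h1 h2) (abs_cH₁_false_le hq hJ hp hr)

lemma tiny_H₀ : Tiny q ((0, m, 0, 0), fun L M N J s => sg s * α J M * cH₀ q L J N) := by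
  obtain ⟨C, hC⟩ := h
  refine ⟨rfl, .of_true_false (C * bnd q) ?_ ?_⟩ <;>
    intro s J M p r hJ hp hr h1 h2 <;> dsimp only at h2 ⊢ <;>
    rw [mul_assoc, abs_mul, abs_sg, one_mul, show 2 * (J + p + r) = 2 * J + 2 * (p + r) by ring,
      zpow_add₀ hq.1.ne', mul_mul_mul_comm] <;> rw [add_zero] at h2
  · exact abs_mul_le_mul hq (hC J M h1 h2) (abs_cH₀_true_le hq hJ hp hr)
  · exact abs_mul_le_mul hq (hC J M h1 h2) (abs_cH₀_false_le hq hJ hp hr)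

end

section
variable {q : ℝ} (hq : q ∈ Set.Ioo (0:ℝ) 1)
include hq

lemma good_D₁ : Good q ((1, 0, 1, 0), fun L M N J _ => cD₁ q L J N) := by
  have hn : ColBdd (fun n => √(nu q (2 * n + 2))) 1 :=
    ⟨1, fun n _ _ => by
      rw [abs_of_nonneg (Real.sqrt_nonneg _)]; exact Real.sqrt_le_one.2 (nu_le_one hq)⟩
  have hd : WShift.Le ((1, 0, 1, 0), fun L M N J _ => cD₁ q L J N -
      √(nu q (2 * rr L N J + 2))) (wS q) := by
    refine le_wS_of_le hq (.of_true_false (bnd q) ?_ ?_) <;>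
      intro s J M p r hJ hp hr h1 h2 <;> dsimp only
    · rw [rr_true]
      exact abs_cD₁_true_le hq hJ hp hr
    · rw [rr_false]
      exact abs_cD₁_false_le hq hJ hp hr
  refine ⟨fun L M N J s s' => rfl, ?_, Or.inr ⟨fun L M N J _ => √(nu q (2 * rr L N J + 2)),
    Or.inl ⟨1, _, hn, rfl⟩, hd⟩⟩
  have := (hd.bdd hq).add hn.colR_bdd
  simp only [colR, sub_add_cancel] at this
  exact this

lemma tiny_D₀ : Tiny q ((0, 0, 1, 0), fun L M N J s => sg s * cD₀ q L J N) := by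
  refine ⟨rfl, .of_true_false (bnd q) ?_ ?_⟩ <;>
    intro s J M p r hJ hp hr h1 h2 <;> dsimp only <;> rw [abs_mul, abs_sg, one_mul]
  · exact abs_cD₀_true_le hq hJ hp hr
  · exact abs_cD₀_false_le hq hJ hp hr

lemma good_Dm : Good q ((-1, 0, 1, 0), fun L M N J _ => cDm q L J N) := by
  refine good_of_le hq (le_wS_of_le hq (.of_true_false (bnd q) ?_ ?_)) <;>
    intro s J M p r hJ hp hr h1 h2 <;> dsimp only
  · exact abs_cDm_true_le hq hJ hp hr
  · exact abs_cDm_false_le hq hJ hp hr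

lemma rowBdd_cA₁ : RowBdd (cA₁ q) 1 0 := ⟨bnd q, fun J M h _ => abs_cA₁_le hq h⟩

lemma rowBdd_cB₁ : RowBdd (cB₁ q) 1 1 := ⟨bnd q, fun J M h _ => abs_cB₁_le hq h⟩

lemma rowBdd_cBm : RowBdd (fun J M => cBm q (J + 1) (M - 1)) 1 (-1) :=
  ⟨bnd q, fun J M h _ => abs_cBm_le hq h⟩

lemma rowSmall_cA₀ : ∃ C, ∀ J M, IsRow J M → IsRow J (M + 0) → |cA₀ q J M| ≤ C * q ^ (2 * J) :=
  ⟨bnd q, fun J M h _ => abs_cA₀_le hq h⟩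

lemma rowSmall_cB₀ : ∃ C, ∀ J M, IsRow J M → IsRow J (M + 1) → |cB₀ q J M| ≤ C * q ^ (2 * J) :=
  ⟨bnd q, fun J M h h' => abs_cB₀_le hq h h'⟩

lemma rowSmall_cB₀' : ∃ C, ∀ J M, IsRow J M → IsRow J (M + -1) →
    |(fun J M => cB₀ q J (M - 1)) J M| ≤ C * q ^ (2 * J) :=
  ⟨bnd q, fun J M h h' => abs_cB₀_le hq (by rwa [sub_eq_add_neg]) (by rwa [sub_add_cancel])⟩

lemma cls_of_adj {t t' : WShift} (h : Cls q t) (h₁ : t'.1 = t.adj.1)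
    (h₂ : ∀ L M N J s, t'.2 L M N J s = t.adj.2 L M N J s) : Cls q t' := by
  rw [WShift.ext' h₁ h₂]
  exact h.adj hq

/-- The last four shifts are transposes of the first four, and the class is closed under
transposition. -/
lemma x₀L_cls : ∀ t ∈ x₀L q, Cls q t := by
  have h1 : Cls q _ := Or.inl (good_C₁ hq (rowBdd_cA₁ hq))
  have h2 : Cls q _ := Or.inr (tiny_C₀ hq (rowBdd_cA₁ hq))
  have h3 : Cls q _ := Or.inl (good_Cm hq (rowBdd_cA₁ hq))
  have h4 : Cls q _ := Or.inl (good_H₁ hq (rowSmall_cA₀ hq))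
  have h5 : Cls q _ := Or.inr (tiny_H₀ hq (rowSmall_cA₀ hq))
  simp only [x₀L, List.forall_mem_cons, List.forall_mem_nil, and_true]
  refine ⟨h1, h2, h3, h4, h5, ?_, ?_, ?_, ?_, by simp⟩
  · exact cls_of_adj hq h4 rfl fun L M N J s => by simp [WShift.adj]
  · exact cls_of_adj hq h3 rfl fun L M N J s => by simp [WShift.adj]
  · exact cls_of_adj hq h2 rfl fun L M N J s => by simp [WShift.adj]
  · exact cls_of_adj hq h1 rfl fun L M N J s => by simp [WShift.adj]

/-- The last four shifts are transposes of shifts that lower m₁; `h6`, …, `h9` are the estimates for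
those. -/
lemma x₁L_cls : ∀ t ∈ x₁L q, Cls q t := by
  have h1 : Cls q _ := Or.inl (good_C₁ hq (rowBdd_cB₁ hq))
  have h2 : Cls q _ := Or.inr (tiny_C₀ hq (rowBdd_cB₁ hq))
  have h3 : Cls q _ := Or.inl (good_Cm hq (rowBdd_cB₁ hq))
  have h4 : Cls q _ := Or.inl (good_H₁ hq (rowSmall_cB₀ hq))
  have h5 : Cls q _ := Or.inr (tiny_H₀ hq (rowSmall_cB₀ hq))
  have h6 : Cls q _ := Or.inl (good_H₁ hq (rowSmall_cB₀' hq))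
  have h7 : Cls q _ := Or.inl (good_Cm hq (rowBdd_cBm hq))
  have h8 : Cls q _ := Or.inr (tiny_C₀ hq (rowBdd_cBm hq))
  have h9 : Cls q _ := Or.inl (good_C₁ hq (rowBdd_cBm hq))
  simp only [x₁L, List.forall_mem_cons, List.forall_mem_nil, and_true]
  refine ⟨h1, h2, h3, h4, h5, ?_, ?_, ?_, ?_, by simp⟩
  · exact cls_of_adj hq h6 rfl fun L M N J s => by simp [WShift.adj]
  · exact cls_of_adj hq h7 rfl fun L M N J s => by simp [WShift.adj]
  · exact cls_of_adj hq h8 rfl fun L M N J s => by simp [WShift.adj]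
  · exact cls_of_adj hq h9 rfl fun L M N J s => by simp [WShift.adj]

lemma x₂L_cls : ∀ t ∈ x₂L q, Cls q t := by
  simp only [x₂L, List.forall_mem_cons, List.forall_mem_nil, and_true]
  exact ⟨Or.inl (good_D₁ hq), Or.inr (tiny_D₀ hq), Or.inl (good_Dm hq), by simp⟩

end

end

section

/-! ### The chiral representation of the quantum sphere -/

lemma clm_ext_incl {A B : Spinors →L[ℂ] Spinors} (h : ∀ v, A (incl v) = B (incl v)) : A = B :=
  clm_ext fun k => by simpa [incl_single] using h (Finsupp.single k 1)

section
variable {q : ℝ} (hq : q ∈ Set.Ioo (0:ℝ) 1)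
include hq

lemma x₀L_bdd : ∀ t ∈ x₀L q, t.Bdd := fun t ht => (x₀L_cls hq t ht).bdd hq

lemma x₁L_bdd : ∀ t ∈ x₁L q, t.Bdd := fun t ht => (x₁L_cls hq t ht).bdd hq

lemma x₂L_bdd : ∀ t ∈ x₂L q, t.Bdd := fun t ht => (x₂L_cls hq t ht).bdd hq

lemma map_adj_cls {l : List WShift} (h : ∀ t ∈ l, Cls q t) : ∀ t ∈ l.map WShift.adj, Cls q t := by
  intro t ht
  obtain ⟨t, ht', rfl⟩ := List.mem_map.1 ht
  exact (h t ht').adj hq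

lemma map_adj_bdd {l : List WShift} (h : ∀ t ∈ l, t.Bdd) : ∀ t ∈ l.map WShift.adj, t.Bdd := by
  intro t ht
  obtain ⟨t, ht', rfl⟩ := List.mem_map.1 ht
  exact (h t ht').adj

lemma star_opB_x₀L : star (opB (x₀L q)) = opB (x₀L q) := by
  rw [star_opB (x₀L_bdd hq)]
  refine clm_ext_incl fun v => ?_
  rw [opB_incl (x₀L_bdd hq), opB_incl (map_adj_bdd hq (x₀L_bdd hq)), opF_x₀L_adj]

/-- The weighted shifts by which the generators act. -/
def genList (q : ℝ) : SphereGen → List WShift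
  | .x0 => x₀L q
  | .x1 => x₁L q
  | .x1s => (x₁L q).map WShift.adj
  | .x2 => x₂L q
  | .x2s => (x₂L q).map WShift.adj

def sphereFree (q : ℝ) : FreeAlgebra ℂ SphereGen →ₐ[ℂ] (Spinors →L[ℂ] Spinors) :=
  FreeAlgebra.lift ℂ fun x => opB (genList q x)

lemma genList_cls (x : SphereGen) : ∀ t ∈ genList q x, Cls q t := by
  cases x
  · exact x₀L_cls hq
  · exact x₁L_cls hq
  · exact map_adj_cls hq (x₁L_cls hq)
  · exact x₂L_cls hq
  · exact map_adj_cls hq (x₂L_cls hq)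

lemma genList_bdd (x : SphereGen) : ∀ t ∈ genList q x, t.Bdd :=
  fun t ht => (genList_cls hq x t ht).bdd hq

lemma star_opB_genList (x : SphereGen) : star (opB (genList q x)) = opB (genList q (star x)) := by
  cases x
  · exact star_opB_x₀L hq
  · exact star_opB (x₁L_bdd hq)
  · exact (congrArg star (star_opB (x₁L_bdd hq)).symm).trans (star_star _)
  · exact star_opB (x₂L_bdd hq)
  · exact (congrArg star (star_opB (x₂L_bdd hq)).symm).trans (star_star _)

lemma sphereFree_freeStar (w : FreeAlgebra ℂ SphereGen) :
    sphereFree q (freeStar w) = star (sphereFree q w) := by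
  induction w using FreeAlgebra.induction with
  | grade0 c =>
    rw [freeStar_algebraMap, AlgHom.commutes, AlgHom.commutes]
    exact algebraMap_star_comm c
  | grade1 x => simp [sphereFree, star_opB_genList hq]
  | mul a b ha hb => simp [ha, hb]
  | add a b ha hb => simp [ha, hb]

lemma opB_mul_eq {x y : SphereGen}
    (h : ∀ v, opF (genList q x) (opF (genList q y) v) =
      (q ^ 2) • opF (genList q y) (opF (genList q x) v)) :
    opB (genList q x) * opB (genList q y) =
      ((q ^ 2 : ℝ) : ℂ) • (opB (genList q y) * opB (genList q x)) := by
  refine clm_ext_incl fun v => ?_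
  change opB _ (opB _ (incl v)) = ((q ^ 2 : ℝ) : ℂ) • (opB _ (opB _ (incl v)))
  rw [opB_incl (genList_bdd hq _), opB_incl (genList_bdd hq _), opB_incl (genList_bdd hq _),
    opB_incl (genList_bdd hq _), h, Complex.coe_smul, LinearMap.map_smul_of_tower]
  rfl

/-- Taking adjoints yields the remaining q²-commutation relations, so that besides xᵢxⱼ only x₁*x₂
has to be computed. -/
lemma opB_mul_star_eq {x y : SphereGen}
    (h : opB (genList q x) * opB (genList q y) =
      ((q ^ 2 : ℝ) : ℂ) • (opB (genList q y) * opB (genList q x))) :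
    opB (genList q (star y)) * opB (genList q (star x)) =
      ((q ^ 2 : ℝ) : ℂ) • (opB (genList q (star x)) * opB (genList q (star y))) := by
  have := congrArg star h
  simpa only [star_mul, star_smul, star_opB_genList hq, Complex.star_def, Complex.conj_ofReal]
    using this

omit hq in
lemma sphereFree_wx (i : Fin 3) : sphereFree q (wx i) = opB (genList q (![.x0, .x1, .x2] i)) :=
  FreeAlgebra.lift_ι_apply _ _

omit hq in
lemma sphereFree_wxs (i : Fin 3) : sphereFree q (wxs i) = opB (genList q (![.x0, .x1s, .x2s] i)) :=
  FreeAlgebra.lift_ι_apply _ _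

lemma opB_mul_incl (x y : SphereGen) (v : FinSpinors) :
    (opB (genList q x) * opB (genList q y)) (incl v) =
      incl (opF (genList q x) (opF (genList q y) v)) := by
  rw [ContinuousLinearMap.mul_apply, opB_incl (genList_bdd hq y), opB_incl (genList_bdd hq x)]

lemma opB_comm_one : opB (genList q .x1s) * opB (genList q .x1) -
    opB (genList q .x1) * opB (genList q .x1s) =
      ((1 - q ^ 4 : ℝ) : ℂ) • (opB (genList q .x0) * opB (genList q .x0)) := by
  refine clm_ext_incl fun v => ?_
  rw [ContinuousLinearMap.sub_apply, ContinuousLinearMap.smul_apply, opB_mul_incl hq,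
    opB_mul_incl hq, opB_mul_incl hq, ← map_sub, ← map_smul, Complex.coe_smul]
  exact congrArg incl (sub_eq_iff_eq_add.2 (x₁L_adj_x₁L hq v))

lemma opB_comm_two : opB (genList q .x2s) * opB (genList q .x2) -
    opB (genList q .x2) * opB (genList q .x2s) = opB (genList q .x1s) * opB (genList q .x1) -
      ((q ^ 4 : ℝ) : ℂ) • (opB (genList q .x1) * opB (genList q .x1s)) := by
  refine clm_ext_incl fun v => ?_
  rw [ContinuousLinearMap.sub_apply, ContinuousLinearMap.sub_apply,
    ContinuousLinearMap.smul_apply, opB_mul_incl hq, opB_mul_incl hq, opB_mul_incl hq,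
    opB_mul_incl hq, ← map_sub, ← map_smul, ← map_sub, Complex.coe_smul]
  exact congrArg incl (x₂L_adj_x₂L hq v)

lemma opB_radius : opB (genList q .x0) * opB (genList q .x0) +
    opB (genList q .x1) * opB (genList q .x1s) + opB (genList q .x2) * opB (genList q .x2s) = 1 := by
  refine clm_ext_incl fun v => ?_
  rw [ContinuousLinearMap.add_apply, ContinuousLinearMap.add_apply, opB_mul_incl hq,
    opB_mul_incl hq, opB_mul_incl hq, ← map_add, ← map_add]
  exact congrArg incl (xL_radius hq v)

lemma sphereFree_rel {a b : FreeAlgebra ℂ SphereGen} (h : SphereRel q a b) :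
    sphereFree q a = sphereFree q b := by
  have h01 := opB_mul_eq hq (x := .x0) (y := .x1) (x₀L_x₁L hq)
  have h02 := opB_mul_eq hq (x := .x0) (y := .x2) (x₀L_x₂L hq)
  have h12 := opB_mul_eq hq (x := .x1) (y := .x2) (x₁L_x₂L hq)
  have h12' := opB_mul_eq hq (x := .x1s) (y := .x2) (x₁L_adj_x₂L hq)
  have h10 : opB (genList q .x1s) * opB (genList q .x0) =
      ((q ^ 2 : ℝ) : ℂ) • (opB (genList q .x0) * opB (genList q .x1s)) := opB_mul_star_eq hq h01
  have h20 : opB (genList q .x2s) * opB (genList q .x0) =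
      ((q ^ 2 : ℝ) : ℂ) • (opB (genList q .x0) * opB (genList q .x2s)) := opB_mul_star_eq hq h02
  have h21 : opB (genList q .x2s) * opB (genList q .x1) =
      ((q ^ 2 : ℝ) : ℂ) • (opB (genList q .x1) * opB (genList q .x2s)) := opB_mul_star_eq hq h12'
  cases h with
  | comm i j h =>
    fin_cases i <;> fin_cases j <;> simp [sphereFree, wx] at h ⊢
    · simpa using h01
    · simpa using h02
    · simpa using h12
  | star_comm i j h =>
    fin_cases i <;> fin_cases j <;> simp [sphereFree, wx, wxs] at h ⊢
    · simpa using h01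
    · simpa using h02
    · simpa using h10
    · simpa using h12'
    · simpa using h20
    · simpa using h21
  | comm_one =>
    rw [map_sub, map_mul, map_mul, map_smul, map_mul]
    simp only [sphereFree_wx, sphereFree_wxs]
    exact opB_comm_one hq
  | comm_two =>
    rw [map_sub, map_sub, map_smul, map_mul, map_mul, map_mul, map_mul]
    simp only [sphereFree_wx, sphereFree_wxs]
    exact opB_comm_two hq
  | radius =>
    rw [map_add, map_add, map_mul, map_mul, map_mul, map_one]
    simp only [sphereFree_wx, sphereFree_wxs]
    exact opB_radius hq

/-- The chiral representation, as a homomorphism of algebras. -/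
def sphereRepHom : SphereAlg q →ₐ[ℂ] (Spinors →L[ℂ] Spinors) :=
  PresentedAlg.lift (sphereFree q) fun a b h =>
    ⟨sphereFree_rel hq h, by
      rw [sphereFree_freeStar hq, sphereFree_freeStar hq, sphereFree_rel hq h]⟩

lemma sphereRepHom_mk (w : FreeAlgebra ℂ SphereGen) :
    sphereRepHom hq (PresentedAlg.mk _ w) = sphereFree q w :=
  PresentedAlg.lift_mk _ _ w

/-- The chiral representation. -/
def sphereRep : SphereAlg q →⋆ₐ[ℂ] (Spinors →L[ℂ] Spinors) where
  toAlgHom := sphereRepHom hq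
  map_star' a := by
    obtain ⟨w, rfl⟩ := PresentedAlg.mk_surjective a
    change sphereRepHom hq _ = star (sphereRepHom hq _)
    rw [PresentedAlg.star_mk, sphereRepHom_mk, sphereRepHom_mk, sphereFree_freeStar hq]

lemma sphereRep_mk (w : FreeAlgebra ℂ SphereGen) :
    sphereRep hq (PresentedAlg.mk _ w) = sphereFree q w :=
  sphereRepHom_mk hq w

lemma sphereRep_gen (x : SphereGen) (k : Idx) :
    sphereRep hq (PresentedAlg.gen _ x) (ket k) =
      incl (opF (genList q x) (Finsupp.single k 1)) := by
  rw [PresentedAlg.gen, sphereRep_mk, sphereFree, FreeAlgebra.lift_ι_apply, ← incl_single,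
    opB_incl (genList_bdd hq x)]

lemma sphereRep_isChiralRep : IsChiralRep (sphereRep hq) := by
  constructor <;> rintro ⟨⟨L, M₁, M₂, J, h⟩, s⟩ <;> rw [sphereRep_gen] <;> congr 1
  · simp only [genList, x₀L, opF_cons, opF_nil, LinearMap.add_apply, wsF_single, x₀vec,
      LinearMap.zero_apply, sub_eq_add_neg, add_zero, Complex.coe_smul, sg]
    abel
  · simp only [genList, x₁L, opF_cons, opF_nil, LinearMap.add_apply, wsF_single, x₁vec,
      LinearMap.zero_apply, sub_eq_add_neg, add_zero, Complex.coe_smul, sg]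
    abel
  · simp only [genList, x₂L, opF_cons, opF_nil, LinearMap.add_apply, wsF_single, x₂vec,
      LinearMap.zero_apply, sub_eq_add_neg, add_zero, Complex.coe_smul, sg]
    abel

/-! ### Commutators with the opposite algebra -/

local notation "𝒞" => commAlg (wq q) (conjSet q) (conjSet_subset hq)

/-- The two properties are proved together, since the derivative of a product involves the factors
as well as their derivatives; both live in the same subalgebra of operators that commute with
`conjSet` modulo the ideal. -/
lemma sphereFree_mem (w : FreeAlgebra ℂ SphereGen) : sphereFree q w ∈ 𝒞 ∧
    ∃ da ∈ 𝒞, IsCommutator dirac (sphereFree q w) da := by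
  induction w using FreeAlgebra.induction with
  | grade0 c =>
    rw [AlgHom.commutes]
    exact ⟨Subalgebra.algebraMap_mem _ c, 0, zero_mem _, .of_algebraMap c⟩
  | grade1 x =>
    rw [sphereFree, FreeAlgebra.lift_ι_apply]
    exact ⟨opB_mem_commAlg hq (genList_cls hq x), opB_isCommutator_dirac hq (genList_cls hq x)⟩
  | mul a b ha hb =>
    obtain ⟨ha, da, hda, h⟩ := ha
    obtain ⟨hb, db, hdb, h'⟩ := hb
    rw [map_mul]
    exact ⟨mul_mem ha hb, _, add_mem (mul_mem hda hb) (mul_mem ha hdb), h.mul h'⟩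
  | add a b ha hb =>
    obtain ⟨ha, da, hda, h⟩ := ha
    obtain ⟨hb, db, hdb, h'⟩ := hb
    rw [map_add]
    exact ⟨add_mem ha hb, _, add_mem hda hdb, h.add h'⟩

lemma realConj_sphereFree_mem (w : FreeAlgebra ℂ SphereGen) :
    realConj (sphereFree q w) ∈ Algebra.adjoin ℂ (conjSet q) := by
  induction w using FreeAlgebra.induction with
  | grade0 c =>
    rw [AlgHom.commutes, realConj_algebraMap]
    exact Subalgebra.algebraMap_mem _ _
  | grade1 x =>
    rw [sphereFree, FreeAlgebra.lift_ι_apply]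
    exact realConj_opB_mem hq (genList_cls hq x)
  | mul a b ha hb =>
    rw [map_mul, realConj_mul]
    exact neg_mem (mul_mem ha hb)
  | add a b ha hb =>
    rw [map_add, realConj_add]
    exact add_mem ha hb

lemma sphereRep_comm_realConj (a b : SphereAlg q) :
    sphereRep hq a * realConj (sphereRep hq b) - realConj (sphereRep hq b) * sphereRep hq a ∈
      idealI := by
  obtain ⟨v, rfl⟩ := PresentedAlg.mk_surjective a
  obtain ⟨w, rfl⟩ := PresentedAlg.mk_surjective b
  rw [sphereRep_mk, sphereRep_mk]
  exact smallIdeal_le hq (commAlg.adjoin (sphereFree_mem hq v).1 (realConj_sphereFree_mem hq w))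

lemma exists_isCommutator_dirac (a : SphereAlg q) :
    ∃ da : Spinors →L[ℂ] Spinors, IsCommutator dirac (sphereRep hq a) da ∧ ∀ b : SphereAlg q,
      da * realConj (sphereRep hq b) - realConj (sphereRep hq b) * da ∈ idealI := by
  obtain ⟨v, rfl⟩ := PresentedAlg.mk_surjective a
  obtain ⟨-, da, hda, h⟩ := sphereFree_mem hq v
  refine ⟨da, by rwa [sphereRep_mk], fun b => ?_⟩
  obtain ⟨w, rfl⟩ := PresentedAlg.mk_surjective b
  rw [sphereRep_mk]
  exact smallIdeal_le hq (commAlg.adjoin hda (realConj_sphereFree_mem hq w))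

end

end

section

/-! ### The real structure, the grading and the Dirac operator -/

lemma realStr_apply (v : Spinors) (k : Idx) :
    realStr v k = phase k.1.neg * conj (v (Idx.neg k)) := rfl

lemma realStr_grading (v : Spinors) : realStr (grading v) = grading (realStr v) := by
  ext k
  simp only [realStr_apply, grading, boundedDiag_apply, Idx.neg, map_mul, map_intCast]
  ring

lemma dirac_apply (v : dirac.domain) (k : Idx) :
    dirac v k = (dval k : ℂ) * (v : Spinors) (Idx.flip k) := rfl

/-- The eigenvalue of |D| is real and depends on l only, while the phase and the reflection do not
involve the chirality. -/
lemma realStr_dirac_apply (v : dirac.domain) (k : Idx) :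
    realStr (dirac v) k = (dval k : ℂ) * realStr (v : Spinors) (Idx.flip k) := by
  simp only [realStr_apply, dirac_apply, map_mul, Complex.conj_ofReal]
  change phase k.1.neg * (dval k * conj ((v : Spinors) (Idx.flip (Idx.neg k)))) =
    dval k * (phase k.1.neg * conj ((v : Spinors) (Idx.flip (Idx.neg k))))
  ring

lemma realStr_mem_dirac_domain {v : Spinors} (h : v ∈ dirac.domain) : realStr v ∈ dirac.domain := by
  change Memℓp (fun k => (dval k : ℂ) * realStr v (Idx.flip k)) 2
  have := lp.memℓp (realStr (dirac ⟨v, h⟩))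
  rwa [show (fun k => (dval k : ℂ) * realStr v (Idx.flip k)) = realStr (dirac ⟨v, h⟩) from
    funext fun k => (realStr_dirac_apply ⟨v, h⟩ k).symm]

lemma mem_dirac_domain_iff (v : Spinors) : v ∈ dirac.domain ↔ realStr v ∈ dirac.domain := by
  refine ⟨realStr_mem_dirac_domain, fun h => ?_⟩
  have := realStr_mem_dirac_domain h
  rw [realStr_realStr] at this
  exact neg_mem_iff.1 this

lemma realStr_dirac (v : dirac.domain) (h : realStr (v : Spinors) ∈ dirac.domain) :
    realStr (dirac v) = dirac ⟨realStr (v : Spinors), h⟩ := by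
  ext k
  exact realStr_dirac_apply v k

/-! ### Self-adjoint multiplication operators -/

section Multiplication
variable (w : Idx → ℝ)

lemma unboundedMul_apply (v : (unboundedMul w id).domain) (k : Idx) :
    unboundedMul w id v k = (w k : ℂ) * (v : Spinors) k := rfl

lemma ket_mem_domain (k : Idx) : ket k ∈ (unboundedMul w id).domain := by
  change Memℓp (fun i => (w i : ℂ) * ket k i) 2
  have h : (fun i => (w i : ℂ) * ket k i) = ((w k : ℂ) • ket k : Spinors) := by
    funext i
    change _ = (w k : ℂ) * ket k i
    simp only [ket_apply]
    split_ifs with h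
    · rw [h]
    · simp
  rw [h]
  exact lp.memℓp _

lemma unboundedMul_ket (k : Idx) :
    unboundedMul w id ⟨ket k, ket_mem_domain w k⟩ = (w k : ℂ) • ket k := by
  ext i
  rw [unboundedMul_apply]
  change _ = (w k : ℂ) * ket k i
  simp only [ket_apply]
  split_ifs with h
  · rw [h]
  · simp

lemma incl_mem_domain (v : FinSpinors) : incl v ∈ (unboundedMul w id).domain := by
  rw [incl, Finsupp.linearCombination_apply]
  exact Submodule.sum_mem _ fun k _ => Submodule.smul_mem _ _ (ket_mem_domain w k)

lemma dense_unboundedMul_domain : Dense ((unboundedMul w id).domain : Set Spinors) := fun f =>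
  mem_closure_of_tendsto (hasSum_ket f) (Filter.Eventually.of_forall fun s =>
    Submodule.sum_mem _ fun k _ => Submodule.smul_mem _ _ (ket_mem_domain w k))

lemma unboundedMul_isFormalAdjoint : (unboundedMul w id).IsFormalAdjoint (unboundedMul w id) := by
  intro x y
  rw [lp.inner_eq_tsum, lp.inner_eq_tsum]
  refine tsum_congr fun k => ?_
  rw [unboundedMul_apply, unboundedMul_apply]
  simp only [RCLike.inner_apply, map_mul, Complex.conj_ofReal]
  ring

/-- A vector y in the domain of the adjoint, paired with a basis vector, shows that the coordinates
of its image are w(k)y(k). These are therefore square-summable, which is the condition defining the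
domain of the operator itself. -/
lemma unboundedMul_isSelfAdjoint : IsSelfAdjoint (unboundedMul w id) := by
  rw [LinearPMap.isSelfAdjoint_def]
  have hd := dense_unboundedMul_domain w
  refine (LinearPMap.eq_of_le_of_domain_eq
    (LinearPMap.IsFormalAdjoint.le_adjoint hd (unboundedMul_isFormalAdjoint w)) ?_).symm
  refine le_antisymm (LinearPMap.IsFormalAdjoint.le_adjoint hd
    (unboundedMul_isFormalAdjoint w)).1 fun y hy => ?_
  change Memℓp (fun k => (w k : ℂ) * y k) 2
  have h : (fun k => (w k : ℂ) * y k) = (LinearPMap.adjoint (unboundedMul w id) ⟨y, hy⟩) := by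
    funext k
    have h1 := LinearPMap.adjoint_isFormalAdjoint hd ⟨y, hy⟩ ⟨ket k, ket_mem_domain w k⟩
    rw [unboundedMul_ket, inner_smul_right] at h1
    have h2 := congrArg conj h1
    rw [inner_conj_symm, inner_ket, map_mul, Complex.conj_ofReal, inner_conj_symm, inner_ket] at h2
    exact h2.symm
  rw [h]
  exact lp.memℓp _

variable {w}

lemma unboundedMul_inner_nonneg (hw : ∀ k, 0 ≤ w k) (x : (unboundedMul w id).domain) :
    0 ≤ (⟪(x : Spinors), unboundedMul w id x⟫_ℂ).re := by
  rw [lp.inner_eq_tsum, Complex.re_tsum (lp.summable_inner _ _)]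
  refine tsum_nonneg fun k => ?_
  rw [unboundedMul_apply, RCLike.inner_apply, mul_assoc, Complex.mul_conj, ← Complex.ofReal_mul,
    Complex.ofReal_re]
  exact mul_nonneg (hw k) (Complex.normSq_nonneg _)

lemma unboundedMul_injective (hw : ∀ k, w k ≠ 0) (x : (unboundedMul w id).domain)
    (h : unboundedMul w id x = 0) : x = 0 := by
  ext k
  have h1 : unboundedMul w id x k = 0 := by rw [h]; rfl
  rw [unboundedMul_apply] at h1
  exact (mul_eq_zero.1 h1).resolve_left (Complex.ofReal_ne_zero.2 (hw k))

end Multiplication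

/-! ### The polar decomposition of the twisted real structure -/

/-- The eigenvalue `q^{m₁ + 3 m₂}` of the positive part. -/
def twist (q : ℝ) (k : Idx) : ℝ := q ^ (hf k.1.M₁ + 3 * hf k.1.M₂)

lemma twistedReal_apply (q : ℝ) (v : FinSpinors) (i : Idx) : twistedReal q v i =
    conj (v (Idx.neg i)) * (phase (Idx.neg i).1 * (twist q (Idx.neg i) : ℂ)) := by
  induction v using Finsupp.induction_linear with
  | zero => simp
  | add f g hf hg => rw [map_add, Finsupp.add_apply, hf, hg, Finsupp.add_apply, map_add, add_mul]
  | single k c =>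
    have h : Finsupp.single k c = c • Finsupp.single k (1 : ℂ) := by simp
    rw [h, map_smulₛₗ, twistedReal_single]
    simp only [Finsupp.smul_apply, smul_eq_mul, Finsupp.single_apply]
    by_cases hk : Idx.neg k = i
    · subst hk
      simp [twist]
    · have : k ≠ Idx.neg i := fun h => hk (by rw [h, Idx.neg_neg])
      simp [hk, this]

lemma realStr_unboundedMul_incl (q : ℝ) (v : FinSpinors) :
    realStr (unboundedMul (twist q) id ⟨incl v, incl_mem_domain _ v⟩) = incl (twistedReal q v) := by
  ext i
  rw [incl_apply, twistedReal_apply, realStr_apply, unboundedMul_apply, incl_apply, map_mul,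
    Complex.conj_ofReal]
  change phase (Idx.neg i).1 * _ = _
  ring

lemma realStr_isAntiunitaryPart {q : ℝ} (hq : 0 < q) :
    IsAntiunitaryPart realStr (twistedReal q) := by
  have hw : ∀ k, 0 < twist q k := fun k => Real.rpow_pos_of_pos hq _
  refine ⟨unboundedMul (twist q) id, unboundedMul_isSelfAdjoint _,
    unboundedMul_inner_nonneg fun k => (hw k).le, unboundedMul_injective fun k => (hw k).ne',
    Set.Subset.antisymm (closure_minimal ?_ ?_) ?_⟩
  · rintro _ ⟨v, rfl⟩
    exact ⟨⟨incl v, incl_mem_domain _ v⟩, Prod.ext rfl (realStr_unboundedMul_incl q v)⟩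
  -- The range is the preimage of the graph of the positive part under (x, y) ↦ (x, J⁻¹y), and the
  -- graph of a self-adjoint operator is closed.
  · have hc := (unboundedMul_isSelfAdjoint (twist q)).isClosed
    have : (Set.range fun x : (unboundedMul (twist q) id).domain =>
        ((x : Spinors), realStr (unboundedMul (twist q) id x))) =
        (fun p : Spinors × Spinors => (p.1, realStr.symm p.2)) ⁻¹'
          ((unboundedMul (twist q) id).graph : Set (Spinors × Spinors)) := by
      ext ⟨x, y⟩
      constructor
      · rintro ⟨x, h⟩
        rw [Prod.ext_iff] at h
        obtain ⟨rfl, rfl⟩ := h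
        refine LinearPMap.mem_graph_iff _ |>.2 ⟨x, rfl, ?_⟩
        exact (realStr.symm_apply_apply _).symm
      · intro h
        obtain ⟨x', rfl, h2⟩ := LinearPMap.mem_graph_iff _ |>.1 h
        refine ⟨x', Prod.ext rfl ?_⟩
        change realStr _ = y
        rw [h2]
        exact realStr.apply_symm_apply _
    rw [this]
    exact hc.preimage (continuous_fst.prodMk (realStr.symm.continuous.comp continuous_snd))
  · rintro _ ⟨x, rfl⟩
    -- The positive part P is diagonal, so truncating x to finitely many basis vectors truncates Px
    -- in the same way and both components converge along the same net.
    have h1 := hasSum_ket (x : Spinors)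
    have h2 := hasSum_ket (unboundedMul (twist q) id x)
    have h3 := (realStr.continuous.tendsto _).comp h2
    refine mem_closure_of_tendsto (h1.prodMk_nhds h3) (Filter.Eventually.of_forall fun s => ?_)
    have e2 : incl (∑ k ∈ s, (x : Spinors) k • Finsupp.single k 1) =
        ∑ k ∈ s, (x : Spinors) k • ket k := by simp only [map_sum, map_smul, incl_single]
    refine ⟨∑ k ∈ s, (x : Spinors) k • Finsupp.single k 1, ?_⟩
    refine Prod.ext ?_ ?_
    · exact e2
    · change incl (twistedReal q _) = realStr _
      rw [← realStr_unboundedMul_incl]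
      congr 1
      ext i
      rw [unboundedMul_apply]
      have e1 : ∀ (f : Idx → ℂ), (∑ k ∈ s, f k • ket k : Spinors) i = if i ∈ s then f i else 0 := by
        intro f
        rw [lp.coeFn_sum, Finset.sum_apply]
        change ∑ k ∈ s, f k * ket k i = _
        simp [ket_apply]
      change _ * (incl _ : Spinors) i = _
      rw [e2, e1, e1]
      split_ifs
      · rfl
      · simp

end

section

/-! ### The symmetry algebra on the lattice -/

/-- A basis vector of the lattice model. -/
def bv (M J : ℤ) (s : ℤˣ) (p r : ℤ) (b : Bool) : Lat := lv M J s (fb p r b)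

def bvOp (f : ℤ → ℤ → ℤˣ → ℤ → ℤ → Bool → Lat) : Lat →ₗ[ℂ] Lat :=
  latOp fun M J s => Finsupp.linearCombination ℂ fun i => f M J s i.1 i.2.1 i.2.2

@[simp] lemma bvOp_bv (f : ℤ → ℤ → ℤˣ → ℤ → ℤ → Bool → Lat) (M J : ℤ) (s : ℤˣ) (p r : ℤ)
    (b : Bool) : bvOp f (bv M J s p r b) = f M J s p r b := by
  simp [bvOp, bv, fb]

section
variable (q : ℝ)

def lE₁ : Lat →ₗ[ℂ] Lat := bvOp fun M J s p r b =>
  (q ^ (-J) / nu q 1 * nu q (J - M)) • bv (M + 1) J s p r b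

def lF₁ : Lat →ₗ[ℂ] Lat := bvOp fun M J s p r b =>
  (q ^ (-J) / nu q 1 * nu q (J + M + 1)) • bv (M - 1) J s p r b

/-- The terms come from the coefficients a, b, c, which raise, preserve and lower j; all of them
preserve l, so only p, r and the parity adjust. -/
def lE₂ : Lat →ₗ[ℂ] Lat := bvOp fun M J s p r b => match b with
  | true =>
    (q ^ (M - p - r + 1) * nu q (2 * p) / (nu q 2 * nu q (2 * J + 3))) •
        bv (M - 1) (J + 1) s (p - 1) r true
    + (q ^ (3 * J - p - r + 2) * nu q (J + M + 1) * nu q (2 * p) /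
        (nu q (2 * J + 1) * nu q (2 * J + 3))) • bv (M - 1) J s (p - 1) (r + 1) false
    + (-q ^ (-M - p - r + 1) * nu q (J + M + 1) * nu q (J + M) * nu q (2 * J + 2 * p + 1) /
        (nu q 2 * nu q (2 * J + 1))) • bv (M - 1) (J - 1) s p (r + 1) true
  | false =>
    (q ^ (M - p - r + 2) * nu q (2 * p) / (nu q 2 * nu q (2 * J + 3))) •
        bv (M - 1) (J + 1) s (p - 1) r false
    + (q ^ (J - p - r) * nu q (J + M + 1) * nu q (2 * J + 2 * p + 3) /
        (nu q (2 * J + 1) * nu q (2 * J + 3))) • bv (M - 1) J s p r true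
    + (-q ^ (-M - p - r) * nu q (J + M + 1) * nu q (J + M) * nu q (2 * J + 2 * p + 3) /
        (nu q 2 * nu q (2 * J + 1))) • bv (M - 1) (J - 1) s p (r + 1) false

def lF₂ : Lat →ₗ[ℂ] Lat := bvOp fun M J s p r b => match b with
  | true =>
    (q ^ (M - p - r + 1) * nu q (J - M) * nu q (J - M - 1) * nu q (2 * J + 2 * r + 3) /
        (nu q 2 * nu q (2 * J + 1))) • bv (M + 1) (J - 1) s (p + 1) r true
    + (q ^ (J - p - r) * nu q (J - M) * nu q (2 * J + 2 * r + 3) /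
        (nu q (2 * J + 1) * nu q (2 * J + 3))) • bv (M + 1) J s p r false
    + (-q ^ (-M - p - r + 1) * nu q (2 * r) / (nu q 2 * nu q (2 * J + 3))) •
        bv (M + 1) (J + 1) s p (r - 1) true
  | false =>
    (q ^ (M - p - r + 2) * nu q (J - M) * nu q (J - M - 1) * nu q (2 * J + 2 * r + 1) /
        (nu q 2 * nu q (2 * J + 1))) • bv (M + 1) (J - 1) s (p + 1) r false
    + (q ^ (3 * J - p - r + 2) * nu q (J - M) * nu q (2 * r) /
        (nu q (2 * J + 1) * nu q (2 * J + 3))) • bv (M + 1) J s (p + 1) (r - 1) true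
    + (-q ^ (-M - p - r) * nu q (2 * r) / (nu q 2 * nu q (2 * J + 3))) •
        bv (M + 1) (J + 1) s p (r - 1) false

end

section
variable {q : ℝ} (hq : q ∈ Set.Ioo (0:ℝ) 1)
include hq

lemma inv_sub_inv_self : (q - q⁻¹)⁻¹ = -q / nu q 1 := by
  have h0 := hq.1.ne'
  have n1 := nu_ne hq 1 (by omega)
  rw [inv_eq_iff_eq_inv, inv_div, nu]
  simp only [Int.reduceMul, zpow_ofNat]
  field_simp
  ring

lemma inv_sq_sub_inv_sq : (q ^ 2 - (q ^ 2)⁻¹)⁻¹ = -q ^ 2 / nu q 2 := by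
  have h0 := hq.1.ne'
  have n1 := nu_ne hq 1 (by omega)
  rw [inv_eq_iff_eq_inv, inv_div, nu]
  simp only [Int.reduceMul, zpow_ofNat]
  field_simp
  ring

variable (M J : ℤ) (s : ℤˣ) (p r : ℤ) (b : Bool)

/-- The scalar on the right is the eigenvalue of (K₁² - K₁⁻²)/(q - q⁻¹) at m₁ = M + 1/2. Unlike for
the sphere, no condition on J is needed: all denominators that involve labels have odd arguments. -/
lemma lE₁_lF₁ : lE₁ q (lF₁ q (bv M J s p r b)) - lF₁ q (lE₁ q (bv M J s p r b)) =
    ((q - q⁻¹)⁻¹ * (q ^ (2 * M + 1) - (q ^ (2 * M + 1))⁻¹)) • bv M J s p r b := by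
  have h0 := hq.1.ne'
  have n1 := nu_ne hq 1 (by omega)
  rw [inv_sub_inv_self hq]
  simp only [lE₁, lF₁, bvOp_bv, LinearMap.map_smul_of_tower, smul_smul, sub_add_cancel,
    add_sub_cancel_right, Int.reduceSub]
  match_scalars
  field_simp
  simp only [nu, zpow_add₀ h0, zpow_sub₀ h0, zpow_neg, mul_add, mul_sub, Int.reduceMul,
    zpow_two_mul_aux, zpow_ofNat, zpow_one]
  have hJ := zpow_ne_zero J h0
  have hM := zpow_ne_zero M h0
  generalize q ^ J = x at *
  generalize q ^ M = y at *
  field_simp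
  ring

set_option maxHeartbeats 1000000 in
lemma lE₁_lF₂ : lE₁ q (lF₂ q (bv M J s p r b)) = lF₂ q (lE₁ q (bv M J s p r b)) := by
  have h0 := hq.1.ne'
  have n1 := nu_ne hq 1 (by omega)
  have n2 := nu_ne hq 2 (by omega)
  have m1 := nu_ne hq (2 * J + 1) (by omega)
  have m3 := nu_ne hq (2 * J + 3) (by omega)
  cases b
  all_goals
    simp only [lE₁, lF₂, bvOp_bv, LinearMap.map_smul_of_tower, map_add, smul_add, smul_smul]
    match_scalars
    all_goals
      try field_simp
      all_goals
        try simp only [nu, zpow_add₀ h0, zpow_sub₀ h0, zpow_neg, mul_add, mul_sub, ← mul_assoc,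
          Int.reduceMul, zpow_two_mul_aux, zpow_three_mul_aux, zpow_four_mul_aux, zpow_ofNat, zpow_one]
        have hJ := zpow_ne_zero J h0
        have hM := zpow_ne_zero M h0
        have hp := zpow_ne_zero p h0
        have hr := zpow_ne_zero r h0
        generalize q ^ J = x at *
        generalize q ^ M = y at *
        generalize q ^ p = z at *
        generalize q ^ r = t at *
        try field_simp
        try ring

set_option maxHeartbeats 4000000 in
lemma lE₂_lF₂ :
    lE₂ q (lF₂ q (bv M J s p r b)) - lF₂ q (lE₂ q (bv M J s p r b)) = ((q ^ 2 - (q ^ 2)⁻¹)⁻¹ *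
      (q ^ (2 * (r - p - (if b then 0 else 1) - M)) - (q ^ (2 * (r - p - (if b then 0 else 1) - M)))⁻¹)) • (bv M J s p r b) := by
  have h0 := hq.1.ne'
  have n1 := nu_ne hq 1 (by omega)
  have n2 := nu_ne hq 2 (by omega)
  obtain ⟨J, rfl⟩ : ∃ n, J = n + 3 := ⟨J - 3, by ring⟩
  have m1 := nu_ne hq (2 * J + 1) (by omega)
  have m3 := nu_ne hq (2 * J + 3) (by omega)
  have m5 := nu_ne hq (2 * J + 5) (by omega)
  have m7 := nu_ne hq (2 * J + 7) (by omega)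
  have m9 := nu_ne hq (2 * J + 9) (by omega)
  have m11 := nu_ne hq (2 * J + 11) (by omega)
  rw [inv_sq_sub_inv_sq hq]
  cases b
  all_goals
    simp only [lE₂, lF₂, if_true, if_false, Bool.false_eq_true, bvOp_bv, LinearMap.map_smul_of_tower, map_add, map_sub, smul_add, smul_sub, smul_smul,
      sub_add_cancel, add_sub_cancel_right, add_sub_assoc, add_assoc, mul_add, Int.reduceAdd,
      Int.reduceSub, Int.reduceMul]
    match_scalars
    all_goals
      try field_simp
      all_goals
        try simp only [nu, zpow_add₀ h0, zpow_sub₀ h0, zpow_neg, mul_add, mul_sub, ← mul_assoc,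
          Int.reduceMul, zpow_two_mul_aux, zpow_three_mul_aux, zpow_four_mul_aux, zpow_ofNat, zpow_one]
        have hJ := zpow_ne_zero J h0
        have hM := zpow_ne_zero M h0
        have hp := zpow_ne_zero p h0
        have hr := zpow_ne_zero r h0
        generalize q ^ J = x at *
        generalize q ^ M = y at *
        generalize q ^ p = z at *
        generalize q ^ r = t at *
        try field_simp
        try ring

set_option maxHeartbeats 4000000 in
lemma lE_serre₁ :
    lE₁ q (lE₂ q (lE₂ q (bv M J s p r b))) - (q ^ 2 + (q ^ 2)⁻¹) • lE₂ q (lE₁ q (lE₂ q (bv M J s p r b))) +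
      lE₂ q (lE₂ q (lE₁ q (bv M J s p r b))) = 0 := by
  have h0 := hq.1.ne'
  have n1 := nu_ne hq 1 (by omega)
  have n2 := nu_ne hq 2 (by omega)
  obtain ⟨J, rfl⟩ : ∃ n, J = n + 3 := ⟨J - 3, by ring⟩
  have m1 := nu_ne hq (2 * J + 1) (by omega)
  have m3 := nu_ne hq (2 * J + 3) (by omega)
  have m5 := nu_ne hq (2 * J + 5) (by omega)
  have m7 := nu_ne hq (2 * J + 7) (by omega)
  have m9 := nu_ne hq (2 * J + 9) (by omega)
  have m11 := nu_ne hq (2 * J + 11) (by omega)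
  cases b
  all_goals
    simp only [lE₁, lE₂, bvOp_bv, LinearMap.map_smul_of_tower, map_add, map_sub, smul_add, smul_sub, smul_smul,
      sub_add_cancel, add_sub_cancel_right, add_sub_assoc, add_assoc, mul_add, Int.reduceAdd,
      Int.reduceSub, Int.reduceMul]
    match_scalars
    all_goals
      try field_simp
      all_goals
        try simp only [nu, zpow_add₀ h0, zpow_sub₀ h0, zpow_neg, mul_add, mul_sub, ← mul_assoc,
          Int.reduceMul, zpow_two_mul_aux, zpow_three_mul_aux, zpow_four_mul_aux, zpow_ofNat, zpow_one]
        have hJ := zpow_ne_zero J h0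
        have hM := zpow_ne_zero M h0
        have hp := zpow_ne_zero p h0
        have hr := zpow_ne_zero r h0
        generalize q ^ J = x at *
        generalize q ^ M = y at *
        generalize q ^ p = z at *
        generalize q ^ r = t at *
        try field_simp
        try ring

set_option maxHeartbeats 4000000 in
lemma lE_serre₂ :
    lE₁ q (lE₁ q (lE₁ q (lE₂ q (bv M J s p r b)))) - (q ^ 2 + 1 + (q ^ 2)⁻¹) •
      (lE₁ q (lE₁ q (lE₂ q (lE₁ q (bv M J s p r b)))) - lE₁ q (lE₂ q (lE₁ q (lE₁ q (bv M J s p r b))))) -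
      lE₂ q (lE₁ q (lE₁ q (lE₁ q (bv M J s p r b)))) = 0 := by
  have h0 := hq.1.ne'
  have n1 := nu_ne hq 1 (by omega)
  have n2 := nu_ne hq 2 (by omega)
  obtain ⟨J, rfl⟩ : ∃ n, J = n + 3 := ⟨J - 3, by ring⟩
  have m1 := nu_ne hq (2 * J + 1) (by omega)
  have m3 := nu_ne hq (2 * J + 3) (by omega)
  have m5 := nu_ne hq (2 * J + 5) (by omega)
  have m7 := nu_ne hq (2 * J + 7) (by omega)
  have m9 := nu_ne hq (2 * J + 9) (by omega)
  have m11 := nu_ne hq (2 * J + 11) (by omega)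
  cases b
  all_goals
    simp only [lE₁, lE₂, bvOp_bv, LinearMap.map_smul_of_tower, map_add, map_sub, smul_add, smul_sub, smul_smul,
      sub_add_cancel, add_sub_cancel_right, add_sub_assoc, add_assoc, mul_add, Int.reduceAdd,
      Int.reduceSub, Int.reduceMul]
    match_scalars
    all_goals
      try field_simp
      all_goals
        try simp only [nu, zpow_add₀ h0, zpow_sub₀ h0, zpow_neg, mul_add, mul_sub, ← mul_assoc,
          Int.reduceMul, zpow_two_mul_aux, zpow_three_mul_aux, zpow_four_mul_aux, zpow_ofNat, zpow_one]
        have hJ := zpow_ne_zero J h0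
        have hM := zpow_ne_zero M h0
        have hp := zpow_ne_zero p h0
        have hr := zpow_ne_zero r h0
        generalize q ^ J = x at *
        generalize q ^ M = y at *
        generalize q ^ p = z at *
        generalize q ^ r = t at *
        try field_simp
        try ring

end

end

section

/-! ### Normal forms of the coefficients of `E₁` and `E₂` -/

/-- The factor `q^(-1/2) / ν(1)`. -/
def kap (q : ℝ) : ℝ := q ^ (-(1 / 2) : ℝ) / nu q 1

def e₁ (q : ℝ) (J M : ℤ) : ℝ := √(qn q (hf J - hf M) * qn q (hf J + hf M + 1))

def ep (q : ℝ) (J M : ℤ) : ℝ := √(qn q (hf J - hf M + 1) * qn q (hf J - hf M + 2))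

def e₀ (q : ℝ) (J M : ℤ) : ℝ := √(qn q (hf J + hf M) * qn q (hf J - hf M + 1))

def em (q : ℝ) (J M : ℤ) : ℝ := √(qn q (hf J + hf M) * qn q (hf J + hf M - 1))

section
variable {q : ℝ} (hq : q ∈ Set.Ioo (0:ℝ) 1)
include hq

lemma kap_ne : kap q ≠ 0 :=
  (div_pos (Real.rpow_pos_of_pos hq.1 _) (nu_pos hq one_pos)).ne'

lemma sqrt_qn_kap {X Y : ℝ} (e x y : ℤ) (hX : X = x) (hY : Y = y) (he : 1 - (X + Y) / 2 = e - 1 / 2) :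
    √(qn q X * qn q Y) = q ^ e * kap q * √(nu q x * nu q y) := by
  rw [sqrt_qn hq x y hX hY, he, sub_eq_add_neg, Real.rpow_add hq.1, Real.rpow_intCast, kap]
  ring

lemma sqrt_qn_int {X Y : ℝ} (e x y : ℤ) (hX : X = x) (hY : Y = y) (he : 1 - (X + Y) / 2 = e) :
    √(qn q X * qn q Y) = q ^ e * (nu q 1)⁻¹ * √(nu q x * nu q y) := by
  rw [sqrt_qn hq x y hX hY, he, Real.rpow_intCast]
  ring

/-- Because |ε| = 1/2, the two factors under the root in the denominators of a and c coincide, so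
the denominator is rational. The half-integral power of q that remains is collected in `kap`. -/
lemma sqrt_qn_div {X Y Z Z' : ℝ} (e x y z : ℤ) (hX : X = x) (hY : Y = y) (hZ : Z = z) (hZ' : Z' = z)
    (hz : 0 < z) (he : Z - (X + Y) / 2 + 1 / 2 = e) :
    1 / qn q 2 * √(qn q X * qn q Y / (qn q Z * qn q Z')) =
      q ^ e * (kap q)⁻¹ * (√(nu q x * nu q y) / (nu q 2 * nu q z)) := by
  have h1 := (nu_pos hq (n := 1) one_pos).ne'
  have h2 := (nu_pos hq (n := 2) two_pos).ne'
  have h3 : 0 ≤ qn q Z := by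
    rw [qn_eq hq z hZ]
    exact mul_nonneg (Real.rpow_nonneg hq.1.le _)
      (div_nonneg (nu_nonneg hq hz.le) (nu_nonneg hq zero_le_one))
  have h4 := (Real.rpow_pos_of_pos hq.1 (-(1 / 2))).ne'
  have h0 := hq.1.ne'
  have h5 := sqrt_div hq (E := -(1 / 2)) (e - 1) x y z hX hY hZ (by push_cast; rw [← he]; ring)
  rw [show Z' = Z by rw [hZ', hZ], Real.sqrt_div' _ (mul_self_nonneg _), Real.sqrt_mul_self h3,
    qn_eq hq (X := 2) 2 (by norm_num), show (1 - 2 : ℝ) = -1 by norm_num, Real.rpow_neg_one, kap]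
  rw [zpow_sub_one₀ h0] at h5
  have h6 : √(qn q X * qn q Y) / qn q Z =
      (q ^ (-(1 / 2) : ℝ))⁻¹ * (q ^ e * q⁻¹ * (√(nu q x * nu q y) / nu q z)) := by
    rw [← h5, inv_mul_cancel_left₀ h4]
  rw [h6]
  field_simp

section
variable (J M : ℤ)

lemma e₁_eq : e₁ q J M = q ^ (-J) * (nu q 1)⁻¹ * √(nu q (J - M) * nu q (J + M + 2)) := by
  unfold e₁
  apply sqrt_qn_int hq <;> simp only [hf] <;> push_cast <;> ring

lemma ep_eq : ep q J M = q ^ (M - J) * kap q * √(nu q (J - M + 1) * nu q (J - M + 2)) := by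
  unfold ep
  apply sqrt_qn_kap hq <;> simp only [hf] <;> push_cast <;> ring

lemma e₀_eq : e₀ q J M = q ^ (-J) * (nu q 1)⁻¹ * √(nu q (J + M + 1) * nu q (J - M + 1)) := by
  unfold e₀
  apply sqrt_qn_int hq <;> simp only [hf] <;> push_cast <;> ring

lemma em_eq : em q J M = q ^ (1 - J - M) * kap q * √(nu q (J + M + 1) * nu q (J + M)) := by
  unfold em
  apply sqrt_qn_kap hq <;> simp only [hf] <;> push_cast <;> ring

end

section
variable (J p r : ℤ)

lemma ca_true (hJ : 0 ≤ J) : ca q (J + p + r) J (r - p) = q ^ (J - p - r + 1) * (kap q)⁻¹ *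
    (√(nu q (2 * p) * nu q (2 * J + 2 * r + 5)) / (nu q 2 * nu q (2 * J + 3))) := by
  simp only [ca, eps_true, abs_of_pos (show (0 : ℝ) < 1 / 2 by norm_num)]
  apply sqrt_qn_div hq (hz := by omega) <;> simp only [hf] <;> push_cast <;> ring

lemma ca_false (hJ : 0 ≤ J) : ca q (J + p + r) J (r - p - 1) = q ^ (J - p - r + 2) * (kap q)⁻¹ *
    (√(nu q (2 * p) * nu q (2 * J + 2 * r + 3)) / (nu q 2 * nu q (2 * J + 3))) := by
  simp only [ca, eps_false, show |(-1 / 2 : ℝ)| = 1 / 2 by norm_num [abs_of_neg]]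
  apply sqrt_qn_div hq (hz := by omega) <;> simp only [hf] <;> push_cast <;> ring

lemma cc_true (hJ : 0 ≤ J) : cc q (J + p + r) J (r - p) = -q ^ (J - p - r) * (kap q)⁻¹ *
    (√(nu q (2 * r + 2) * nu q (2 * J + 2 * p + 1)) / (nu q 2 * nu q (2 * J + 1))) := by
  simp only [cc, eps_true, abs_of_pos (show (0 : ℝ) < 1 / 2 by norm_num), neg_mul, neg_div, neg_inj]
  apply sqrt_qn_div hq (hz := by omega) <;> simp only [hf] <;> push_cast <;> ring

lemma cc_false (hJ : 0 ≤ J) : cc q (J + p + r) J (r - p - 1) = -q ^ (J - p - r - 1) * (kap q)⁻¹ *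
    (√(nu q (2 * r + 2) * nu q (2 * J + 2 * p + 3)) / (nu q 2 * nu q (2 * J + 1))) := by
  simp only [cc, eps_false, show |(-1 / 2 : ℝ)| = 1 / 2 by norm_num [abs_of_neg], neg_mul,
    neg_div (qn q 2), neg_inj]
  apply sqrt_qn_div hq (hz := by omega) <;> simp only [hf] <;> push_cast <;> ring

lemma cb_true : cb q (J + p + r) J (r - p) = q ^ (4 * J - p - r + 2) * nu q 1 *
    (√(nu q (2 * p) * nu q (2 * r + 2)) / (nu q (2 * J + 1) * nu q (2 * J + 3))) := by
  simp only [cb, eps_true]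
  rw [abs_of_pos (by norm_num), show (2 * (1 / 2) : ℝ) = q ^ (0 : ℝ) by simp]
  apply sqrt_div_mul hq <;> simp only [hf] <;> push_cast <;> ring

lemma cb_false : cb q (J + p + r) J (r - p - 1) = q ^ (2 * J - p - r) * nu q 1 *
    (√(nu q (2 * J + 2 * p + 3) * nu q (2 * J + 2 * r + 3)) /
      (nu q (2 * J + 1) * nu q (2 * J + 3))) := by
  simp only [cb, eps_false]
  rw [abs_of_neg (by norm_num), show (2 * -(-1 / 2) : ℝ) = q ^ (0 : ℝ) by rw [Real.rpow_zero]; norm_num]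
  apply sqrt_div_mul hq <;> simp only [hf] <;> push_cast <;> ring

end

/-! ### The coefficients in the gauge of the lattice -/

omit hq in
lemma gauge_sqrt_two {x y g₁ g₂ r₁ r₂ : ℝ} (hx : 0 ≤ x) (h₁ : √x * g₁ = r₁) (h₂ : √y * g₂ = r₂)
    (K : ℝ) : K * √(x * y) * (g₁ * g₂) = K * (r₁ * r₂) := by
  rw [Real.sqrt_mul hx, ← h₁, ← h₂]; ring

section
variable {J M : ℤ} (hu : 0 ≤ J - M) (hu' : 0 ≤ J + M + 1)
include hu hu'

lemma gauge_e₁ : e₁ q J M * gU q J (M + 1) = (q ^ (-J) * (nu q 1)⁻¹ * nu q (J - M)) * gU q J M := by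
  have h1 := ig_down hq 1 (J - M) (J - (M + 1)) (J - M) (by omega) (by ring) (by ring) (by norm_num)
  have h2 := ig_up hq 1 1 (J + M + 1) (J + (M + 1) + 1) (J + M + 2) (by omega) (by ring) (by ring) (by norm_num)
  have h3 := gauge_sqrt_two (nu_nonneg hq (by omega)) h1 h2 (q ^ (-J) * (nu q 1)⁻¹)
  have h4 : e₁ q J M = q ^ (-J) * (nu q 1)⁻¹ * √(nu q (J - M) * nu q (J + M + 2)) := by
    rw [e₁_eq hq]
  rw [h4, gU, gU]
  linear_combination h3

lemma gauge_e₁' : e₁ q J (M - 1) * gU q J (M - 1) = (q ^ (-J) * (nu q 1)⁻¹ * nu q (J + M + 1)) * gU q J M := by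
  have h1 := ig_up hq 1 1 (J - M) (J - (M - 1)) (J - M + 1) (by omega) (by ring) (by ring) (by norm_num)
  have h2 := ig_down hq 1 (J + M + 1) (J + (M - 1) + 1) (J + M + 1) (by omega) (by ring) (by ring) (by norm_num)
  have h3 := gauge_sqrt_two (nu_nonneg hq (by omega)) h1 h2 (q ^ (-J) * (nu q 1)⁻¹)
  have h4 : e₁ q J (M - 1) = q ^ (-J) * (nu q 1)⁻¹ * √(nu q (J - M + 1) * nu q (J + M + 1)) := by
    rw [e₁_eq hq]; ring_nf
  rw [h4, gU, gU]
  linear_combination h3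

lemma gauge_e₀ : e₀ q J M * gU q J (M - 1) = (q ^ (-J) * (nu q 1)⁻¹ * nu q (J + M + 1)) * gU q J M := by
  have h1 := ig_down hq 1 (J + M + 1) (J + (M - 1) + 1) (J + M + 1) (by omega) (by ring) (by ring) (by norm_num)
  have h2 := ig_up hq 1 1 (J - M) (J - (M - 1)) (J - M + 1) (by omega) (by ring) (by ring) (by norm_num)
  have h3 := gauge_sqrt_two (nu_nonneg hq (by omega)) h1 h2 (q ^ (-J) * (nu q 1)⁻¹)
  have h4 : e₀ q J M = q ^ (-J) * (nu q 1)⁻¹ * √(nu q (J + M + 1) * nu q (J - M + 1)) := by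
    rw [e₀_eq hq]
  rw [h4, gU, gU]
  linear_combination h3

lemma gauge_e₀' : e₀ q J (M + 1) * gU q J (M + 1) = (q ^ (-J) * (nu q 1)⁻¹ * nu q (J - M)) * gU q J M := by
  have h1 := ig_up hq 1 1 (J + M + 1) (J + (M + 1) + 1) (J + M + 2) (by omega) (by ring) (by ring) (by norm_num)
  have h2 := ig_down hq 1 (J - M) (J - (M + 1)) (J - M) (by omega) (by ring) (by ring) (by norm_num)
  have h3 := gauge_sqrt_two (nu_nonneg hq (by omega)) h1 h2 (q ^ (-J) * (nu q 1)⁻¹)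
  have h4 : e₀ q J (M + 1) = q ^ (-J) * (nu q 1)⁻¹ * √(nu q (J + M + 2) * nu q (J - M)) := by
    rw [e₀_eq hq]; ring_nf
  rw [h4, gU, gU]
  linear_combination h3

lemma gauge_ep : ep q J M * gU q (J + 1) (M - 1) = (q ^ (M - J) * kap q * 1) * gU q J M := by
  have h1 := ig_up_up hq (J - M) (J + 1 - (M - 1)) (J + 1 - (M - 1)) (J - M + 1) (J - M + 2) (by omega) (by ring) (by ring) (by ring)
  have h4 : ep q J M = q ^ (M - J) * kap q * √(nu q (J - M + 1) * nu q (J - M + 2)) := by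
    rw [ep_eq hq]
  rw [h4, gU, gU]
  rw [show J + 1 + (M - 1) + 1 = J + M + 1 by ring]
  linear_combination q ^ (M - J) * kap q * ig q 1 1 (J + M + 1) * h1

lemma gauge_ep' : ep q (J - 1) (M + 1) * gU q (J - 1) (M + 1) = (q ^ (M - J + 2) * kap q * (nu q (J - M) * nu q (J - M - 1))) * gU q J M := by
  have h1 := ig_down_down hq (J - M) (J - 1 - (M + 1)) (J - M) (J - M - 1) (by omega) (by ring) (by ring) (by ring)
  have h4 : ep q (J - 1) (M + 1) = q ^ (M - J + 2) * kap q * √(nu q (J - M) * nu q (J - M - 1)) := by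
    rw [ep_eq hq, mul_comm (nu q (J - M))]; ring_nf
  rw [h4, gU, gU]
  rw [show J - 1 + (M + 1) + 1 = J + M + 1 by ring]
  linear_combination q ^ (M - J + 2) * kap q * ig q 1 1 (J + M + 1) * h1

lemma gauge_em : em q J M * gU q (J - 1) (M - 1) = (q ^ (1 - J - M) * kap q * (nu q (J + M + 1) * nu q (J + M))) * gU q J M := by
  have h1 := ig_down_down hq (J + M + 1) (J - 1 + (M - 1) + 1) (J + M + 1) (J + M) (by omega) (by ring) (by ring) (by ring)
  have h4 : em q J M = q ^ (1 - J - M) * kap q * √(nu q (J + M + 1) * nu q (J + M)) := by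
    rw [em_eq hq]
  rw [h4, gU, gU]
  rw [show J - 1 - (M - 1) = J - M by ring]
  linear_combination q ^ (1 - J - M) * kap q * ig q 1 1 (J - M) * h1

lemma gauge_em' : em q (J + 1) (M + 1) * gU q (J + 1) (M + 1) = (q ^ (-1 - J - M) * kap q * 1) * gU q J M := by
  have h1 := ig_up_up hq (J + M + 1) (J + 1 + (M + 1) + 1) (J + 1 + (M + 1) + 1) (J + M + 2) (J + M + 3) (by omega) (by ring) (by ring) (by ring)
  have h4 : em q (J + 1) (M + 1) = q ^ (-1 - J - M) * kap q * √(nu q (J + M + 2) * nu q (J + M + 3)) := by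
    rw [em_eq hq, mul_comm (nu q (J + M + 2))]; ring_nf
  rw [h4, gU, gU]
  rw [show J + 1 - (M + 1) = J - M by ring]
  linear_combination q ^ (-1 - J - M) * kap q * ig q 1 1 (J - M) * h1

end

section
variable {J p r : ℤ} (hJ : 0 ≤ J) (hp : 0 ≤ p) (hr : 0 ≤ r)
include hJ hp hr

lemma gauge_ca_true {L N : ℤ} (hL : L = J + p + r) (hN : N = r - p) :
    ca q L J N * gW q (J + 1) (p - 1) r true =
      (q ^ (J - p - r + 1) * (kap q)⁻¹ * (nu q (2 * p) / (nu q 2 * nu q (2 * J + 3)))) * gW q J p r true := by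
  subst hL hN
  have hn : ca q (J + p + r) J (r - p) = q ^ (J - p - r + 1) * (kap q)⁻¹ *
      (√(nu q (2 * p) * nu q (2 * J + 2 * r + 5)) / (nu q 2 * nu q (2 * J + 3))) := by
    rw [ca_true hq J p r (by omega)]
  have h1 := ig_down hq 2 (p) (p - 1) (2 * p) (by omega) (by ring) (by ring) (by norm_num)
  have h2 := ig_up hq 2 1 (J + r + 2) (J + 1 + r + 2) (2 * J + 2 * r + 5) (by omega) (by ring) (by ring) (by norm_num)
  have h3 := gauge_two (nu_nonneg hq (by omega)) h1 h2 (q ^ (J - p - r + 1) * (kap q)⁻¹) (nu q 2 * nu q (2 * J + 3))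
    (ig q 2 2 (r) * ig q 2 1 (J + p + 1))
  rw [hn, gW_true (J + 1) (p - 1) r (J + 1 + r + 2) (J + p + 1) (by ring) (by ring),
    gW_true J p r (J + r + 2) (J + p + 1) (by ring) (by ring)]
  linear_combination h3

lemma gauge_ca_false {L N : ℤ} (hL : L = J + p + r) (hN : N = r - p - 1) :
    ca q L J N * gW q (J + 1) (p - 1) r false =
      (q ^ (J - p - r + 2) * (kap q)⁻¹ * (nu q (2 * p) / (nu q 2 * nu q (2 * J + 3)))) * gW q J p r false := by
  subst hL hN
  have hn : ca q (J + p + r) J (r - p - 1) = q ^ (J - p - r + 2) * (kap q)⁻¹ *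
      (√(nu q (2 * p) * nu q (2 * J + 2 * r + 3)) / (nu q 2 * nu q (2 * J + 3))) := by
    rw [ca_false hq J p r (by omega)]
  have h1 := ig_down hq 2 (p) (p - 1) (2 * p) (by omega) (by ring) (by ring) (by norm_num)
  have h2 := ig_up hq 2 1 (J + r + 1) (J + 1 + r + 1) (2 * J + 2 * r + 3) (by omega) (by ring) (by ring) (by norm_num)
  have h3 := gauge_two (nu_nonneg hq (by omega)) h1 h2 (q ^ (J - p - r + 2) * (kap q)⁻¹) (nu q 2 * nu q (2 * J + 3))
    (ig q 2 2 (r) * ig q 2 1 (J + p + 2))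
  rw [hn, gW_false (J + 1) (p - 1) r (J + 1 + r + 1) (J + p + 2) (by ring) (by ring),
    gW_false J p r (J + r + 1) (J + p + 2) (by ring) (by ring)]
  linear_combination h3

lemma gauge_ca_true' {L N : ℤ} (hL : L = J - 1 + (p + 1) + r) (hN : N = r - (p + 1)) (hJ₁ : 0 ≤ J - 1) :
    ca q L (J - 1) N * gW q (J - 1) (p + 1) r true =
      (q ^ (J - p - r - 1) * (kap q)⁻¹ * (nu q (2 * J + 2 * r + 3) / (nu q 2 * nu q (2 * J + 1)))) * gW q J p r true := by
  subst hL hN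
  have hn : ca q (J - 1 + (p + 1) + r) (J - 1) (r - (p + 1)) = q ^ (J - p - r - 1) * (kap q)⁻¹ *
      (√(nu q (2 * p + 2) * nu q (2 * J + 2 * r + 3)) / (nu q 2 * nu q (2 * J + 1))) := by
    rw [ca_true hq (J - 1) (p + 1) r (by omega)]; ring_nf
  have h1 := ig_up hq 2 2 (p) (p + 1) (2 * p + 2) (by omega) (by ring) (by ring) (by norm_num)
  have h2 := ig_down_one hq (J + r + 2) (J - 1 + r + 2) (2 * J + 2 * r + 3) (by omega) (by ring) (by ring)
  have h3 := gauge_two (nu_nonneg hq (by omega)) h1 h2 (q ^ (J - p - r - 1) * (kap q)⁻¹) (nu q 2 * nu q (2 * J + 1))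
    (ig q 2 2 (r) * ig q 2 1 (J + p + 1))
  rw [hn, gW_true (J - 1) (p + 1) r (J - 1 + r + 2) (J + p + 1) (by ring) (by ring),
    gW_true J p r (J + r + 2) (J + p + 1) (by ring) (by ring)]
  linear_combination h3

lemma gauge_ca_false' {L N : ℤ} (hL : L = J - 1 + (p + 1) + r) (hN : N = r - (p + 1) - 1) (hJ₁ : 0 ≤ J - 1) :
    ca q L (J - 1) N * gW q (J - 1) (p + 1) r false =
      (q ^ (J - p - r) * (kap q)⁻¹ * (nu q (2 * J + 2 * r + 1) / (nu q 2 * nu q (2 * J + 1)))) * gW q J p r false := by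
  subst hL hN
  have hn : ca q (J - 1 + (p + 1) + r) (J - 1) (r - (p + 1) - 1) = q ^ (J - p - r) * (kap q)⁻¹ *
      (√(nu q (2 * p + 2) * nu q (2 * J + 2 * r + 1)) / (nu q 2 * nu q (2 * J + 1))) := by
    rw [ca_false hq (J - 1) (p + 1) r (by omega)]; ring_nf
  have h1 := ig_up hq 2 2 (p) (p + 1) (2 * p + 2) (by omega) (by ring) (by ring) (by norm_num)
  have h2 := ig_down_one hq (J + r + 1) (J - 1 + r + 1) (2 * J + 2 * r + 1) (by omega) (by ring) (by ring)
  have h3 := gauge_two (nu_nonneg hq (by omega)) h1 h2 (q ^ (J - p - r) * (kap q)⁻¹) (nu q 2 * nu q (2 * J + 1))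
    (ig q 2 2 (r) * ig q 2 1 (J + p + 2))
  rw [hn, gW_false (J - 1) (p + 1) r (J - 1 + r + 1) (J + p + 2) (by ring) (by ring),
    gW_false J p r (J + r + 1) (J + p + 2) (by ring) (by ring)]
  linear_combination h3

lemma gauge_cb_true {L N : ℤ} (hL : L = J + p + r) (hN : N = r - p) :
    cb q L J N * gW q J (p - 1) (r + 1) false =
      (q ^ (4 * J - p - r + 2) * nu q 1 * (nu q (2 * p) / (nu q (2 * J + 1) * nu q (2 * J + 3)))) * gW q J p r true := by
  subst hL hN
  have hn : cb q (J + p + r) J (r - p) = q ^ (4 * J - p - r + 2) * nu q 1 *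
      (√(nu q (2 * p) * nu q (2 * r + 2)) / (nu q (2 * J + 1) * nu q (2 * J + 3))) := by
    rw [cb_true hq J p r]
  have h1 := ig_down hq 2 (p) (p - 1) (2 * p) (by omega) (by ring) (by ring) (by norm_num)
  have h2 := ig_up hq 2 2 (r) (r + 1) (2 * r + 2) (by omega) (by ring) (by ring) (by norm_num)
  have h3 := gauge_two (nu_nonneg hq (by omega)) h1 h2 (q ^ (4 * J - p - r + 2) * nu q 1) (nu q (2 * J + 1) * nu q (2 * J + 3))
    (ig q 2 1 (J + r + 2) * ig q 2 1 (J + p + 1))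
  rw [hn, gW_false J (p - 1) (r + 1) (J + r + 2) (J + p + 1) (by ring) (by ring),
    gW_true J p r (J + r + 2) (J + p + 1) (by ring) (by ring)]
  linear_combination h3

lemma gauge_cb_false {L N : ℤ} (hL : L = J + p + r) (hN : N = r - p - 1) :
    cb q L J N * gW q J p r true =
      (q ^ (2 * J - p - r) * nu q 1 * (nu q (2 * J + 2 * p + 3) / (nu q (2 * J + 1) * nu q (2 * J + 3)))) * gW q J p r false := by
  subst hL hN
  have hn : cb q (J + p + r) J (r - p - 1) = q ^ (2 * J - p - r) * nu q 1 *
      (√(nu q (2 * J + 2 * p + 3) * nu q (2 * J + 2 * r + 3)) / (nu q (2 * J + 1) * nu q (2 * J + 3))) := by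
    rw [cb_false hq J p r]
  have h1 := ig_down_one hq (J + p + 2) (J + p + 1) (2 * J + 2 * p + 3) (by omega) (by ring) (by ring)
  have h2 := ig_up hq 2 1 (J + r + 1) (J + r + 2) (2 * J + 2 * r + 3) (by omega) (by ring) (by ring) (by norm_num)
  have h3 := gauge_two (nu_nonneg hq (by omega)) h1 h2 (q ^ (2 * J - p - r) * nu q 1) (nu q (2 * J + 1) * nu q (2 * J + 3))
    (ig q 2 2 (p) * ig q 2 2 (r))
  rw [hn, gW_true J p r (J + r + 2) (J + p + 1) (by ring) (by ring),
    gW_false J p r (J + r + 1) (J + p + 2) (by ring) (by ring)]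
  linear_combination h3

lemma gauge_cb_true' {L N : ℤ} (hL : L = J + p + r) (hN : N = r - p - 1) :
    cb q L J N * gW q J p r false =
      (q ^ (2 * J - p - r) * nu q 1 * (nu q (2 * J + 2 * r + 3) / (nu q (2 * J + 1) * nu q (2 * J + 3)))) * gW q J p r true := by
  subst hL hN
  have hn : cb q (J + p + r) J (r - p - 1) = q ^ (2 * J - p - r) * nu q 1 *
      (√(nu q (2 * J + 2 * p + 3) * nu q (2 * J + 2 * r + 3)) / (nu q (2 * J + 1) * nu q (2 * J + 3))) := by
    rw [cb_false hq J p r]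
  have h1 := ig_up hq 2 1 (J + p + 1) (J + p + 2) (2 * J + 2 * p + 3) (by omega) (by ring) (by ring) (by norm_num)
  have h2 := ig_down_one hq (J + r + 2) (J + r + 1) (2 * J + 2 * r + 3) (by omega) (by ring) (by ring)
  have h3 := gauge_two (nu_nonneg hq (by omega)) h1 h2 (q ^ (2 * J - p - r) * nu q 1) (nu q (2 * J + 1) * nu q (2 * J + 3))
    (ig q 2 2 (p) * ig q 2 2 (r))
  rw [hn, gW_false J p r (J + r + 1) (J + p + 2) (by ring) (by ring),
    gW_true J p r (J + r + 2) (J + p + 1) (by ring) (by ring)]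
  linear_combination h3

lemma gauge_cb_false' {L N : ℤ} (hL : L = J + (p + 1) + (r - 1)) (hN : N = (r - 1) - (p + 1)) :
    cb q L J N * gW q J (p + 1) (r - 1) true =
      (q ^ (4 * J - p - r + 2) * nu q 1 * (nu q (2 * r) / (nu q (2 * J + 1) * nu q (2 * J + 3)))) * gW q J p r false := by
  subst hL hN
  have hn : cb q (J + (p + 1) + (r - 1)) J ((r - 1) - (p + 1)) = q ^ (4 * J - p - r + 2) * nu q 1 *
      (√(nu q (2 * p + 2) * nu q (2 * r)) / (nu q (2 * J + 1) * nu q (2 * J + 3))) := by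
    rw [cb_true hq J (p + 1) (r - 1)]; ring_nf
  have h1 := ig_up hq 2 2 (p) (p + 1) (2 * p + 2) (by omega) (by ring) (by ring) (by norm_num)
  have h2 := ig_down hq 2 (r) (r - 1) (2 * r) (by omega) (by ring) (by ring) (by norm_num)
  have h3 := gauge_two (nu_nonneg hq (by omega)) h1 h2 (q ^ (4 * J - p - r + 2) * nu q 1) (nu q (2 * J + 1) * nu q (2 * J + 3))
    (ig q 2 1 (J + r + 1) * ig q 2 1 (J + p + 2))
  rw [hn, gW_true J (p + 1) (r - 1) (J + r + 1) (J + p + 2) (by ring) (by ring),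
    gW_false J p r (J + r + 1) (J + p + 2) (by ring) (by ring)]
  linear_combination h3

lemma gauge_cc_true {L N : ℤ} (hL : L = J + p + r) (hN : N = r - p) :
    cc q L J N * gW q (J - 1) p (r + 1) true =
      (-q ^ (J - p - r) * (kap q)⁻¹ * (nu q (2 * J + 2 * p + 1) / (nu q 2 * nu q (2 * J + 1)))) * gW q J p r true := by
  subst hL hN
  have hn : cc q (J + p + r) J (r - p) = -q ^ (J - p - r) * (kap q)⁻¹ *
      (√(nu q (2 * r + 2) * nu q (2 * J + 2 * p + 1)) / (nu q 2 * nu q (2 * J + 1))) := by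
    rw [cc_true hq J p r (by omega)]
  have h1 := ig_up hq 2 2 (r) (r + 1) (2 * r + 2) (by omega) (by ring) (by ring) (by norm_num)
  have h2 := ig_down_one hq (J + p + 1) (J - 1 + p + 1) (2 * J + 2 * p + 1) (by omega) (by ring) (by ring)
  have h3 := gauge_two (nu_nonneg hq (by omega)) h1 h2 (-q ^ (J - p - r) * (kap q)⁻¹) (nu q 2 * nu q (2 * J + 1))
    (ig q 2 2 (p) * ig q 2 1 (J + r + 2))
  rw [hn, gW_true (J - 1) p (r + 1) (J + r + 2) (J - 1 + p + 1) (by ring) (by ring),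
    gW_true J p r (J + r + 2) (J + p + 1) (by ring) (by ring)]
  linear_combination h3

lemma gauge_cc_false {L N : ℤ} (hL : L = J + p + r) (hN : N = r - p - 1) :
    cc q L J N * gW q (J - 1) p (r + 1) false =
      (-q ^ (J - p - r - 1) * (kap q)⁻¹ * (nu q (2 * J + 2 * p + 3) / (nu q 2 * nu q (2 * J + 1)))) * gW q J p r false := by
  subst hL hN
  have hn : cc q (J + p + r) J (r - p - 1) = -q ^ (J - p - r - 1) * (kap q)⁻¹ *
      (√(nu q (2 * r + 2) * nu q (2 * J + 2 * p + 3)) / (nu q 2 * nu q (2 * J + 1))) := by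
    rw [cc_false hq J p r (by omega)]
  have h1 := ig_up hq 2 2 (r) (r + 1) (2 * r + 2) (by omega) (by ring) (by ring) (by norm_num)
  have h2 := ig_down_one hq (J + p + 2) (J - 1 + p + 2) (2 * J + 2 * p + 3) (by omega) (by ring) (by ring)
  have h3 := gauge_two (nu_nonneg hq (by omega)) h1 h2 (-q ^ (J - p - r - 1) * (kap q)⁻¹) (nu q 2 * nu q (2 * J + 1))
    (ig q 2 2 (p) * ig q 2 1 (J + r + 1))
  rw [hn, gW_false (J - 1) p (r + 1) (J + r + 1) (J - 1 + p + 2) (by ring) (by ring),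
    gW_false J p r (J + r + 1) (J + p + 2) (by ring) (by ring)]
  linear_combination h3

lemma gauge_cc_true' {L N : ℤ} (hL : L = J + 1 + p + (r - 1)) (hN : N = (r - 1) - p) :
    cc q L (J + 1) N * gW q (J + 1) p (r - 1) true =
      (-q ^ (J - p - r + 2) * (kap q)⁻¹ * (nu q (2 * r) / (nu q 2 * nu q (2 * J + 3)))) * gW q J p r true := by
  subst hL hN
  have hn : cc q (J + 1 + p + (r - 1)) (J + 1) ((r - 1) - p) = -q ^ (J - p - r + 2) * (kap q)⁻¹ *
      (√(nu q (2 * r) * nu q (2 * J + 2 * p + 3)) / (nu q 2 * nu q (2 * J + 3))) := by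
    rw [cc_true hq (J + 1) p (r - 1) (by omega)]; ring_nf
  have h1 := ig_down hq 2 (r) (r - 1) (2 * r) (by omega) (by ring) (by ring) (by norm_num)
  have h2 := ig_up hq 2 1 (J + p + 1) (J + 1 + p + 1) (2 * J + 2 * p + 3) (by omega) (by ring) (by ring) (by norm_num)
  have h3 := gauge_two (nu_nonneg hq (by omega)) h1 h2 (-q ^ (J - p - r + 2) * (kap q)⁻¹) (nu q 2 * nu q (2 * J + 3))
    (ig q 2 2 (p) * ig q 2 1 (J + r + 2))
  rw [hn, gW_true (J + 1) p (r - 1) (J + r + 2) (J + 1 + p + 1) (by ring) (by ring),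
    gW_true J p r (J + r + 2) (J + p + 1) (by ring) (by ring)]
  linear_combination h3

lemma gauge_cc_false' {L N : ℤ} (hL : L = J + 1 + p + (r - 1)) (hN : N = (r - 1) - p - 1) :
    cc q L (J + 1) N * gW q (J + 1) p (r - 1) false =
      (-q ^ (J - p - r + 1) * (kap q)⁻¹ * (nu q (2 * r) / (nu q 2 * nu q (2 * J + 3)))) * gW q J p r false := by
  subst hL hN
  have hn : cc q (J + 1 + p + (r - 1)) (J + 1) ((r - 1) - p - 1) = -q ^ (J - p - r + 1) * (kap q)⁻¹ *
      (√(nu q (2 * r) * nu q (2 * J + 2 * p + 5)) / (nu q 2 * nu q (2 * J + 3))) := by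
    rw [cc_false hq (J + 1) p (r - 1) (by omega)]; ring_nf
  have h1 := ig_down hq 2 (r) (r - 1) (2 * r) (by omega) (by ring) (by ring) (by norm_num)
  have h2 := ig_up hq 2 1 (J + p + 2) (J + 1 + p + 2) (2 * J + 2 * p + 5) (by omega) (by ring) (by ring) (by norm_num)
  have h3 := gauge_two (nu_nonneg hq (by omega)) h1 h2 (-q ^ (J - p - r + 1) * (kap q)⁻¹) (nu q 2 * nu q (2 * J + 3))
    (ig q 2 2 (p) * ig q 2 1 (J + r + 1))
  rw [hn, gW_false (J + 1) p (r - 1) (J + r + 1) (J + 1 + p + 2) (by ring) (by ring),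
    gW_false J p r (J + r + 1) (J + p + 2) (by ring) (by ring)]
  linear_combination h3

end

end

end

section

/-! ### The generators of the symmetry algebra on finite linear combinations -/

section
variable (q : ℝ)

def E₁L : List WShift := [((0, 1, 0, 0), fun _ M _ J _ => e₁ q J M)]

def E₂L : List WShift :=
  [((0, -1, 1, 1), fun L M N J _ => ep q J M * ca q L J N),
   ((0, -1, 1, 0), fun L M N J _ => e₀ q J M * cb q L J N),
   ((0, -1, 1, -1), fun L M N J _ => em q J M * cc q L J N)]

end

/-- The factors κ and κ' are `kap` and its inverse, or ν(1)⁻¹ and ν(1). They cancel between the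
m₁-dependent and the m₂-dependent factor of a coefficient, leaving an integral power of q. -/
lemma gauge_mul_coef {q : ℝ} (h0 : q ≠ 0) {J' M' e f : ℤ} (n : ℤ) {α γ κ κ' A X g h' h : ℝ}
    (hκ : κ * κ' = 1) (hn : e + f = n) (hα : α * gU q J' M' = (q ^ e * κ * A) * g)
    (hγ : 0 ≤ J' → γ * h' = (q ^ f * κ' * X) * h) :
    (α * γ) * (gU q J' M' * h') = (q ^ n * A * X) * (g * h) := by
  rw [gauge_mul hα hγ, ← hn, zpow_add₀ h0]
  linear_combination (q ^ e * q ^ f * A * X * g * h) * hκ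

lemma gauge_mul_coef_neg {q : ℝ} (h0 : q ≠ 0) {J' M' e f : ℤ} (n : ℤ) {α γ κ κ' A X g h' h : ℝ}
    (hκ : κ * κ' = 1) (hn : e + f = n) (hα : α * gU q J' M' = (q ^ e * κ * A) * g)
    (hγ : 0 ≤ J' → γ * h' = (-q ^ f * κ' * X) * h) :
    (α * γ) * (gU q J' M' * h') = (-q ^ n * A * X) * (g * h) := by
  rw [gauge_mul hα hγ, ← hn, zpow_add₀ h0]
  linear_combination (-q ^ e * q ^ f * A * X * g * h) * hκ

section
variable {q : ℝ} (hq : q ∈ Set.Ioo (0:ℝ) 1)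
include hq

lemma e₁_gauge_mul {J M M' M'' : ℤ} {K A h : ℝ} (hα : e₁ q J M * gU q J M' = (K * A) * gU q J M'') :
    e₁ q J M * (gU q J M' * h) = (K * A) * (gU q J M'' * h) := by
  linear_combination h * hα

lemma Phi_E₁ (v : FinSpinors) : Phi q (opF (E₁L q) v) = lE₁ q (Phi q v) := by
  suffices h : (Phi q ∘ₗ opF (E₁L q) : FinSpinors →ₗ[ℂ] Lat) = lE₁ q ∘ₗ Phi q from
    LinearMap.congr_fun h v
  refine fin_ext (E := Lat) ?_ ?_ <;> intro s J M p r hJ hp hr hu hu'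
  · have hl := isLabel_true.2 ⟨hp, hr, hu, hu'⟩
    simp only [LinearMap.comp_apply, opF, E₁L, List.map_cons, List.map_nil, List.sum_cons, List.sum_nil,
      LinearMap.add_apply, LinearMap.zero_apply, WShift.adj, wsF_vec _ s hl, add_zero, sub_zero, neg_zero,
      sub_neg_eq_add, ← sub_eq_add_neg, add_sub_cancel_right, sub_add_cancel, neg_neg, Prod.fst_neg,
      Prod.snd_neg, map_add, LinearMap.map_smul_of_tower]
    rw [Phi_true q s J (M + 1) p r rfl rfl, Phi_true q s J M p r rfl rfl]
    simp only [lv_smul_smul]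
    rw [e₁_gauge_mul hq (gauge_e₁ hq hu hu')]
    change _ = lE₁ q (_ • bv M J s p r true)
    simp only [lE₁, bvOp_bv, LinearMap.map_smul_of_tower]
    simp only [bv, smul_add]
    module
  · have hl := isLabel_false.2 ⟨hp, hr, hu, hu'⟩
    simp only [LinearMap.comp_apply, opF, E₁L, List.map_cons, List.map_nil, List.sum_cons, List.sum_nil,
      LinearMap.add_apply, LinearMap.zero_apply, WShift.adj, wsF_vec _ s hl, add_zero, sub_zero, neg_zero,
      sub_neg_eq_add, ← sub_eq_add_neg, add_sub_cancel_right, sub_add_cancel, neg_neg, Prod.fst_neg,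
      Prod.snd_neg, map_add, LinearMap.map_smul_of_tower]
    rw [Phi_false q s J (M + 1) p r rfl rfl, Phi_false q s J M p r rfl rfl]
    simp only [lv_smul_smul]
    rw [e₁_gauge_mul hq (gauge_e₁ hq hu hu')]
    change _ = lE₁ q (_ • bv M J s p r false)
    simp only [lE₁, bvOp_bv, LinearMap.map_smul_of_tower]
    simp only [bv, smul_add]
    module

lemma Phi_F₁ (v : FinSpinors) : Phi q (opF ((E₁L q).map WShift.adj) v) = lF₁ q (Phi q v) := by
  suffices h : (Phi q ∘ₗ opF ((E₁L q).map WShift.adj) : FinSpinors →ₗ[ℂ] Lat) = lF₁ q ∘ₗ Phi q from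
    LinearMap.congr_fun h v
  refine fin_ext (E := Lat) ?_ ?_ <;> intro s J M p r hJ hp hr hu hu'
  · have hl := isLabel_true.2 ⟨hp, hr, hu, hu'⟩
    simp only [LinearMap.comp_apply, opF, E₁L, List.map_cons, List.map_nil, List.sum_cons, List.sum_nil,
      LinearMap.add_apply, LinearMap.zero_apply, WShift.adj, wsF_vec _ s hl, add_zero, sub_zero, neg_zero,
      sub_neg_eq_add, ← sub_eq_add_neg, add_sub_cancel_right, sub_add_cancel, neg_neg, Prod.fst_neg,
      Prod.snd_neg, map_add, LinearMap.map_smul_of_tower]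
    rw [Phi_true q s J (M - 1) p r rfl rfl, Phi_true q s J M p r rfl rfl]
    simp only [lv_smul_smul]
    rw [e₁_gauge_mul hq (gauge_e₁' hq hu hu')]
    change _ = lF₁ q (_ • bv M J s p r true)
    simp only [lF₁, bvOp_bv, LinearMap.map_smul_of_tower]
    simp only [bv, smul_add]
    module
  · have hl := isLabel_false.2 ⟨hp, hr, hu, hu'⟩
    simp only [LinearMap.comp_apply, opF, E₁L, List.map_cons, List.map_nil, List.sum_cons, List.sum_nil,
      LinearMap.add_apply, LinearMap.zero_apply, WShift.adj, wsF_vec _ s hl, add_zero, sub_zero, neg_zero,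
      sub_neg_eq_add, ← sub_eq_add_neg, add_sub_cancel_right, sub_add_cancel, neg_neg, Prod.fst_neg,
      Prod.snd_neg, map_add, LinearMap.map_smul_of_tower]
    rw [Phi_false q s J (M - 1) p r rfl rfl, Phi_false q s J M p r rfl rfl]
    simp only [lv_smul_smul]
    rw [e₁_gauge_mul hq (gauge_e₁' hq hu hu')]
    change _ = lF₁ q (_ • bv M J s p r false)
    simp only [lF₁, bvOp_bv, LinearMap.map_smul_of_tower]
    simp only [bv, smul_add]
    module

lemma Phi_E₂ (v : FinSpinors) : Phi q (opF (E₂L q) v) = lE₂ q (Phi q v) := by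
  have h0 := hq.1.ne'
  have hκ : kap q * (kap q)⁻¹ = 1 := mul_inv_cancel₀ (kap_ne hq)
  have hν : (nu q 1)⁻¹ * nu q 1 = 1 := inv_mul_cancel₀ (nu_pos hq one_pos).ne'
  suffices h : (Phi q ∘ₗ opF (E₂L q) : FinSpinors →ₗ[ℂ] Lat) = lE₂ q ∘ₗ Phi q from
    LinearMap.congr_fun h v
  refine fin_ext (E := Lat) ?_ ?_ <;> intro s J M p r hJ hp hr hu hu'
  · have hl := isLabel_true.2 ⟨hp, hr, hu, hu'⟩
    have t1 := gauge_mul_coef h0 (M - p - r + 1) hκ (by ring) (gauge_ep hq hu hu') fun hJ' =>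
      gauge_ca_true hq hJ hp hr (L := J + p + r) (N := r - p) (by ring) (by ring)
    have t2 := gauge_mul_coef h0 (3 * J - p - r + 2) hν (by ring) (gauge_e₀ hq hu hu') fun hJ' =>
      gauge_cb_true hq hJ hp hr (L := J + p + r) (N := r - p) (by ring) (by ring)
    have t3 := gauge_mul_coef_neg h0 (-M - p - r + 1) hκ (by ring) (gauge_em hq hu hu') fun hJ' =>
      gauge_cc_true hq hJ hp hr (L := J + p + r) (N := r - p) (by ring) (by ring)
    simp only [LinearMap.comp_apply, opF, E₂L, List.map_cons, List.map_nil, List.sum_cons, List.sum_nil,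
      LinearMap.add_apply, LinearMap.zero_apply, WShift.adj, wsF_vec _ s hl, add_zero, sub_zero, neg_zero,
      sub_neg_eq_add, ← sub_eq_add_neg, add_sub_cancel_right, sub_add_cancel, neg_neg, Prod.fst_neg,
      Prod.snd_neg, map_add, LinearMap.map_smul_of_tower]
    rw [Phi_true q s (J + 1) (M - 1) (p - 1) r (L := J + p + r) (N := r - p + 1) (by ring) (by ring),
      Phi_false q s J (M - 1) (p - 1) (r + 1) (L := J + p + r) (N := r - p + 1) (by ring) (by ring),
      Phi_true q s (J - 1) (M - 1) p (r + 1) (L := J + p + r) (N := r - p + 1) (by ring) (by ring),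
      Phi_true q s J M p r (L := J + p + r) (N := r - p) (by ring) (by ring)]
    simp only [lv_smul_smul]
    rw [t1, t2, t3]
    change _ = lE₂ q (_ • bv M J s p r true)
    simp only [lE₂, bvOp_bv, LinearMap.map_smul_of_tower]
    simp only [bv, smul_add]
    module
  · have hl := isLabel_false.2 ⟨hp, hr, hu, hu'⟩
    have t1 := gauge_mul_coef h0 (M - p - r + 2) hκ (by ring) (gauge_ep hq hu hu') fun hJ' =>
      gauge_ca_false hq hJ hp hr (L := J + p + r) (N := r - p - 1) (by ring) (by ring)
    have t2 := gauge_mul_coef h0 (J - p - r) hν (by ring) (gauge_e₀ hq hu hu') fun hJ' =>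
      gauge_cb_false hq hJ hp hr (L := J + p + r) (N := r - p - 1) (by ring) (by ring)
    have t3 := gauge_mul_coef_neg h0 (-M - p - r) hκ (by ring) (gauge_em hq hu hu') fun hJ' =>
      gauge_cc_false hq hJ hp hr (L := J + p + r) (N := r - p - 1) (by ring) (by ring)
    simp only [LinearMap.comp_apply, opF, E₂L, List.map_cons, List.map_nil, List.sum_cons, List.sum_nil,
      LinearMap.add_apply, LinearMap.zero_apply, WShift.adj, wsF_vec _ s hl, add_zero, sub_zero, neg_zero,
      sub_neg_eq_add, ← sub_eq_add_neg, add_sub_cancel_right, sub_add_cancel, neg_neg, Prod.fst_neg,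
      Prod.snd_neg, map_add, LinearMap.map_smul_of_tower]
    rw [Phi_false q s (J + 1) (M - 1) (p - 1) r (L := J + p + r) (N := r - p) (by ring) (by ring),
      Phi_true q s J (M - 1) p r (L := J + p + r) (N := r - p) (by ring) (by ring),
      Phi_false q s (J - 1) (M - 1) p (r + 1) (L := J + p + r) (N := r - p) (by ring) (by ring),
      Phi_false q s J M p r (L := J + p + r) (N := r - p - 1) (by ring) (by ring)]
    simp only [lv_smul_smul]
    rw [t1, t2, t3]
    change _ = lE₂ q (_ • bv M J s p r false)
    simp only [lE₂, bvOp_bv, LinearMap.map_smul_of_tower]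
    simp only [bv, smul_add]
    module

lemma Phi_F₂ (v : FinSpinors) : Phi q (opF ((E₂L q).map WShift.adj) v) = lF₂ q (Phi q v) := by
  have h0 := hq.1.ne'
  have hκ : kap q * (kap q)⁻¹ = 1 := mul_inv_cancel₀ (kap_ne hq)
  have hν : (nu q 1)⁻¹ * nu q 1 = 1 := inv_mul_cancel₀ (nu_pos hq one_pos).ne'
  suffices h : (Phi q ∘ₗ opF ((E₂L q).map WShift.adj) : FinSpinors →ₗ[ℂ] Lat) = lF₂ q ∘ₗ Phi q from
    LinearMap.congr_fun h v
  refine fin_ext (E := Lat) ?_ ?_ <;> intro s J M p r hJ hp hr hu hu'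
  · have hl := isLabel_true.2 ⟨hp, hr, hu, hu'⟩
    have t1 := gauge_mul_coef h0 (M - p - r + 1) hκ (by ring) (gauge_ep' hq hu hu') fun hJ' =>
      gauge_ca_true' hq hJ hp hr (L := J + p + r) (N := r - p - 1) (by ring) (by ring) hJ'
    have t2 := gauge_mul_coef h0 (J - p - r) hν (by ring) (gauge_e₀' hq hu hu') fun hJ' =>
      gauge_cb_true' hq hJ hp hr (L := J + p + r) (N := r - p - 1) (by ring) (by ring)
    have t3 := gauge_mul_coef_neg h0 (-M - p - r + 1) hκ (by ring) (gauge_em' hq hu hu') fun hJ' =>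
      gauge_cc_true' hq hJ hp hr (L := J + p + r) (N := r - p - 1) (by ring) (by ring)
    simp only [LinearMap.comp_apply, opF, E₂L, List.map_cons, List.map_nil, List.sum_cons, List.sum_nil,
      LinearMap.add_apply, LinearMap.zero_apply, WShift.adj, wsF_vec _ s hl, add_zero, sub_zero, neg_zero,
      sub_neg_eq_add, ← sub_eq_add_neg, add_sub_cancel_right, sub_add_cancel, neg_neg, Prod.fst_neg,
      Prod.snd_neg, map_add, LinearMap.map_smul_of_tower]
    rw [Phi_true q s (J - 1) (M + 1) (p + 1) r (L := J + p + r) (N := r - p - 1) (by ring) (by ring),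
      Phi_false q s J (M + 1) p r (L := J + p + r) (N := r - p - 1) (by ring) (by ring),
      Phi_true q s (J + 1) (M + 1) p (r - 1) (L := J + p + r) (N := r - p - 1) (by ring) (by ring),
      Phi_true q s J M p r (L := J + p + r) (N := r - p) (by ring) (by ring)]
    simp only [lv_smul_smul]
    rw [t1, t2, t3]
    change _ = lF₂ q (_ • bv M J s p r true)
    simp only [lF₂, bvOp_bv, LinearMap.map_smul_of_tower]
    simp only [bv, smul_add]
    module
  · have hl := isLabel_false.2 ⟨hp, hr, hu, hu'⟩
    have t1 := gauge_mul_coef h0 (M - p - r + 2) hκ (by ring) (gauge_ep' hq hu hu') fun hJ' =>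
      gauge_ca_false' hq hJ hp hr (L := J + p + r) (N := r - p - 1 - 1) (by ring) (by ring) hJ'
    have t2 := gauge_mul_coef h0 (3 * J - p - r + 2) hν (by ring) (gauge_e₀' hq hu hu') fun hJ' =>
      gauge_cb_false' hq hJ hp hr (L := J + p + r) (N := r - p - 1 - 1) (by ring) (by ring)
    have t3 := gauge_mul_coef_neg h0 (-M - p - r) hκ (by ring) (gauge_em' hq hu hu') fun hJ' =>
      gauge_cc_false' hq hJ hp hr (L := J + p + r) (N := r - p - 1 - 1) (by ring) (by ring)
    simp only [LinearMap.comp_apply, opF, E₂L, List.map_cons, List.map_nil, List.sum_cons, List.sum_nil,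
      LinearMap.add_apply, LinearMap.zero_apply, WShift.adj, wsF_vec _ s hl, add_zero, sub_zero, neg_zero,
      sub_neg_eq_add, ← sub_eq_add_neg, add_sub_cancel_right, sub_add_cancel, neg_neg, Prod.fst_neg,
      Prod.snd_neg, map_add, LinearMap.map_smul_of_tower]
    rw [Phi_false q s (J - 1) (M + 1) (p + 1) r (L := J + p + r) (N := r - p - 1 - 1) (by ring) (by ring),
      Phi_true q s J (M + 1) (p + 1) (r - 1) (L := J + p + r) (N := r - p - 1 - 1) (by ring) (by ring),
      Phi_false q s (J + 1) (M + 1) p (r - 1) (L := J + p + r) (N := r - p - 1 - 1) (by ring) (by ring),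
      Phi_false q s J M p r (L := J + p + r) (N := r - p - 1) (by ring) (by ring)]
    simp only [lv_smul_smul]
    rw [t1, t2, t3]
    change _ = lF₂ q (_ • bv M J s p r false)
    simp only [lF₂, bvOp_bv, LinearMap.map_smul_of_tower]
    simp only [bv, smul_add]
    module

end

end

section

/-! ### The representation of the symmetry algebra -/

lemma fin_ext_vec {E : Type*} [AddCommGroup E] [Module ℂ E] {f g : FinSpinors →ₗ[ℂ] E}
    (h : ∀ (s : ℤˣ) (L M N J : ℤ), IsLabel L M N J → f (vec s L M N J) = g (vec s L M N J)) :
    f = g :=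
  fin_ext
    (fun s J M p r _ hp hr hu hu' => h s _ _ _ _ (isLabel_true.2 ⟨hp, hr, hu, hu'⟩))
    (fun s J M p r _ hp hr hu hu' => h s _ _ _ _ (isLabel_false.2 ⟨hp, hr, hu, hu'⟩))

lemma lat_bv_ext {A B : Lat →ₗ[ℂ] Lat} (h : ∀ M J s p r b, A (bv M J s p r b) = B (bv M J s p r b)) :
    A = B := by
  refine Finsupp.lhom_ext' fun ⟨M, J, s⟩ => ?_
  refine fib_ext (M := Lat) ?_
  intro p r b
  exact h M J s p r b

/-- The eigenvalues of `K₁` and `K₂`. -/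
def kw (q : ℝ) (i : Fin 2) (M N : ℤ) : ℝ := ![q ^ hf M, q ^ (hf N - hf M)] i

def uList (q : ℝ) : UGen → List WShift
  | .K i => [(0, fun _ M N _ _ => kw q i M N)]
  | .Kinv i => [(0, fun _ M N _ _ => (kw q i M N)⁻¹)]
  | .E i => ![E₁L q, E₂L q] i
  | .F i => (![E₁L q, E₂L q] i).map WShift.adj

def uFree (q : ℝ) : FreeAlgebra ℂ UGen →ₐ[ℂ] Module.End ℂ FinSpinors :=
  FreeAlgebra.lift ℂ fun x => opF (uList q x)

section
variable {q : ℝ}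

lemma opF_singleton (t : WShift) : opF [t] = wsF t := by simp [opF]

lemma inner_uList (x : UGen) (v w : FinSpinors) :
    ⟪incl (opF (uList q x) v), incl w⟫_ℂ = ⟪incl v, incl (opF (uList q (star x)) w)⟫_ℂ := by
  cases x with
  | K i =>
    rw [inner_opF]
    simp [uList, WShift.adj, star]
  | Kinv i =>
    rw [inner_opF]
    simp [uList, WShift.adj, star]
  | E i => exact inner_opF _ v w
  | F i =>
    rw [← inner_conj_symm, ← inner_conj_symm (incl v)]
    exact congrArg conj (inner_opF _ w v).symm

lemma inner_uFree (a : FreeAlgebra ℂ UGen) (v w : FinSpinors) :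
    ⟪incl (uFree q a v), incl w⟫_ℂ = ⟪incl v, incl (uFree q (freeStar a) w)⟫_ℂ := by
  induction a using FreeAlgebra.induction generalizing v w with
  | grade0 c =>
    rw [freeStar_algebraMap, AlgHom.commutes, AlgHom.commutes, Module.algebraMap_end_apply,
      Module.algebraMap_end_apply, map_smul, map_smul, inner_smul_left, inner_smul_right]
  | grade1 x =>
    rw [freeStar_ι, uFree, FreeAlgebra.lift_ι_apply, FreeAlgebra.lift_ι_apply]
    exact inner_uList x v w
  | mul a b ha hb =>
    rw [freeStar_mul, map_mul, map_mul, Module.End.mul_apply, Module.End.mul_apply, ha, hb]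
  | add a b ha hb =>
    rw [freeStar_add, map_add, map_add, LinearMap.add_apply, LinearMap.add_apply, map_add, map_add,
      inner_add_left, inner_add_right, ha, hb]

/-- The starred word acts by the adjoint, which is determined by the matrix of the original. An
identity of operators therefore implies its conjugate, and only the listed relations have to be
checked. -/
lemma uFree_freeStar {a b : FreeAlgebra ℂ UGen} (h : uFree q a = uFree q b) :
    uFree q (freeStar a) = uFree q (freeStar b) := by
  ext1 v
  apply LinearMap.ext_ring
  ext k
  rw [← inner_single_incl, ← inner_single_incl]
  simp only [LinearMap.comp_apply]
  rw [← inner_uFree, ← inner_uFree, h]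

lemma K_vec (i : Fin 2) (s : ℤˣ) {L M N J : ℤ} :
    opF (uList q (.K i)) (vec s L M N J) = kw q i M N • vec s L M N J := by
  by_cases h : IsLabel L M N J
  · rw [uList, opF_singleton, wsF_vec _ _ h]
    simp
  · simp [vec, h]

lemma Kinv_vec (i : Fin 2) (s : ℤˣ) {L M N J : ℤ} :
    opF (uList q (.Kinv i)) (vec s L M N J) = (kw q i M N)⁻¹ • vec s L M N J := by
  by_cases h : IsLabel L M N J
  · rw [uList, opF_singleton, wsF_vec _ _ h]
    simp
  · simp [vec, h]

end

section
variable {q : ℝ} (hq : q ∈ Set.Ioo (0:ℝ) 1)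
include hq

lemma kw_pos (i : Fin 2) (M N : ℤ) : 0 < kw q i M N := by
  fin_cases i <;> exact Real.rpow_pos_of_pos hq.1 _

lemma kw_zero_sq (M N : ℤ) : kw q 0 M N * kw q 0 M N = q ^ (2 * M + 1) := by
  change q ^ hf M * q ^ hf M = _
  rw [← Real.rpow_add hq.1, ← Real.rpow_intCast]
  congr 1
  simp only [hf]; push_cast; ring

lemma kw_one_sq (M N : ℤ) : kw q 1 M N * kw q 1 M N = q ^ (2 * (N - M)) := by
  change q ^ (hf N - hf M) * q ^ (hf N - hf M) = _
  rw [← Real.rpow_add hq.1, ← Real.rpow_intCast]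
  congr 1
  simp only [hf]; push_cast; ring

local notation "K₀" => opF (uList q (UGen.K 0))
local notation "K₁" => opF (uList q (UGen.K 1))
local notation "K₀'" => opF (uList q (UGen.Kinv 0))
local notation "K₁'" => opF (uList q (UGen.Kinv 1))
local notation "E₁" => opF (E₁L q)
local notation "E₂" => opF (E₂L q)
local notation "F₁" => opF (List.map WShift.adj (E₁L q))
local notation "F₂" => opF (List.map WShift.adj (E₂L q))

/-- A shift is an eigenvector for conjugation by the diagonal operators Kᵢ; the eigenvalue is the
ratio of the eigenvalues of Kᵢ after and before the shift. -/
lemma opF_K_conj (i : Fin 2) (c : ℝ) {l : List WShift}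
    (h : ∀ t ∈ l, ∀ M N, kw q i (M + t.1.2.1) (N + t.1.2.2.1) = c * kw q i M N) :
    opF (uList q (.K i)) ∘ₗ opF l ∘ₗ opF (uList q (.Kinv i)) = c • opF l := by
  induction l with
  | nil => simp [opF_nil]
  | cons t l ih =>
    rw [opF_cons, LinearMap.add_comp, LinearMap.comp_add, ih fun t' ht' => h t' (by simp [ht']),
      smul_add]
    congr 1
    refine fin_ext_vec fun s L M N J hl => ?_
    have h1 := h t (by simp) M N
    have h2 := (kw_pos hq i M N).ne'
    simp only [LinearMap.comp_apply, LinearMap.smul_apply, Kinv_vec,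
      LinearMap.map_smul_of_tower, wsF_vec _ _ hl, K_vec, h1, smul_smul]
    congr 1
    field_simp

lemma opF_EF₁ : E₁ ∘ₗ F₁ - F₁ ∘ₗ E₁ = (q - q⁻¹)⁻¹ • (K₀ ∘ₗ K₀ - K₀' ∘ₗ K₀') := by
  refine fin_ext ?_ ?_ <;> intro s J M p r hJ hp hr hu hu' <;> apply Phi_injective hq
  · have h := lE₁_lF₁ hq M J s p r true
    rw [← kw_zero_sq hq M (r - p), bv] at h
    simp only [LinearMap.sub_apply, LinearMap.comp_apply, LinearMap.smul_apply, map_sub,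
      Phi_E₁ hq, Phi_F₁ hq, LinearMap.map_smul_of_tower, K_vec, Kinv_vec,
      Phi_true q s J M p r rfl rfl]
    linear_combination (norm := module) (gU q J M * gW q J p r true) • h
  · have h := lE₁_lF₁ hq M J s p r false
    rw [← kw_zero_sq hq M (r - p - 1), bv] at h
    simp only [LinearMap.sub_apply, LinearMap.comp_apply, LinearMap.smul_apply, map_sub,
      Phi_E₁ hq, Phi_F₁ hq, LinearMap.map_smul_of_tower, K_vec, Kinv_vec,
      Phi_false q s J M p r rfl rfl]
    linear_combination (norm := module) (gU q J M * gW q J p r false) • h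

lemma opF_EF₂ : E₂ ∘ₗ F₂ - F₂ ∘ₗ E₂ = (q ^ 2 - (q ^ 2)⁻¹)⁻¹ • (K₁ ∘ₗ K₁ - K₁' ∘ₗ K₁') := by
  refine fin_ext ?_ ?_ <;> intro s J M p r hJ hp hr hu hu' <;> apply Phi_injective hq
  · have h := lE₂_lF₂ hq M J s p r true
    simp only [if_true, sub_zero] at h
    rw [← kw_one_sq hq M (r - p), bv] at h
    simp only [LinearMap.sub_apply, LinearMap.comp_apply, LinearMap.smul_apply, map_sub,
      Phi_E₂ hq, Phi_F₂ hq, LinearMap.map_smul_of_tower, K_vec, Kinv_vec,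
      Phi_true q s J M p r rfl rfl]
    linear_combination (norm := module) (gU q J M * gW q J p r true) • h
  · have h := lE₂_lF₂ hq M J s p r false
    simp only [if_false, Bool.false_eq_true] at h
    rw [← kw_one_sq hq M (r - p - 1), bv] at h
    simp only [LinearMap.sub_apply, LinearMap.comp_apply, LinearMap.smul_apply, map_sub,
      Phi_E₂ hq, Phi_F₂ hq, LinearMap.map_smul_of_tower, K_vec, Kinv_vec,
      Phi_false q s J M p r rfl rfl]
    linear_combination (norm := module) (gU q J M * gW q J p r false) • h

lemma opF_E₁_F₂ : E₁ ∘ₗ F₂ = F₂ ∘ₗ E₁ := by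
  refine LinearMap.ext fun v => Phi_injective hq ?_
  simp only [LinearMap.comp_apply, Phi_E₁ hq, Phi_F₂ hq]
  exact LinearMap.congr_fun (lat_bv_ext (A := lE₁ q ∘ₗ lF₂ q) (B := lF₂ q ∘ₗ lE₁ q)
    fun M J s p r b => lE₁_lF₂ hq M J s p r b) (Phi q v)

lemma opF_serre₁ (v : FinSpinors) :
    E₁ (E₂ (E₂ v)) + E₂ (E₂ (E₁ v)) = (q ^ 2 + (q ^ 2)⁻¹) • E₂ (E₁ (E₂ v)) := by
  refine Phi_injective hq ?_
  simp only [map_add, LinearMap.map_smul_of_tower, Phi_E₁ hq, Phi_E₂ hq]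
  refine LinearMap.congr_fun (lat_bv_ext (A := lE₁ q ∘ₗ lE₂ q ∘ₗ lE₂ q + lE₂ q ∘ₗ lE₂ q ∘ₗ lE₁ q)
    (B := (q ^ 2 + (q ^ 2)⁻¹) • (lE₂ q ∘ₗ lE₁ q ∘ₗ lE₂ q)) fun M J s p r b => ?_) (Phi q v)
  simp only [LinearMap.comp_apply, LinearMap.add_apply, LinearMap.smul_apply]
  linear_combination (norm := module) lE_serre₁ hq M J s p r b

lemma opF_serre₂ (v : FinSpinors) :
    E₁ (E₁ (E₁ (E₂ v))) + (q ^ 2 + 1 + (q ^ 2)⁻¹) • E₁ (E₂ (E₁ (E₁ v))) =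
      (q ^ 2 + 1 + (q ^ 2)⁻¹) • E₁ (E₁ (E₂ (E₁ v))) + E₂ (E₁ (E₁ (E₁ v))) := by
  refine Phi_injective hq ?_
  simp only [map_add, LinearMap.map_smul_of_tower, Phi_E₁ hq, Phi_E₂ hq]
  refine LinearMap.congr_fun (lat_bv_ext (A := lE₁ q ∘ₗ lE₁ q ∘ₗ lE₁ q ∘ₗ lE₂ q +
      (q ^ 2 + 1 + (q ^ 2)⁻¹) • (lE₁ q ∘ₗ lE₂ q ∘ₗ lE₁ q ∘ₗ lE₁ q))
    (B := (q ^ 2 + 1 + (q ^ 2)⁻¹) • (lE₁ q ∘ₗ lE₁ q ∘ₗ lE₂ q ∘ₗ lE₁ q) +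
      lE₂ q ∘ₗ lE₁ q ∘ₗ lE₁ q ∘ₗ lE₁ q) fun M J s p r b => ?_) (Phi q v)
  simp only [LinearMap.comp_apply, LinearMap.add_apply, LinearMap.smul_apply]
  linear_combination (norm := module) lE_serre₂ hq M J s p r b

omit hq in
lemma end_coe_smul (c : ℝ) (A : Module.End ℂ FinSpinors) : (c : ℂ) • A = c • A :=
  LinearMap.ext fun v => Complex.coe_smul c (A v)

omit hq in
lemma uFree_ι (x : UGen) : uFree q (FreeAlgebra.ι ℂ x) = opF (uList q x) :=
  FreeAlgebra.lift_ι_apply _ _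

lemma opF_KE (i j : Fin 2) : opF (uList q (.K i)) ∘ₗ opF (uList q (.E j)) ∘ₗ
    opF (uList q (.Kinv i)) = (if i = j then qpow q i else q⁻¹) • opF (uList q (.E j)) := by
  apply opF_K_conj hq
  have e : ∀ x y z : ℝ, z = x + y → q ^ z = q ^ x * q ^ y := fun x y z h => by
    rw [h, Real.rpow_add hq.1]
  fin_cases i <;> fin_cases j <;>
    simp [uList, E₁L, E₂L, kw, qpow, hf] <;> intros <;>
    first
    | (rw [← Real.rpow_neg_one q]; apply e; push_cast; ring1)
    | (rw [← Real.rpow_natCast]; apply e; push_cast; ring1)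
    | (nth_rw 2 [← Real.rpow_one q]; apply e; push_cast; ring1)

lemma uFree_rel {a b : FreeAlgebra ℂ UGen} (h : URel q a b) : uFree q a = uFree q b := by
  cases h with
  | KK =>
    rw [map_sub, map_mul, map_mul, map_zero, sub_eq_zero, wK, wK, uFree_ι, uFree_ι]
    refine fin_ext_vec fun s L M N J _ => ?_
    simp only [Module.End.mul_apply, K_vec, LinearMap.map_smul_of_tower, smul_smul, mul_comm]
  | K_Kinv i =>
    rw [map_mul, map_one, wK, wKinv, uFree_ι, uFree_ι]
    refine fin_ext_vec fun s L M N J _ => ?_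
    simp only [Module.End.mul_apply, K_vec, Kinv_vec, LinearMap.map_smul_of_tower, smul_smul,
      inv_mul_cancel₀ (kw_pos hq i M N).ne', one_smul, Module.End.one_apply]
  | Kinv_K i =>
    rw [map_mul, map_one, wK, wKinv, uFree_ι, uFree_ι]
    refine fin_ext_vec fun s L M N J _ => ?_
    simp only [Module.End.mul_apply, K_vec, Kinv_vec, LinearMap.map_smul_of_tower, smul_smul,
      mul_inv_cancel₀ (kw_pos hq i M N).ne', one_smul, Module.End.one_apply]
  | EF j =>
    simp only [map_sub, map_mul, map_smul, wK, wKinv, wE, wF, uFree_ι]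
    rw [end_coe_smul]
    fin_cases j
    · simp only [qpow, Fin.zero_eta, Fin.val_zero, zero_add, pow_one]
      exact opF_EF₁ hq
    · exact opF_EF₂ hq
  | EF_ne i j h =>
    rw [map_sub, map_mul, map_mul, map_zero, sub_eq_zero, wE, wF, uFree_ι, uFree_ι]
    fin_cases i <;> fin_cases j <;> simp at h
    · exact opF_E₁_F₂ hq
    -- The commutation of E₂ and F₁ is the conjugate of that of E₁ and F₂.
    · have h1 : uFree q (wE 0 * wF 1) = uFree q (wF 1 * wE 0) := by
        rw [map_mul, map_mul, wE, wF, uFree_ι, uFree_ι]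
        exact opF_E₁_F₂ hq
      have h2 := uFree_freeStar h1
      rw [freeStar_mul, freeStar_mul, wE, wF, freeStar_ι, freeStar_ι, map_mul, map_mul] at h2
      simp only [uFree_ι] at h2
      exact h2
  | KE i =>
    rw [map_mul, map_mul, map_smul, wK, wE, wKinv, uFree_ι, uFree_ι, uFree_ι, end_coe_smul]
    have := opF_KE hq i i
    rwa [if_pos rfl] at this
  | KE_ne i j h =>
    rw [map_mul, map_mul, map_smul, wK, wE, wKinv, uFree_ι, uFree_ι, uFree_ι, end_coe_smul]
    have := opF_KE hq i j
    rwa [if_neg h] at this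
  | serre₁ =>
    simp only [map_sub, map_add, map_mul, map_smul, map_zero, wE, uFree_ι]
    rw [end_coe_smul]
    refine LinearMap.ext fun v => ?_
    have h := opF_serre₁ hq v
    simp only [LinearMap.sub_apply, LinearMap.add_apply, LinearMap.smul_apply,
      Module.End.mul_apply, LinearMap.zero_apply, uList, Matrix.cons_val_zero, Matrix.cons_val_one]
    linear_combination (norm := module) h
  | serre₂ =>
    simp only [map_sub, map_add, map_mul, map_smul, map_zero, wE, uFree_ι]
    rw [end_coe_smul]
    refine LinearMap.ext fun v => ?_
    have h := opF_serre₂ hq v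
    simp only [LinearMap.sub_apply, LinearMap.add_apply, LinearMap.smul_apply,
      Module.End.mul_apply, LinearMap.zero_apply, uList, Matrix.cons_val_zero, Matrix.cons_val_one]
    linear_combination (norm := module) h

/-- The representation of the symmetry algebra on finite linear combinations. -/
def uRep : Uq q →ₐ[ℂ] Module.End ℂ FinSpinors :=
  PresentedAlg.lift (r := URel q) (B := Module.End ℂ FinSpinors) (uFree q) fun _ _ h => ⟨uFree_rel hq h, uFree_freeStar (uFree_rel hq h)⟩

lemma uRep_mk (w : FreeAlgebra ℂ UGen) : uRep hq (PresentedAlg.mk (URel q) w) = uFree q w :=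
  PresentedAlg.lift_mk _ _ w

lemma uRep_gen (x : UGen) : uRep hq (PresentedAlg.gen (URel q) x) = opF (uList q x) := by
  rw [PresentedAlg.gen, uRep_mk, uFree_ι]

lemma uRep_isSpinorRep : IsSpinorRep (uRep hq) where
  K i k := by
    rw [uRep_gen, uList, opF_singleton, wsF_single, Kvec, Complex.coe_smul]
    obtain ⟨⟨L, M, N, J, h⟩, s⟩ := k
    simp only [Prod.fst_zero, Prod.snd_zero, add_zero, vec, dif_pos h]
    rfl
  E i k := by
    rw [uRep_gen]
    obtain ⟨⟨L, M, N, J, h⟩, s⟩ := k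
    fin_cases i
    · simp [uList, E₁L, opF_singleton, wsF_single, Evec, e₁]
    · simp [uList, E₂L, opF_cons, opF_nil, wsF_single, Evec, ep, e₀, em, ← sub_eq_add_neg, add_assoc]
      simp only [← Complex.ofReal_mul, Complex.coe_smul]
  star h v w := by
    obtain ⟨a, rfl⟩ := PresentedAlg.mk_surjective h
    rw [PresentedAlg.star_mk, uRep_mk, uRep_mk]
    exact inner_uFree a v w

end

end

section

/-! ### Equivariance of the twisted real structure -/

lemma IsLabel.neg {L M N J : ℤ} (h : IsLabel L M N J) : IsLabel L (-M - 1) (-N - 1) J :=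
  (Label.neg ⟨L, M, N, J, h⟩).valid

/-- `i^{2l+1} (-1)^{j+m₁} q^{m₁+3m₂}`. -/
def tw (q : ℝ) (L M N J : ℤ) : ℝ := (-1) ^ (L + J + M) * q ^ (hf M + 3 * hf N)

lemma twistedReal_vec (q : ℝ) (s : ℤˣ) (L M N J : ℤ) :
    twistedReal q (vec s L M N J) = tw q L M N J • vec s L (-M - 1) (-N - 1) J := by
  by_cases h : IsLabel L M N J
  · rw [vec, dif_pos h, vec, dif_pos h.neg, twistedReal_single, phase_eq_zpow, tw,
      ← Complex.coe_smul]
    push_cast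
    rfl
  · have h' : ¬ IsLabel L (-M - 1) (-N - 1) J := fun h' => h (by simpa using h'.neg)
    rw [vec, dif_neg h, vec, dif_neg h', map_zero, smul_zero]

lemma twistedReal_real_smul (q c : ℝ) (v : FinSpinors) :
    twistedReal q (c • v) = c • twistedReal q v := by
  rw [← Complex.coe_smul, map_smulₛₗ, Complex.conj_ofReal, Complex.coe_smul]

lemma twistedReal_eq_of_vec {q : ℝ} {A B : FinSpinors →ₗ[ℂ] FinSpinors}
    (h : ∀ (s : ℤˣ) (L M N J : ℤ), IsLabel L M N J →
      twistedReal q (A (vec s L M N J)) = B (twistedReal q (vec s L M N J))) (v : FinSpinors) :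
    twistedReal q (A v) = B (twistedReal q v) := by
  induction v using Finsupp.induction_linear with
  | zero => simp
  | add v w hv hw => rw [map_add, map_add, map_add, map_add, hv, hw]
  | single k a =>
    obtain ⟨⟨L, M, N, J, hk⟩, s⟩ := k
    have h' := h s L M N J hk
    rw [vec, dif_pos hk] at h'
    rw [← mul_one a, ← smul_eq_mul, ← Finsupp.smul_single, map_smul, map_smulₛₗ, map_smulₛₗ,
      map_smul, h']

section
variable {q : ℝ}

/-- T reflects m₁ and m₂ but not l and j, so it carries a shift to the one with these two components
reversed; the hypothesis compares the weights, including the factor of T before and after the shift.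
-/
lemma twistedReal_wsF {t t' : WShift} {c : ℝ}
    (hs : t'.1 = (t.1.1, -t.1.2.1, -t.1.2.2.1, t.1.2.2.2))
    (h : ∀ L M N J s, t.2 L M N J s *
      tw q (L + t.1.1) (M + t.1.2.1) (N + t.1.2.2.1) (J + t.1.2.2.2) =
        c * (tw q L M N J * t'.2 L (-M - 1) (-N - 1) J s)) (v : FinSpinors) :
    twistedReal q (wsF t v) = c • wsF t' (twistedReal q v) := by
  refine twistedReal_eq_of_vec (B := c • wsF t') (fun s L M N J hl => ?_) v
  rw [wsF_vec _ _ hl, twistedReal_real_smul, twistedReal_vec, twistedReal_vec, smul_smul, h,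
    LinearMap.smul_apply, LinearMap.map_smul_of_tower, wsF_vec _ _ hl.neg, smul_smul, smul_smul, hs,
    mul_assoc]
  simp only [show -(M + t.1.2.1) - 1 = -M - 1 + -t.1.2.1 by ring,
    show -(N + t.1.2.2.1) - 1 = -N - 1 + -t.1.2.2.1 by ring]

lemma e₁_neg (J M : ℤ) : e₁ q J (-M - 1 - 1) = e₁ q J M := by
  have h : hf J - hf (-M - 1 - 1) = hf J + hf M + 1 ∧ hf J + hf (-M - 1 - 1) + 1 = hf J - hf M := by
    constructor <;> simp only [hf] <;> push_cast <;> ring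
  rw [e₁, e₁, h.1, h.2, mul_comm]

lemma e₀_neg (J M : ℤ) : e₀ q J (-M) = e₀ q J M := by
  have h : hf J + hf (-M) = hf J - hf M + 1 ∧ hf J - hf (-M) + 1 = hf J + hf M := by
    constructor <;> simp only [hf] <;> push_cast <;> ring
  rw [e₀, e₀, h.1, h.2, mul_comm]

lemma em_neg (J M : ℤ) : em q (J + 1) (-M) = ep q J M := by
  have h : hf (J + 1) + hf (-M) = hf J - hf M + 2 ∧ hf J - hf M + 2 - 1 = hf J - hf M + 1 := by
    constructor <;> simp only [hf] <;> push_cast <;> ring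
  rw [em, ep, h.1, h.2, mul_comm]

lemma eps_add_one_neg (L J N : ℤ) : eps L (J + 1) (-N - 2) = -eps L J N := by
  have h : Even (L - (J + 1) - (-N - 2)) ↔ ¬ Even (L - J - N) := by
    simp only [Int.even_iff]; omega
  simp only [eps, h, ite_not]
  split_ifs <;> norm_num

lemma eps_neg (L J N : ℤ) : eps L J (-N - 2) = eps L J N := by
  have h : Even (L - J - (-N - 2)) ↔ Even (L - J - N) := by
    simp only [Int.even_iff]; omega
  simp only [eps, h]

/-- The step a leads from (J, N) to (J + 1, N + 1). At the reflection of that end point, where N is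
replaced by -N - 2, ε has the opposite sign, and the coefficient c there is -a. -/
lemma cc_neg (L J N : ℤ) : cc q L (J + 1) (-N - 2) = -ca q L J N := by
  simp only [cc, ca, eps_add_one_neg, abs_neg]
  have h1 : hf L - hf (J + 1) + hf (-N - 2) + 2 - -eps L J N = hf L - hf J - hf N + eps L J N := by
    simp only [hf]; push_cast; ring
  have h2 : hf L + hf (J + 1) - hf (-N - 2) + 1 - -eps L J N =
      hf L + hf J + hf N + 3 + eps L J N := by
    simp only [hf]; push_cast; ring
  have h3 : 2 * (hf (J + 1) + |eps L J N|) - 1 = 2 * (hf J + |eps L J N|) + 1 := by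
    simp only [hf]; push_cast; ring
  have h4 : 2 * (hf (J + 1) - |eps L J N|) + 1 = 2 * (hf J - |eps L J N|) + 3 := by
    simp only [hf]; push_cast; ring
  rw [h1, h2, h3, h4]
  ring

lemma cb_neg (L J N : ℤ) : cb q L J (-N - 2) = cb q L J N := by
  simp only [cb, eps_neg]
  have h1 : hf L - eps L J N * (2 * hf J + 1) - hf (-N - 2) + 1 =
      hf L - eps L J N * (2 * hf J + 1) + hf N + 2 := by
    simp only [hf]; push_cast; ring
  have h2 : hf L - eps L J N * (2 * hf J + 1) + hf (-N - 2) + 2 =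
      hf L - eps L J N * (2 * hf J + 1) - hf N + 1 := by
    simp only [hf]; push_cast; ring
  rw [h1, h2, mul_comm (qn q _) (qn q _)]

end

section
variable {q : ℝ} (hq : q ∈ Set.Ioo (0:ℝ) 1)
include hq

lemma tw_mul_tw_neg (L M N J : ℤ) : tw q L M N J * tw q L (-M - 1) (-N - 1) J = -1 := by
  have h1 : q ^ (hf M + 3 * hf N) * q ^ (hf (-M - 1) + 3 * hf (-N - 1)) = 1 := by
    rw [← Real.rpow_add hq.1, ← Real.rpow_zero q]
    congr 1
    simp only [hf]; push_cast; ring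
  have h2 : (-1 : ℝ) ^ (L + J + M) * (-1) ^ (L + J + (-M - 1)) = -1 := by
    rw [← zpow_add₀ (by norm_num), show L + J + M + (L + J + (-M - 1)) = 2 * (L + J - 1) + 1 by ring,
      zpow_add₀ (by norm_num), zpow_mul]
    norm_num
  rw [tw, tw, mul_mul_mul_comm, h1, h2, mul_one]

/-- The power of q gained by T under a shift is the change of m₁ + 3m₂: it is 1 for E₁ and 2 for
each term of E₂. -/
lemma tw_add {L M N J a b c d : ℤ} (n : ℤ) (hn : b + 3 * c = n) :
    tw q (L + a) (M + b) (N + c) (J + d) = (-1) ^ (a + b + d) * q ^ n * tw q L M N J := by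
  have h1 : q ^ (hf (M + b) + 3 * hf (N + c)) = q ^ n * q ^ (hf M + 3 * hf N) := by
    rw [← Real.rpow_intCast, ← Real.rpow_add hq.1, ← hn]
    congr 1
    simp only [hf]; push_cast; ring
  rw [tw, tw, h1, show L + a + (J + d) + (M + b) = a + b + d + (L + J + M) by ring,
    zpow_add₀ (by norm_num)]
  ring

/-- The powers of q at a label and at its reflection are inverse to each other, so T² equals J². -/
lemma twistedReal_twistedReal (v : FinSpinors) : twistedReal q (twistedReal q v) = -v := by
  induction v using Finsupp.induction_linear with
  | zero => simp
  | add v w hv hw => rw [map_add, map_add, hv, hw, neg_add]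
  | single k a =>
    obtain ⟨⟨L, M, N, J, hk⟩, s⟩ := k
    have h : Finsupp.single (⟨L, M, N, J, hk⟩, s) (1 : ℂ) = vec s L M N J := by rw [vec, dif_pos hk]
    rw [← mul_one a, ← smul_eq_mul, ← Finsupp.smul_single, map_smulₛₗ, map_smulₛₗ, h,
      twistedReal_vec, twistedReal_real_smul, twistedReal_vec, smul_smul, tw_mul_tw_neg hq,
      Complex.conj_conj, show -(-M - 1) - 1 = M by ring,
      show -(-N - 1) - 1 = N by ring]
    module

lemma twistedReal_K (i : Fin 2) (v : FinSpinors) : twistedReal q (opF (uList q (.K i)) v) =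
    opF (uList q (.Kinv i)) (twistedReal q v) := by
  refine twistedReal_eq_of_vec (fun s L M N J _ => ?_) v
  have h : kw q i M N = (kw q i (-M - 1) (-N - 1))⁻¹ := by
    fin_cases i
    · change q ^ _ = (q ^ _)⁻¹
      rw [← Real.rpow_neg hq.1.le]
      congr 1
      simp only [hf]; push_cast; ring
    · change q ^ _ = (q ^ _)⁻¹
      rw [← Real.rpow_neg hq.1.le]
      congr 1
      simp only [hf]; push_cast; ring
  rw [K_vec, twistedReal_real_smul, twistedReal_vec, LinearMap.map_smul_of_tower, Kinv_vec, h,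
    smul_comm]

lemma twistedReal_Kinv (i : Fin 2) (v : FinSpinors) : twistedReal q (opF (uList q (.Kinv i)) v) =
    opF (uList q (.K i)) (twistedReal q v) := by
  refine twistedReal_eq_of_vec (fun s L M N J _ => ?_) v
  have h : (kw q i M N)⁻¹ = kw q i (-M - 1) (-N - 1) := by
    fin_cases i
    · change (q ^ _)⁻¹ = q ^ _
      rw [← Real.rpow_neg hq.1.le]
      congr 1
      simp only [hf]; push_cast; ring
    · change (q ^ _)⁻¹ = q ^ _
      rw [← Real.rpow_neg hq.1.le]
      congr 1
      simp only [hf]; push_cast; ring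
  rw [Kinv_vec, twistedReal_real_smul, twistedReal_vec, LinearMap.map_smul_of_tower, K_vec, h,
    smul_comm]

lemma twistedReal_E₁ (v : FinSpinors) : twistedReal q (opF (E₁L q) v) =
    (-q) • opF ((E₁L q).map WShift.adj) (twistedReal q v) := by
  simp only [E₁L, List.map_cons, List.map_nil, opF_singleton]
  refine twistedReal_wsF (by simp [WShift.adj]) (fun L M N J s => ?_) v
  rw [tw_add hq 1 (by simp)]
  simp only [WShift.adj, sub_zero, e₁_neg]
  norm_num
  ring

/-- Transposition reverses the shift of j while T does not. Hence the term that raises j corresponds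
to the transpose of the term that lowers it, and conversely; the middle term corresponds to its own
transpose. -/
lemma twistedReal_E₂ (v : FinSpinors) : twistedReal q (opF (E₂L q) v) =
    (-q ^ 2) • opF ((E₂L q).map WShift.adj) (twistedReal q v) := by
  simp only [E₂L, List.map_cons, List.map_nil, opF_cons, opF_nil, LinearMap.add_apply,
    LinearMap.zero_apply, map_add, map_zero, add_zero]
  have t1 := twistedReal_wsF (q := q) (t := ((0, -1, 1, 1), fun L M N J _ => ep q J M * ca q L J N))
    (t' := WShift.adj ((0, -1, 1, -1), fun L M N J _ => em q J M * cc q L J N)) (c := -q ^ 2)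
    (by simp [WShift.adj]) (fun L M N J s => by
      rw [tw_add hq 2 (by simp)]
      simp only [WShift.adj, sub_zero, sub_neg_eq_add, sub_add_cancel]
      rw [em_neg, show -N - 1 - 1 = -N - 2 by ring, cc_neg]
      norm_num
      ring) v
  have t2 := twistedReal_wsF (q := q) (t := ((0, -1, 1, 0), fun L M N J _ => e₀ q J M * cb q L J N))
    (t' := WShift.adj ((0, -1, 1, 0), fun L M N J _ => e₀ q J M * cb q L J N)) (c := -q ^ 2)
    (by simp [WShift.adj]) (fun L M N J s => by
      rw [tw_add hq 2 (by simp)]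
      simp only [WShift.adj, sub_zero, sub_neg_eq_add, sub_add_cancel]
      rw [e₀_neg, show -N - 1 - 1 = -N - 2 by ring, cb_neg]
      norm_num
      ring) v
  have t3 := twistedReal_wsF (q := q) (t := ((0, -1, 1, -1), fun L M N J _ => em q J M * cc q L J N))
    (t' := WShift.adj ((0, -1, 1, 1), fun L M N J _ => ep q J M * ca q L J N)) (c := -q ^ 2)
    (by simp [WShift.adj]) (fun L M N J s => by
      have h1 := em_neg (q := q) (J - 1) (-M)
      have h2 := cc_neg (q := q) L (J - 1) (-N - 2)
      rw [sub_add_cancel, neg_neg] at h1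
      rw [sub_add_cancel, show -(-N - 2) - 2 = N by ring] at h2
      rw [tw_add hq 2 (by simp)]
      simp only [WShift.adj, sub_zero, sub_neg_eq_add, sub_add_cancel]
      rw [h1, h2, show -N - 1 - 1 = -N - 2 by ring]
      norm_num
      ring) v
  rw [t1, t2, t3]
  module

lemma twistedReal_E (i : Fin 2) (v : FinSpinors) : twistedReal q (opF (uList q (.E i)) v) =
    (-qpow q i) • opF (uList q (.F i)) (twistedReal q v) := by
  fin_cases i
  · simpa [uList, qpow] using twistedReal_E₁ hq v
  · simpa [uList, qpow] using twistedReal_E₂ hq v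

/-- Obtained from the relation for E by applying T on both sides, since T² = -1. -/
lemma twistedReal_F (i : Fin 2) (v : FinSpinors) : twistedReal q (opF (uList q (.F i)) v) =
    (-(qpow q i)⁻¹) • opF (uList q (.E i)) (twistedReal q v) := by
  have h0 : qpow q i ≠ 0 := (pow_pos hq.1 _).ne'
  have h := congrArg (twistedReal q) (twistedReal_E hq i (twistedReal q v))
  rw [twistedReal_twistedReal hq, twistedReal_twistedReal hq, twistedReal_real_smul, map_neg,
    map_neg] at h
  rw [← neg_neg (opF (uList q (.E i)) (twistedReal q v)), h, smul_neg, smul_smul, neg_mul_neg,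
    inv_mul_cancel₀ h0, one_smul, neg_neg]

end

section
variable (q : Set.Ioo (0:ℝ) 1)

lemma antipodeStar_add (a b : Uq (q : ℝ)) :
    Uq.antipodeStar q (a + b) = Uq.antipodeStar q a + Uq.antipodeStar q b := by
  simp [Uq.antipodeStar]

/-- The antipode and the involution both reverse products, so their composite preserves them. Being
also antilinear, it is compatible with the antilinear T, and equivariance needs to be checked on
generators only. -/
lemma antipodeStar_mul (a b : Uq (q : ℝ)) :
    Uq.antipodeStar q (a * b) = Uq.antipodeStar q a * Uq.antipodeStar q b := by
  simp [Uq.antipodeStar]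

lemma antipodeStar_algebraMap (c : ℂ) :
    Uq.antipodeStar q (algebraMap ℂ _ c) = algebraMap ℂ _ (conj c) := by
  rw [Uq.antipodeStar, AlgHom.commutes, MulOpposite.algebraMap_apply, MulOpposite.unop_op,
    Algebra.algebraMap_eq_smul_one, star_smul, star_one, Algebra.algebraMap_eq_smul_one]
  rfl

lemma antipodeStar_gen (x : UGen) : Uq.antipodeStar q (PresentedAlg.gen _ x) =
    star (MulOpposite.unop (freeAntipode q (FreeAlgebra.ι ℂ x))) := by
  rw [Uq.antipodeStar, Uq.antipode, PresentedAlg.gen, PresentedAlg.lift_mk]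

lemma twistedReal_uRep_gen (x : UGen) (v : FinSpinors) :
    twistedReal (q : ℝ) (uRep q.2 (PresentedAlg.gen _ x) v) =
      uRep q.2 (Uq.antipodeStar q (PresentedAlg.gen _ x)) (twistedReal (q : ℝ) v) := by
  rw [uRep_gen, antipodeStar_gen, freeAntipode, FreeAlgebra.lift_ι_apply]
  cases x with
  | K i =>
    simp only [MulOpposite.unop_op, PresentedAlg.star_gen, uRep_gen]
    exact twistedReal_K q.2 i v
  | Kinv i =>
    simp only [MulOpposite.unop_op, PresentedAlg.star_gen, uRep_gen]
    exact twistedReal_Kinv q.2 i v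
  | E i =>
    simp only [MulOpposite.unop_op, star_smul, PresentedAlg.star_gen, map_smul, uRep_gen]
    rw [twistedReal_E q.2, star_neg, Complex.star_def, Complex.conj_ofReal, ← Complex.ofReal_neg]
    exact (Complex.coe_smul _ _).symm
  | F i =>
    simp only [MulOpposite.unop_op, star_smul, PresentedAlg.star_gen, map_smul, uRep_gen]
    rw [twistedReal_F q.2, star_neg, Complex.star_def, Complex.conj_ofReal, ← Complex.ofReal_neg]
    exact (Complex.coe_smul _ _).symm

lemma twistedReal_uRep (h : Uq (q : ℝ)) (v : FinSpinors) :
    twistedReal (q : ℝ) (uRep q.2 h v) =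
      uRep q.2 (Uq.antipodeStar q h) (twistedReal (q : ℝ) v) := by
  obtain ⟨w, rfl⟩ := PresentedAlg.mk_surjective h
  induction w using FreeAlgebra.induction generalizing v with
  | grade0 c =>
    rw [AlgHom.commutes, antipodeStar_algebraMap, AlgHom.commutes, AlgHom.commutes,
      Module.algebraMap_end_apply, Module.algebraMap_end_apply, map_smulₛₗ]
  | grade1 x => exact twistedReal_uRep_gen q x v
  | mul a b ha hb =>
    rw [map_mul, antipodeStar_mul, map_mul, map_mul, Module.End.mul_apply, Module.End.mul_apply,
      ha, hb]
  | add a b ha hb =>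
    rw [map_add, antipodeStar_add, map_add, map_add, LinearMap.add_apply, LinearMap.add_apply,
      map_add, ha, hb]

end

end

end QSphere

end

theorem mainTheorem7 (q : Set.Ioo (0 : ℝ) 1) :
    -- `J² = -1`, `J γ = γ J` and `J D = D J`
    (∀ v : Spinors, realStr (realStr v) = -v) ∧
    (∀ v : Spinors, realStr (grading v) = grading (realStr v)) ∧
    (∀ v : Spinors, v ∈ dirac.domain ↔ realStr v ∈ dirac.domain) ∧
    (∀ (v : dirac.domain) (h : realStr (v : Spinors) ∈ dirac.domain),
      realStr (dirac v) = dirac ⟨realStr (v : Spinors), h⟩) ∧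
    -- `J` is the antiunitary part of `T`, and `T` is equivariant
    IsAntiunitaryPart realStr (twistedReal (q : ℝ)) ∧
    (∃ ρ : Uq (q : ℝ) →ₐ[ℂ] Module.End ℂ FinSpinors, IsSpinorRep ρ ∧
      ∀ (h : Uq (q : ℝ)) (v : FinSpinors),
        twistedReal (q : ℝ) (ρ h v) = ρ (Uq.antipodeStar q h) (twistedReal (q : ℝ) v)) ∧
    -- the commutant and first order conditions modulo the ideal
    (∃ π : SphereAlg (q : ℝ) →⋆ₐ[ℂ] (Spinors →L[ℂ] Spinors), IsChiralRep π ∧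
      (∀ a b : SphereAlg (q : ℝ),
        π a * realConj (π b) - realConj (π b) * π a ∈ idealI) ∧
      (∀ a : SphereAlg (q : ℝ), ∃ da : Spinors →L[ℂ] Spinors, IsCommutator dirac (π a) da ∧
        ∀ b : SphereAlg (q : ℝ),
          da * realConj (π b) - realConj (π b) * da ∈ idealI)) := by
  exact ⟨realStr_realStr, realStr_grading, mem_dirac_domain_iff, realStr_dirac,
    realStr_isAntiunitaryPart q.2.1, ⟨uRep q.2, uRep_isSpinorRep q.2, twistedReal_uRep q⟩,
    ⟨sphereRep q.2, sphereRep_isChiralRep q.2, sphereRep_comm_realConj q.2,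
      exists_isCommutator_dirac q.2⟩⟩
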